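/- **Notation.** For $s>0$ and $x\in\mathbb R^n$ let $\rho_s(x)=e^{-\pi\|x/s\|^2}$, and $\rho_s(A)=\sum_{x\in A}\rho_s(x)$. For an $n$-dimensional lattice $L\subset\mathbb R^n$ ($n\ge 1$, full rank), $L^*$ is the dual lattice, $\lambda_1(L)$ the length of a shortest nonzero vector, $D_{L,r}$ the distribution on $L$ with $D_{L,r}(x)=\rho_r(x)/\rho_r(L)$, and, for $\varepsilon>0$, $\eta_\varepsilon(L)$ the smallest $s>0$ with $\rho_{1/s}(L^*\setminus\{0\})\le\varepsilon$ (smoothing parameter). Inputs (a basis of $L$, vectors, numbers) are rational and written in binary. **Problems.** - $\mathrm{GapCVP}'_g$: given a basis of an $n$-dimensional lattice $L$, a vector $t$ and $d>0$. YES: $\mathrm{dist}(t,L)\le d$. NO: $\lambda_1(L)>g(n)d$ and $\mathrm{dist}(t,L)>g(n)d$. - $\mathrm{GapSVP}_g$: given a basis of an $n$-dimensional lattice $L$ and $d>0$. YES: $\lambda_1(L)\le d$. NO: $\lambda_1(L)>g(n)d$. - $\mathrm{DGS}_\varphi$, for a real-valued function $\varphi$ on lattices: given a basis of a lattice $L$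 and $r>\varphi(L)$, output a sample from $D_{L,r}$. An oracle for $\mathrm{DGS}_\varphi$ answers every such query with a fresh independent sample from $D_{L,r}$ (given by its integer coefficients in the basis of the query), and may behave arbitrarily on all other queries. A polynomial time reduction from a promise problem to $\mathrm{DGS}_\varphi$ is an oracle program, deterministic apart from the answers of the oracle, that runs in time (bit cost) polynomial in the bit length of the input, whatever the oracle answers, and that, with any oracle for $\mathrm{DGS}_\varphi$, accepts every YES instance with probability at least $1-\delta$ and every NO instance with probability at most $\delta$, where $\delta=\min(1/3,2^{-cn})$ for a constant $c>0$. **Lemma.** For any $\gamma=\gamma(n)\ge 1$, there is a polynomial time reduction from $\mathrm{GapCVP}'_{100\sqrt n\cdot\gamma(n)}$ to $\mathrm{DGS}_{\sqrt n\,\gamma(n)/\lambda_1(L^*)}$. Moreover, there is an absolute constant $C>0$ such that for any $\alpha=\alpha(n)\in(0,1)$ there is a polynomial time reduction from $\mathrm{GapSVP}_{C n/\alpha(n)}$ to $\mathrm{DGS}_{\sqrt{2n}\cdot\eta_{\varepsilon(n)}(L)/\alpha(n)}$ with $\varepsilon(n)=2^{-n}$. Hence an efficient (possibly quantum) algorithm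 for the latter sampling problem yields one for $\mathrm{GapSVP}_{O(n/\alpha)}$. -/

import Mathlib

noncomputable section

namespace LatticeReduction

/-! ## Gaussians and lattices in Euclidean space -/

/-- Euclidean `n`-space. -/
abbrev E (n : ℕ) : Type := EuclideanSpace ℝ (Fin n)

/-- The Gaussian function `ρ_s(x) = exp(-π ‖x / s‖²)`. -/
def rho {n : ℕ} (s : ℝ) (x : E n) : ℝ := Real.exp (-Real.pi * (‖x‖ / s) ^ 2)

/-- `ρ_s(A) = ∑_{x ∈ A} ρ_s(x)`, used for subsets of lattices. -/
def rhoSum {n : ℕ} (s : ℝ) (A : Set (E n)) : ℝ := ∑' x : A, rho s (x : E n)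

/-- The probability that the discrete Gaussian distribution `D_{A,s}` gives to a point of `A`. -/
def discreteGaussian {n : ℕ} (A : Set (E n)) (s : ℝ) (x : E n) : ℝ := rho s x / rhoSum s A

/-- The length of a shortest nonzero vector of `L`. -/
def lambda1 {n : ℕ} (L : Submodule ℤ (E n)) : ℝ := sInf {l : ℝ | ∃ x ∈ L, x ≠ 0 ∧ ‖x‖ = l}

/-- The dual lattice: all vectors having integral inner products with all vectors of `L`. -/
def dual {n : ℕ} (L : Submodule ℤ (E n)) : Submodule ℤ (E n) where
  carrier := {y | ∀ x ∈ L, ∃ k : ℤ, inner ℝ x y = (k : ℝ)}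
  add_mem' := by
    intro a b ha hb x hx
    obtain ⟨k, hk⟩ := ha x hx
    obtain ⟨l, hl⟩ := hb x hx
    exact ⟨k + l, by rw [inner_add_right, hk, hl]; push_cast; rfl⟩
  zero_mem' := by
    intro x _
    exact ⟨0, by simp⟩
  smul_mem' := by
    intro c y hy x hx
    obtain ⟨k, hk⟩ := hy x hx
    refine ⟨c * k, ?_⟩
    rw [← Int.cast_smul_eq_zsmul ℝ c y, inner_smul_right, hk]
    push_cast
    rfl

/-- The smoothing parameter `η_ε(L)`: the smallest `s > 0` with `ρ_{1/s}(L* ∖ {0}) ≤ ε`. -/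
def smoothingParameter {n : ℕ} (ε : ℝ) (L : Submodule ℤ (E n)) : ℝ :=
  sInf {s : ℝ | 0 < s ∧ rhoSum (1 / s) ((dual L : Set (E n)) \ {0}) ≤ ε}

/-! ## Lattices, vectors and numbers as finite inputs

Rational data are given by integer numerators over a positive denominator; fractions need not be
in lowest terms, and an input is a finite list of integers. -/

/-- A basis of an `n`-dimensional lattice in `ℝⁿ`: the `i`-th basis vector is `num i / den`. -/
structure LatticeBasis (n : ℕ) where
  num : Matrix (Fin n) (Fin n) ℤ
  den : ℕ
  den_pos : 0 < den
  det_ne_zero : num.det ≠ 0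

namespace LatticeBasis

/-- The `i`-th basis vector. -/
def vec {n : ℕ} (B : LatticeBasis n) (i : Fin n) : E n :=
  WithLp.toLp 2 fun j => (B.num i j : ℝ) / (B.den : ℝ)

/-- The lattice of all integer combinations of the basis vectors. -/
def lattice {n : ℕ} (B : LatticeBasis n) : Submodule ℤ (E n) :=
  Submodule.span ℤ (Set.range B.vec)

/-- The lattice vector with given integer coefficients. -/
def comb {n : ℕ} (B : LatticeBasis n) (z : Fin n → ℤ) : E n := ∑ i, z i • B.vec i

/-- The dimension, the rows of the numerator matrix, and the denominator. -/
def encode {n : ℕ} (B : LatticeBasis n) : List ℤ :=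
  (n : ℤ) :: (List.ofFn fun i => List.ofFn fun j => B.num i j).flatten ++ [(B.den : ℤ)]

end LatticeBasis

/-- A positive rational number. -/
structure PosRational where
  num : ℕ
  den : ℕ
  num_pos : 0 < num
  den_pos : 0 < den

namespace PosRational

def val (q : PosRational) : ℝ := (q.num : ℝ) / (q.den : ℝ)

def encode (q : PosRational) : List ℤ := [(q.num : ℤ), (q.den : ℤ)]

end PosRational

/-- A rational vector `num / den`. -/
structure RationalVector (n : ℕ) where
  num : Fin n → ℤ
  den : ℕ
  den_pos : 0 < den

namespace RationalVector

def val {n : ℕ} (t : RationalVector n) : E n :=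
  WithLp.toLp 2 fun j => (t.num j : ℝ) / (t.den : ℝ)

def encode {n : ℕ} (t : RationalVector n) : List ℤ := List.ofFn t.num ++ [(t.den : ℤ)]

end RationalVector

/-! ## A machine model: a random access machine over `ℤ` with logarithmic cost and an oracle

The memory has one integer in each cell, the cells are numbered by `ℤ`. All costs count bits. -/

/-- The number of bits of an integer, with its sign. -/
def bitLen (z : ℤ) : ℕ := Nat.size z.natAbs + 1

/-- The number of bits of a list of integers. -/
def listSize (l : List ℤ) : ℕ := (l.map bitLen).sum

/-- Arithmetic expressions; `load e` is the content of the cell with number `e`. -/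
inductive Expr : Type
  | const (z : ℤ) : Expr
  | load (e : Expr) : Expr
  | add (e f : Expr) : Expr
  | sub (e f : Expr) : Expr
  | mul (e f : Expr) : Expr
  | div (e f : Expr) : Expr

namespace Expr

def eval (m : ℤ → ℤ) : Expr → ℤ
  | const z => z
  | load e => m (e.eval m)
  | add e f => e.eval m + f.eval m
  | sub e f => e.eval m - f.eval m
  | mul e f => e.eval m * f.eval m
  | div e f => e.eval m / f.eval m

/-- The cost of an evaluation: every constant, address, operand and result is charged its bits. -/
def cost (m : ℤ → ℤ) : Expr → ℕ
  | const z => bitLen z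
  | load e => e.cost m + bitLen (m (e.eval m)) + 1
  | add e f => e.cost m + f.cost m + bitLen (e.eval m + f.eval m) + 1
  | sub e f => e.cost m + f.cost m + bitLen (e.eval m - f.eval m) + 1
  | mul e f => e.cost m + f.cost m + bitLen (e.eval m * f.eval m) + 1
  | div e f => e.cost m + f.cost m + bitLen (e.eval m / f.eval m) + 1

end Expr

/-- Programs.
* `store a e` writes the value of `e` to the cell with number `a`;
* `ite e p q` runs `p` if `e` is positive, and `q` otherwise;
* `loop e p` repeats `p` as long as `e` is positive;
* `query a k dst cap` sends the list of the `k` integers in the cells from `a` on to the oracle.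
  An answer of at most `cap` bits is written, preceded by its length, to the cells from `dst` on;
  for a longer answer `-1` is written to cell `dst`. (Answers have no a priori length bound; `cap`
  is the time that the program spends on reading the answer, and it pays for it.) -/
inductive Prog : Type
  | store (a e : Expr) : Prog
  | seq (p q : Prog) : Prog
  | ite (e : Expr) (p q : Prog) : Prog
  | loop (e : Expr) (p : Prog) : Prog
  | query (a k dst cap : Expr) : Prog

/-- The content of the `k` cells from `a` on. -/
def readList (m : ℤ → ℤ) (a : ℤ) (k : ℕ) : List ℤ := (List.range k).map fun i => m (a + (i : ℤ))

/-- The memory after a list has been written to the cells from `a` on. -/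
def writeList (m : ℤ → ℤ) (a : ℤ) (l : List ℤ) : ℤ → ℤ := fun j =>
  if a ≤ j ∧ j < a + (l.length : ℤ) then l.getD (j - a).toNat 0 else m j

/-- The memory after the answer to a query has been received. -/
def receive (m : ℤ → ℤ) (dst : ℤ) (cap : ℕ) (ans : List ℤ) : ℤ → ℤ :=
  if listSize ans ≤ cap then writeList m dst ((ans.length : ℤ) :: ans) else writeList m dst [-1]

/-- A configuration: what remains to be run, the memory, and the time used so far. -/
structure Config where
  todo : List Prog
  mem : ℤ → ℤ
  time : ℕ

/-- A randomized oracle. Every call draws a fresh, independent answer. -/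
abbrev Oracle : Type := List ℤ → PMF (List ℤ)

/-- One step; its only source of randomness is the oracle. -/
def step (O : Oracle) (c : Config) : PMF Config :=
  match c.todo with
  | [] => PMF.pure c
  | Prog.store a e :: K =>
      PMF.pure ⟨K, Function.update c.mem (a.eval c.mem) (e.eval c.mem),
        c.time + a.cost c.mem + e.cost c.mem + 1⟩
  | Prog.seq p q :: K => PMF.pure ⟨p :: q :: K, c.mem, c.time + 1⟩
  | Prog.ite e p q :: K =>
      PMF.pure ⟨(if 0 < e.eval c.mem then p else q) :: K, c.mem, c.time + e.cost c.mem + 1⟩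
  | Prog.loop e p :: K =>
      PMF.pure ⟨if 0 < e.eval c.mem then p :: Prog.loop e p :: K else K, c.mem,
        c.time + e.cost c.mem + 1⟩
  | Prog.query a k dst cap :: K =>
      (O (readList c.mem (a.eval c.mem) (k.eval c.mem).toNat)).map fun ans =>
        ⟨K, receive c.mem (dst.eval c.mem) (cap.eval c.mem).toNat ans,
          c.time + a.cost c.mem + k.cost c.mem + dst.cost c.mem + cap.cost c.mem
            + listSize (readList c.mem (a.eval c.mem) (k.eval c.mem).toNat)
            + (cap.eval c.mem).toNat + 1⟩

/-- The distribution of the configuration after `k` steps. -/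
def run (O : Oracle) : ℕ → Config → PMF Config
  | 0, c => PMF.pure c
  | k + 1, c => (step O c).bind (run O k)

/-- The input is placed in the cells `0, 1, 2, …`; all other cells contain `0`. -/
def initial (P : Prog) (input : List ℤ) : Config := ⟨[P], writeList (fun _ => 0) 0 input, 0⟩

/-- Whatever the oracle answers, the program halts within time `T`. (Every step takes time at
least one, so that `T` steps suffice.) -/
def HaltsWithin (P : Prog) (O : Oracle) (input : List ℤ) (T : ℕ) : Prop :=
  ∀ c ∈ (run O T (initial P input)).support, c.todo = [] ∧ c.time ≤ T

/-- The probability that the program has halted after `T` steps and accepts,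
which it does by leaving `1` in cell `-1`. -/
def acceptProb (P : Prog) (O : Oracle) (input : List ℤ) (T : ℕ) : ℝ :=
  ((run O T (initial P input)).toOuterMeasure {c | c.todo = [] ∧ c.mem (-1) = 1}).toReal

/-! ## The computational problems -/

/-- A promise problem on lattices, with the dimension of its instances. -/
structure PromiseProblem where
  Inst : Type
  dim : Inst → ℕ
  encode : Inst → List ℤ
  yes : Inst → Prop
  no : Inst → Prop

/-- An instance of a gap version of the shortest vector problem. -/
structure SVPInstance where
  n : ℕ
  n_pos : 1 ≤ n
  B : LatticeBasis n
  d : PosRational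

/-- `GapSVP_g`. -/
def GapSVP (g : ℕ → ℝ) : PromiseProblem where
  Inst := SVPInstance
  dim x := x.n
  encode x := x.B.encode ++ x.d.encode
  yes x := lambda1 x.B.lattice ≤ x.d.val
  no x := g x.n * x.d.val < lambda1 x.B.lattice

/-- An instance of a gap version of the closest vector problem. -/
structure CVPInstance where
  n : ℕ
  n_pos : 1 ≤ n
  B : LatticeBasis n
  t : RationalVector n
  d : PosRational

/-- The variant of `GapCVP_g` in which also `λ₁(L) > g(n) d` is promised for NO instances. -/
def GapCVPPrime (g : ℕ → ℝ) : PromiseProblem where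
  Inst := CVPInstance
  dim x := x.n
  encode x := x.B.encode ++ x.t.encode ++ x.d.encode
  yes x := Metric.infDist x.t.val (x.B.lattice : Set (E x.n)) ≤ x.d.val
  no x := g x.n * x.d.val < lambda1 x.B.lattice ∧
    g x.n * x.d.val < Metric.infDist x.t.val (x.B.lattice : Set (E x.n))

/-- A real-valued function on lattices. -/
abbrev LatticeFunction : Type := (n : ℕ) → Submodule ℤ (E n) → ℝ

/-- The oracle solves `DGS_φ`: for all `n ≥ 1`, all bases of `n`-dimensional lattices `L` and all
`r > φ(L)` its answer is a sample from `D_{L,r}`, given by the list of its coefficients in the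
basis of the query. On all other queries the oracle may behave arbitrarily. -/
def SolvesDGS (φ : LatticeFunction) (O : Oracle) : Prop :=
  ∀ (n : ℕ) (B : LatticeBasis n) (r : PosRational), 1 ≤ n → φ n B.lattice < r.val →
    ∀ z : Fin n → ℤ, O (B.encode ++ r.encode) (List.ofFn z) =
      ENNReal.ofReal (discreteGaussian (B.lattice : Set (E n)) r.val (B.comb z))

/-- There is a polynomial time reduction from the promise problem `Q` to `DGS_φ`: a program that
runs in time polynomial in the bit size of the input, for every input and every oracle, and that,
with any oracle for `DGS_φ`, decides `Q` with error probability `2^{-Ω(n)}` (and at most `1/3` in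
all dimensions). -/
def PolyTimeReducesToDGS (Q : PromiseProblem) (φ : LatticeFunction) : Prop :=
  ∃ (P : Prog) (p : Polynomial ℕ) (c : ℝ), 0 < c ∧
    (∀ (O : Oracle) (x : Q.Inst),
      HaltsWithin P O (Q.encode x) (p.eval (listSize (Q.encode x)))) ∧
    ∀ O : Oracle, SolvesDGS φ O → ∀ x : Q.Inst,
      (Q.yes x → 1 - min (1 / 3) ((2 : ℝ) ^ (-(c * (Q.dim x : ℝ)))) ≤
        acceptProb P O (Q.encode x) (p.eval (listSize (Q.encode x)))) ∧
      (Q.no x → acceptProb P O (Q.encode x) (p.eval (listSize (Q.encode x))) ≤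
        min (1 / 3) ((2 : ℝ) ^ (-(c * (Q.dim x : ℝ)))))

end LatticeReduction

end

/-! Let `L` be the given lattice and `t` the target. The program samples vectors `w` of the dual
lattice with parameter `r = 1 / (20 d)`. Since `w` has integral inner products with `L`, the residue
of `⟨w, t⟩` modulo 1 depends only on the coset of `t`, and it separates targets near to `L` from
targets far from `L`. The program draws `N = 10⁵ n⁵` samples and runs three tests: the answers are
coefficient lists of the right length and of bounded size; every weighted second moment `∑ w_j w_k`
is at most `N r²` in absolute value, with weight `1` on the diagonal and `n` off it; and the squared
distances of `⟨w, t⟩` to the integers have mean larger than `1/40`. It accepts exactly if some test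
fails.

For a YES instance there is `e = t - v` with `v` in `L` and `‖e‖ ≤ 2 d`. The distance of `⟨w, t⟩` to
the integers is at most `|⟨w, e⟩|`, and if the moment test passes, then `∑ ⟨w, e⟩² ≤ 2 N r² ‖e‖² ≤ N
/ 50`, so that the distance test fails (`Regular.bad_ne_zero`). This holds for all integral answers.
It has to: nothing is promised about `λ₁(L)` here, so the oracle may be queried outside its domain.
YES instances are accepted with probability one.

For a NO instance `λ₁(L)` and `dist(t, L)` are at least `5 √n / r`, and the oracle does return
Gaussian samples. Poisson summation (`IsDualPair.exists_hasSum_rho`) gives `E cos(2π⟨w, x⟩) =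
ρ_{1/r}(x + L) / ρ_{1/r}(L)`. At `x = t` the quotient is tiny by a weak form of Banaszczyk's tail
bound (`IsDualPair.tail_le`), which forces a mean squared distance of almost `1 / (2π²) > 1/40`. For
small `x` the same identity shows that second moments along any vector are at most those of the
continuous Gaussian (`IsDualPair.second_moment_le`), and along unit vectors smaller by a factor of
at least `1 - 1/n` only (`IsDualPair.le_second_moment_of_norm_eq_one`). Polarization then bounds the
mixed moments by `r² / (2π n)`, which pays for the weight `n`. Chernoff's inequality for truncated
samples and a union bound finish this case (`Separated.prob_bad_le`).

The shortest vector problem is reduced to `n` problems of this kind: the lattice `L_i` arises from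
`L` by doubling the basis vector `b_i`, and `b_i` is the target. A shortest vector may be assumed to
have an odd coefficient, say at `b_i`, and then it is the difference of `b_i` and a vector of `L_i`.
Conversely `b_i + L_i` is contained in `L` and misses `0`. The hypothesis on the parameter is met
because `η_ε(L_i*) ≤ √n / λ₁(L_i)` for `ε = 2^{-n}` (`IsDualPair.smoothingParameter_le`).

The other half of the proof is about the machine. The dual bases are computed with the algorithm of
Faddeev and LeVerrier, which has a fixed control flow, uses exact integer divisions only, and keeps
all numbers polynomially long. No query depends on an answer, so the run is a function of
independent answers to a fixed list of queries (`run_eq_map_tape`). Nearly every stage is one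
accumulating loop whose effect is known in closed form (`exists_runs_accumProg`); a stage lengthens
numbers by a constant factor, and the number of stages is fixed. The same program, with other
expressions for its parameters, serves both reductions. -/

namespace LatticeReduction

/-! ## Executions relative to a list of oracle answers -/

/-- A list of queries with their answers. -/
abbrev Trace : Type := List (List ℤ × List ℤ)

/-- `Exec c h c'`: some steps lead from `c` to `c'`, with queries and answers `h`. -/
inductive Exec : Config → Trace → Config → Prop
  | refl (c : Config) : Exec c [] c
  | store {a e : Expr} {K : List Prog} {m : ℤ → ℤ} {t : ℕ} {h : Trace} {c : Config} :
      Exec ⟨K, Function.update m (a.eval m) (e.eval m), t + a.cost m + e.cost m + 1⟩ h c →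
      Exec ⟨Prog.store a e :: K, m, t⟩ h c
  | seq {p q : Prog} {K : List Prog} {m : ℤ → ℤ} {t : ℕ} {h : Trace} {c : Config} :
      Exec ⟨p :: q :: K, m, t + 1⟩ h c → Exec ⟨Prog.seq p q :: K, m, t⟩ h c
  | ite {e : Expr} {p q : Prog} {K : List Prog} {m : ℤ → ℤ} {t : ℕ} {h : Trace} {c : Config} :
      Exec ⟨(if 0 < e.eval m then p else q) :: K, m, t + e.cost m + 1⟩ h c →
      Exec ⟨Prog.ite e p q :: K, m, t⟩ h c
  | loop {e : Expr} {p : Prog} {K : List Prog} {m : ℤ → ℤ} {t : ℕ} {h : Trace} {c : Config} :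
      Exec ⟨if 0 < e.eval m then p :: Prog.loop e p :: K else K, m, t + e.cost m + 1⟩ h c →
      Exec ⟨Prog.loop e p :: K, m, t⟩ h c
  | query {a k dst cap : Expr} {K : List Prog} {m : ℤ → ℤ} {t : ℕ} {h : Trace} {c : Config}
      {ans : List ℤ} :
      Exec ⟨K, receive m (dst.eval m) (cap.eval m).toNat ans,
          t + a.cost m + k.cost m + dst.cost m + cap.cost m
            + listSize (readList m (a.eval m) (k.eval m).toNat)
            + (cap.eval m).toNat + 1⟩ h c →
      Exec ⟨Prog.query a k dst cap :: K, m, t⟩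
        ((readList m (a.eval m) (k.eval m).toNat, ans) :: h) c

theorem Exec.trans {c₁ c₂ c₃ : Config} {h₁ h₂ : Trace} (H₁ : Exec c₁ h₁ c₂)
    (H₂ : Exec c₂ h₂ c₃) : Exec c₁ (h₁ ++ h₂) c₃ := by
  induction H₁ with
  | refl c => exact H₂
  | store _ ih => exact Exec.store (ih H₂)
  | seq _ ih => exact Exec.seq (ih H₂)
  | ite _ ih => exact Exec.ite (ih H₂)
  | loop _ ih => exact Exec.loop (ih H₂)
  | query _ ih => exact Exec.query (ih H₂)

theorem Exec.time_le {c c' : Config} {h : Trace} (H : Exec c h c') : c.time ≤ c'.time := by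
  induction H with
  | refl c => exact le_rfl
  | store _ ih => simp only at ih ⊢; omega
  | seq _ ih => simp only at ih ⊢; omega
  | ite _ ih => simp only at ih ⊢; omega
  | loop _ ih => simp only at ih ⊢; omega
  | query _ ih => simp only at ih ⊢; omega

/-- The joint distribution of independent answers to a list of queries. -/
noncomputable def tape (O : Oracle) : List (List ℤ) → PMF (List (List ℤ))
  | [] => PMF.pure []
  | q :: qs => (O q).bind fun a => (tape O qs).map (a :: ·)

theorem run_halted (O : Oracle) (T : ℕ) (m : ℤ → ℤ) (t : ℕ) :
    run O T ⟨[], m, t⟩ = PMF.pure ⟨[], m, t⟩ := by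
  induction T with
  | zero => rfl
  | succ T ih => rw [run]; simp only [step]; rw [PMF.pure_bind, ih]

theorem tape_cons_map (O : Oracle) (q : List ℤ) (qs : List (List ℤ))
    (final : List (List ℤ) → Config) : (tape O (q :: qs)).map final =
      (O q).bind fun a => (tape O qs).map fun as => final (a :: as) := by
  rw [tape, PMF.map_bind]
  congr 1
  funext a
  rw [PMF.map_comp]
  rfl

/-- If the queries of a program do not depend on the answers, then its final configuration is a
function of independent answers to these queries. -/
theorem run_eq_map_tape (O : Oracle) (T : ℕ) : ∀ (c : Config) (qs : List (List ℤ))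
    (final : List (List ℤ) → Config),
    (∀ as, as.length = qs.length → Exec c (qs.zip as) (final as) ∧ (final as).todo = [] ∧
      (final as).time ≤ c.time + T) →
    run O T c = (tape O qs).map final := by
  have halted : ∀ (m : ℤ → ℤ) (t T : ℕ) (qs : List (List ℤ)) (final : List (List ℤ) → Config),
      (∀ as, as.length = qs.length → Exec ⟨[], m, t⟩ (qs.zip as) (final as)) →
      run O T ⟨[], m, t⟩ = (tape O qs).map final := by
    intro m t T qs final H
    -- Any answers of the right number will do here: a halted configuration consumes none, so the
    -- list of queries must be empty.
    have h := H (List.replicate qs.length []) (by simp)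
    cases qs with
    | nil =>
      simp only [List.length_nil, List.replicate_zero, List.zip_nil_left] at h
      have h3 : final [] = ⟨[], m, t⟩ := by
        generalize final [] = c' at h
        cases h
        rfl
      rw [run_halted, tape, PMF.pure_map, h3]
    | cons q qs =>
      exfalso
      generalize final _ = c' at h
      simp only [List.length_cons, List.replicate_succ, List.zip_cons_cons] at h
      generalize hh : (q, _) :: _ = h' at h
      cases h
      cases hh
  induction T with
  | zero =>
    intro c qs final H
    obtain ⟨todo, m, t⟩ := c
    cases todo with
    | nil => exact halted m t 0 qs final fun as ha => (H as ha).1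
    | cons p K =>
      -- Every command costs at least one unit of time, so a program that is not finished cannot
      -- meet a time bound of zero further units.
      exfalso
      obtain ⟨h1, h2, h3⟩ := H (List.replicate qs.length []) (by simp)
      generalize final _ = c' at h1 h2 h3
      generalize qs.zip _ = h at h1
      simp only at h3
      cases h1 with
      | refl => simp at h2
      | store h1 => have := h1.time_le; simp only at this; omega
      | seq h1 => have := h1.time_le; simp only at this; omega
      | ite h1 => have := h1.time_le; simp only at this; omega
      | loop h1 => have := h1.time_le; simp only at this; omega
      | query h1 => have := h1.time_le; simp only at this; omega
  | succ T ih =>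
    intro c qs final H
    obtain ⟨todo, m, t⟩ := c
    -- All commands except queries have one successor, and the execution for each tape can be
    -- inverted to pass through it.
    have det : ∀ (p : Prog) (K : List Prog) (c' : Config), step O ⟨p :: K, m, t⟩ = PMF.pure c' →
        t + 1 ≤ c'.time → (∀ as c'', as.length = qs.length → c''.todo = [] →
          Exec ⟨p :: K, m, t⟩ (qs.zip as) c'' → Exec c' (qs.zip as) c'') →
        (∀ as, as.length = qs.length → Exec ⟨p :: K, m, t⟩ (qs.zip as) (final as) ∧
          (final as).todo = [] ∧ (final as).time ≤ t + (T + 1)) →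
        run O (T + 1) ⟨p :: K, m, t⟩ = (tape O qs).map final := by
      intro p K c' h1 h2 h3 H
      rw [run, h1, PMF.pure_bind]
      refine ih c' qs final fun as ha => ?_
      obtain ⟨h4, h5, h6⟩ := H as ha
      exact ⟨h3 as _ ha h5 h4, h5, by omega⟩
    cases todo with
    | nil => exact halted m t _ qs final fun as ha => (H as ha).1
    | cons p K =>
      cases p with
      | store a e =>
        refine det _ _ _ rfl (by simp only; omega) (fun as c'' _ h2 h3 => ?_) H
        generalize qs.zip as = h at h3 ⊢
        cases h3 with
        | refl => simp at h2
        | store h1 => exact h1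
      | seq p q =>
        refine det _ _ _ rfl (by simp only; omega) (fun as c'' _ h2 h3 => ?_) H
        generalize qs.zip as = h at h3 ⊢
        cases h3 with
        | refl => simp at h2
        | seq h1 => exact h1
      | ite e p q =>
        refine det _ _ _ rfl (by simp only; omega) (fun as c'' _ h2 h3 => ?_) H
        generalize qs.zip as = h at h3 ⊢
        cases h3 with
        | refl => simp at h2
        | ite h1 => exact h1
      | loop e p =>
        refine det _ _ _ rfl (by simp only; omega) (fun as c'' _ h2 h3 => ?_) H
        generalize qs.zip as = h at h3 ⊢
        cases h3 with
        | refl => simp at h2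
        | loop h1 => exact h1
      | query a k dst cap =>
        cases qs with
        | nil =>
          exfalso
          obtain ⟨h1, h2, h3⟩ := H [] rfl
          rw [List.zip_nil_left] at h1
          generalize final [] = c' at h1 h2
          cases h1
          simp at h2
        | cons q qs =>
          have key : ∀ a' as c'', c''.todo = [] →
              Exec ⟨Prog.query a k dst cap :: K, m, t⟩ ((q :: qs).zip (a' :: as)) c'' →
              q = readList m (a.eval m) (k.eval m).toNat ∧
              Exec ⟨K, receive m (dst.eval m) (cap.eval m).toNat a',
                t + a.cost m + k.cost m + dst.cost m + cap.cost m
                  + listSize (readList m (a.eval m) (k.eval m).toNat)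
                  + (cap.eval m).toNat + 1⟩ (qs.zip as) c'' := by
            intro a' as c'' h1 h2
            rw [List.zip_cons_cons] at h2
            generalize hh : (q, a') :: _ = h' at h2
            cases h2 with
            | refl => cases hh
            | query h3 =>
              rw [List.cons.injEq, Prod.mk.injEq] at hh
              obtain ⟨⟨h4, h5⟩, h6⟩ := hh
              subst h4 h5 h6
              exact ⟨rfl, h3⟩
          -- The content of a query is fixed before its answer arrives, so the execution for a
          -- single arbitrary tape identifies it.
          have hq : q = readList m (a.eval m) (k.eval m).toNat := by
            obtain ⟨h1, h2, -⟩ := H ([] :: List.replicate qs.length []) (by simp)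
            exact (key _ _ _ h2 h1).1
          rw [run, tape_cons_map, step, PMF.bind_map, hq]
          congr 1
          funext a'
          simp only [Function.comp]
          refine ih _ qs (fun as => final (a' :: as)) fun as ha => ?_
          obtain ⟨h1, h2, h3⟩ := H (a' :: as) (by simp [ha])
          exact ⟨(key _ _ _ h2 h1).2, h2, by simp only at h3 ⊢; omega⟩

/-! ## Costs and bounds for expressions -/

/-- All cells contain integers of at most `B` bits. -/
def Bdd (B : ℕ) (m : ℤ → ℤ) : Prop := ∀ a, bitLen (m a) ≤ B

theorem Bdd.mono {B B' : ℕ} {m : ℤ → ℤ} (h : Bdd B m) (hB : B ≤ B') : Bdd B' m :=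
  fun a => (h a).trans hB

theorem Bdd.update {B : ℕ} {m : ℤ → ℤ} (h : Bdd B m) {a z : ℤ} (hz : bitLen z ≤ B) :
    Bdd B (Function.update m a z) := by
  intro j
  rcases eq_or_ne j a with rfl | hj
  · simpa using hz
  · simpa [hj] using h j

theorem one_le_bitLen (z : ℤ) : 1 ≤ bitLen z := Nat.le_add_left _ _

theorem bitLen_le_iff {z : ℤ} {B : ℕ} : bitLen z ≤ B + 1 ↔ z.natAbs < 2 ^ B := by
  unfold bitLen
  rw [Nat.add_le_add_iff_right, Nat.size_le]

theorem bitLen_le_of_natAbs_le {y z : ℤ} (h : y.natAbs ≤ z.natAbs) : bitLen y ≤ bitLen z :=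
  Nat.add_le_add_right (Nat.size_le_size h) 1

theorem natAbs_lt_of_bitLen_le {z : ℤ} {B : ℕ} (h : bitLen z ≤ B) : z.natAbs < 2 ^ B := by
  have := bitLen_le_iff.1 (h.trans (Nat.le_succ B))
  exact this

theorem bitLen_mul_le (y z : ℤ) : bitLen (y * z) ≤ bitLen y + bitLen z := by
  have h : bitLen (y * z) ≤ (Nat.size y.natAbs + Nat.size z.natAbs) + 1 := by
    rw [bitLen_le_iff, Int.natAbs_mul, pow_add]
    exact Nat.mul_lt_mul'' (Nat.lt_size_self _) (Nat.lt_size_self _)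
  unfold bitLen at *
  omega

theorem bitLen_add_le' (y z : ℤ) {B : ℕ} (hy : y.natAbs < 2 ^ B) (hz : z.natAbs < 2 ^ B) :
    bitLen (y + z) ≤ B + 2 := by
  rw [bitLen_le_iff, pow_succ]
  have := Int.natAbs_add_le y z
  omega

theorem bitLen_add_le (y z : ℤ) : bitLen (y + z) ≤ bitLen y + bitLen z := by
  have h : bitLen (y + z) ≤ max (Nat.size y.natAbs) (Nat.size z.natAbs) + 2 :=
    bitLen_add_le' y z
      ((Nat.lt_size_self _).trans_le (Nat.pow_le_pow_right two_pos (le_max_left _ _)))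
      ((Nat.lt_size_self _).trans_le (Nat.pow_le_pow_right two_pos (le_max_right _ _)))
  unfold bitLen at *
  omega

theorem bitLen_neg (z : ℤ) : bitLen (-z) = bitLen z := by simp [bitLen]

theorem bitLen_sub_le (y z : ℤ) : bitLen (y - z) ≤ bitLen y + bitLen z := by
  rw [sub_eq_add_neg, ← bitLen_neg z]
  exact bitLen_add_le _ _

theorem bitLen_ediv_le (y z : ℤ) : bitLen (y / z) ≤ bitLen y :=
  bitLen_le_of_natAbs_le (by simpa using Int.natAbs_ediv_le_natAbs y z)

namespace Expr

/-- A factor by which the evaluation of an expression may increase the number of bits. -/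
def growth : Expr → ℕ
  | const z => bitLen z
  | load _ => 1
  | add e f => e.growth + f.growth
  | sub e f => e.growth + f.growth
  | mul e f => e.growth + f.growth
  | div e _ => e.growth

/-- The cost of an evaluation is at most this factor times the number of bits of the cells. -/
def costFactor : Expr → ℕ
  | const z => bitLen z
  | load e => e.costFactor + 2
  | add e f => e.costFactor + f.costFactor + (e.growth + f.growth) + 1
  | sub e f => e.costFactor + f.costFactor + (e.growth + f.growth) + 1
  | mul e f => e.costFactor + f.costFactor + (e.growth + f.growth) + 1
  | div e f => e.costFactor + f.costFactor + e.growth + 1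

/-- Bit lengths are subadditive under sums, differences and products, and quotients are no longer
than the dividend. A fixed expression therefore lengthens numbers by a constant factor at most, and
no individual magnitudes have to be tracked in straight-line code. -/
theorem bitLen_eval_le {B : ℕ} (hB : 1 ≤ B) {m : ℤ → ℤ} (hm : Bdd B m) :
    ∀ e : Expr, bitLen (e.eval m) ≤ e.growth * B
  | const z => Nat.le_mul_of_pos_right _ hB
  | load e => by simpa [growth] using! hm (e.eval m)
  | add e f => by
      rw [growth, add_mul]
      exact (bitLen_add_le _ _).trans
        (Nat.add_le_add (bitLen_eval_le hB hm e) (bitLen_eval_le hB hm f))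
  | sub e f => by
      rw [growth, add_mul]
      exact (bitLen_sub_le _ _).trans
        (Nat.add_le_add (bitLen_eval_le hB hm e) (bitLen_eval_le hB hm f))
  | mul e f => by
      rw [growth, add_mul]
      exact (bitLen_mul_le _ _).trans
        (Nat.add_le_add (bitLen_eval_le hB hm e) (bitLen_eval_le hB hm f))
  | div e f => (bitLen_ediv_le _ _).trans (bitLen_eval_le hB hm e)

theorem cost_le {B : ℕ} (hB : 1 ≤ B) {m : ℤ → ℤ} (hm : Bdd B m) :
    ∀ e : Expr, e.cost m ≤ e.costFactor * B
  | const z => Nat.le_mul_of_pos_right _ hB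
  | load e => by
      have h1 := cost_le hB hm e
      have h2 := hm (e.eval m)
      simp only [cost, costFactor, add_mul]
      omega
  | add e f => by
      have h1 := cost_le hB hm e
      have h2 := cost_le hB hm f
      have h3 := bitLen_eval_le hB hm (add e f)
      simp only [cost, costFactor, add_mul, growth, eval] at *
      omega
  | sub e f => by
      have h1 := cost_le hB hm e
      have h2 := cost_le hB hm f
      have h3 := bitLen_eval_le hB hm (sub e f)
      simp only [cost, costFactor, add_mul, growth, eval] at *
      omega
  | mul e f => by
      have h1 := cost_le hB hm e
      have h2 := cost_le hB hm f
      have h3 := bitLen_eval_le hB hm (mul e f)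
      simp only [cost, costFactor, add_mul, growth, eval] at *
      omega
  | div e f => by
      have h1 := cost_le hB hm e
      have h2 := cost_le hB hm f
      have h3 := bitLen_eval_le hB hm (div e f)
      simp only [cost, costFactor, add_mul, growth, eval] at *
      omega

end Expr

/-! ## Rules for programs -/

/-- The program leads from memory `m` to memory `m'` in time `b`, with queries and answers `h`. -/
def Runs (P : Prog) (m : ℤ → ℤ) (h : Trace) (m' : ℤ → ℤ) (b : ℕ) : Prop :=
  ∀ (K : List Prog) (t : ℕ), ∃ t', t' ≤ t + b ∧ Exec ⟨P :: K, m, t⟩ h ⟨K, m', t'⟩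

theorem Runs.mono {P : Prog} {m m' : ℤ → ℤ} {h : Trace} {b b' : ℕ} (H : Runs P m h m' b)
    (hb : b ≤ b') : Runs P m h m' b' := by
  intro K t
  obtain ⟨t', h1, h2⟩ := H K t
  exact ⟨t', by omega, h2⟩

theorem runs_store (a e : Expr) (m : ℤ → ℤ) : Runs (Prog.store a e) m []
    (Function.update m (a.eval m) (e.eval m)) (a.cost m + e.cost m + 1) :=
  fun _ _ => ⟨_, by omega, Exec.store (Exec.refl _)⟩

theorem Runs.seq {p q : Prog} {m₁ m₂ m₃ : ℤ → ℤ} {h₁ h₂ : Trace} {b₁ b₂ : ℕ}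
    (H₁ : Runs p m₁ h₁ m₂ b₁) (H₂ : Runs q m₂ h₂ m₃ b₂) :
    Runs (Prog.seq p q) m₁ (h₁ ++ h₂) m₃ (b₁ + b₂ + 1) := by
  intro K t
  obtain ⟨t₁, ht₁, E₁⟩ := H₁ (q :: K) (t + 1)
  obtain ⟨t₂, ht₂, E₂⟩ := H₂ K t₁
  exact ⟨t₂, by omega, Exec.seq (E₁.trans E₂)⟩

theorem runs_loop_done {e : Expr} {m : ℤ → ℤ} (he : e.eval m ≤ 0) (p : Prog) :
    Runs (Prog.loop e p) m [] m (e.cost m + 1) := by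
  intro K t
  refine ⟨t + e.cost m + 1, by omega, Exec.loop ?_⟩
  rw [if_neg (not_lt.2 he)]
  exact Exec.refl _

theorem Runs.loop {e : Expr} {p : Prog} {m₁ m₂ m₃ : ℤ → ℤ} {h₁ h₂ : Trace} {b₁ b₂ : ℕ}
    (he : 0 < e.eval m₁) (H₁ : Runs p m₁ h₁ m₂ b₁) (H₂ : Runs (Prog.loop e p) m₂ h₂ m₃ b₂) :
    Runs (Prog.loop e p) m₁ (h₁ ++ h₂) m₃ (e.cost m₁ + 1 + b₁ + b₂) := by
  intro K t
  obtain ⟨t₁, ht₁, E₁⟩ := H₁ (Prog.loop e p :: K) (t + e.cost m₁ + 1)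
  obtain ⟨t₂, ht₂, E₂⟩ := H₂ K t₁
  refine ⟨t₂, by omega, Exec.loop ?_⟩
  rw [if_pos he]
  exact E₁.trans E₂

theorem runs_query (a k dst cap : Expr) (m : ℤ → ℤ) (ans : List ℤ) :
    Runs (Prog.query a k dst cap) m [(readList m (a.eval m) (k.eval m).toNat, ans)]
      (receive m (dst.eval m) (cap.eval m).toNat ans)
      (a.cost m + k.cost m + dst.cost m + cap.cost m
        + listSize (readList m (a.eval m) (k.eval m).toNat) + (cap.eval m).toNat + 1) :=
  fun _ _ => ⟨_, by omega, Exec.query (Exec.refl _)⟩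

/-- Repeat `body` for the values `0, …, cnt - 1` of the variable in cell `v`. -/
def forProg (v : ℤ) (cnt : Expr) (body : Prog) : Prog :=
  Prog.seq (Prog.store (Expr.const v) (Expr.const 0))
    (Prog.loop (Expr.sub cnt (Expr.load (Expr.const v)))
      (Prog.seq body
        (Prog.store (Expr.const v) (Expr.add (Expr.load (Expr.const v)) (Expr.const 1)))))

/-- A bound for the costs of the administration of a loop. -/
def forFactor (v : ℤ) (cnt : Expr) : ℕ := cnt.costFactor + cnt.growth + 4 * bitLen v + 40

/-- The rule for counted loops: `I k` is the invariant at the moment when the variable has the value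
`k`, before the `k`-th round. The bit bound is part of the invariant because it controls the costs
of the administration; the factor `N + 1` accounts for the final evaluation of the condition. -/
theorem runs_forProg {v : ℤ} {cnt : Expr} {body : Prog} {m : ℤ → ℤ} {N b B : ℕ} (hB : 1 ≤ B)
    (I : ℕ → (ℤ → ℤ) → Prop) (h : ℕ → Trace)
    (h0 : I 0 (Function.update m v 0))
    (hI : ∀ k ≤ N, ∀ m, I k m → m v = k ∧ cnt.eval m = N ∧ Bdd B m)
    (hbody : ∀ k < N, ∀ m, I k m → ∃ m', Runs body m (h k) m' b ∧ Bdd B m' ∧ m' v = k ∧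
      I (k + 1) (Function.update m' v (k + 1))) :
    ∃ m', I N m' ∧ Runs (forProg v cnt body) m ((List.range N).flatMap h) m'
      ((N + 1) * (b + forFactor v cnt * B)) := by
  have hcost : ∀ m, Bdd B m →
      (Expr.sub cnt (Expr.load (Expr.const v))).cost m ≤
        (cnt.costFactor + cnt.growth + bitLen v + 4) * B := fun m hm => by
    refine (Expr.cost_le hB hm _).trans_eq ?_
    simp only [Expr.costFactor, Expr.growth]
    ring
  have hcost2 : ∀ m, Bdd B m → (Expr.const v).cost m +
      (Expr.add (Expr.load (Expr.const v)) (Expr.const 1)).cost m ≤ (2 * bitLen v + 10) * B := by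
    intro m hm
    refine (Nat.add_le_add (Expr.cost_le hB hm _) (Expr.cost_le hB hm _)).trans ?_
    rw [← add_mul]
    refine Nat.mul_le_mul_right _ ?_
    simp only [Expr.costFactor, Expr.growth]
    have : bitLen 1 = 2 := by decide
    omega
  -- Induction on the number `j` of rounds that remain.
  have key : ∀ j k, k + j = N → ∀ m, I k m → ∃ m', I N m' ∧
      Runs (Prog.loop (Expr.sub cnt (Expr.load (Expr.const v)))
        (Prog.seq body (Prog.store (Expr.const v)
          (Expr.add (Expr.load (Expr.const v)) (Expr.const 1))))) m
        ((List.range' k j).flatMap h) m'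
        ((cnt.costFactor + cnt.growth + bitLen v + 4) * B + 1 +
          j * (b + (cnt.costFactor + cnt.growth + 3 * bitLen v + 18) * B)) := by
    intro j
    induction j with
    | zero =>
      intro k hk m hmI
      obtain rfl : k = N := by omega
      obtain ⟨h1, h2, h3⟩ := hI k le_rfl m hmI
      refine ⟨m, hmI, (runs_loop_done ?_ _).mono ?_⟩
      · simp [Expr.eval, h1, h2]
      · have := hcost m h3
        omega
    | succ j ih =>
      intro k hk m hmI
      obtain ⟨h1, h2, h3⟩ := hI k (by omega) m hmI
      obtain ⟨m', r1, r2, r3, r4⟩ := hbody k (by omega) m hmI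
      obtain ⟨m'', r5, r6⟩ := ih (k + 1) (by omega) _ r4
      refine ⟨m'', r5, ?_⟩
      have r7 := runs_store (Expr.const v)
        (Expr.add (Expr.load (Expr.const v)) (Expr.const 1)) m'
      simp only [Expr.eval, r3] at r7
      have r8 := Runs.loop (e := Expr.sub cnt (Expr.load (Expr.const v))) (m₁ := m)
        (by simp only [Expr.eval, h1, h2]; omega) (r1.seq r7) r6
      simp only [List.append_nil] at r8
      rw [List.range'_succ, List.flatMap_cons]
      refine r8.mono ?_
      have c1 := hcost m h3
      have c2 := hcost2 m' r2
      have : (b + (cnt.costFactor + cnt.growth + 3 * bitLen v + 18) * B) =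
        b + (cnt.costFactor + cnt.growth + bitLen v + 4) * B + (2 * bitLen v + 10) * B + 4 * B := by
        ring
      have c3 : (j + 1) * (b + (cnt.costFactor + cnt.growth + 3 * bitLen v + 18) * B) =
        j * (b + (cnt.costFactor + cnt.growth + 3 * bitLen v + 18) * B) +
        (b + (cnt.costFactor + cnt.growth + 3 * bitLen v + 18) * B) := by ring
      omega
  obtain ⟨m', r1, r2⟩ := key N 0 (by omega) _ h0
  refine ⟨m', r1, ?_⟩
  have r3 := (runs_store (Expr.const v) (Expr.const 0) m).seq r2
  rw [List.nil_append, ← List.range_eq_range'] at r3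
  refine r3.mono ?_
  have c : (Expr.const v).cost m + (Expr.const 0).cost m = bitLen v + 1 := rfl
  have c' : bitLen v ≤ bitLen v * B := Nat.le_mul_of_pos_right _ hB
  have e1 : forFactor v cnt * B = (cnt.costFactor + cnt.growth + bitLen v + 4) * B +
    3 * (bitLen v * B) + 36 * B := by unfold forFactor; ring
  have e2 : (N + 1) * (b + forFactor v cnt * B) = N * (b + forFactor v cnt * B) + b +
    forFactor v cnt * B := by ring
  have e3 : N * (b + (cnt.costFactor + cnt.growth + 3 * bitLen v + 18) * B) ≤
      N * (b + forFactor v cnt * B) := by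
    refine Nat.mul_le_mul_left _ (Nat.add_le_add_left (Nat.mul_le_mul_right _ ?_) _)
    unfold forFactor
    omega
  omega

/-- The indices with quotient `q` are the block from `q * b` on. A loop that adds to the cell with
number `p / b` thus computes `A` sums of length `b`, without nested loops. -/
theorem sum_range_mul_ite_div (A b q : ℕ) (hq : q < A) (V : ℕ → ℤ) :
    (∑ p ∈ Finset.range (A * b), if p / b = q then V p else 0) =
      ∑ l ∈ Finset.range b, V (q * b + l) := by
  rcases Nat.eq_zero_or_pos b with rfl | hb
  · simp
  have hdiv : ∀ a l, l < b → (a * b + l) / b = a := fun a l hl => by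
    rw [mul_comm, Nat.mul_add_div hb, Nat.div_eq_of_lt hl, add_zero]
  have key : ∀ n : ℕ, (∑ p ∈ Finset.range (n * b), if p / b = q then V p else 0) =
      if q < n then ∑ l ∈ Finset.range b, V (q * b + l) else 0 := by
    intro n
    induction n with
    | zero => simp
    | succ n ih =>
      rw [add_mul, one_mul, Finset.sum_range_add, ih]
      have hc : (∑ l ∈ Finset.range b, if (n * b + l) / b = q then V (n * b + l) else 0) =
          ∑ l ∈ Finset.range b, if n = q then V (n * b + l) else 0 :=
        Finset.sum_congr rfl fun l hl => by rw [hdiv n l (Finset.mem_range.1 hl)]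
      rw [hc]
      rcases lt_trichotomy q n with h | rfl | h
      · simp [h, h.ne', Nat.lt_succ_of_lt h]
      · simp
      · rw [if_neg (by omega), if_neg (by omega)]
        simp [h.ne]
  rw [key, if_pos hq]

/-- For `p < cnt`, add the value of `val` to the cell `addr`; the expressions depend on `p` through
the variable in cell `v`. -/
def accumProg (v : ℤ) (cnt addr val : Expr) : Prog :=
  forProg v cnt (Prog.store addr (Expr.add (Expr.load addr) val))

/-- The effect of `accumProg` when the cell that is addressed at time `p` is `g (p / b)`. -/
theorem exists_runs_accumProg (v : ℤ) (cnt addr val : Expr) : ∃ κ w : ℕ, ∀ (m : ℤ → ℤ)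
    (A b B : ℕ) (g : ℕ → ℤ) (V : ℕ → ℤ), 1 ≤ B → Bdd B m → (∀ q < A, g q ≠ v) →
    (∀ q < A, ∀ q' < A, g q = g q' → q = q') →
    (∀ m' : ℤ → ℤ, (∀ a, a ≠ v → (∀ q < A, g q ≠ a) → m' a = m a) →
      cnt.eval m' = ((A * b : ℕ) : ℤ)) →
    (∀ p < A * b, ∀ m' : ℤ → ℤ, m' v = p → (∀ a, a ≠ v → (∀ q < A, g q ≠ a) → m' a = m a) →
      addr.eval m' = g (p / b) ∧ val.eval m' = V p) →
    ∃ m', Runs (accumProg v cnt addr val) m [] m' ((A * b + 1) * (κ * B)) ∧ Bdd (w * B) m' ∧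
      (∀ q < A, m' (g q) = m (g q) + ∑ l ∈ Finset.range b, V (q * b + l)) ∧
      (∀ a, a ≠ v → (∀ q < A, g q ≠ a) → m' a = m a) ∧ m' v = ((A * b : ℕ) : ℤ) := by
  refine ⟨(2 * addr.costFactor + addr.growth + val.costFactor + val.growth + 10 +
      forFactor v cnt) * (cnt.growth + val.growth * (cnt.growth + 1) + 4),
    cnt.growth + val.growth * (cnt.growth + 1) + 4, ?_⟩
  intro m A b B g V hB hm hgv hinj hcnt hev
  have hdiv : ∀ p < A * b, p / b < A := fun p hp => Nat.div_lt_of_lt_mul (by rwa [mul_comm])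
  set w := cnt.growth + val.growth * (cnt.growth + 1) + 4 with hw
  have hNB : bitLen ((A * b : ℕ) : ℤ) ≤ cnt.growth * B := by
    rw [← hcnt m fun _ _ _ => rfl]
    exact Expr.bitLen_eval_le hB hm cnt
  have hpB : ∀ p ≤ A * b, bitLen (p : ℤ) ≤ cnt.growth * B := fun p hp =>
    (bitLen_le_of_natAbs_le (by rwa [Int.natAbs_natCast, Int.natAbs_natCast])).trans hNB
  have hVB : ∀ p < A * b, bitLen (V p) ≤ val.growth * (cnt.growth + 1) * B := by
    intro p hp
    have h1 : Bdd ((cnt.growth + 1) * B) (Function.update m v p) := by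
      refine (hm.mono ?_).update ((hpB p hp.le).trans ?_)
      · exact Nat.le_mul_of_pos_left _ (Nat.succ_pos _)
      · exact Nat.mul_le_mul_right _ (Nat.le_succ _)
    have h2 := (hev p hp (Function.update m v p) (by simp) fun a ha _ => by simp [ha]).2
    rw [← h2, mul_assoc]
    exact Expr.bitLen_eval_le (hB.trans (Nat.le_mul_of_pos_left _ (Nat.succ_pos _))) h1 val
  -- The memory after `k` rounds in closed form, so that the loop invariant is an equality of
  -- memories.
  let F : ℕ → ℤ → ℤ := fun k a => if a = v then (k : ℤ) else
    m a + ∑ p ∈ Finset.range k, if g (p / b) = a then V p else 0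
  have hFv : ∀ k, F k v = k := fun k => by simp [F]
  have hFa : ∀ k ≤ A * b, ∀ a, a ≠ v → (∀ q < A, g q ≠ a) → F k a = m a := by
    intro k hk a ha hq
    simp only [F, if_neg ha]
    rw [Finset.sum_eq_zero, add_zero]
    intro p hp
    rw [if_neg (hq _ (hdiv p (lt_of_lt_of_le (Finset.mem_range.1 hp) hk)))]
  have hFB : ∀ k ≤ A * b, Bdd (w * B) (F k) := by
    intro k hk a
    by_cases ha : a = v
    · rw [ha, hFv]
      refine (hpB k hk).trans (Nat.mul_le_mul_right _ ?_)
      omega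
    · simp only [F, if_neg ha]
      -- A sum is at most as long as its number of terms and its longest term together. Both are
      -- `O(B)` bits, hence accumulation costs only a constant factor in length, however many rounds
      -- there are.
      have h1 : (m a).natAbs < 2 ^ B := natAbs_lt_of_bitLen_le (hm a)
      have h2 : (∑ p ∈ Finset.range k, if g (p / b) = a then V p else 0).natAbs ≤
          k * 2 ^ (val.growth * (cnt.growth + 1) * B) := by
        rw [← Int.ofNat_le, Int.natCast_natAbs]
        refine (Finset.abs_sum_le_sum_abs _ _).trans ?_
        refine (Finset.sum_le_card_nsmul _ _ (2 ^ (val.growth * (cnt.growth + 1) * B) : ℤ)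
          fun p hp => ?_).trans_eq (by simp)
        split_ifs
        · rw [← Int.natCast_natAbs]
          exact_mod_cast (natAbs_lt_of_bitLen_le
            (hVB p (lt_of_lt_of_le (Finset.mem_range.1 hp) hk))).le
        · simp
      have h3 : k < 2 ^ (cnt.growth * B) := by
        simpa using natAbs_lt_of_bitLen_le (hpB k hk)
      have h4 : k * 2 ^ (val.growth * (cnt.growth + 1) * B) <
          2 ^ (cnt.growth * B + val.growth * (cnt.growth + 1) * B) := by
        rw [pow_add]
        exact Nat.mul_lt_mul_of_pos_right h3 (by positivity)
      have h5 := bitLen_add_le' (m a) _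
        (B := B + (cnt.growth * B + val.growth * (cnt.growth + 1) * B))
        (h1.trans_le (Nat.pow_le_pow_right two_pos (Nat.le_add_right _ _)))
        ((h2.trans_lt h4).trans_le (Nat.pow_le_pow_right two_pos (Nat.le_add_left _ _)))
      refine h5.trans ?_
      rw [hw, add_mul, add_mul]
      omega
  have hwB : 1 ≤ w * B := Nat.mul_pos (by omega) hB
  obtain ⟨m', r1, r2⟩ := runs_forProg (v := v) (cnt := cnt)
    (body := Prog.store addr (Expr.add (Expr.load addr) val)) (m := m) (N := A * b)
    (b := (2 * addr.costFactor + addr.growth + val.costFactor + val.growth + 10) * (w * B)) hwB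
    (fun k m' => m' = F k) (fun _ => []) (by
      funext a
      by_cases ha : a = v <;> simp [F, ha])
    (by
      rintro k hk _ rfl
      exact ⟨hFv k, hcnt _ (hFa k hk), hFB k hk⟩)
    (by
      rintro k hk _ rfl
      obtain ⟨h1, h2⟩ := hev k hk (F k) (hFv k) (hFa k hk.le)
      have hgk := hgv _ (hdiv k hk)
      have hupd : Function.update (Function.update (F k) (addr.eval (F k))
          ((Expr.add (Expr.load addr) val).eval (F k))) v (k + 1) = F (k + 1) := by
        funext a
        by_cases ha : a = v
        · simp [F, ha]
        · rw [Function.update_of_ne ha]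
          simp only [Expr.eval, h1, h2]
          by_cases hga : a = g (k / b)
          · subst hga
            simp [F, hgk, Finset.sum_range_succ]
            ring
          · rw [Function.update_of_ne hga]
            simp [F, ha, Finset.sum_range_succ, Ne.symm hga]
      refine ⟨_, (runs_store _ _ _).mono ?_, ?_, ?_, hupd⟩
      · refine (Nat.add_le_add_right (Nat.add_le_add (Expr.cost_le hwB (hFB k hk.le) _)
          (Expr.cost_le hwB (hFB k hk.le) _)) 1).trans ?_
        rw [← add_mul]
        simp only [Expr.costFactor, Expr.growth]
        nlinarith
      · have h3 : ∀ a, Function.update (F k) (addr.eval (F k))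
          ((Expr.add (Expr.load addr) val).eval (F k)) a = if a = v then (k : ℤ) else F (k + 1) a := by
          intro a
          rw [← hupd]
          by_cases ha : a = v
          · subst ha
            rw [h1, Function.update_of_ne hgk.symm, hFv, if_pos rfl]
          · rw [if_neg ha, Function.update_of_ne ha]
        intro a
        rw [h3]
        split_ifs with ha
        · rw [← hFv k]
          exact hFB k hk.le v
        · exact hFB (k + 1) hk a
      · rw [h1, Function.update_of_ne hgk.symm, hFv])
  subst r1
  refine ⟨F (A * b), ?_, hFB _ le_rfl, ?_, hFa _ le_rfl, hFv _⟩
  · have : (List.range (A * b)).flatMap (fun _ => ([] : Trace)) = [] := by simp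
    rw [this] at r2
    refine r2.mono (Nat.mul_le_mul_left _ (le_of_eq ?_))
    ring
  · intro q hq
    simp only [F, if_neg (hgv q hq)]
    rw [← sum_range_mul_ite_div A b q hq]
    congr 1
    refine Finset.sum_congr rfl fun p hp => ?_
    have := hdiv p (Finset.mem_range.1 hp)
    by_cases h : p / b = q
    · simp [h]
    · rw [if_neg h, if_neg fun h' => h (hinj _ this _ hq h')]

/-- Divide the cell `y` by two until it is zero, and count the steps in the cell `c`. -/
def sizeProg (y c : ℤ) : Prog :=
  Prog.loop (Expr.load (Expr.const y))
    (Prog.seq (Prog.store (Expr.const y) (Expr.div (Expr.load (Expr.const y)) (Expr.const 2)))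
      (Prog.store (Expr.const c) (Expr.add (Expr.load (Expr.const c)) (Expr.const 1))))

/-- Halving a number until it vanishes takes as many steps as it has binary digits. The counter
never exceeds the bit length of the initial value, so all cells stay below the old bound `B`. -/
theorem exists_runs_sizeProg (y c : ℤ) (hyc : y ≠ c) : ∃ κ : ℕ, ∀ (Y B : ℕ) (m : ℤ → ℤ), 1 ≤ B →
    Bdd B m → m y = Y → m c = 0 → ∃ m', Runs (sizeProg y c) m [] m' ((Nat.size Y + 1) * (κ * B)) ∧
      Bdd B m' ∧ m' c = Nat.size Y ∧ ∀ a, a ≠ y → a ≠ c → m' a = m a := by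
  refine ⟨3 * bitLen y + 2 * bitLen c + 40, ?_⟩
  have key : ∀ (B Y j : ℕ) (m : ℤ → ℤ), 1 ≤ B → Bdd B m → m y = Y → m c = j → Nat.size Y + j + 1 ≤ B →
      ∃ m', Runs (sizeProg y c) m [] m'
        ((Nat.size Y + 1) * ((3 * bitLen y + 2 * bitLen c + 40) * B)) ∧ Bdd B m' ∧
        m' c = ((Nat.size Y + j : ℕ) : ℤ) ∧ ∀ a, a ≠ y → a ≠ c → m' a = m a := by
    intro B Y
    have hb2 : bitLen 2 = 3 := by decide
    have hb1 : bitLen 1 = 2 := by decide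
    induction Y using Nat.strong_induction_on with
    | _ Y ih =>
      intro j m hB hm hy hc hj
      rcases Nat.eq_zero_or_pos Y with rfl | hY
      · refine ⟨m, (runs_loop_done (by simp [Expr.eval, hy]) _).mono ?_, hm, by simp [hc],
          fun _ _ _ => rfl⟩
        have := Expr.cost_le hB hm (Expr.load (Expr.const y))
        simp only [Expr.costFactor] at this
        simp only [Nat.size_zero, zero_add, one_mul]
        nlinarith
      · have hsz : Nat.size Y = Nat.size (Y / 2) + 1 := by
          have := Nat.size_bit (b := Y.bodd) (n := Y.div2) (by rw [Nat.bit_bodd_div2]; omega)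
          rwa [Nat.bit_bodd_div2, Nat.div2_val] at this
        have hjB : bitLen ((j : ℤ) + 1) ≤ B := by
          have h1 : bitLen ((j + 1 : ℕ) : ℤ) ≤ j + 1 + 1 := by
            rw [bitLen_le_iff, Int.natAbs_natCast]
            exact Nat.lt_two_pow_self
          push_cast at h1
          omega
        have hm1 : Bdd B (Function.update m y ((Y / 2 : ℕ) : ℤ)) := by
          refine hm.update ((bitLen_le_of_natAbs_le (z := m y) ?_).trans (hm y))
          rw [hy, Int.natAbs_natCast, Int.natAbs_natCast]
          exact Nat.div_le_self Y 2
        have hm2 := hm1.update (a := c) hjB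
        obtain ⟨m', r1, r2, r3, r4⟩ := ih (Y / 2) (by omega) (j + 1) _ hB hm2
          (by rw [Function.update_of_ne hyc, Function.update_self]) (by simp) (by omega)
        refine ⟨m', ?_, r2, by rw [r3]; congr 1; omega, fun a h1 h2 => ?_⟩
        · have s1 := runs_store (Expr.const y)
            (Expr.div (Expr.load (Expr.const y)) (Expr.const 2)) m
          have s2 := runs_store (Expr.const c)
            (Expr.add (Expr.load (Expr.const c)) (Expr.const 1))
            (Function.update m y ((Y / 2 : ℕ) : ℤ))
          have e1 : (Expr.div (Expr.load (Expr.const y)) (Expr.const 2)).eval m =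
              ((Y / 2 : ℕ) : ℤ) := by simp [Expr.eval, hy]
          have e2 : (Expr.add (Expr.load (Expr.const c)) (Expr.const 1)).eval
              (Function.update m y ((Y / 2 : ℕ) : ℤ)) = (j : ℤ) + 1 := by
            simp [Expr.eval, hyc.symm, hc]
          rw [e1] at s1
          rw [e2] at s2
          have s3 := Runs.loop (e := Expr.load (Expr.const y))
            (by simpa [Expr.eval, hy] using hY) (s1.seq s2) r1
          simp only [List.append_nil] at s3
          refine s3.mono ?_
          have c1 := Expr.cost_le hB hm (Expr.load (Expr.const y))
          have c2 := Expr.cost_le hB hm (Expr.const y)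
          have c3 := Expr.cost_le hB hm (Expr.div (Expr.load (Expr.const y)) (Expr.const 2))
          have c4 := Expr.cost_le hB hm1 (Expr.const c)
          have c5 := Expr.cost_le hB hm1 (Expr.add (Expr.load (Expr.const c)) (Expr.const 1))
          simp only [Expr.costFactor, Expr.growth, hb1, hb2] at c1 c2 c3 c4 c5
          rw [hsz, add_mul (Nat.size (Y / 2) + 1) 1, one_mul]
          nlinarith
        · rw [r4 a h1 h2, Function.update_of_ne h2, Function.update_of_ne h1]
  intro Y B m hB hm hy hc
  have hsz : Nat.size Y + 1 ≤ B := by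
    have := hm y
    rw [hy] at this
    simpa [bitLen] using this
  obtain ⟨m', r1, r2, r3, r4⟩ := key B Y 0 m hB hm hy (by simpa using hc) (by omega)
  exact ⟨m', r1, r2, by simpa using r3, r4⟩

/-! ## The algorithm of Faddeev and LeVerrier -/

open Polynomial in
-- The product rule in every term of the Leibniz formula.
theorem derivative_det {n : ℕ} {R : Type*} [CommRing R] (M : Matrix (Fin n) (Fin n) R[X]) :
    derivative M.det = ∑ i, (M.updateCol i fun j => derivative (M j i)).det := by
  simp only [Matrix.det_apply, map_sum]
  rw [Finset.sum_comm]
  refine Finset.sum_congr rfl fun σ _ => ?_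
  rw [Units.smul_def, derivative_smul, derivative_prod_finset, Finset.smul_sum]
  refine Finset.sum_congr rfl fun i _ => ?_
  rw [Units.smul_def, ← Finset.mul_prod_erase Finset.univ _ (Finset.mem_univ i), mul_comm]
  congr 2
  · simp
  · refine Finset.prod_congr rfl fun j hj => ?_
    rw [Matrix.updateCol_ne (Finset.ne_of_mem_erase hj)]

open Polynomial in
-- Jacobi's formula. The derivative of the `i`-th column of `X - A` is the `i`-th unit vector, so
-- the `i`-th determinant in the product rule is a diagonal cofactor.
theorem derivative_charpoly {n : ℕ} {R : Type*} [CommRing R] (A : Matrix (Fin n) (Fin n) R) :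
    derivative A.charpoly = A.charmatrix.adjugate.trace := by
  rw [Matrix.charpoly, derivative_det, Matrix.trace]
  refine Finset.sum_congr rfl fun i _ => ?_
  rw [Matrix.diag_apply, ← Matrix.transpose_apply A.charmatrix.adjugate,
    Matrix.adjugate_transpose, Matrix.adjugate_def, Matrix.of_apply, Matrix.transpose_transpose,
    Matrix.cramer_apply]
  congr 2
  ext1 j
  by_cases h : j = i
  · subst h; simp
  · simp [h]

/-- The matrices and coefficients computed by the algorithm of Faddeev and LeVerrier. -/
def leverrier {n : ℕ} (A : Matrix (Fin n) (Fin n) ℤ) : ℕ → Matrix (Fin n) (Fin n) ℤ × ℤ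
  | 0 => (0, 1)
  | k + 1 => (A * (leverrier A k).1 + (leverrier A k).2 • 1,
      (-(A * (A * (leverrier A k).1 + (leverrier A k).2 • 1)).trace) / ((k : ℤ) + 1))

/-- The coefficients of the adjugate of the characteristic matrix. -/
noncomputable def adjCoeff {n : ℕ} (A : Matrix (Fin n) (Fin n) ℤ) (k : ℕ) : Matrix (Fin n) (Fin n) ℤ :=
  Matrix.of fun i j => (A.charmatrix.adjugate i j).coeff k

open Polynomial in
theorem charmatrix_mul_coeff {n : ℕ} (A : Matrix (Fin n) (Fin n) ℤ)
    (N : Matrix (Fin n) (Fin n) ℤ[X]) (k : ℕ) (i j : Fin n) :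
    ((A.charmatrix * N) i j).coeff k =
      (X * N i j).coeff k - (A * Matrix.of fun i j => (N i j).coeff k) i j := by
  rw [Matrix.charmatrix, sub_mul, Matrix.sub_apply, coeff_sub]
  congr 2
  · rw [Matrix.scalar_apply, Matrix.diagonal_mul]
  · simp [Matrix.mul_apply, finsetSum_coeff]

open Polynomial in
-- The constant coefficient of the identity `(X - A) adj(X - A) = χ_A`. It is the reason why the
-- last matrix of the algorithm is a multiple of the inverse of `A`.
theorem adjCoeff_zero {n : ℕ} (A : Matrix (Fin n) (Fin n) ℤ) :
    A * adjCoeff A 0 = -(A.charpoly.coeff 0 • 1) := by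
  ext i j
  have h := charmatrix_mul_coeff A A.charmatrix.adjugate 0 i j
  rw [Matrix.mul_adjugate] at h
  simp only [Matrix.smul_apply, Matrix.one_apply, mul_coeff_zero, coeff_X_zero, zero_mul,
    zero_sub, smul_eq_mul, Matrix.neg_apply] at h ⊢
  change _ = -(A * adjCoeff A 0) i j at h
  rw [← neg_eq_iff_eq_neg, ← h]
  split_ifs <;> simp [Matrix.charpoly]

open Polynomial in
-- The higher coefficients of the same identity; read downwards, this is the recursion of the
-- algorithm.
theorem adjCoeff_succ {n : ℕ} (A : Matrix (Fin n) (Fin n) ℤ) (k : ℕ) :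
    adjCoeff A k = A * adjCoeff A (k + 1) + A.charpoly.coeff (k + 1) • 1 := by
  ext i j
  have h := charmatrix_mul_coeff A A.charmatrix.adjugate (k + 1) i j
  rw [Matrix.mul_adjugate, coeff_X_mul] at h
  change _ = adjCoeff A k i j - (A * adjCoeff A (k + 1)) i j at h
  rw [Matrix.add_apply, ← sub_eq_iff_eq_add', ← h]
  simp only [Matrix.smul_apply, Matrix.one_apply, smul_eq_mul]
  split_ifs <;> simp [Matrix.charpoly]

open Polynomial in
theorem trace_adjCoeff {n : ℕ} (A : Matrix (Fin n) (Fin n) ℤ) (k : ℕ) :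
    (adjCoeff A k).trace = A.charpoly.coeff (k + 1) * ((k : ℤ) + 1) := by
  rw [← coeff_derivative, derivative_charpoly, Matrix.trace, Matrix.trace, finsetSum_coeff]
  rfl

open Polynomial in
-- The entries are polynomials, so the coefficients vanish eventually. As the characteristic
-- polynomial has degree `n`, the recursion carries zero down to index `n`, and no degree of a
-- cofactor is needed.
theorem adjCoeff_eq_zero {n : ℕ} (A : Matrix (Fin n) (Fin n) ℤ) (k : ℕ) (hk : n ≤ k) :
    adjCoeff A k = 0 := by
  have h0 : ∃ K, ∀ k, K ≤ k → adjCoeff A k = 0 := by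
    refine ⟨(Finset.univ.sup fun i => Finset.univ.sup fun j =>
      (A.charmatrix.adjugate i j).natDegree) + 1, fun k hk => ?_⟩
    ext i j
    refine coeff_eq_zero_of_natDegree_lt (lt_of_lt_of_le (Nat.lt_succ_of_le ?_) hk)
    exact (Finset.le_sup (f := fun j => (A.charmatrix.adjugate i j).natDegree)
      (Finset.mem_univ j)).trans (Finset.le_sup (f := fun i => Finset.univ.sup fun j =>
      (A.charmatrix.adjugate i j).natDegree) (Finset.mem_univ i))
  obtain ⟨K, hK⟩ := h0
  have key : ∀ d k, n ≤ k → K ≤ k + d → adjCoeff A k = 0 := by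
    intro d
    induction d with
    | zero => exact fun k _ hk => hK k hk
    | succ d ih =>
      intro k h1 h2
      rw [adjCoeff_succ, ih (k + 1) (by omega) (by omega), coeff_eq_zero_of_natDegree_lt]
      · simp
      · rw [Matrix.charpoly_natDegree_eq_dim, Fintype.card_fin]
        omega
  exact key K k hk (by omega)

/-- Taking traces in the recursion and inserting Jacobi's formula gives `tr(A M_{k+1}) = -(k+1)
c_{k+1}`, where `M_k`, `c_k` are the matrices and coefficients of the algorithm. The integer
division is therefore exact. -/
theorem leverrier_eq {n : ℕ} (A : Matrix (Fin n) (Fin n) ℤ) (k : ℕ) (hk : k ≤ n) :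
    leverrier A k = (adjCoeff A (n - k), A.charpoly.coeff (n - k)) := by
  induction k with
  | zero =>
    have h := A.charpoly_monic.coeff_natDegree
    rw [Matrix.charpoly_natDegree_eq_dim, Fintype.card_fin] at h
    rw [leverrier, Nat.sub_zero, adjCoeff_eq_zero A n le_rfl, h]
  | succ k ih =>
    obtain ⟨d, hd⟩ := Nat.exists_eq_add_of_le hk
    have hd1 : n - k = d + 1 := by omega
    have hd2 : n - (k + 1) = d := by omega
    have hstep : A * adjCoeff A (d + 1) + A.charpoly.coeff (d + 1) • (1 : Matrix _ _ ℤ) =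
      adjCoeff A d := (adjCoeff_succ A d).symm
    rw [leverrier, ih (by omega), hd1, hd2, hstep]
    congr 1
    have htr : (A * adjCoeff A d).trace = -((k : ℤ) + 1) * A.charpoly.coeff d := by
      have hn : (n : ℤ) = k + 1 + d := by exact_mod_cast hd
      cases d with
      | zero =>
        rw [adjCoeff_zero, Matrix.trace_neg, Matrix.trace_smul, Matrix.trace_one, Fintype.card_fin,
          hn, smul_eq_mul]
        push_cast
        ring
      | succ d =>
        have h := congrArg Matrix.trace (adjCoeff_succ A d)
        rw [trace_adjCoeff, Matrix.trace_add, Matrix.trace_smul, Matrix.trace_one,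
          Fintype.card_fin, hn, smul_eq_mul] at h
        push_cast at h
        linear_combination -h
    rw [htr]
    have : -(-((k : ℤ) + 1) * A.charpoly.coeff d) = A.charpoly.coeff d * ((k : ℤ) + 1) := by ring
    rw [this, Int.mul_ediv_cancel _ (by positivity)]

theorem mul_leverrier {n : ℕ} (A : Matrix (Fin n) (Fin n) ℤ) :
    A * (leverrier A n).1 = -((leverrier A n).2 • 1) := by
  rw [leverrier_eq A n le_rfl, Nat.sub_self]
  exact adjCoeff_zero A

theorem leverrier_ne_zero {n : ℕ} {A : Matrix (Fin n) (Fin n) ℤ} (hA : A.det ≠ 0) :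
    (leverrier A n).2 ≠ 0 := by
  rw [leverrier_eq A n le_rfl, Nat.sub_self]
  intro h
  apply hA
  rw [Matrix.det_eq_sign_charpoly_coeff]
  simp only at h
  rw [h, mul_zero]

/-- If everything is bounded by `U` after `k` steps, the next matrix is bounded by `n X U + U ≤ 2 n
X U`, its product with `A` by `2 n² X² U`, and the trace by `n` times this. Only the resulting bit
length, of order `n log (n X)`, matters. -/
theorem abs_leverrier_le {n : ℕ} (A : Matrix (Fin n) (Fin n) ℤ) {X : ℤ} (hX : 1 ≤ X)
    (hA : ∀ i j, |A i j| ≤ X) (hn : 1 ≤ n) (k : ℕ) :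
    (∀ i j, |(leverrier A k).1 i j| ≤ (2 * (n : ℤ) ^ 3 * X ^ 2) ^ k) ∧
      |(leverrier A k).2| ≤ (2 * (n : ℤ) ^ 3 * X ^ 2) ^ k ∧
      |(A * (leverrier A k).1).trace| ≤ (2 * (n : ℤ) ^ 3 * X ^ 2) ^ k := by
  have hn' : (1 : ℤ) ≤ n := by exact_mod_cast hn
  have hmul : ∀ (M : Matrix (Fin n) (Fin n) ℤ) (U : ℤ), (∀ i j, |M i j| ≤ U) →
      ∀ i j, |(A * M) i j| ≤ n * (X * U) := by
    intro M U hM i j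
    rw [Matrix.mul_apply]
    refine (Finset.abs_sum_le_sum_abs _ _).trans ?_
    refine (Finset.sum_le_card_nsmul _ _ (X * U) fun l _ => ?_).trans_eq (by simp)
    rw [abs_mul]
    exact mul_le_mul (hA _ _) (hM _ _) (abs_nonneg _) (by omega)
  induction k with
  | zero => simp [leverrier]
  | succ k ih =>
    obtain ⟨h1, h2, -⟩ := ih
    set U := (2 * (n : ℤ) ^ 3 * X ^ 2) ^ k with hU
    have hU1 : 1 ≤ U := one_le_pow₀ (by nlinarith [one_le_pow₀ hn' (n := 3), one_le_pow₀ hX (n := 2)])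
    have hM : ∀ i j, |(leverrier A (k + 1)).1 i j| ≤ 2 * n * X * U := by
      intro i j
      change |(A * (leverrier A k).1 + (leverrier A k).2 • (1 : Matrix (Fin n) (Fin n) ℤ)) i j| ≤ _
      rw [Matrix.add_apply]
      refine (abs_add_le _ _).trans ?_
      have h3 := hmul _ _ h1 i j
      have h4 : |((leverrier A k).2 • (1 : Matrix (Fin n) (Fin n) ℤ)) i j| ≤ U := by
        rw [Matrix.smul_apply, Matrix.one_apply]
        split_ifs
        · simpa using h2
        · simp; omega
      have h5 : 1 ≤ (n : ℤ) * X := by nlinarith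
      nlinarith
    have e : (2 * (n : ℤ) ^ 3 * X ^ 2) ^ (k + 1) = 2 * (n : ℤ) ^ 3 * X ^ 2 * U := by
      rw [hU, pow_succ]; ring
    rw [e]
    suffices h4 : |(A * (leverrier A (k + 1)).1).trace| ≤ 2 * (n : ℤ) ^ 3 * X ^ 2 * U by
      refine ⟨fun i j => (hM i j).trans ?_, ?_, h4⟩
      · have h5 : 1 ≤ (n : ℤ) ^ 2 * X := by nlinarith [one_le_pow₀ hn' (n := 2)]
        have h6 : 0 ≤ 2 * (n : ℤ) * X * U := by positivity
        nlinarith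
      · rw [← abs_neg] at h4
        refine le_trans ?_ h4
        change |(-(A * (leverrier A (k + 1)).1).trace) / ((k : ℤ) + 1)| ≤ _
        exact Int.abs_ediv_le_abs _ _
    rw [Matrix.trace]
    refine (Finset.abs_sum_le_sum_abs _ _).trans ?_
    refine (Finset.sum_le_card_nsmul _ _ _ fun l _ => hmul _ _ hM l l).trans_eq ?_
    simp
    ring

/-! ## The program -/

namespace Expr

instance : Add Expr := ⟨add⟩
instance : Sub Expr := ⟨sub⟩
instance : Mul Expr := ⟨mul⟩
instance : Div Expr := ⟨div⟩
instance : Mod Expr := ⟨fun e f => sub e (mul f (div e f))⟩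
instance (k : ℕ) : OfNat Expr k := ⟨const k⟩

@[simp] theorem eval_const (m : ℤ → ℤ) (z : ℤ) : (const z).eval m = z := rfl
@[simp] theorem eval_load (m : ℤ → ℤ) (e : Expr) : (load e).eval m = m (e.eval m) := rfl
@[simp] theorem eval_add (m : ℤ → ℤ) (e f : Expr) : (e + f).eval m = e.eval m + f.eval m := rfl
@[simp] theorem eval_sub (m : ℤ → ℤ) (e f : Expr) : (e - f).eval m = e.eval m - f.eval m := rfl
@[simp] theorem eval_mul (m : ℤ → ℤ) (e f : Expr) : (e * f).eval m = e.eval m * f.eval m := rfl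
@[simp] theorem eval_div (m : ℤ → ℤ) (e f : Expr) : (e / f).eval m = e.eval m / f.eval m := rfl
@[simp] theorem eval_mod (m : ℤ → ℤ) (e f : Expr) : (e % f).eval m = e.eval m % f.eval m :=
  (Int.emod_def _ _).symm
@[simp] theorem eval_ofNat (m : ℤ → ℤ) (k : ℕ) :
    (no_index (OfNat.ofNat k) : Expr).eval m = k := rfl

/-- The indicator of equality. -/
def eqInd (e f : Expr) : Expr := 1 / (1 + (e - f) * (e - f))

/-- The indicator of negative numbers. -/
def negInd (e : Expr) : Expr := 0 - e / (1 + e * e)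

-- Tests are expressed by arithmetic, so that the loop bodies need no branching: `1 / (1 + x²)` is
-- zero for all integers `x ≠ 0`. The analogous indicator of negative numbers relies on division
-- rounding downwards, which makes `x / (1 + x²)` equal to `-1` for `x < 0` and to `0` otherwise.
@[simp] theorem eval_eqInd (m : ℤ → ℤ) (e f : Expr) :
    (eqInd e f).eval m = if e.eval m = f.eval m then 1 else 0 := by
  simp only [eqInd, eval_div, eval_add, eval_mul, eval_sub, eval_ofNat, Nat.cast_one]
  split_ifs with h
  · simp [h]
  · have h1 : 0 < (e.eval m - f.eval m) * (e.eval m - f.eval m) :=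
      mul_self_pos.2 (sub_ne_zero.2 h)
    exact Int.ediv_eq_zero_of_lt zero_le_one (by omega)

@[simp] theorem eval_negInd (m : ℤ → ℤ) (e : Expr) :
    (negInd e).eval m = if e.eval m < 0 then 1 else 0 := by
  simp only [negInd, eval_div, eval_add, eval_mul, eval_sub, eval_ofNat, Nat.cast_one,
    Nat.cast_zero]
  generalize e.eval m = x
  split_ifs with h
  · have h1 : x / (1 + x * x) = -1 := by
      rw [Int.ediv_eq_iff_of_pos (by nlinarith)]
      constructor <;> nlinarith
    rw [h1]; rfl
  · have h1 : x / (1 + x * x) = 0 := Int.ediv_eq_zero_of_lt (by omega) (by nlinarith)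
    rw [h1]; rfl

end Expr

/-- The address of the entry `q` of the array `r`. -/
def arr (r q : ℕ) : ℤ := -80 - 16 * (q : ℤ) + r

/-- The address of an entry of the array `r`. -/
def arrE (r : ℕ) (e : Expr) : Expr := Expr.const (-80) - 16 * e + Expr.const r

theorem eval_arrE {m : ℤ → ℤ} {e : Expr} {q : ℕ} (h : e.eval m = q) (r : ℕ) :
    (arrE r e).eval m = arr r q := by
  simp [arrE, arr, h]

/-- The dimension, in cell `0`. -/
def nE : Expr := Expr.load 0

/-- The variable of the inner loops. -/
def pE : Expr := Expr.load (Expr.const (-2))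

/-- The variable of the outer loop. -/
def kE : Expr := Expr.load (Expr.const (-3))

/-- Expressions for a family of `K` lattices, given by the weights `F i j`, the scale `g` and the
targets `τ i k / s`, for the number `N` of samples, and for a factor `Y`. -/
structure FamilyCode where
  K : Expr
  N : Expr
  a : Expr
  g : Expr
  s : Expr
  dn : Expr
  dd : Expr
  Y : Expr
  F : Expr → Expr → Expr
  τ : Expr → Expr → Expr

namespace FamilyCode

variable (P : FamilyCode)

def nn : Expr := nE * nE

/-- The input matrix. -/
def A (i j : Expr) : Expr := Expr.load (1 + i * nE + j)

/-- The address of the queries. -/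
def H : Expr := nn + nE + 5

/-- The address of the answers. -/
def H' : Expr := H + P.K * (nn + 4)

/-- Array `0` contains all matrices of the algorithm one after the other, array `1` the coefficients
and array `2` the traces. Every round writes to fresh cells that contain zero, as accumulation
requires: first the product with the input matrix, then the multiple of the identity on its
diagonal, then the trace. -/
def leverrierBody : Prog :=
  Prog.seq (accumProg (-2) (nn * nE) (arrE 0 ((kE + 1) * nn + pE / nE))
      (A (pE / nE / nE) (pE % nE) *
        Expr.load (arrE 0 (kE * nn + (pE % nE * nE + pE / nE % nE))))) <|
  Prog.seq (accumProg (-2) nE (arrE 0 ((kE + 1) * nn + (pE * nE + pE)))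
      (Expr.load (arrE 1 kE))) <|
  Prog.seq (accumProg (-2) nn (arrE 2 (kE + 1))
      (A (pE / nE) (pE % nE) *
        Expr.load (arrE 0 ((kE + 1) * nn + (pE % nE * nE + pE / nE))))) <|
  Prog.store (arrE 1 (kE + 1)) ((0 - Expr.load (arrE 2 (kE + 1))) / (kE + 1))

def leverrierProg : Prog :=
  Prog.seq (Prog.store (arrE 1 0) 1) (forProg (-3) nE leverrierBody)

/-- The last coefficient of the characteristic polynomial. -/
def c : Expr := Expr.load (arrE 1 nE)

/-- The last matrix of the algorithm of Faddeev and LeVerrier. -/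
def M (i j : Expr) : Expr := Expr.load (arrE 0 (nE * nn + (i * nE + j)))

/-- The square makes the denominator positive whatever the sign of `c`; the numerators contain a
compensating factor `c`. -/
def den : Expr := P.g * (c * c)

def pos : Expr := pE % (nn + 4)

/-- A query is a block of `n² + 4` integers: the dimension, the numerators, the denominator, and the
two numbers of the fraction `dd / (20 dn)`. The indicators select the entry from its position in the
block. -/
def bufProg : Prog :=
  accumProg (-2) (P.K * (nn + 4)) (H + pE)
    (Expr.eqInd pos 0 * nE
      + (1 - Expr.eqInd pos 0 - Expr.eqInd pos (nn + 1) - Expr.eqInd pos (nn + 2)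
          - Expr.eqInd pos (nn + 3)) *
        (P.F (pE / (nn + 4)) ((pos - 1) / nE) *
          (P.a * (0 - M ((pos - 1) % nE) ((pos - 1) / nE)) * c))
      + Expr.eqInd pos (nn + 1) * P.den + Expr.eqInd pos (nn + 2) * P.dd
      + Expr.eqInd pos (nn + 3) * (20 * P.dn))

/-- The number in cell `-4` is an upper bound for the squares of the coefficients of all samples
below the truncation radius; its binary size, computed in cell `-5`, determines how many bits of an
answer are read. -/
def boundProg : Prog :=
  Prog.seq (accumProg (-2) nn (Expr.const (-4))
    (A (pE / nE) (pE % nE) * A (pE / nE) (pE % nE) * P.Y)) <|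
  Prog.seq (Prog.store (Expr.const (-9)) (Expr.load (Expr.const (-4)))) <|
  sizeProg (-9) (-5)

def cap : Expr := nE * (Expr.load (Expr.const (-5)) + 1)

def queryProg : Prog :=
  forProg (-2) (P.K * P.N)
    (Prog.query (H + pE / P.N * (nn + 4)) (nn + 4) (P.H' + pE * (cap + 1)) cap)

/-- The sampled vectors. -/
def sampleProg : Prog :=
  accumProg (-2) (P.K * P.N * nE * nE) (arrE 3 (pE / nE))
    (Expr.load (P.H' + pE / nE / nE * (cap + 1) + (pE % nE + 1)) *
      Expr.load (H + pE / nE / nE / P.N * (nn + 4) + (pE % nE * nE + pE / nE % nE + 1)))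

/-- Sums of products of the coordinates of the samples. -/
def momentProg : Prog :=
  accumProg (-2) (P.K * nn * P.N) (arrE 4 (pE / P.N))
    (Expr.load (arrE 3 ((pE / P.N / nn * P.N + pE % P.N) * nE + pE / P.N / nE % nE)) *
      Expr.load (arrE 3 ((pE / P.N / nn * P.N + pE % P.N) * nE + pE / P.N % nE)))

/-- Inner products of the samples with the targets. -/
def productProg : Prog :=
  accumProg (-2) (P.K * P.N * nE) (arrE 5 (pE / nE))
    (Expr.load (arrE 3 (pE / nE * nE + pE % nE)) * P.τ (pE / nE / P.N) (pE % nE))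

def D : Expr := P.den * P.s

/-- The subtracted multiple of `D` is a nearest one: `⌊y / D + 1/2⌋ = ⌊(2 y + D) / (2 D)⌋`. -/
def centered (y D : Expr) : Expr := y - D * ((2 * y + D) / (2 * D))

def distProg : Prog :=
  accumProg (-2) (P.K * P.N) (arrE 6 (pE / P.N))
    (centered (Expr.load (arrE 5 pE)) P.D * centered (Expr.load (arrE 5 pE)) P.D)

/-- An answer that was too long has left `-1` in the cell of its length, and so it is counted as
well. -/
def badLengthProg : Prog :=
  accumProg (-2) (P.K * P.N) (Expr.const (-6))
    (1 - Expr.eqInd (Expr.load (P.H' + pE * (cap + 1))) nE)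

/-- Absolute values are compared through their squares, after all denominators have been cleared.
The factor in the middle is `1` on the diagonal and `n` off it. -/
def badMomentProg : Prog :=
  accumProg (-2) (P.K * nn) (Expr.const (-7))
    (Expr.negInd ((P.N * (P.dd * P.dd) * (P.den * P.den)) * (P.N * (P.dd * P.dd) * (P.den * P.den)) -
      (Expr.load (arrE 4 pE) * (nE - (nE - 1) * Expr.eqInd (pE / nE % nE) (pE % nE)) *
        (400 * (P.dn * P.dn))) *
      (Expr.load (arrE 4 pE) * (nE - (nE - 1) * Expr.eqInd (pE / nE % nE) (pE % nE)) *
        (400 * (P.dn * P.dn)))))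

def badDistProg : Prog :=
  accumProg (-2) P.K (Expr.const (-8))
    (1 - Expr.negInd (P.N * (P.D * P.D) - 40 * Expr.load (arrE 6 pE)))

def verdictProg : Prog :=
  Prog.store (Expr.const (-1)) (1 - Expr.eqInd (Expr.load (Expr.const (-6)) +
    Expr.load (Expr.const (-7)) + Expr.load (Expr.const (-8))) 0)

/-- The program that accepts if one of the tests of the family fails. -/
def prog : Prog :=
  Prog.seq leverrierProg <| Prog.seq P.bufProg <| Prog.seq P.boundProg <| Prog.seq P.queryProg <|
  Prog.seq P.sampleProg <| Prog.seq P.momentProg <| Prog.seq P.productProg <|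
  Prog.seq P.distProg <| Prog.seq P.badLengthProg <| Prog.seq P.badMomentProg <|
  Prog.seq P.badDistProg verdictProg

end FamilyCode

/-! ## The values computed by the program -/

/-- The data of a run of the program: the input and the answers. -/
structure RunData where
  n : ℕ
  K : ℕ
  N : ℕ
  a : ℕ
  g : ℕ
  s : ℕ
  dn : ℕ
  dd : ℕ
  Y₀ : ℕ
  A : Matrix (Fin n) (Fin n) ℤ
  F : ℕ → ℕ → ℤ
  τ : ℕ → ℕ → ℤ
  input : ℤ → ℤ
  as : ℕ → List ℤ

/-- The centered remainder of `y` modulo `D`. -/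
def centeredMod (y D : ℤ) : ℤ := y - D * ((2 * y + D) / (2 * D))

/-- The entries of a matrix, and `0` outside. -/
def entry {n : ℕ} (A : Matrix (Fin n) (Fin n) ℤ) (i j : ℕ) : ℤ :=
  if h : i < n ∧ j < n then A ⟨i, h.1⟩ ⟨j, h.2⟩ else 0

namespace RunData

variable (r : RunData)

def H : ℕ := r.n * r.n + r.n + 5
def H' : ℕ := r.H + r.K * (r.n * r.n + 4)
def c : ℤ := (leverrier r.A r.n).2
def num (i j k : ℕ) : ℤ := r.F i j * (r.a * (0 - entry (leverrier r.A r.n).1 k j) * r.c)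
def den : ℤ := r.g * (r.c * r.c)

/-- The entries of the `i`-th query. -/
def buf (i x : ℕ) : ℤ :=
  if x = 0 then r.n else if x ≤ r.n * r.n then r.num i ((x - 1) / r.n) ((x - 1) % r.n)
  else if x = r.n * r.n + 1 then r.den else if x = r.n * r.n + 2 then r.dd else 20 * r.dn

def Y : ℕ := ∑ p ∈ Finset.range (r.n * r.n), (entry r.A (p / r.n) (p % r.n)).natAbs ^ 2 * r.Y₀
def cap : ℕ := r.n * (Nat.size r.Y + 1)

/-- The cells in which an answer is received. -/
def received (s x : ℕ) : ℤ :=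
  (if listSize (r.as s) ≤ r.cap then ((r.as s).length : ℤ) :: r.as s else [-1]).getD x 0

def w (s k : ℕ) : ℤ := ∑ l ∈ Finset.range r.n, r.received s (l + 1) * r.num (s / r.N) l k
def S (i j k : ℕ) : ℤ := ∑ s ∈ Finset.range r.N, r.w (i * r.N + s) j * r.w (i * r.N + s) k
def y (s : ℕ) : ℤ := ∑ k ∈ Finset.range r.n, r.w s k * r.τ (s / r.N) k
def D : ℤ := r.den * r.s
def dist (i : ℕ) : ℤ :=
  ∑ s ∈ Finset.range r.N, centeredMod (r.y (i * r.N + s)) r.D * centeredMod (r.y (i * r.N + s)) r.D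

def badLength (s : ℕ) : ℤ := 1 - if r.received s 0 = r.n then 1 else 0

def weightedMoment (i j k : ℕ) : ℤ :=
  r.S i j k * (r.n - (r.n - 1) * if (j : ℤ) = k then 1 else 0) * (400 * (r.dn * r.dn))

def momentBound : ℤ := r.N * (r.dd * r.dd) * (r.den * r.den)

def badMoment (i j k : ℕ) : ℤ :=
  if r.momentBound * r.momentBound - r.weightedMoment i j k * r.weightedMoment i j k < 0 then 1
  else 0

def badDist (i : ℕ) : ℤ := 1 - if r.N * (r.D * r.D) - 40 * r.dist i < 0 then 1 else 0

/-- The final contents of the arrays. -/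
def arrays : ℕ → ℕ → ℤ
  | 0, q => if q < (r.n + 1) * (r.n * r.n) then
      entry (leverrier r.A (q / (r.n * r.n))).1 (q / r.n % r.n) (q % r.n) else 0
  | 1, q => if q < r.n + 1 then (leverrier r.A q).2 else 0
  | 2, q => if q < r.n + 1 then (r.A * (leverrier r.A q).1).trace else 0
  | 3, q => if q < r.K * r.N * r.n then r.w (q / r.n) (q % r.n) else 0
  | 4, q => if q < r.K * (r.n * r.n) then r.S (q / (r.n * r.n)) (q / r.n % r.n) (q % r.n) else 0
  | 5, q => if q < r.K * r.N then r.y q else 0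
  | 6, q => if q < r.K then r.dist q else 0
  | _, _ => 0

/-- The final contents of the memory. -/
def full (x : ℤ) : ℤ :=
  -- The inverse of `arr`: since 16 divides 80, the residue modulo 16 is the number of the array.
  -- For a nonzero residue the quotient is rounded down to one less than the index, which the last
  -- summand corrects.
  if x < -64 then r.arrays (x % 16).toNat ((-80 - x) / 16 + (if x % 16 = 0 then 0 else 1)).toNat
  else if x < 0 then
    if x = -4 then r.Y else if x = -5 then Nat.size r.Y
    else if x = -6 then ∑ s ∈ Finset.range (r.K * r.N), r.badLength s
    else if x = -7 then ∑ p ∈ Finset.range (r.K * (r.n * r.n)),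
      r.badMoment (p / (r.n * r.n)) (p / r.n % r.n) (p % r.n)
    else if x = -8 then ∑ i ∈ Finset.range r.K, r.badDist i
    else 0
  else if x < r.H then r.input x
  else if x < r.H' then
    r.buf ((x - r.H).toNat / (r.n * r.n + 4)) ((x - r.H).toNat % (r.n * r.n + 4))
  else if x < r.H' + r.K * r.N * (r.cap + 1) then
    r.received ((x - r.H').toNat / (r.cap + 1)) ((x - r.H').toNat % (r.cap + 1))
  else 0

/-- The memory is divided into regions. -/
def region (x : ℤ) : ℕ :=
  if x < -64 then (x % 16).toNat else if x < 0 then 20 + (-x).toNat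
  else if x < r.H then 16 else if x < r.H' then 17 else 18

/-- The regions in `R` have their final contents, the others (except for some loop variables) are
empty. -/
def Known (R : List ℕ) (m : ℤ → ℤ) : Prop :=
  ∀ x, x ≠ -2 → x ≠ -3 → x ≠ -9 → m x = if r.region x ∈ R then r.full x else 0

theorem full_arr {i : ℕ} (hi : i < 16) (q : ℕ) : r.full (arr i q) = r.arrays i q := by
  have h1 : arr i q < -64 := by unfold arr; omega
  have h2 : arr i q % 16 = i := by unfold arr; omega
  rw [full, if_pos h1, h2, Int.toNat_natCast]
  congr 1
  unfold arr
  split_ifs <;> omega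

theorem region_arr {i : ℕ} (hi : i < 16) (q : ℕ) : r.region (arr i q) = i := by
  have h1 : arr i q < -64 := by unfold arr; omega
  have h2 : arr i q % 16 = i := by unfold arr; omega
  rw [region, if_pos h1, h2, Int.toNat_natCast]

theorem region_eq_arr {i : ℕ} (hi : i < 16) {x : ℤ} (h : r.region x = i) :
    ∃ q : ℕ, x = arr i q := by
  unfold region at h
  split_ifs at h with h1 h2 h3 h4 <;> try omega
  refine ⟨((-80 - x + i) / 16).toNat, ?_⟩
  unfold arr
  omega

end RunData

/-! ### Values of the expressions in a memory with known regions -/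

namespace RunData

/-- The expressions of the family have the values prescribed by the data. -/
structure Valid (P : FamilyCode) (r : RunData) : Prop where
  n_pos : 1 ≤ r.n
  N_pos : 1 ≤ r.N
  input_zero : r.input 0 = r.n
  input_A : ∀ i j, i < r.n → j < r.n → r.input (1 + i * r.n + j) = entry r.A i j
  eval : ∀ m : ℤ → ℤ, (∀ x : ℤ, 0 ≤ x → x < r.H → m x = r.input x) →
    P.K.eval m = r.K ∧ P.N.eval m = r.N ∧ P.a.eval m = r.a ∧ P.g.eval m = r.g ∧
    P.s.eval m = r.s ∧ P.dn.eval m = r.dn ∧ P.dd.eval m = r.dd ∧ P.Y.eval m = r.Y₀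
  eval_F : ∀ m : ℤ → ℤ, (∀ x : ℤ, 0 ≤ x → x < r.H → m x = r.input x) → ∀ (e f : Expr) (i j : ℕ),
    e.eval m = i → f.eval m = j → i < r.K → j < r.n → (P.F e f).eval m = r.F i j
  eval_τ : ∀ m : ℤ → ℤ, (∀ x : ℤ, 0 ≤ x → x < r.H → m x = r.input x) → ∀ (e f : Expr) (i j : ℕ),
    e.eval m = i → f.eval m = j → i < r.K → j < r.n → (P.τ e f).eval m = r.τ i j

/-- A bound for the lengths of the loops. -/
def X (r : RunData) : ℕ := (r.K + 1) * (r.N + 1) * (r.n + 2) ^ 5 + Nat.size r.Y + 1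

def maxEntry (r : RunData) : ℤ := 1 + ∑ i, ∑ j, |r.A i j|

/-- A bound for the lengths of some numbers that occur during the computation. -/
def beta (r : RunData) : ℕ :=
  bitLen ((2 * (r.n : ℤ) ^ 3 * r.maxEntry ^ 2) ^ r.n) + r.cap + bitLen ((r.n ^ 3 : ℕ) : ℤ)

theorem one_le_X (r : RunData) : 1 ≤ r.X := Nat.le_add_left _ _

/-- The regions in `R` have their final contents. -/
def Sees (r : RunData) (R : List ℕ) (m : ℤ → ℤ) : Prop := ∀ x, r.region x ∈ R → m x = r.full x

variable {P : FamilyCode} {r : RunData} {R : List ℕ} {m : ℤ → ℤ}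

theorem Sees.input (h : r.Sees R m) (hR : 16 ∈ R) (x : ℤ) (h0 : 0 ≤ x) (hx : x < r.H) :
    m x = r.input x := by
  have h1 : r.region x = 16 := by
    unfold region
    rw [if_neg (by omega), if_neg (by omega), if_pos hx]
  rw [h x (by rwa [h1]), full, if_neg (by omega), if_neg (by omega), if_pos hx]

theorem Sees.arr (h : r.Sees R m) {i : ℕ} (hi : i < 16) (hR : i ∈ R) (q : ℕ) :
    m (arr i q) = r.arrays i q := by
  rw [h _ (by rwa [r.region_arr hi]), r.full_arr hi]

theorem Sees.n (h : r.Sees R m) (hP : r.Valid P) (hR : 16 ∈ R) : nE.eval m = r.n := by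
  rw [← hP.input_zero]
  exact h.input hR 0 le_rfl (by unfold H; omega)

theorem entry_index_lt {n i j : ℕ} (hi : i < n) (hj : j < n) : i * n + j < n * n := by
  have : (i + 1) * n ≤ n * n := Nat.mul_le_mul_right _ hi
  rw [add_mul] at this
  omega

theorem Sees.A (h : r.Sees R m) (hP : r.Valid P) (hR : 16 ∈ R) {e f : Expr} {i j : ℕ}
    (he : e.eval m = i) (hf : f.eval m = j) (hi : i < r.n) (hj : j < r.n) :
    (FamilyCode.A e f).eval m = entry r.A i j := by
  rw [← hP.input_A i j hi hj]
  simp only [FamilyCode.A, Expr.eval_load, Expr.eval_add, Expr.eval_mul, h.n hP hR, he, hf,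
    Expr.eval_ofNat, Nat.cast_one]
  refine h.input hR _ (by positivity) ?_
  have : i * r.n + j < r.n * r.n := entry_index_lt hi hj
  zify at this
  unfold H
  push_cast
  linarith

theorem Sees.evals (h : r.Sees R m) (hP : r.Valid P) (hR : 16 ∈ R) :
    P.K.eval m = r.K ∧ P.N.eval m = r.N ∧ P.a.eval m = r.a ∧ P.g.eval m = r.g ∧
    P.s.eval m = r.s ∧ P.dn.eval m = r.dn ∧ P.dd.eval m = r.dd ∧ P.Y.eval m = r.Y₀ :=
  hP.eval m (h.input hR)

theorem Sees.nn (h : r.Sees R m) (hP : r.Valid P) (hR : 16 ∈ R) :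
    FamilyCode.nn.eval m = ((r.n * r.n : ℕ) : ℤ) := by
  simp [FamilyCode.nn, h.n hP hR]

theorem Sees.H (h : r.Sees R m) (hP : r.Valid P) (hR : 16 ∈ R) :
    FamilyCode.H.eval m = r.H := by
  simp [FamilyCode.H, h.n hP hR, h.nn hP hR, RunData.H]

theorem Sees.H' (h : r.Sees R m) (hP : r.Valid P) (hR : 16 ∈ R) :
    P.H'.eval m = r.H' := by
  simp [FamilyCode.H', h.H hP hR, h.nn hP hR, RunData.H', (h.evals hP hR).1]

theorem Sees.c (h : r.Sees R m) (hP : r.Valid P) (hR : 16 ∈ R) (hR1 : 1 ∈ R) :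
    FamilyCode.c.eval m = r.c := by
  rw [FamilyCode.c, Expr.eval_load, eval_arrE (h.n hP hR), h.arr (by omega) hR1]
  simp [arrays, RunData.c]

theorem digits {n i j : ℕ} (k : ℕ) (hi : i < n) (hj : j < n) :
    (k * (n * n) + (i * n + j)) / (n * n) = k ∧ (k * (n * n) + (i * n + j)) / n % n = i ∧
      (k * (n * n) + (i * n + j)) % n = j := by
  have hn : 0 < n := by omega
  have h1 : i * n + j < n * n := entry_index_lt hi hj
  have h2 : k * (n * n) + (i * n + j) = n * (k * n + i) + j := by ring
  refine ⟨?_, ?_, ?_⟩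
  · rw [mul_comm k, Nat.mul_add_div (by positivity), Nat.div_eq_of_lt h1, add_zero]
  · rw [h2, Nat.mul_add_div hn, Nat.div_eq_of_lt hj, add_zero, mul_comm k, Nat.mul_add_mod,
      Nat.mod_eq_of_lt hi]
  · rw [h2, Nat.mul_add_mod, Nat.mod_eq_of_lt hj]

theorem Sees.M (h : r.Sees R m) (hP : r.Valid P) (hR : 16 ∈ R) (hR0 : 0 ∈ R) {e f : Expr}
    {i j : ℕ} (he : e.eval m = i) (hf : f.eval m = j) (hi : i < r.n) (hj : j < r.n) :
    (FamilyCode.M e f).eval m = entry (leverrier r.A r.n).1 i j := by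
  obtain ⟨h1, h2, h3⟩ := digits r.n hi hj
  have h4 : r.n * (r.n * r.n) + (i * r.n + j) < (r.n + 1) * (r.n * r.n) := by
    have := entry_index_lt hi hj
    rw [add_mul]
    omega
  rw [FamilyCode.M, Expr.eval_load, eval_arrE (q := r.n * (r.n * r.n) + (i * r.n + j))
    (by simp [h.n hP hR, h.nn hP hR, he, hf]), h.arr (by omega) hR0]
  simp only [arrays, h1, h2, h3, if_pos h4]

theorem Sees.den (h : r.Sees R m) (hP : r.Valid P) (hR : 16 ∈ R) (hR1 : 1 ∈ R) :
    P.den.eval m = r.den := by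
  simp [FamilyCode.den, h.c hP hR hR1, RunData.den, (h.evals hP hR).2.2.2.1]

theorem Sees.D (h : r.Sees R m) (hP : r.Valid P) (hR : 16 ∈ R) (hR1 : 1 ∈ R) :
    P.D.eval m = r.D := by
  simp [FamilyCode.D, h.den hP hR hR1, RunData.D, (h.evals hP hR).2.2.2.2.1]

theorem Sees.cap (h : r.Sees R m) (hP : r.Valid P) (hR : 16 ∈ R) (hR1 : 25 ∈ R) :
    FamilyCode.cap.eval m = r.cap := by
  have h1 : r.region (-5) = 25 := by simp [region]
  have h2 := h (-5) (by rwa [h1])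
  simp only [full, Int.reduceNeg, Int.reduceLT, reduceIte, Int.reduceEq] at h2
  simp [FamilyCode.cap, h.n hP hR, RunData.cap, h2]

end RunData

/-! ### Composition of parts, and loops that fill one region -/

/-- A rule for a part of the program, with bounds that are uniform in the data. -/
def Triple (P : FamilyCode) (Q : Prog) (pre post : RunData → (ℤ → ℤ) → Prop)
    (h : RunData → Trace) : Prop :=
  ∃ κ w : ℕ, ∀ (r : RunData) (m : ℤ → ℤ) (B : ℕ), r.Valid P → 1 ≤ B → r.beta ≤ B → Bdd B m →
    pre r m → ∃ m', post r m' ∧ Runs Q m (h r) m' (r.X * (κ * B)) ∧ Bdd (w * B) m'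

/-- The second part starts with numbers of `w₁ B` bits. As a rule holds for every sufficiently large
`B`, it may be applied with `w₁ B`, and only the constants multiply. A fixed number of parts keeps
the time polynomial. -/
theorem Triple.seq {P : FamilyCode} {Q₁ Q₂ : Prog} {p₁ p₂ p₃ : RunData → (ℤ → ℤ) → Prop}
    {h₁ h₂ : RunData → Trace} (H₁ : Triple P Q₁ p₁ p₂ h₁) (H₂ : Triple P Q₂ p₂ p₃ h₂) :
    Triple P (Prog.seq Q₁ Q₂) p₁ p₃ (fun r => h₁ r ++ h₂ r) := by
  obtain ⟨κ₁, w₁, H₁⟩ := H₁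
  obtain ⟨κ₂, w₂, H₂⟩ := H₂
  refine ⟨κ₁ + κ₂ * w₁ + 1, w₂ * w₁, fun r m B hP hB hβ hm h => ?_⟩
  obtain ⟨m₁, a₁, a₂, a₃⟩ := H₁ r m B hP hB hβ hm h
  have hw : 1 ≤ w₁ := by
    rcases Nat.eq_zero_or_pos w₁ with rfl | hw
    · have h1 := a₃ 0
      have h2 := one_le_bitLen (m₁ 0)
      omega
    · exact hw
  have hwB : B ≤ w₁ * B := Nat.le_mul_of_pos_left _ hw
  obtain ⟨m₂, b₁, b₂, b₃⟩ := H₂ r m₁ (w₁ * B) hP (by omega) (by omega) a₃ a₁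
  refine ⟨m₂, b₁, (a₂.seq b₂).mono ?_, by rwa [mul_assoc]⟩
  have : 1 ≤ r.X * B := Nat.mul_pos r.one_le_X hB
  have e : r.X * ((κ₁ + κ₂ * w₁ + 1) * B) =
    r.X * (κ₁ * B) + r.X * (κ₂ * (w₁ * B)) + r.X * B := by ring
  omega

open RunData in
/-- A single loop that fills one region. -/
theorem triple_accumProg (P : FamilyCode) (R : List ℕ) (j : ℕ) (cnt addr val : Expr)
    (A b : RunData → ℕ) (g V : RunData → ℕ → ℤ) (hR : 22 ∉ R ∧ 23 ∉ R ∧ 29 ∉ R)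
    (hj : j ∉ R ∧ j ≠ 22 ∧ j ≠ 23 ∧ j ≠ 29)
    (H : ∀ r : RunData, r.Valid P → A r * b r + 1 ≤ r.X ∧
      (∀ q < A r, r.region (g r q) = j) ∧
      (∀ q < A r, ∀ q' < A r, g r q = g r q' → q = q') ∧
      (∀ q < A r, r.full (g r q) = ∑ l ∈ Finset.range (b r), V r (q * b r + l)) ∧
      (∀ x, r.region x = j → (∀ q < A r, g r q ≠ x) → r.full x = 0) ∧
      (∀ m : ℤ → ℤ, r.Sees R m → cnt.eval m = ((A r * b r : ℕ) : ℤ) ∧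
        ∀ p < A r * b r, m (-2) = p → addr.eval m = g r (p / b r) ∧ val.eval m = V r p)) :
    Triple P (accumProg (-2) cnt addr val) (fun r m => r.Known R m)
      (fun r m => r.Known (j :: R) m) (fun _ => []) := by
  obtain ⟨κ, w, hκ⟩ := exists_runs_accumProg (-2) cnt addr val
  refine ⟨κ, w, fun r m B hP hB hβ hm hK => ?_⟩
  obtain ⟨h1, h2, h3, h4, h5, h6⟩ := H r hP
  have reg2 : r.region (-2) = 22 := by simp [region]
  have reg3 : r.region (-3) = 23 := by simp [region]
  have reg9 : r.region (-9) = 29 := by simp [region]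
  have hg : ∀ q < A r, g r q ≠ -2 ∧ g r q ≠ -3 ∧ g r q ≠ -9 := by
    intro q hq
    have := h2 q hq
    refine ⟨?_, ?_, ?_⟩ <;> intro h <;> rw [h] at this <;> omega
  have hsees : ∀ m' : ℤ → ℤ, (∀ x, x ≠ -2 → (∀ q < A r, g r q ≠ x) → m' x = m x) →
      r.Sees R m' := by
    intro m' hm' x hx
    have hx2 : x ≠ -2 := by rintro rfl; exact hR.1 (by rwa [← reg2])
    have hx3 : x ≠ -3 := by rintro rfl; exact hR.2.1 (by rwa [← reg3])
    have hx9 : x ≠ -9 := by rintro rfl; exact hR.2.2 (by rwa [← reg9])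
    rw [hm' x hx2 ?_, hK x hx2 hx3 hx9, if_pos hx]
    rintro q hq rfl
    rw [h2 q hq] at hx
    exact hj.1 hx
  obtain ⟨m', a1, a2, a3, a4, -⟩ := hκ m (A r) (b r) B (g r) (V r) hB hm (fun q hq => (hg q hq).1) h3
    (fun m' hm' => (h6 m' (hsees m' hm')).1)
    (fun p hp m' hv hm' => (h6 m' (hsees m' hm')).2 p hp hv)
  refine ⟨m', ?_, a1.mono (Nat.mul_le_mul_right _ h1), a2⟩
  intro x hx2 hx3 hx9
  by_cases hx : ∃ q < A r, g r q = x
  · obtain ⟨q, hq, rfl⟩ := hx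
    rw [a3 q hq, hK _ hx2 hx3 hx9, if_neg (by rw [h2 q hq]; exact hj.1), zero_add,
      if_pos (by rw [h2 q hq]; exact List.mem_cons_self), h4 q hq]
  · push Not at hx
    rw [a4 x hx2 hx, hK x hx2 hx3 hx9]
    by_cases hxj : r.region x = j
    · rw [if_neg (by rw [hxj]; exact hj.1), h5 x hxj hx, ite_self]
    · simp [hxj]

open RunData in
/-- A single loop that fills one array. -/
theorem triple_array (P : FamilyCode) (R : List ℕ) (j : ℕ) (cnt idx val : Expr)
    (A b : RunData → ℕ) (V : RunData → ℕ → ℤ) (hR : 22 ∉ R ∧ 23 ∉ R ∧ 29 ∉ R)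
    (hj : j ∉ R) (hj16 : j < 16)
    (H : ∀ r : RunData, r.Valid P → A r * b r + 1 ≤ r.X ∧
      (∀ q < A r, r.arrays j q = ∑ l ∈ Finset.range (b r), V r (q * b r + l)) ∧
      (∀ q, A r ≤ q → r.arrays j q = 0) ∧
      (∀ m : ℤ → ℤ, r.Sees R m → cnt.eval m = ((A r * b r : ℕ) : ℤ) ∧
        ∀ p < A r * b r, m (-2) = p → idx.eval m = ((p / b r : ℕ) : ℤ) ∧ val.eval m = V r p)) :
    Triple P (accumProg (-2) cnt (arrE j idx) val) (fun r m => r.Known R m)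
      (fun r m => r.Known (j :: R) m) (fun _ => []) := by
  refine triple_accumProg P R j cnt (arrE j idx) val A b (fun _ q => arr j q) V hR
    ⟨hj, by omega, by omega, by omega⟩ fun r hP => ?_
  obtain ⟨h1, h2, h3, h4⟩ := H r hP
  refine ⟨h1, fun q _ => r.region_arr hj16 q, fun q _ q' _ h => ?_, fun q hq => ?_,
    fun x hx hq => ?_, fun m hm => ⟨(h4 m hm).1, fun p hp hv => ?_⟩⟩
  · unfold arr at h
    omega
  · rw [r.full_arr hj16, h2 q hq]
  · obtain ⟨q, rfl⟩ := r.region_eq_arr hj16 hx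
    rw [r.full_arr hj16]
    exact h3 q (not_lt.1 fun h => hq q h rfl)
  · obtain ⟨h5, h6⟩ := (h4 m hm).2 p hp hv
    exact ⟨eval_arrE h5 j, h6⟩

open RunData in
/-- A single loop that computes one number. -/
theorem triple_scalar (P : FamilyCode) (R : List ℕ) (j : ℕ) (cnt val : Expr)
    (b : RunData → ℕ) (V : RunData → ℕ → ℤ) (hR : 22 ∉ R ∧ 23 ∉ R ∧ 29 ∉ R)
    (hj : 20 + j ∉ R) (hj8 : 4 ≤ j ∧ j ≤ 8)
    (H : ∀ r : RunData, r.Valid P → b r + 1 ≤ r.X ∧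
      (r.full (-j) = ∑ l ∈ Finset.range (b r), V r l) ∧
      (∀ m : ℤ → ℤ, r.Sees R m → cnt.eval m = (b r : ℤ) ∧
        ∀ p < b r, m (-2) = p → val.eval m = V r p)) :
    Triple P (accumProg (-2) cnt (Expr.const (-j)) val) (fun r m => r.Known R m)
      (fun r m => r.Known ((20 + j) :: R) m) (fun _ => []) := by
  have hreg : ∀ (r : RunData) x, r.region x = 20 + j ↔ x = -j := by
    intro r x
    unfold region
    constructor
    · intro h
      split_ifs at h <;> omega
    · rintro rfl
      rw [if_neg (by omega), if_pos (by omega)]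
      omega
  refine triple_accumProg P R (20 + j) cnt _ val (fun _ => 1) b (fun _ _ => -j) V hR
    ⟨hj, by omega, by omega, by omega⟩ fun r hP => ?_
  obtain ⟨h1, h2, h4⟩ := H r hP
  refine ⟨by omega, fun q _ => (hreg r _).2 rfl, fun q _ q' _ h => by omega, fun q hq => ?_,
    fun x hx hq => ?_, fun m hm => ⟨by rw [one_mul]; exact (h4 m hm).1, fun p hp hv => ?_⟩⟩
  · obtain rfl : q = 0 := by omega
    simpa using h2
  · exact absurd ((hreg r x).1 hx).symm (hq 0 one_pos)
  · rw [one_mul] at hp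
    exact ⟨rfl, (h4 m hm).2 p hp hv⟩

theorem mul_add_div_mod {n j : ℕ} (i : ℕ) (hj : j < n) :
    (i * n + j) / n = i ∧ (i * n + j) % n = j := by
  have hn : 0 < n := by omega
  rw [mul_comm]
  exact ⟨by rw [Nat.mul_add_div hn, Nat.div_eq_of_lt hj, add_zero],
    by rw [Nat.mul_add_mod, Nat.mod_eq_of_lt hj]⟩

theorem mul_add_lt_mul {K N i j : ℕ} (hi : i < K) (hj : j < N) : i * N + j < K * N := by
  have : (i + 1) * N ≤ K * N := Nat.mul_le_mul_right _ hi
  rw [add_mul] at this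
  omega

/-! ### Correctness of the accumulating loops -/

namespace RunData

variable {P : FamilyCode} {r : RunData} {R : List ℕ} {m : ℤ → ℤ}

theorem Sees.buf (h : r.Sees R m) (hR : 17 ∈ R) {i x : ℕ} (hi : i < r.K)
    (hx : x < r.n * r.n + 4) :
    m (r.H + i * ((r.n * r.n + 4 : ℕ) : ℤ) + x) = r.buf i x := by
  have e : (r.H + i * ((r.n * r.n + 4 : ℕ) : ℤ) + x : ℤ) =
      ((r.H + (i * (r.n * r.n + 4) + x) : ℕ) : ℤ) := by push_cast; ring
  have h1 := mul_add_lt_mul hi hx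
  rw [e]
  have h2 : r.H + (i * (r.n * r.n + 4) + x) < r.H' := by
    unfold RunData.H'
    omega
  rw [h _ ?_, full, if_neg (by omega), if_neg (by omega), if_neg (by omega),
    if_pos (by exact_mod_cast h2)]
  · have h3 : (((r.H + (i * (r.n * r.n + 4) + x) : ℕ) : ℤ) - r.H).toNat =
        i * (r.n * r.n + 4) + x := by omega
    obtain ⟨h4, h5⟩ := mul_add_div_mod i hx
    rw [h3, h4, h5]
  · unfold region
    rwa [if_neg (by omega), if_neg (by omega), if_neg (by omega),
      if_pos (by exact_mod_cast h2)]

theorem buf_num {i l k : ℕ} (hl : l < r.n) (hk : k < r.n) :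
    r.buf i (l * r.n + k + 1) = r.num i l k := by
  have h := entry_index_lt hl hk
  obtain ⟨h1, h2⟩ := mul_add_div_mod l hk
  rw [RunData.buf, if_neg (by omega), if_pos (by omega), Nat.add_sub_cancel, h1, h2]

theorem Sees.received (h : r.Sees R m) (hR : 18 ∈ R) {s x : ℕ} (hs : s < r.K * r.N)
    (hx : x < r.cap + 1) :
    m (r.H' + s * ((r.cap + 1 : ℕ) : ℤ) + x) = r.received s x := by
  have e : (r.H' + s * ((r.cap + 1 : ℕ) : ℤ) + x : ℤ) =
      ((r.H' + (s * (r.cap + 1) + x) : ℕ) : ℤ) := by push_cast; ring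
  have h1 := mul_add_lt_mul hs hx
  rw [e]
  have h2 : r.H ≤ r.H' := Nat.le_add_right _ _
  have h2' : r.H' + (s * (r.cap + 1) + x) < r.H' + r.K * r.N * (r.cap + 1) := by omega
  rw [h _ ?_, full, if_neg (by omega), if_neg (by omega), if_neg (by omega), if_neg (by omega),
    if_pos (by exact_mod_cast h2')]
  · have h3 : (((r.H' + (s * (r.cap + 1) + x) : ℕ) : ℤ) - r.H').toNat =
        s * (r.cap + 1) + x := by omega
    obtain ⟨h4, h5⟩ := mul_add_div_mod s hx
    rw [h3, h4, h5]
  · unfold region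
    rwa [if_neg (by omega), if_neg (by omega), if_neg (by omega), if_neg (by omega)]

theorem X_bounds (r : RunData) :
    r.K * (r.n * r.n + 4) + 1 ≤ r.X ∧ r.K * r.N * r.n * r.n + 1 ≤ r.X ∧
    r.n * r.n * r.n + 1 ≤ r.X := by
  have e : r.X = r.K * r.N * (r.n + 2) ^ 5 + r.K * (r.n + 2) ^ 5 + r.N * (r.n + 2) ^ 5 +
    (r.n + 2) ^ 5 + Nat.size r.Y + 1 := by unfold X; ring
  have e3 : (r.n + 2) ^ 3 = r.n * r.n * r.n + 6 * (r.n * r.n) + 12 * r.n + 8 := by ring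
  have e5 : (r.n + 2) ^ 3 ≤ (r.n + 2) ^ 5 := Nat.pow_le_pow_right (by omega) (by omega)
  have h1 : r.K * (r.n * r.n + 4) ≤ r.K * (r.n + 2) ^ 5 :=
    Nat.mul_le_mul_left _ (by nlinarith [Nat.zero_le (r.n * r.n * r.n)])
  have h2 : r.K * r.N * (r.n * r.n) ≤ r.K * r.N * (r.n + 2) ^ 5 :=
    Nat.mul_le_mul_left _ (by nlinarith [Nat.zero_le (r.n * r.n * r.n)])
  have h3 : 0 ≤ r.n * r.n * r.n := Nat.zero_le _
  rw [mul_assoc (r.K * r.N)]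
  refine ⟨?_, ?_, ?_⟩ <;> omega

theorem X_bound {r : RunData} {a : ℕ} (h : a ≤ r.K * r.N * r.n * r.n) :
    a + 1 ≤ r.X := by
  have := r.X_bounds.2.1
  omega

theorem triple_sampleProg (P : FamilyCode) (R : List ℕ) (hR : 22 ∉ R ∧ 23 ∉ R ∧ 29 ∉ R)
    (hin : 16 ∈ R ∧ 17 ∈ R ∧ 18 ∈ R ∧ 25 ∈ R) (h3 : 3 ∉ R) :
    Triple P P.sampleProg (fun r m => r.Known R m) (fun r m => r.Known (3 :: R) m)
      (fun _ => []) := by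
  obtain ⟨i16, i17, i18, i25⟩ := hin
  refine triple_array P R 3 _ _ _ (fun r => r.K * r.N * r.n) (fun r => r.n)
    (fun r p => r.received (p / r.n / r.n) (p % r.n + 1) *
      r.num (p / r.n / r.n / r.N) (p % r.n) (p / r.n % r.n)) hR h3 (by omega) fun r hP => ?_
  refine ⟨r.X_bounds.2.1, fun q hq => ?_, fun q hq => by simp [arrays, hq], fun m hm => ?_⟩
  · simp only [arrays, if_pos hq, RunData.w]
    refine Finset.sum_congr rfl fun l hl => ?_
    obtain ⟨h1, h2⟩ := mul_add_div_mod q (Finset.mem_range.1 hl)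
    rw [h1, h2]
  · have hn := hm.n hP i16
    have hK := hm.evals hP i16
    refine ⟨by simp [hn, hK], fun p hp hv => ?_⟩
    have hp' : pE.eval m = p := hv
    refine ⟨by simp [hp', hn], ?_⟩
    have hn0 := hP.n_pos
    have hpn : p % r.n < r.n := Nat.mod_lt _ hn0
    have hqn : p / r.n % r.n < r.n := Nat.mod_lt _ hn0
    have hs : p / r.n / r.n < r.K * r.N :=
      Nat.div_lt_of_lt_mul (Nat.div_lt_of_lt_mul (by convert hp using 1; ring))
    have hi : p / r.n / r.n / r.N < r.K := Nat.div_lt_of_lt_mul (by rwa [mul_comm])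
    have hcap : p % r.n + 1 < r.cap + 1 := by
      have : r.n * 1 ≤ r.n * (Nat.size r.Y + 1) := Nat.mul_le_mul_left _ (by omega)
      unfold RunData.cap
      omega
    have hidx : p % r.n * r.n + p / r.n % r.n + 1 < r.n * r.n + 4 := by
      have := entry_index_lt hpn hqn
      omega
    rw [← hm.received i18 hs hcap, ← buf_num hpn hqn, ← hm.buf i17 hi hidx]
    simp only [Expr.eval_mul, Expr.eval_load, Expr.eval_add, Expr.eval_div, Expr.eval_mod,
      hm.H' hP i16, hm.H hP i16, hm.nn hP i16, hm.cap hP i16 i25, hp', hn, hK.2.1,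
      Expr.eval_ofNat]
    push_cast
    congr 2

theorem triple_momentProg (P : FamilyCode) (R : List ℕ) (hR : 22 ∉ R ∧ 23 ∉ R ∧ 29 ∉ R)
    (hin : 16 ∈ R ∧ 3 ∈ R) (h4 : 4 ∉ R) :
    Triple P P.momentProg (fun r m => r.Known R m) (fun r m => r.Known (4 :: R) m)
      (fun _ => []) := by
  obtain ⟨i16, i3⟩ := hin
  refine triple_array P R 4 _ _ _ (fun r => r.K * (r.n * r.n)) (fun r => r.N)
    (fun r p => r.w (p / r.N / (r.n * r.n) * r.N + p % r.N) (p / r.N / r.n % r.n) *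
      r.w (p / r.N / (r.n * r.n) * r.N + p % r.N) (p / r.N % r.n)) hR h4 (by omega) fun r hP => ?_
  refine ⟨X_bound (le_of_eq (by ring)), fun q hq => ?_,
    fun q hq => by simp [arrays, hq], fun m hm => ?_⟩
  · simp only [arrays, if_pos hq, RunData.S]
    refine Finset.sum_congr rfl fun l hl => ?_
    obtain ⟨h1, h2⟩ := mul_add_div_mod q (Finset.mem_range.1 hl)
    rw [h1, h2]
  · have hn := hm.n hP i16
    have hK := hm.evals hP i16
    refine ⟨by simp [hm.nn hP i16, hK], fun p hp hv => ?_⟩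
    have hp' : pE.eval m = p := hv
    refine ⟨by simp [hp', hK], ?_⟩
    have hn0 := hP.n_pos
    have hN0 := hP.N_pos
    have hi : p / r.N / (r.n * r.n) < r.K :=
      Nat.div_lt_of_lt_mul (Nat.div_lt_of_lt_mul (by convert hp using 1; ring))
    have hs := mul_add_lt_mul hi (Nat.mod_lt p hN0)
    have hw : ∀ (e : Expr) (j : ℕ), j < r.n → e.eval m = j →
        (Expr.load (arrE 3 ((pE / P.N / FamilyCode.nn * P.N + pE % P.N) * nE + e))).eval m =
        r.w (p / r.N / (r.n * r.n) * r.N + p % r.N) j := by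
      intro e j hj he
      rw [Expr.eval_load, eval_arrE (q := (p / r.N / (r.n * r.n) * r.N + p % r.N) * r.n + j)
        (by simp [hp', hn, hK, he, hm.nn hP i16]), hm.arr (by omega) i3]
      obtain ⟨h1, h2⟩ := mul_add_div_mod (p / r.N / (r.n * r.n) * r.N + p % r.N) hj
      rw [arrays, if_pos (mul_add_lt_mul hs hj), h1, h2]
    rw [Expr.eval_mul, hw _ (p / r.N / r.n % r.n) (Nat.mod_lt _ hn0) (by simp [hp', hn, hK]),
      hw _ (p / r.N % r.n) (Nat.mod_lt _ hn0) (by simp [hp', hn, hK])]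

theorem triple_productProg (P : FamilyCode) (R : List ℕ) (hR : 22 ∉ R ∧ 23 ∉ R ∧ 29 ∉ R)
    (hin : 16 ∈ R ∧ 3 ∈ R) (h5 : 5 ∉ R) :
    Triple P P.productProg (fun r m => r.Known R m) (fun r m => r.Known (5 :: R) m)
      (fun _ => []) := by
  obtain ⟨i16, i3⟩ := hin
  refine triple_array P R 5 _ _ _ (fun r => r.K * r.N) (fun r => r.n)
    (fun r p => r.w (p / r.n) (p % r.n) * r.τ (p / r.n / r.N) (p % r.n)) hR h5 (by omega)
    fun r hP => ?_
  have hn0 := hP.n_pos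
  refine ⟨X_bound (Nat.le_mul_of_pos_right _ hn0), fun q hq => ?_,
    fun q hq => by simp [arrays, hq], fun m hm => ?_⟩
  · simp only [arrays, if_pos hq, RunData.y]
    refine Finset.sum_congr rfl fun l hl => ?_
    obtain ⟨h1, h2⟩ := mul_add_div_mod q (Finset.mem_range.1 hl)
    rw [h1, h2]
  · have hn := hm.n hP i16
    have hK := hm.evals hP i16
    refine ⟨by simp [hn, hK], fun p hp hv => ?_⟩
    have hp' : pE.eval m = p := hv
    refine ⟨by simp [hp', hn], ?_⟩
    have hpn : p % r.n < r.n := Nat.mod_lt _ hn0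
    have hs : p / r.n < r.K * r.N := Nat.div_lt_of_lt_mul (by rwa [mul_comm])
    have hi : p / r.n / r.N < r.K := Nat.div_lt_of_lt_mul (by rwa [mul_comm])
    rw [Expr.eval_mul, Expr.eval_load, eval_arrE (q := p / r.n * r.n + p % r.n)
      (by simp [hp', hn]), hm.arr (by omega) i3, hP.eval_τ m (hm.input i16) _ _ (p / r.n / r.N)
      (p % r.n) (by simp [hp', hn, hK]) (by simp [hp', hn]) hi hpn]
    obtain ⟨h1, h2⟩ := mul_add_div_mod (p / r.n) hpn
    rw [arrays, if_pos (mul_add_lt_mul hs hpn), h1, h2]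

theorem triple_distProg (P : FamilyCode) (R : List ℕ) (hR : 22 ∉ R ∧ 23 ∉ R ∧ 29 ∉ R)
    (hin : 16 ∈ R ∧ 1 ∈ R ∧ 5 ∈ R) (h6 : 6 ∉ R) :
    Triple P P.distProg (fun r m => r.Known R m) (fun r m => r.Known (6 :: R) m)
      (fun _ => []) := by
  obtain ⟨i16, i1, i5⟩ := hin
  refine triple_array P R 6 _ _ _ (fun r => r.K) (fun r => r.N)
    (fun r p => centeredMod (r.y p) r.D * centeredMod (r.y p) r.D) hR h6 (by omega)
    fun r hP => ?_
  have hn0 := hP.n_pos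
  refine ⟨X_bound ((Nat.le_mul_of_pos_right _ hn0).trans (Nat.le_mul_of_pos_right _ hn0)),
    fun q hq => ?_, fun q hq => by simp [arrays, hq], fun m hm => ?_⟩
  · simp only [arrays, if_pos hq, RunData.dist]
  · have hn := hm.n hP i16
    have hK := hm.evals hP i16
    refine ⟨by simp [hK], fun p hp hv => ?_⟩
    have hp' : pE.eval m = p := hv
    refine ⟨by simp [hp', hK], ?_⟩
    have h1 : (Expr.load (arrE 5 pE)).eval m = r.y p := by
      rw [Expr.eval_load, eval_arrE hp', hm.arr (by omega) i5, arrays, if_pos hp]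
    simp only [FamilyCode.centered, Expr.eval_mul, Expr.eval_sub, Expr.eval_div, Expr.eval_add, h1,
      hm.D hP i16 i1, Expr.eval_ofNat, centeredMod, Nat.cast_ofNat]

theorem triple_badLengthProg (P : FamilyCode) (R : List ℕ) (hR : 22 ∉ R ∧ 23 ∉ R ∧ 29 ∉ R)
    (hin : 16 ∈ R ∧ 18 ∈ R ∧ 25 ∈ R) (h : 26 ∉ R) :
    Triple P P.badLengthProg (fun r m => r.Known R m) (fun r m => r.Known (26 :: R) m)
      (fun _ => []) := by
  obtain ⟨i16, i18, i25⟩ := hin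
  refine triple_scalar P R 6 _ _ (fun r => r.K * r.N) (fun r p => r.badLength p) hR h (by omega)
    fun r hP => ?_
  have hn0 := hP.n_pos
  refine ⟨X_bound ((Nat.le_mul_of_pos_right _ hn0).trans (Nat.le_mul_of_pos_right _ hn0)),
    by simp [full], fun m hm => ?_⟩
  have hn := hm.n hP i16
  have hK := hm.evals hP i16
  refine ⟨by simp [hK], fun p hp hv => ?_⟩
  have hp' : pE.eval m = p := hv
  have h1 := hm.received i18 hp (x := 0) (by omega)
  simp only [Expr.eval_sub, Expr.eval_eqInd, Expr.eval_load, Expr.eval_add, Expr.eval_mul,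
    hm.H' hP i16, hm.cap hP i16 i25, hp', hn, Expr.eval_ofNat, badLength, ← h1]
  push_cast
  simp

theorem triple_badMomentProg (P : FamilyCode) (R : List ℕ) (hR : 22 ∉ R ∧ 23 ∉ R ∧ 29 ∉ R)
    (hin : 16 ∈ R ∧ 1 ∈ R ∧ 4 ∈ R) (h : 27 ∉ R) :
    Triple P P.badMomentProg (fun r m => r.Known R m) (fun r m => r.Known (27 :: R) m)
      (fun _ => []) := by
  obtain ⟨i16, i1, i4⟩ := hin
  refine triple_scalar P R 7 _ _ (fun r => r.K * (r.n * r.n))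
    (fun r p => r.badMoment (p / (r.n * r.n)) (p / r.n % r.n) (p % r.n)) hR h (by omega)
    fun r hP => ?_
  refine ⟨X_bound ?_, by simp [full], fun m hm => ?_⟩
  · rw [mul_assoc (r.K * r.N)]
    exact Nat.mul_le_mul_right _ (Nat.le_mul_of_pos_right _ hP.N_pos)
  have hn := hm.n hP i16
  have hK := hm.evals hP i16
  refine ⟨by simp [hK, hm.nn hP i16], fun p hp hv => ?_⟩
  have hp' : pE.eval m = p := hv
  have h1 : (Expr.load (arrE 4 pE)).eval m =
      r.S (p / (r.n * r.n)) (p / r.n % r.n) (p % r.n) := by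
    rw [Expr.eval_load, eval_arrE hp', hm.arr (by omega) i4, arrays, if_pos hp]
  simp only [Expr.eval_negInd, Expr.eval_sub, Expr.eval_eqInd, Expr.eval_mul, h1, hK,
    hm.den hP i16 i1, hp', hn, Expr.eval_ofNat, badMoment, momentBound, weightedMoment,
    Expr.eval_div, Expr.eval_mod]
  push_cast
  rfl

theorem triple_badDistProg (P : FamilyCode) (R : List ℕ) (hR : 22 ∉ R ∧ 23 ∉ R ∧ 29 ∉ R)
    (hin : 16 ∈ R ∧ 1 ∈ R ∧ 6 ∈ R) (h : 28 ∉ R) :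
    Triple P P.badDistProg (fun r m => r.Known R m) (fun r m => r.Known (28 :: R) m)
      (fun _ => []) := by
  obtain ⟨i16, i1, i6⟩ := hin
  refine triple_scalar P R 8 _ _ (fun r => r.K) (fun r p => r.badDist p) hR h (by omega)
    fun r hP => ?_
  refine ⟨?_, by simp [full], fun m hm => ?_⟩
  · exact (Nat.succ_le_succ (Nat.le_mul_of_pos_right _ (by omega))).trans r.X_bounds.1
  have hK := hm.evals hP i16
  refine ⟨by simp [hK], fun p hp hv => ?_⟩
  have hp' : pE.eval m = p := hv
  have h1 : (Expr.load (arrE 6 pE)).eval m = r.dist p := by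
    rw [Expr.eval_load, eval_arrE hp', hm.arr (by omega) i6, arrays, if_pos hp]
  simp only [Expr.eval_negInd, Expr.eval_sub, Expr.eval_mul, h1, hK, hm.D hP i16 i1,
    Expr.eval_ofNat, badDist]
  push_cast
  rfl

theorem triple_bufProg (P : FamilyCode) (R : List ℕ) (hR : 22 ∉ R ∧ 23 ∉ R ∧ 29 ∉ R)
    (hin : 16 ∈ R ∧ 0 ∈ R ∧ 1 ∈ R) (h : 17 ∉ R) :
    Triple P P.bufProg (fun r m => r.Known R m) (fun r m => r.Known (17 :: R) m)
      (fun _ => []) := by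
  obtain ⟨i16, i0, i1⟩ := hin
  have hreg : ∀ (r : RunData) x, r.region x = 17 ↔ (r.H : ℤ) ≤ x ∧ x < r.H' := by
    intro r x
    have : r.H ≤ r.H' := Nat.le_add_right _ _
    unfold region
    split_ifs <;> omega
  have hfull : ∀ (r : RunData) (q : ℕ), q < r.K * (r.n * r.n + 4) →
      r.full (r.H + q) = r.buf (q / (r.n * r.n + 4)) (q % (r.n * r.n + 4)) := by
    intro r q hq
    have h1 : (r.H : ℤ) + q < r.H' := by unfold H'; omega
    rw [full, if_neg (by omega), if_neg (by omega), if_neg (by omega), if_pos h1]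
    congr <;> omega
  refine triple_accumProg P R 17 _ _ _ (fun r => r.K * (r.n * r.n + 4)) (fun _ => 1)
    (fun r q => r.H + q) (fun r p => r.buf (p / (r.n * r.n + 4)) (p % (r.n * r.n + 4))) hR
    ⟨h, by omega, by omega, by omega⟩ fun r hP => ?_
  refine ⟨by simpa using r.X_bounds.1, fun q hq => (hreg r _).2 ?_, fun q _ q' _ _ => by omega,
    fun q hq => by simpa using hfull r q hq, fun x hx hq => ?_, fun m hm => ?_⟩
  · unfold H'
    omega
  · obtain ⟨h1, h2⟩ := (hreg r x).1 hx
    refine absurd ?_ (hq (x - r.H).toNat ?_)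
    · omega
    · unfold H' at h2
      omega
  · have hn := hm.n hP i16
    have hK := hm.evals hP i16
    have hnn := hm.nn hP i16
    refine ⟨by simp [hK, hnn], fun p hp hv => ?_⟩
    have hp' : pE.eval m = p := hv
    refine ⟨by simp [hm.H hP i16, hp'], ?_⟩
    have hi : p / (r.n * r.n + 4) < r.K := Nat.div_lt_of_lt_mul (by
      rw [mul_one] at hp; rwa [mul_comm])
    have hpos : FamilyCode.pos.eval m = ((p % (r.n * r.n + 4) : ℕ) : ℤ) := by
      simp [FamilyCode.pos, hp', hnn]
    have hx := Nat.mod_lt p (show 0 < r.n * r.n + 4 by omega)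
    have hnum : p % (r.n * r.n + 4) ≠ 0 → p % (r.n * r.n + 4) ≤ r.n * r.n →
        (P.F (pE / (FamilyCode.nn + 4)) ((FamilyCode.pos - 1) / nE) *
          (P.a * (0 - FamilyCode.M ((FamilyCode.pos - 1) % nE) ((FamilyCode.pos - 1) / nE)) *
            FamilyCode.c)).eval m =
        r.num (p / (r.n * r.n + 4)) ((p % (r.n * r.n + 4) - 1) / r.n)
          ((p % (r.n * r.n + 4) - 1) % r.n) := by
      intro h1 h2
      obtain ⟨x, hx'⟩ := Nat.exists_eq_succ_of_ne_zero h1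
      have hj : x / r.n < r.n := Nat.div_lt_of_lt_mul (by omega)
      have hk : x % r.n < r.n := Nat.mod_lt _ hP.n_pos
      have ej : ((FamilyCode.pos - 1) / nE).eval m = ((x / r.n : ℕ) : ℤ) := by
        simp [hpos, hn, hx']
      have ek : ((FamilyCode.pos - 1) % nE).eval m = ((x % r.n : ℕ) : ℤ) := by
        simp [hpos, hn, hx']
      rw [hx', Nat.succ_sub_one, Expr.eval_mul, Expr.eval_mul, Expr.eval_mul, Expr.eval_sub,
        hP.eval_F m (hm.input i16) _ _ (p / (r.n * r.n + 4)) (x / r.n) (by simp [hp', hnn]) ej hi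
        hj, hm.M hP i16 i0 ek ej hk hj, hm.c hP i16 i1, hK.2.2.1]
      simp [num]
    generalize hx0 : p % (r.n * r.n + 4) = x at *
    rw [Expr.eval_add, Expr.eval_add, Expr.eval_add, Expr.eval_add, Expr.eval_mul _ (_ - _)]
    generalize Expr.eval m (P.F _ _ * _) = z at *
    simp only [Expr.eval_mul, Expr.eval_sub, Expr.eval_eqInd, Expr.eval_add, hpos, hn, hnn, hK,
      hm.den hP i16 i1, Expr.eval_ofNat]
    have c1 : ((x : ℤ) = ((r.n * r.n : ℕ) : ℤ) + ((1 : ℕ) : ℤ)) ↔ x = r.n * r.n + 1 := by omega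
    have c2 : ((x : ℤ) = ((r.n * r.n : ℕ) : ℤ) + ((2 : ℕ) : ℤ)) ↔ x = r.n * r.n + 2 := by omega
    have c3 : ((x : ℤ) = ((r.n * r.n : ℕ) : ℤ) + ((3 : ℕ) : ℤ)) ↔ x = r.n * r.n + 3 := by omega
    have c0 : ((x : ℤ) = ((0 : ℕ) : ℤ)) ↔ x = 0 := by omega
    simp only [c0, c1, c2, c3, RunData.buf]
    by_cases h0 : x = 0
    · simp [h0]
    by_cases h1 : x ≤ r.n * r.n
    · simp [h0, h1, hnum h0 h1, show x ≠ r.n * r.n + 1 by omega, show x ≠ r.n * r.n + 2 by omega,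
        show x ≠ r.n * r.n + 3 by omega]
    by_cases h2 : x = r.n * r.n + 1
    · simp [h2]
    by_cases h3 : x = r.n * r.n + 2
    · simp [h3]
    · obtain rfl : x = r.n * r.n + 3 := by omega
      simp

end RunData

/-! ### The length bound for the answers, the queries, the verdict -/

namespace RunData

theorem Known.sees {r : RunData} {R : List ℕ} {m : ℤ → ℤ} (h : r.Known R m)
    (hR : 22 ∉ R ∧ 23 ∉ R ∧ 29 ∉ R) : r.Sees R m := by
  intro x hx
  have reg2 : r.region (-2) = 22 := by simp [region]
  have reg3 : r.region (-3) = 23 := by simp [region]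
  have reg9 : r.region (-9) = 29 := by simp [region]
  rw [h x ?_ ?_ ?_, if_pos hx]
  · rintro rfl; exact hR.1 (by rwa [← reg2])
  · rintro rfl; exact hR.2.1 (by rwa [← reg3])
  · rintro rfl; exact hR.2.2 (by rwa [← reg9])

theorem triple_bound (P : FamilyCode) (R : List ℕ) (hR : 22 ∉ R ∧ 23 ∉ R ∧ 29 ∉ R)
    (hin : 16 ∈ R) (h : 24 ∉ R) :
    Triple P (accumProg (-2) FamilyCode.nn (Expr.const (-4))
      (FamilyCode.A (pE / nE) (pE % nE) * FamilyCode.A (pE / nE) (pE % nE) * P.Y))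
      (fun r m => r.Known R m) (fun r m => r.Known (24 :: R) m) (fun _ => []) := by
  refine triple_scalar P R 4 _ _ (fun r => r.n * r.n) (fun r p => ((entry r.A (p / r.n)
    (p % r.n)).natAbs ^ 2 * r.Y₀ : ℕ)) hR h (by omega) fun r hP => ?_
  refine ⟨?_, by simp [full, Y], fun m hm => ⟨hm.nn hP hin, fun p hp hv => ?_⟩⟩
  · have := r.X_bounds.2.2
    have : r.n * r.n * 1 ≤ r.n * r.n * r.n := Nat.mul_le_mul_left _ hP.n_pos
    omega
  have hn := hm.n hP hin
  have hp' : pE.eval m = p := hv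
  have h1 := hm.A hP hin (e := pE / nE) (f := pE % nE) (i := p / r.n) (j := p % r.n)
    (by simp [hp', hn]) (by simp [hp', hn]) (Nat.div_lt_of_lt_mul hp) (Nat.mod_lt _ hP.n_pos)
  rw [Expr.eval_mul, Expr.eval_mul, h1, (hm.evals hP hin).2.2.2.2.2.2.2]
  push_cast
  rw [sq_abs]
  ring

theorem triple_size (P : FamilyCode) (R : List ℕ) (hin : 24 ∈ R) (h : 25 ∉ R) :
    Triple P (Prog.seq (Prog.store (Expr.const (-9)) (Expr.load (Expr.const (-4))))
      (sizeProg (-9) (-5)))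
      (fun r m => r.Known R m) (fun r m => r.Known (25 :: R) m) (fun _ => []) := by
  obtain ⟨κ, hκ⟩ := exists_runs_sizeProg (-9) (-5) (by decide)
  refine ⟨κ + 30, 1, fun r m B hP hB hβ hm hK => ?_⟩
  have hreg : ∀ x, r.region x = 25 ↔ x = -5 := by
    intro x
    unfold region
    constructor
    · intro h
      split_ifs at h <;> omega
    · rintro rfl
      simp
  have h4 : m (-4) = r.Y := by
    rw [hK (-4) (by decide) (by decide) (by decide)]
    simp [region, hin, full]
  have h5 : m (-5) = 0 := by
    rw [hK (-5) (by decide) (by decide) (by decide), (hreg _).2 rfl, if_neg h]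
  -- Computing the size destroys its argument, hence the copy in the scratch cell `-9`.
  have hm1 : Bdd B (Function.update m (-9) (m (-4))) := hm.update (hm _)
  have s1 := runs_store (Expr.const (-9)) (Expr.load (Expr.const (-4))) m
  obtain ⟨m', a1, a2, a3, a4⟩ := hκ r.Y B _ hB hm1 (by simp [h4]) (by simp [h5])
  refine ⟨m', fun x h2 h3 h9 => ?_, (s1.seq a1).mono ?_, by rwa [one_mul]⟩
  · by_cases hx : x = -5
    · subst hx
      rw [a3, if_pos (by rw [(hreg _).2 rfl]; exact List.mem_cons_self)]
      simp [full]
    · rw [a4 x h9 hx, Function.update_of_ne h9, hK x h2 h3 h9]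
      have : r.region x ≠ 25 := fun h => hx ((hreg x).1 h)
      simp [this]
  · have c1 := Expr.cost_le hB hm (Expr.load (Expr.const (-4)))
    have c2 := Expr.cost_le hB hm (Expr.const (-9))
    have e1 : (Expr.load (Expr.const (-4))).costFactor = 6 := by decide
    have e2 : (Expr.const (-9)).costFactor = 5 := by decide
    rw [e1] at c1
    rw [e2] at c2
    have h1 : Nat.size r.Y + 1 ≤ r.X := by unfold X; omega
    have h2 : (Nat.size r.Y + 1) * (κ * B) ≤ r.X * (κ * B) := Nat.mul_le_mul_right _ h1
    have h3 : 1 * B ≤ r.X * B := Nat.mul_le_mul_right _ (by omega)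
    have h4 : r.X * ((κ + 30) * B) = r.X * (κ * B) + 30 * (r.X * B) := by ring
    omega

/-- The `i`-th query. -/
def query (r : RunData) (i : ℕ) : List ℤ := (List.range (r.n * r.n + 4)).map (r.buf i)

/-- The queries and answers. -/
def trace (r : RunData) : Trace :=
  (List.range (r.K * r.N)).flatMap fun s => [(r.query (s / r.N), r.as s)]

theorem listSize_le {l : List ℤ} {B : ℕ} (h : ∀ z ∈ l, bitLen z ≤ B) :
    listSize l ≤ l.length * B := by
  unfold listSize
  refine (List.sum_le_card_nsmul _ B ?_).trans_eq (by simp)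
  simpa using h

theorem bitLen_le_listSize {l : List ℤ} {z : ℤ} (h : z ∈ l) : bitLen z ≤ listSize l :=
  List.single_le_sum (by simp) _ (List.mem_map_of_mem h)

theorem length_le_listSize (l : List ℤ) : l.length ≤ listSize l := by
  induction l with
  | nil => simp
  | cons z l ih =>
    have := one_le_bitLen z
    simp only [listSize, List.map_cons, List.sum_cons, List.length_cons] at ih ⊢
    omega

theorem bitLen_received_le (r : RunData) (s x : ℕ) : bitLen (r.received s x) ≤ r.cap + 2 := by
  unfold received
  split_ifs with h
  · cases x with
    | zero =>
      rw [List.getD_cons_zero, bitLen_le_iff, Int.natAbs_natCast]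
      have := length_le_listSize (r.as s)
      exact Nat.lt_two_pow_self.trans_le (Nat.pow_le_pow_right two_pos (by omega))
    | succ x =>
      rw [List.getD_cons_succ]
      by_cases hx : x < (r.as s).length
      · rw [List.getD_eq_getElem _ _ hx]
        exact (bitLen_le_listSize (List.getElem_mem hx)).trans (h.trans (by omega))
      · rw [List.getD_eq_default _ _ (not_lt.1 hx)]
        exact Nat.le_add_left _ _
  · cases x with
    | zero => exact Nat.le_add_left _ _
    | succ x => simp [bitLen]

theorem readList_eq (m : ℤ → ℤ) (a : ℤ) (k : ℕ) :
    readList m a k = (List.range k).map fun i : ℕ => m (a + i) := by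
  unfold readList
  have h : (do let i ← List.range k; pure (i : ℤ) : List ℤ) = (List.range k).map fun i : ℕ => (i : ℤ) :=
    List.flatMap_pure_eq_map _ _
  rw [h, List.map_map]
  rfl

/-- A short answer does not fill its block of `cap + 1` cells. The block must have been zero, and
then the remaining cells agree with the default value in `received`. -/
theorem receive_apply (r : RunData) (s : ℕ) (m : ℤ → ℤ) (d x : ℤ)
    (h0 : ∀ x, d ≤ x → x < d + (r.cap + 1 : ℕ) → m x = 0) :
    receive m d r.cap (r.as s) x = if d ≤ x ∧ x < d + (r.cap + 1 : ℕ) then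
      r.received s (x - d).toNat else m x := by
  have key : ∀ l : List ℤ, l.length ≤ r.cap + 1 → writeList m d l x =
      if d ≤ x ∧ x < d + (r.cap + 1 : ℕ) then l.getD (x - d).toNat 0 else m x := by
    intro l hl
    unfold writeList
    by_cases h1 : d ≤ x ∧ x < d + (l.length : ℤ)
    · rw [if_pos h1, if_pos ⟨h1.1, by omega⟩]
    · rw [if_neg h1]
      split_ifs with h2
      · rw [List.getD_eq_default _ _ (by omega), h0 x h2.1 h2.2]
      · rfl
  unfold receive received
  split_ifs with h1
  · have := length_le_listSize (r.as s)
    exact (key _ (by simp; omega)).trans (if_pos ‹_›)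
  · have := length_le_listSize (r.as s)
    exact (key _ (by simp; omega)).trans (if_neg ‹_›)
  · exact (key _ (by simp)).trans (if_pos ‹_›)
  · exact (key _ (by simp)).trans (if_neg ‹_›)

/-- This loop does not accumulate, so it gets its own invariant: after `k` queries exactly the first
`k` blocks have been written. The time of a query contains the value of `cap` and not just its bit
length; this is why `cap` is a summand of `beta`. -/
theorem triple_queryProg (P : FamilyCode) (R : List ℕ) (hR : 22 ∉ R ∧ 23 ∉ R ∧ 29 ∉ R)
    (hin : 16 ∈ R ∧ 17 ∈ R ∧ 25 ∈ R) (h18 : 18 ∉ R) :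
    Triple P P.queryProg (fun r m => r.Known R m) (fun r m => r.Known (18 :: R) m) trace := by
  obtain ⟨i16, i17, i25⟩ := hin
  set w := (P.K * P.N).growth + 3 with hw
  refine ⟨((FamilyCode.H + pE / P.N * (FamilyCode.nn + 4)).costFactor +
    (FamilyCode.nn + 4).costFactor + (P.H' + pE * (FamilyCode.cap + 1)).costFactor +
    FamilyCode.cap.costFactor + forFactor (-2) (P.K * P.N) + 3) * w, w,
    fun r m₀ B hP hB hβ hm₀ hK => ?_⟩
  have hcapB : r.cap ≤ B := by
    unfold beta at hβ
    omega
  have hwB : 1 ≤ w * B := Nat.mul_pos (by omega) hB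
  have hBw : B ≤ w * B := Nat.le_mul_of_pos_left _ (by omega)
  have hsees₀ := hK.sees hR
  have hKN : bitLen ((r.K * r.N : ℕ) : ℤ) ≤ (P.K * P.N).growth * B := by
    have h1 := Expr.bitLen_eval_le hB hm₀ (P.K * P.N)
    rwa [Expr.eval_mul, (hsees₀.evals hP i16).1, (hsees₀.evals hP i16).2.1, ← Nat.cast_mul] at h1
  have hreg : ∀ x, r.region x = 18 ↔ (r.H' : ℤ) ≤ x := by
    intro x
    have : r.H ≤ r.H' := Nat.le_add_right _ _
    unfold region
    split_ifs <;> omega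
  have hzero : ∀ x, (r.H' : ℤ) ≤ x → m₀ x = 0 := by
    intro x hx
    rw [hK x (by omega) (by omega) (by omega), if_neg (by rw [(hreg x).2 hx]; exact h18)]
  have hfull : ∀ k < r.K * r.N, ∀ x : ℤ, (r.H' : ℤ) + k * ((r.cap + 1 : ℕ) : ℤ) ≤ x →
      x < (r.H' : ℤ) + k * ((r.cap + 1 : ℕ) : ℤ) + (r.cap + 1 : ℕ) → r.full x =
      r.received k (x - (r.H' + k * ((r.cap + 1 : ℕ) : ℤ))).toNat := by
    intro k hk x h1 h2
    have h3 : r.H ≤ r.H' := Nat.le_add_right _ _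
    obtain ⟨y, hy⟩ := Int.eq_ofNat_of_zero_le (sub_nonneg.2 h1)
    have hy' : y < r.cap + 1 := by omega
    have hx : x = ((r.H' + (k * (r.cap + 1) + y) : ℕ) : ℤ) := by
      push_cast
      push_cast at hy
      linarith
    have h4 := mul_add_lt_mul hk hy'
    obtain ⟨h5, h6⟩ := mul_add_div_mod k hy'
    have h7 : (x - r.H').toNat = k * (r.cap + 1) + y := by omega
    have h8 : r.H' + (k * (r.cap + 1) + y) < r.H' + r.K * r.N * (r.cap + 1) := by omega
    rw [full, if_neg (by omega), if_neg (by omega), if_neg (by omega), if_neg (by omega),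
      if_pos (by rw [hx]; exact_mod_cast h8), h7, h5, h6, hy, Int.toNat_natCast]
  have hsees : ∀ (k : ℕ) (m : ℤ → ℤ), (∀ x, x ≠ -2 → m x = if (r.H' : ℤ) ≤ x ∧
      x < r.H' + k * ((r.cap + 1 : ℕ) : ℤ) then r.full x else m₀ x) → r.Sees R m := by
    intro k m hm x hx
    have h2 : x ≠ -2 := by
      rintro rfl
      exact hR.1 (by simpa [region] using hx)
    rw [hm x h2, if_neg, hsees₀ x hx]
    rintro ⟨h3, -⟩
    rw [(hreg x).2 h3] at hx
    exact h18 hx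
  have hbdd : ∀ k ≤ r.K * r.N, ∀ m : ℤ → ℤ, m (-2) = k → (∀ x, x ≠ -2 → m x =
      if (r.H' : ℤ) ≤ x ∧ x < r.H' + k * ((r.cap + 1 : ℕ) : ℤ) then r.full x else m₀ x) →
      Bdd (w * B) m := by
    intro k hk m h2 hm x
    have e : w * B = (P.K * P.N).growth * B + 3 * B := by rw [hw, add_mul]
    by_cases hx : x = -2
    · subst hx
      rw [h2]
      have := (bitLen_le_of_natAbs_le (y := (k : ℤ)) (z := ((r.K * r.N : ℕ) : ℤ))
        (by rwa [Int.natAbs_natCast, Int.natAbs_natCast])).trans hKN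
      omega
    · rw [hm x hx]
      split_ifs with h3
      · have h4 : r.H ≤ r.H' := Nat.le_add_right _ _
        have h5 : x < r.H' + r.K * r.N * (r.cap + 1) := by
          refine h3.2.trans_le ?_
          have : k * (r.cap + 1) ≤ r.K * r.N * (r.cap + 1) := Nat.mul_le_mul_right _ hk
          zify at this
          push_cast
          linarith
        rw [full, if_neg (by omega), if_neg (by omega), if_neg (by omega), if_neg (by omega),
          if_pos h5]
        have := r.bitLen_received_le ((x - r.H').toNat / (r.cap + 1))
          ((x - r.H').toNat % (r.cap + 1))
        omega
      · exact (hm₀ x).trans hBw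
  obtain ⟨m', ⟨a1, a2⟩, a3⟩ := runs_forProg (v := -2) (cnt := P.K * P.N)
    (body := Prog.query (FamilyCode.H + pE / P.N * (FamilyCode.nn + 4)) (FamilyCode.nn + 4)
      (P.H' + pE * (FamilyCode.cap + 1)) FamilyCode.cap) (m := m₀) (N := r.K * r.N)
    (b := ((FamilyCode.H + pE / P.N * (FamilyCode.nn + 4)).costFactor +
      (FamilyCode.nn + 4).costFactor + (P.H' + pE * (FamilyCode.cap + 1)).costFactor +
      FamilyCode.cap.costFactor + (r.n * r.n + 4) + 2) * (w * B)) hwB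
    (fun k m => m (-2) = k ∧ ∀ x, x ≠ -2 → m x = if (r.H' : ℤ) ≤ x ∧
      x < r.H' + k * ((r.cap + 1 : ℕ) : ℤ) then r.full x else m₀ x)
    (fun s => [(r.query (s / r.N), r.as s)])
    (by
      refine ⟨by simp, fun x hx => ?_⟩
      rw [Function.update_of_ne hx, if_neg]
      push_cast
      omega)
    (by
      rintro k hk m ⟨h2, hm⟩
      have hs := (hsees k m hm).evals hP i16
      exact ⟨h2, by simp [hs], hbdd k hk m h2 hm⟩)
    (by
      rintro k hk m ⟨h2, hm⟩
      have hs := hsees k m hm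
      have hev := hs.evals hP i16
      have hB' := hbdd k hk.le m h2 hm
      have hp' : pE.eval m = k := h2
      have hi : k / r.N < r.K := Nat.div_lt_of_lt_mul (by rwa [mul_comm])
      have eq1 : (FamilyCode.H + pE / P.N * (FamilyCode.nn + 4)).eval m =
          r.H + (k / r.N : ℕ) * ((r.n * r.n + 4 : ℕ) : ℤ) := by
        simp [hs.H hP i16, hs.nn hP i16, hp', hev]
      have eq2 : (FamilyCode.nn + 4).eval m = ((r.n * r.n + 4 : ℕ) : ℤ) := by
        simp [hs.nn hP i16]
      have eq3 : (P.H' + pE * (FamilyCode.cap + 1)).eval m =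
          r.H' + k * ((r.cap + 1 : ℕ) : ℤ) := by
        simp [hs.H' hP i16, hs.cap hP i16 i25, hp']
      have eq4 := hs.cap hP i16 i25
      have eq5 : readList m (r.H + (k / r.N : ℕ) * ((r.n * r.n + 4 : ℕ) : ℤ))
          (r.n * r.n + 4) = r.query (k / r.N) := by
        rw [readList_eq]
        refine List.map_congr_left fun x hx => ?_
        exact hs.buf i17 hi (List.mem_range.1 hx)
      have hq := runs_query (FamilyCode.H + pE / P.N * (FamilyCode.nn + 4)) (FamilyCode.nn + 4)
        (P.H' + pE * (FamilyCode.cap + 1)) FamilyCode.cap m (r.as k)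
      rw [eq1, eq2, eq3, eq4, Int.toNat_natCast, Int.toNat_natCast, eq5] at hq
      have hk0 : (0 : ℤ) ≤ k * ((r.cap + 1 : ℕ) : ℤ) := by positivity
      have hrec := fun x => r.receive_apply k m (r.H' + k * ((r.cap + 1 : ℕ) : ℤ)) x
        (fun y h3 h4 => by rw [hm y (by omega), if_neg (by omega), hzero y (by omega)])
      have hnew : ∀ x, x ≠ -2 → receive m (r.H' + k * ((r.cap + 1 : ℕ) : ℤ)) r.cap (r.as k) x =
          if (r.H' : ℤ) ≤ x ∧ x < r.H' + (k + 1 : ℕ) * ((r.cap + 1 : ℕ) : ℤ) then r.full x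
          else m₀ x := by
        intro x hx
        rw [hrec x]
        have e : ((k + 1 : ℕ) : ℤ) * ((r.cap + 1 : ℕ) : ℤ) =
          k * ((r.cap + 1 : ℕ) : ℤ) + ((r.cap + 1 : ℕ) : ℤ) := by push_cast; ring
        rw [e]
        split_ifs with h3 h4 h4
        · exact (hfull k hk x h3.1 h3.2).symm
        · omega
        · rw [hm x hx, if_pos (by omega)]
        · rw [hm x hx, if_neg (by omega)]
      have hnew2 : receive m (r.H' + k * ((r.cap + 1 : ℕ) : ℤ)) r.cap (r.as k) (-2) = k := by
        rw [hrec, if_neg (by omega), h2]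
      refine ⟨_, hq.mono ?_, ?_, hnew2, by simp, fun x hx => ?_⟩
      · have c1 := Expr.cost_le hwB hB' (FamilyCode.H + pE / P.N * (FamilyCode.nn + 4))
        have c2 := Expr.cost_le hwB hB' (FamilyCode.nn + 4)
        have c3 := Expr.cost_le hwB hB' (P.H' + pE * (FamilyCode.cap + 1))
        have c4 := Expr.cost_le hwB hB' FamilyCode.cap
        have c5 : listSize (r.query (k / r.N)) ≤ (r.n * r.n + 4) * (w * B) := by
          refine (listSize_le (B := w * B) fun z hz => ?_).trans_eq (by simp [query])
          rw [← eq5] at hz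
          obtain ⟨x, -, rfl⟩ := List.mem_map.1 hz
          exact hB' _
        simp only [add_mul] at c1 c2 c3 c4 c5 ⊢
        omega
      · intro x
        by_cases hx : x = -2
        · rw [hx, hnew2, ← h2]
          exact hB' _
        · have h5 := hbdd (k + 1) hk (Function.update (receive m
            (r.H' + k * ((r.cap + 1 : ℕ) : ℤ)) r.cap (r.as k)) (-2) (k + 1)) (by simp)
            (fun x hx => by rw [Function.update_of_ne hx, hnew x hx]) x
          rwa [Function.update_of_ne hx] at h5
      · rw [Function.update_of_ne hx, hnew x hx])
  refine ⟨m', fun x h2 h3 h9 => ?_, a3.mono ?_, hbdd _ le_rfl m' a1 a2⟩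
  · rw [a2 x h2]
    split_ifs with h4 h5 h5
    · rfl
    · rw [(hreg x).2 h4.1] at h5
      exact absurd List.mem_cons_self h5
    · by_cases h6 : (r.H' : ℤ) ≤ x
      · have h7 : r.H ≤ r.H' := Nat.le_add_right _ _
        rw [hzero x h6, full, if_neg (by omega), if_neg (by omega), if_neg (by omega),
          if_neg (by omega), if_neg]
        push_cast at h4
        omega
      · rw [hK x h2 h3 h9, if_pos]
        rw [List.mem_cons, hreg] at h5
        exact h5.resolve_left h6
    · rw [hK x h2 h3 h9, if_neg fun h6 => h5 (List.mem_cons_of_mem _ h6)]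
  · have h1 : (r.K * r.N + 1) * (r.n * r.n + 4) ≤ r.X := by
      unfold X
      have e1 : r.K * r.N + 1 ≤ (r.K + 1) * (r.N + 1) := by
        have : (r.K + 1) * (r.N + 1) = r.K * r.N + r.K + r.N + 1 := by ring
        omega
      have e2 : r.n * r.n + 4 ≤ (r.n + 2) ^ 5 := by
        have : (r.n + 2) ^ 2 ≤ (r.n + 2) ^ 5 := Nat.pow_le_pow_right (by omega) (by omega)
        nlinarith
      have := Nat.mul_le_mul e1 e2
      omega
    have h2 : r.K * r.N + 1 ≤ r.X := le_trans (Nat.le_mul_of_pos_right _ (by omega)) h1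
    generalize (FamilyCode.H + pE / P.N * (FamilyCode.nn + 4)).costFactor +
      (FamilyCode.nn + 4).costFactor + (P.H' + pE * (FamilyCode.cap + 1)).costFactor +
      FamilyCode.cap.costFactor = a
    have e : (r.K * r.N + 1) * ((a + (r.n * r.n + 4) + 2) * (w * B) +
        forFactor (-2) (P.K * P.N) * (w * B)) =
        (r.K * r.N + 1) * (r.n * r.n + 4) * (w * B) +
        (r.K * r.N + 1) * ((a + 2 + forFactor (-2) (P.K * P.N)) * (w * B)) := by ring
    rw [e]
    refine (Nat.add_le_add (Nat.mul_le_mul_right _ h1) (Nat.mul_le_mul_right _ h2)).trans_eq ?_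
    ring

/-- The verdict of the tests. -/
def bad (r : RunData) : ℤ :=
  ∑ s ∈ Finset.range (r.K * r.N), r.badLength s +
  ∑ p ∈ Finset.range (r.K * (r.n * r.n)),
      r.badMoment (p / (r.n * r.n)) (p / r.n % r.n) (p % r.n) +
  ∑ i ∈ Finset.range r.K, r.badDist i

theorem triple_verdictProg (P : FamilyCode) (R : List ℕ)
    (hin : 26 ∈ R ∧ 27 ∈ R ∧ 28 ∈ R) :
    Triple P FamilyCode.verdictProg (fun r m => r.Known R m)
      (fun r m => m (-1) = 1 - if r.bad = 0 then 1 else 0) (fun _ => []) := by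
  refine ⟨(Expr.const (-1)).costFactor + (1 - Expr.eqInd (Expr.load (Expr.const (-6)) +
    Expr.load (Expr.const (-7)) + Expr.load (Expr.const (-8))) 0).costFactor + 1,
    1 + (1 - Expr.eqInd (Expr.load (Expr.const (-6)) +
    Expr.load (Expr.const (-7)) + Expr.load (Expr.const (-8))) 0).growth,
    fun r m B hP hB hβ hm hK => ?_⟩
  refine ⟨_, ?_, (runs_store _ _ _).mono ?_, ?_⟩
  · have h6 : m (-6) = r.full (-6) := by
      rw [hK (-6) (by decide) (by decide) (by decide), if_pos (by simpa [region] using hin.1)]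
    have h7 : m (-7) = r.full (-7) := by
      rw [hK (-7) (by decide) (by decide) (by decide), if_pos (by simpa [region] using hin.2.1)]
    have h8 : m (-8) = r.full (-8) := by
      rw [hK (-8) (by decide) (by decide) (by decide), if_pos (by simpa [region] using hin.2.2)]
    have h9 : r.full (-6) + r.full (-7) + r.full (-8) = r.bad := by simp [full, bad]
    change Function.update m (-1) _ (-1) = _
    rw [Function.update_self, Expr.eval_sub, Expr.eval_eqInd]
    simp only [Expr.eval_add, Expr.eval_load, Expr.eval_const, h6, h7, h8, h9, Expr.eval_ofNat]
    simp
  · have c1 := Expr.cost_le hB hm (Expr.const (-1))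
    have c2 := Expr.cost_le hB hm (1 - Expr.eqInd (Expr.load (Expr.const (-6)) +
      Expr.load (Expr.const (-7)) + Expr.load (Expr.const (-8))) 0)
    refine le_trans ?_ (Nat.le_mul_of_pos_left _ r.one_le_X)
    rw [add_mul, add_mul]
    omega
  · rw [add_mul]
    exact (hm.mono (by omega)).update ((Expr.bitLen_eval_le hB hm _).trans (by omega))

end RunData

/-! ### Correctness of the loop of Faddeev and LeVerrier -/

theorem sum_range_mul_eq (a b : ℕ) (f : ℕ → ℤ) :
    ∑ p ∈ Finset.range (a * b), f p =
      ∑ q ∈ Finset.range a, ∑ l ∈ Finset.range b, f (q * b + l) := by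
  induction a with
  | zero => simp
  | succ a ih => rw [add_mul, one_mul, Finset.sum_range_add, ih, Finset.sum_range_succ]

theorem entry_coe {n : ℕ} (A : Matrix (Fin n) (Fin n) ℤ) (i j : Fin n) : entry A i j = A i j := by
  simp [entry]

theorem entry_mul_add {n : ℕ} (A M : Matrix (Fin n) (Fin n) ℤ) (c : ℤ) {i j : ℕ} (hi : i < n)
    (hj : j < n) : entry (A * M + c • 1) i j =
      ∑ l ∈ Finset.range n, entry A i l * entry M l j + if i = j then c else 0 := by
  rw [Finset.sum_range]
  lift i to Fin n using hi
  lift j to Fin n using hj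
  simp only [entry_coe, Matrix.add_apply, Matrix.mul_apply, Matrix.smul_apply, Matrix.one_apply,
    Fin.val_inj, smul_eq_mul, mul_ite, mul_one, mul_zero]

theorem trace_mul_eq {n : ℕ} (A M : Matrix (Fin n) (Fin n) ℤ) :
    (A * M).trace = ∑ p ∈ Finset.range (n * n), entry A (p / n) (p % n) * entry M (p % n) (p / n) := by
  rw [sum_range_mul_eq, Finset.sum_range, Matrix.trace]
  refine Finset.sum_congr rfl fun i _ => ?_
  rw [Finset.sum_range, Matrix.diag_apply, Matrix.mul_apply]
  refine Finset.sum_congr rfl fun l _ => ?_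
  obtain ⟨h1, h2⟩ := mul_add_div_mod i l.2
  rw [h1, h2, entry_coe, entry_coe]

theorem arr_inj {i q i' q' : ℕ} (hi : i < 16) (hi' : i' < 16) (h : arr i q = arr i' q') :
    i = i' ∧ q = q' := by
  unfold arr at h
  omega

namespace RunData

/-- The contents of the first three arrays after `k` steps of the algorithm. -/
def partialArrays (r : RunData) (k : ℕ) : ℕ → ℕ → ℤ
  | 0, q => if q < (k + 1) * (r.n * r.n) then
      entry (leverrier r.A (q / (r.n * r.n))).1 (q / r.n % r.n) (q % r.n) else 0
  | 1, q => if q < k + 1 then (leverrier r.A q).2 else 0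
  | 2, q => if q < k + 1 then (r.A * (leverrier r.A q).1).trace else 0
  | _, _ => 0

/-- The first three arrays contain the results of `k` steps. -/
def Partial (r : RunData) (k : ℕ) (m : ℤ → ℤ) : Prop :=
  (∀ i < 3, ∀ q, m (arr i q) = r.partialArrays k i q) ∧
    ∀ x, x ≠ -2 → x ≠ -3 → x ≠ -9 → (∀ i < 3, ∀ q, x ≠ arr i q) →
      m x = if r.region x = 16 then r.full x else 0

theorem Partial.sees {r : RunData} {k : ℕ} {m m' : ℤ → ℤ} (h : r.Partial k m)
    (hm' : ∀ x, 0 ≤ x → m' x = m x) : r.Sees [16] m' := by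
  intro x hx
  rw [List.mem_singleton] at hx
  have h1 : 0 ≤ x := by
    unfold region at hx
    split_ifs at hx <;> omega
  rw [hm' x h1, h.2 x (by omega) (by omega) (by omega) (fun i hi q => by unfold arr; omega),
    if_pos hx]

theorem abs_entry_le {n : ℕ} {A : Matrix (Fin n) (Fin n) ℤ} {U : ℤ} (hU : 0 ≤ U)
    (h : ∀ i j, |A i j| ≤ U) (i j : ℕ) : |entry A i j| ≤ U := by
  unfold entry
  split_ifs
  · exact h _ _
  · simpa

/-- This is the only loop around other loops. A constant factor in bit length for each of the `n`
rounds would be exponential, so an a priori bound for all intermediate results is needed. -/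
theorem abs_partialArrays_le {P : FamilyCode} {r : RunData} (hP : r.Valid P) {k : ℕ} (hk : k ≤ r.n)
    (i q : ℕ) : bitLen (r.partialArrays k i q) ≤ r.beta := by
  have hX : 1 ≤ r.maxEntry := by
    have : 0 ≤ ∑ i, ∑ j, |r.A i j| := by positivity
    unfold maxEntry
    omega
  have hA : ∀ i j, |r.A i j| ≤ r.maxEntry := by
    intro i j
    have h1 : |r.A i j| ≤ ∑ j, |r.A i j| :=
      Finset.single_le_sum (f := fun j => |r.A i j|) (fun _ _ => abs_nonneg _) (Finset.mem_univ j)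
    have h2 : ∑ j, |r.A i j| ≤ ∑ i, ∑ j, |r.A i j| :=
      Finset.single_le_sum (f := fun i => ∑ j, |r.A i j|) (fun _ _ => by positivity)
        (Finset.mem_univ i)
    unfold maxEntry
    omega
  set U := 2 * (r.n : ℤ) ^ 3 * r.maxEntry ^ 2 with hU
  have hn : (1 : ℤ) ≤ r.n := by exact_mod_cast hP.n_pos
  have hU1 : 1 ≤ U := by nlinarith [one_le_pow₀ hn (n := 3), one_le_pow₀ hX (n := 2)]
  have hpow : ∀ l ≤ r.n, U ^ l ≤ U ^ r.n := fun l hl => pow_le_pow_right₀ hU1 hl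
  have h0 : 0 ≤ U ^ r.n := by positivity
  have key : |r.partialArrays k i q| ≤ U ^ r.n := by
    unfold partialArrays
    split
    · split_ifs with h
      · have h1 : q / (r.n * r.n) < k + 1 := Nat.div_lt_of_lt_mul (by rwa [mul_comm])
        exact abs_entry_le h0 (fun i j => ((abs_leverrier_le r.A hX hA hP.n_pos _).1 i j).trans
          (hpow _ (by omega))) _ _
      · simpa
    · split_ifs with h
      · exact (abs_leverrier_le r.A hX hA hP.n_pos _).2.1.trans (hpow _ (by omega))
      · simpa
    · split_ifs with h
      · exact (abs_leverrier_le r.A hX hA hP.n_pos _).2.2.trans (hpow _ (by omega))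
      · simpa
    · simpa
  refine (bitLen_le_of_natAbs_le (z := U ^ r.n) ?_).trans ?_
  · zify
    rwa [abs_of_nonneg h0]
  · unfold beta
    rw [← hU]
    omega

/-- One round of the algorithm. The cells `-2`, `-3` and `-9` are not covered by `Partial`; their
values are recorded because the bit bound at the start of the next round concerns every cell. -/
theorem exists_runs_leverrierBody : ∃ κ w : ℕ, ∀ (P : FamilyCode) (r : RunData) (k B : ℕ)
    (m : ℤ → ℤ), r.Valid P → 1 ≤ B → Bdd B m → k < r.n → m (-3) = k → r.Partial k m →
    ∃ m', Runs FamilyCode.leverrierBody m [] m' ((r.n * r.n * r.n + 1) * (κ * B)) ∧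
      Bdd (w * B) m' ∧ m' (-3) = k ∧ m' (-2) = ((r.n * r.n : ℕ) : ℤ) ∧
      m' (-9) = m (-9) ∧ r.Partial (k + 1) m' := by
  obtain ⟨κ₁, w₁, H₁⟩ := exists_runs_accumProg (-2) (FamilyCode.nn * nE)
    (arrE 0 ((kE + 1) * FamilyCode.nn + pE / nE)) (FamilyCode.A (pE / nE / nE) (pE % nE) *
        Expr.load (arrE 0 (kE * FamilyCode.nn + (pE % nE * nE + pE / nE % nE))))
  obtain ⟨κ₂, w₂, H₂⟩ := exists_runs_accumProg (-2) nE
    (arrE 0 ((kE + 1) * FamilyCode.nn + (pE * nE + pE))) (Expr.load (arrE 1 kE))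
  obtain ⟨κ₃, w₃, H₃⟩ := exists_runs_accumProg (-2) FamilyCode.nn (arrE 2 (kE + 1))
    (FamilyCode.A (pE / nE) (pE % nE) *
        Expr.load (arrE 0 ((kE + 1) * FamilyCode.nn + (pE % nE * nE + pE / nE))))
  set vE := (0 - Expr.load (arrE 2 (kE + 1))) / (kE + 1) with hvE
  refine ⟨κ₁ + κ₂ * w₁ + κ₃ * (w₂ * w₁) +
    ((arrE 1 (kE + 1)).costFactor + vE.costFactor) * (w₃ * w₂ * w₁) + 10,
    (vE.growth + 1) * (w₃ * w₂ * w₁), fun P r k B m hP hB hm hk hk3 hpart => ?_⟩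
  have hn0 := hP.n_pos
  have harr0 := hpart.1 0 (by omega)
  have harr1 := hpart.1 1 (by omega)
  have harr2 := hpart.1 2 (by omega)
  have pos_w : ∀ {w B : ℕ} {m : ℤ → ℤ}, Bdd (w * B) m → 1 ≤ w * B := fun h =>
    (one_le_bitLen _).trans (h 0)
  -- the product of the matrices
  obtain ⟨m₁, a1, a2, a3, a4, -⟩ := H₁ m (r.n * r.n) r.n B
    (fun q => arr 0 ((k + 1) * (r.n * r.n) + q))
    (fun p => entry r.A (p / r.n / r.n) (p % r.n) *
      entry (leverrier r.A k).1 (p % r.n) (p / r.n % r.n)) hB hm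
    (fun q _ => by unfold arr; omega)
    (fun q _ q' _ h => by have := (arr_inj (by omega) (by omega) h).2; omega)
    (fun m' hm' => by
      have hs := hpart.sees (m' := m') fun x hx => hm' x (by omega) fun q _ => by unfold arr; omega
      simp [hs.n hP (by simp), hs.nn hP (by simp)])
    (fun p hp m' hv hm' => by
      have hs := hpart.sees (m' := m') fun x hx => hm' x (by omega) fun q _ => by unfold arr; omega
      have hn := hs.n hP (by simp)
      have hnn := hs.nn hP (by simp)
      have hp' : pE.eval m' = p := hv
      have hk' : kE.eval m' = k := by
        rw [← hk3]
        exact hm' (-3) (by decide) fun q _ => by unfold arr; omega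
      have hi : p / r.n / r.n < r.n := Nat.div_lt_of_lt_mul (Nat.div_lt_of_lt_mul
        (by convert hp using 1; ring))
      have hj : p / r.n % r.n < r.n := Nat.mod_lt _ hn0
      have hl : p % r.n < r.n := Nat.mod_lt _ hn0
      refine ⟨eval_arrE (by simp [hk', hnn, hp', hn]) 0, ?_⟩
      rw [Expr.eval_mul, hs.A hP (by simp) (i := p / r.n / r.n) (j := p % r.n)
        (by simp [hp', hn]) (by simp [hp', hn]) hi hl, Expr.eval_load,
        eval_arrE (q := k * (r.n * r.n) + (p % r.n * r.n + p / r.n % r.n))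
        (by simp [hk', hnn, hp', hn])]
      have h1 := entry_index_lt hl hj
      have h2 : k * (r.n * r.n) + (p % r.n * r.n + p / r.n % r.n) < (k + 1) * (r.n * r.n) := by
        rw [add_mul]; omega
      rw [hm' _ (by unfold arr; omega) fun q _ h => by
        have := (arr_inj (by omega) (by omega) h).2
        rw [← this] at h2
        omega, harr0]
      obtain ⟨d1, d2, d3⟩ := digits k hl hj
      simp only [partialArrays, if_pos h2, d1, d2, d3])
  have b1 : ∀ i q, i < 3 → (i = 0 → q < (k + 1) * (r.n * r.n) ∨ (k + 2) * (r.n * r.n) ≤ q) →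
      m₁ (arr i q) = r.partialArrays k i q := by
    intro i q hi h
    rw [a4 _ (by unfold arr; omega) fun q' hq' h' => ?_, hpart.1 i hi]
    obtain ⟨e1, e2⟩ := arr_inj (by omega) (by omega) h'
    rcases h e1.symm with h3 | h3
    · omega
    · have : (k + 2) * (r.n * r.n) = (k + 1) * (r.n * r.n) + r.n * r.n := by ring
      omega
  have b2 : ∀ i < r.n, ∀ j < r.n, m₁ (arr 0 ((k + 1) * (r.n * r.n) + (i * r.n + j))) =
      ∑ l ∈ Finset.range r.n, entry r.A i l * entry (leverrier r.A k).1 l j := by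
    intro i hi j hj
    rw [a3 _ (entry_index_lt hi hj), harr0]
    simp only [partialArrays]
    rw [if_neg (by omega), zero_add]
    refine Finset.sum_congr rfl fun l hl => ?_
    obtain ⟨d1, d2⟩ := mul_add_div_mod (i * r.n + j) (Finset.mem_range.1 hl)
    obtain ⟨d3, d4⟩ := mul_add_div_mod i hj
    rw [d1, d2, d3, d4]
  have c1 : ∀ x, x ≠ -2 → (∀ q, x ≠ arr 0 q) → m₁ x = m x := fun x hx hq =>
    a4 x hx fun q _ h => hq _ h.symm
  -- the multiple of the identity matrix
  obtain ⟨m₂, a5, a6, a7, a8, -⟩ := H₂ m₁ r.n 1 (w₁ * B)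
    (fun q => arr 0 ((k + 1) * (r.n * r.n) + (q * r.n + q)))
    (fun _ => (leverrier r.A k).2) (pos_w a2) a2
    (fun q _ => by unfold arr; omega)
    (fun q hq q' hq' h => by
      have h1 := (arr_inj (by omega) (by omega) h).2
      have h2 := (mul_add_div_mod q hq).2
      have h3 := (mul_add_div_mod q' hq').2
      rw [← h2, ← h3]
      congr 1
      omega)
    (fun m' hm' => by
      have hs := hpart.sees (m' := m') fun x hx =>
        (hm' x (by omega) fun q _ => by unfold arr; omega).trans
        (c1 x (by omega) fun q => by unfold arr; omega)
      simp [hs.n hP (by simp)])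
    (fun p hp m' hv hm' => by
      have hs := hpart.sees (m' := m') fun x hx =>
        (hm' x (by omega) fun q _ => by unfold arr; omega).trans
        (c1 x (by omega) fun q => by unfold arr; omega)
      have hn := hs.n hP (by simp)
      have hnn := hs.nn hP (by simp)
      have hp' : pE.eval m' = p := hv
      have hk' : kE.eval m' = k := by
        rw [← hk3, ← c1 (-3) (by decide) fun q => by unfold arr; omega]
        exact hm' (-3) (by decide) fun q _ => by unfold arr; omega
      refine ⟨eval_arrE (by simp [hk', hnn, hp', hn]) 0, ?_⟩
      rw [Expr.eval_load, eval_arrE hk', hm' _ (by unfold arr; omega)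
        (fun q _ h => by have := (arr_inj (by omega) (by omega) h).1; omega),
        b1 1 k (by omega) (by omega)]
      simp [partialArrays])
  have b3 : ∀ i q, i < 3 → (i = 0 → q < (k + 1) * (r.n * r.n) ∨ (k + 2) * (r.n * r.n) ≤ q) →
      m₂ (arr i q) = r.partialArrays k i q := by
    intro i q hi h
    rw [a8 _ (by unfold arr; omega) fun q' hq' h' => ?_, b1 i q hi h]
    obtain ⟨e1, e2⟩ := arr_inj (by omega) (by omega) h'
    have h4 := entry_index_lt hq' hq'
    rcases h e1.symm with h3 | h3
    · omega
    · have : (k + 2) * (r.n * r.n) = (k + 1) * (r.n * r.n) + r.n * r.n := by ring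
      omega
  have b4 : ∀ i < r.n, ∀ j < r.n, m₂ (arr 0 ((k + 1) * (r.n * r.n) + (i * r.n + j))) =
      entry (leverrier r.A (k + 1)).1 i j := by
    intro i hi j hj
    rw [leverrier]
    simp only
    rw [entry_mul_add _ _ _ hi hj]
    by_cases hij : i = j
    · subst hij
      rw [a7 i hi, b2 i hi i hi, if_pos rfl, Finset.sum_range_one]
    · rw [a8 _ (by unfold arr; omega) fun q' hq' h' => ?_, b2 i hi j hj, if_neg hij, add_zero]
      have h1 := (arr_inj (by omega) (by omega) h').2
      have h2 := mul_add_div_mod i hj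
      have h3 := mul_add_div_mod q' hq'
      have h4 : q' * r.n + q' = i * r.n + j := by omega
      rw [h4] at h3
      omega
  have c2 : ∀ x, x ≠ -2 → (∀ q, x ≠ arr 0 q) → m₂ x = m x := fun x hx hq =>
    (a8 x hx fun q _ h => hq _ h.symm).trans (c1 x hx hq)
  -- the trace
  obtain ⟨m₃, a9, a10, a11, a12, a13⟩ := H₃ m₂ 1 (r.n * r.n) (w₂ * (w₁ * B))
    (fun _ => arr 2 (k + 1))
    (fun p => entry r.A (p / r.n) (p % r.n) *
      entry (leverrier r.A (k + 1)).1 (p % r.n) (p / r.n)) (pos_w a6) a6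
    (fun q _ => by unfold arr; omega)
    (fun q hq q' hq' _ => by omega)
    (fun m' hm' => by
      have hs := hpart.sees (m' := m') fun x hx =>
        (hm' x (by omega) fun q _ => by unfold arr; omega).trans
        (c2 x (by omega) fun q => by unfold arr; omega)
      simp [hs.nn hP (by simp)])
    (fun p hp m' hv hm' => by
      have hs := hpart.sees (m' := m') fun x hx =>
        (hm' x (by omega) fun q _ => by unfold arr; omega).trans
        (c2 x (by omega) fun q => by unfold arr; omega)
      have hn := hs.n hP (by simp)
      have hnn := hs.nn hP (by simp)
      have hp' : pE.eval m' = p := hv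
      have hk' : kE.eval m' = k := by
        rw [← hk3, ← c2 (-3) (by decide) fun q => by unfold arr; omega]
        exact hm' (-3) (by decide) fun q _ => by unfold arr; omega
      have hi : p / r.n < r.n := Nat.div_lt_of_lt_mul (by rwa [one_mul] at hp)
      have hl : p % r.n < r.n := Nat.mod_lt _ hn0
      refine ⟨eval_arrE (by simp [hk']) 2, ?_⟩
      rw [Expr.eval_mul, hs.A hP (by simp) (i := p / r.n) (j := p % r.n)
        (by simp [hp', hn]) (by simp [hp', hn]) hi hl, Expr.eval_load,
        eval_arrE (q := (k + 1) * (r.n * r.n) + (p % r.n * r.n + p / r.n))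
        (by simp [hk', hnn, hp', hn]), hm' _ (by unfold arr; omega)
        (fun q _ h => by have := (arr_inj (by omega) (by omega) h).1; omega), b4 _ hl _ hi])
  have b5 : m₃ (arr 2 (k + 1)) = (r.A * (leverrier r.A (k + 1)).1).trace := by
    rw [a11 0 one_pos, b3 2 (k + 1) (by omega) (by omega), trace_mul_eq]
    simp [partialArrays]
  have c3 : ∀ x, x ≠ -2 → x ≠ arr 2 (k + 1) → m₃ x = m₂ x := fun x hx h =>
    a12 x hx fun q _ h' => h h'.symm
  have hk₃ : kE.eval m₃ = k := by
    change m₃ (-3) = k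
    rw [c3 (-3) (by decide) (by unfold arr; omega), c2 (-3) (by decide)
      (fun q => by unfold arr; omega), hk3]
  have a14 := runs_store (arrE 1 (kE + 1)) vE m₃
  have e1 : (arrE 1 (kE + 1)).eval m₃ = arr 1 (k + 1) := eval_arrE (by simp [hk₃]) 1
  have e2 : vE.eval m₃ = (leverrier r.A (k + 1)).2 := by
    rw [hvE, Expr.eval_div, Expr.eval_sub, Expr.eval_load, eval_arrE (q := k + 1)
      (by simp [hk₃]), b5]
    simp [hk₃, leverrier]
  have hB3 : 1 ≤ w₃ * (w₂ * (w₁ * B)) := pos_w a10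
  have hval := Expr.bitLen_eval_le hB3 a10 vE
  have hcost := Nat.add_le_add (Expr.cost_le hB3 a10 (arrE 1 (kE + 1)))
    (Expr.cost_le hB3 a10 vE)
  rw [e1] at a14
  refine ⟨_, (a1.seq (a5.seq (a9.seq a14))).mono ?_, ?_, ?_, ?_, ?_, ?_, ?_⟩
  · rw [← add_mul] at hcost
    set Z := r.n * r.n * r.n + 1 with hZ
    have z1 : r.n * 1 + 1 ≤ Z := by
      have : r.n * 1 ≤ r.n * (r.n * r.n) := Nat.mul_le_mul_left _ (Nat.mul_pos hn0 hn0)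
      rw [hZ, mul_assoc]
      omega
    have z2 : 1 * (r.n * r.n) + 1 ≤ Z := by
      have : r.n * r.n * 1 ≤ r.n * r.n * r.n := Nat.mul_le_mul_left _ hn0
      omega
    have z3 : 1 ≤ Z := by omega
    have y2 := Nat.mul_le_mul_right (κ₂ * (w₁ * B)) z1
    have y3 := Nat.mul_le_mul_right (κ₃ * (w₂ * (w₁ * B))) z2
    have y4 := Nat.mul_le_mul_right (((arrE 1 (kE + 1)).costFactor + vE.costFactor) *
      (w₃ * (w₂ * (w₁ * B)))) z3
    have y5 := Nat.mul_le_mul z3 hB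
    have e : Z * ((κ₁ + κ₂ * w₁ + κ₃ * (w₂ * w₁) +
        ((arrE 1 (kE + 1)).costFactor + vE.costFactor) * (w₃ * w₂ * w₁) + 10) * B) =
        Z * (κ₁ * B) + Z * (κ₂ * (w₁ * B)) + Z * (κ₃ * (w₂ * (w₁ * B))) +
        Z * (((arrE 1 (kE + 1)).costFactor + vE.costFactor) * (w₃ * (w₂ * (w₁ * B)))) +
        10 * (Z * B) := by ring
    rw [e]
    omega
  · have e : (vE.growth + 1) * (w₃ * w₂ * w₁) * B =
      vE.growth * (w₃ * (w₂ * (w₁ * B))) + w₃ * (w₂ * (w₁ * B)) := by ring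
    rw [e]
    exact (a10.mono (by omega)).update (hval.trans (by omega))
  · rw [Function.update_of_ne (by unfold arr; omega)]
    exact hk₃
  · rw [Function.update_of_ne (by unfold arr; omega), a13, one_mul]
  · rw [Function.update_of_ne (by unfold arr; omega), c3 (-9) (by decide) (by unfold arr; omega),
      c2 (-9) (by decide) (fun q => by unfold arr; omega)]
  · have old : ∀ i q, i < 3 → (i = 0 → q < (k + 1) * (r.n * r.n) ∨ (k + 2) * (r.n * r.n) ≤ q) →
        (i ≠ 0 → q ≠ k + 1) →
        Function.update m₃ (arr 1 (k + 1)) (vE.eval m₃) (arr i q) = r.partialArrays k i q := by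
      intro i q hi h0 h1
      rw [Function.update_of_ne, c3 _ (by unfold arr; omega), b3 i q hi h0]
      · intro h
        have := arr_inj (by omega) (by omega) h
        omega
      · intro h
        have := arr_inj (by omega) (by omega) h
        omega
    have e12 : (k + 1 + 1) * (r.n * r.n) = (k + 1) * (r.n * r.n) + r.n * r.n := by ring
    have e13 : (k + 2) * (r.n * r.n) = (k + 1) * (r.n * r.n) + r.n * r.n := by ring
    intro i hi q
    obtain rfl | rfl | rfl : i = 0 ∨ i = 1 ∨ i = 2 := by omega
    · by_cases h1 : q < (k + 1) * (r.n * r.n)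
      · rw [old 0 q hi (fun _ => Or.inl h1) (by omega)]
        simp only [partialArrays]
        rw [if_pos h1, if_pos (by omega)]
      by_cases h2 : (k + 2) * (r.n * r.n) ≤ q
      · rw [old 0 q hi (fun _ => Or.inr h2) (by omega)]
        simp only [partialArrays]
        rw [if_neg h1, if_neg (by omega)]
      · obtain ⟨x, rfl⟩ := Nat.exists_eq_add_of_le (not_lt.1 h1)
        have hx : x < r.n * r.n := by
          have : (k + 2) * (r.n * r.n) = (k + 1) * (r.n * r.n) + r.n * r.n := by ring
          omega
        have hxi : x / r.n < r.n := Nat.div_lt_of_lt_mul hx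
        have hxj : x % r.n < r.n := Nat.mod_lt _ hn0
        have hxe : x = x / r.n * r.n + x % r.n := by
          rw [mul_comm]; exact (Nat.div_add_mod x r.n).symm
        have h3 := b4 _ hxi _ hxj
        obtain ⟨d1, d2, d3⟩ := digits (k + 1) hxi hxj
        rw [← hxe] at h3 d1 d2 d3
        rw [Function.update_of_ne (fun h => by have := arr_inj (by omega) (by omega) h; omega),
          c3 _ (by unfold arr; omega) (fun h => by
            have := arr_inj (by omega) (by omega) h; omega), h3]
        simp only [partialArrays, d1, d2, d3]
        rw [if_pos (by omega)]
    · by_cases h1 : q = k + 1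
      · subst h1
        rw [Function.update_self, e2]
        simp [partialArrays]
      · rw [old 1 q hi (by omega) (fun _ => h1)]
        simp only [partialArrays]
        split_ifs <;> first | rfl | omega
    · by_cases h1 : q = k + 1
      · subst h1
        rw [Function.update_of_ne (fun h => by have := arr_inj (by omega) (by omega) h; omega), b5]
        simp [partialArrays]
      · rw [old 2 q hi (by omega) (fun _ => h1)]
        simp only [partialArrays]
        split_ifs <;> first | rfl | omega
  · intro x h2 h3 h9 hx
    rw [Function.update_of_ne (hx 1 (by omega) _), c3 x h2 (hx 2 (by omega) _),
      c2 x h2 (hx 0 (by omega)), hpart.2 x h2 h3 h9 hx]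

/-- After every round the weak bound `w B` from the round is discarded, and the bound `B` is
restored from the explicit contents of the memory and from `beta ≤ B`. -/
theorem triple_leverrierProg (P : FamilyCode) :
    Triple P FamilyCode.leverrierProg (fun r m => r.Known [16] m)
      (fun r m => r.Known [0, 1, 2, 16] m) (fun _ => []) := by
  obtain ⟨κ, w, H⟩ := exists_runs_leverrierBody
  refine ⟨(κ + forFactor (-3) nE) * (w + 2) + 200, w + 2, fun r m₀ B hP hB hβ hm₀ hK => ?_⟩
  have hn0 := hP.n_pos
  have hsmall : ∀ x : ℕ, x ≤ r.n ^ 3 → bitLen x ≤ B := by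
    intro x hx
    refine (bitLen_le_of_natAbs_le (z := ((r.n ^ 3 : ℕ) : ℤ)) ?_).trans ?_
    · rwa [Int.natAbs_natCast, Int.natAbs_natCast]
    · unfold beta at hβ
      omega
  have hn3 : r.n * r.n ≤ r.n ^ 3 := by
    have : r.n * r.n * 1 ≤ r.n * r.n * r.n := Nat.mul_le_mul_left _ hn0
    calc _ = r.n * r.n * 1 := by ring
      _ ≤ _ := this
      _ = _ := by ring
  have hn1 : r.n ≤ r.n ^ 3 := (Nat.le_mul_of_pos_left _ hn0).trans hn3
  have s1 := runs_store (arrE 1 0) 1 m₀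
  have e1 : (arrE 1 0).eval m₀ = arr 1 0 := eval_arrE (by simp) 1
  have e2 : (1 : Expr).eval m₀ = 1 := by simp
  rw [e1, e2] at s1
  set m₁ := Function.update m₀ (arr 1 0) 1 with hm₁
  have hsees : ∀ k m, r.Partial k m → r.Sees [16] m := fun k m h => h.sees fun _ _ => rfl
  have hbdd : ∀ k ≤ r.n, ∀ m, r.Partial k m → m (-3) = k → bitLen (m (-2)) ≤ B →
      m (-9) = m₀ (-9) → Bdd B m := by
    intro k hk m h h3 h2 h9 x
    by_cases hx2 : x = -2
    · rwa [hx2]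
    by_cases hx3 : x = -3
    · rw [hx3, h3]
      exact hsmall k (by omega)
    by_cases hx9 : x = -9
    · rw [hx9, h9]
      exact hm₀ _
    by_cases hx : ∀ i < 3, ∀ q, x ≠ arr i q
    · rw [h.2 x hx2 hx3 hx9 hx]
      have h4 := hm₀ x
      rw [hK x hx2 hx3 hx9] at h4
      simpa using h4
    · push Not at hx
      obtain ⟨i, hi, q, rfl⟩ := hx
      rw [h.1 i hi q]
      exact (abs_partialArrays_le hP hk i q).trans hβ
  have hpart₁ : ∀ m : ℤ → ℤ, (∀ x, x ≠ -3 → m x = m₁ x) → r.Partial 0 m := by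
    intro m hm
    constructor
    · intro i hi q
      rw [hm _ (by unfold arr; omega), hm₁]
      by_cases h : arr i q = arr 1 0
      · obtain ⟨rfl, rfl⟩ := arr_inj (by omega) (by omega) h
        simp [partialArrays, leverrier]
      · rw [Function.update_of_ne h, hK _ (by unfold arr; omega) (by unfold arr; omega)
          (by unfold arr; omega), r.region_arr (by omega), if_neg (by simp; omega)]
        have hne : ¬ (i = 1 ∧ q = 0) := by rintro ⟨rfl, rfl⟩; exact h rfl
        obtain rfl | rfl | rfl : i = 0 ∨ i = 1 ∨ i = 2 := by omega
        · simp only [partialArrays]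
          split_ifs with hq
          · rw [Nat.div_eq_of_lt (by omega)]
            simp [leverrier, entry]
          · rfl
        · simp only [partialArrays]
          rw [if_neg (by omega)]
        · simp only [partialArrays]
          split_ifs with hq
          · obtain rfl : q = 0 := by omega
            simp [leverrier]
          · rfl
    · intro x h2 h3 h9 hx
      rw [hm x h3, hm₁, Function.update_of_ne (hx 1 (by omega) 0), hK x h2 h3 h9]
      simp
  have hwB : B ≤ (w + 2) * B := Nat.le_mul_of_pos_left _ (by omega)
  obtain ⟨m', ⟨r1, r2, r3, r4⟩, r5⟩ := runs_forProg (v := -3) (cnt := nE)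
    (body := FamilyCode.leverrierBody) (m := m₁) (N := r.n) (B := (w + 2) * B)
    (b := (r.n * r.n * r.n + 1) * (κ * B)) (by omega)
    (fun k m => r.Partial k m ∧ m (-3) = k ∧ bitLen (m (-2)) ≤ B ∧ m (-9) = m₀ (-9))
    (fun _ => [])
    (by
      refine ⟨hpart₁ _ fun x hx => Function.update_of_ne hx _ _, by simp, ?_, ?_⟩
      · rw [Function.update_of_ne (by decide), hm₁, Function.update_of_ne (by unfold arr; omega)]
        exact hm₀ _
      · rw [Function.update_of_ne (by decide), hm₁, Function.update_of_ne (by unfold arr; omega)])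
    (by
      rintro k hk m ⟨h1, h2, h3, h4⟩
      exact ⟨h2, (hsees k m h1).n hP (by simp), (hbdd k hk m h1 h2 h3 h4).mono hwB⟩)
    (by
      rintro k hk m ⟨h1, h2, h3, h4⟩
      obtain ⟨m', c1, c2, c3, c4, c6, c5⟩ := H P r k B m hP hB (hbdd k hk.le m h1 h2 h3 h4) hk h2 h1
      refine ⟨m', c1, c2.mono (Nat.mul_le_mul_right _ (by omega)), c3, ?_, by simp, ?_, ?_⟩
      · refine ⟨fun i hi q => ?_, fun x x2 x3 x9 hx => ?_⟩
        · rw [Function.update_of_ne (by unfold arr; omega), c5.1 i hi q]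
        · rw [Function.update_of_ne x3, c5.2 x x2 x3 x9 hx]
      · rw [Function.update_of_ne (by decide), c4]
        exact hsmall _ hn3
      · rw [Function.update_of_ne (by decide), c6, h4])
  have etrace : [] ++ (List.range r.n).flatMap (fun _ => ([] : Trace)) = [] := by simp
  refine ⟨m', fun x h2 h3 h9 => ?_, (etrace ▸ s1.seq r5).mono ?_, (hbdd _ le_rfl m' r1 r2 r3 r4).mono hwB⟩
  · by_cases hx : ∀ i < 3, ∀ q, x ≠ arr i q
    · rw [r1.2 x h2 h3 h9 hx]
      have : ∀ i < 3, r.region x ≠ i := fun i hi h => by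
        obtain ⟨q, hq⟩ := r.region_eq_arr (by omega) h
        exact hx i hi q hq
      simp [this 0, this 1, this 2]
    · push Not at hx
      obtain ⟨i, hi, q, rfl⟩ := hx
      rw [r1.1 i hi q, r.region_arr (by omega), r.full_arr (by omega)]
      obtain rfl | rfl | rfl : i = 0 ∨ i = 1 ∨ i = 2 := by omega
      all_goals simp [partialArrays, arrays]
  · have c1 := Expr.cost_le hB hm₀ (arrE 1 0)
    have c2 := Expr.cost_le hB hm₀ 1
    have d1 : (arrE 1 0).costFactor ≤ 100 := by decide
    have d2 : (1 : Expr).costFactor ≤ 10 := by decide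
    have d1' := Nat.mul_le_mul_right B d1
    have d2' := Nat.mul_le_mul_right B d2
    have hX : (r.n + 1) * (r.n * r.n * r.n + 1) ≤ r.X := by
      have h1 : (r.n + 2) ^ 5 ≤ r.X := by
        have : 1 * (r.n + 2) ^ 5 ≤ (r.K + 1) * (r.N + 1) * (r.n + 2) ^ 5 :=
          Nat.mul_le_mul_right _ (Nat.mul_pos (by omega) (by omega))
        unfold X
        omega
      refine le_trans ?_ h1
      calc _ ≤ (r.n + 2) * (r.n + 2) ^ 4 := Nat.mul_le_mul (by omega) (by ring_nf; omega)
        _ = _ := by ring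
    have hX1 : r.n + 1 ≤ r.X := (Nat.le_mul_of_pos_right _ (by omega)).trans hX
    have f1 := Nat.mul_le_mul_right (κ * B) hX
    have f2 := Nat.mul_le_mul_right (forFactor (-3) nE * ((w + 2) * B)) hX1
    have f3 : B ≤ r.X * B := Nat.le_mul_of_pos_left _ r.one_le_X
    have f4 : r.X * (κ * B) ≤ r.X * (κ * ((w + 2) * B)) :=
      Nat.mul_le_mul_left _ (Nat.mul_le_mul_left _ hwB)
    have e : r.X * (((κ + forFactor (-3) nE) * (w + 2) + 200) * B) = r.X * (κ * ((w + 2) * B)) +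
        r.X * (forFactor (-3) nE * ((w + 2) * B)) + 200 * (r.X * B) := by ring
    have e' : (r.n + 1) * ((r.n * r.n * r.n + 1) * (κ * B) + forFactor (-3) nE * ((w + 2) * B)) =
        (r.n + 1) * (r.n * r.n * r.n + 1) * (κ * B) +
        (r.n + 1) * (forFactor (-3) nE * ((w + 2) * B)) := by ring
    rw [e, e']
    omega

end RunData

/-! ### The whole program, and its acceptance probability in terms of the answers -/

namespace RunData

theorem triple_boundProg (P : FamilyCode) (R : List ℕ) (hR : 22 ∉ R ∧ 23 ∉ R ∧ 29 ∉ R)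
    (hin : 16 ∈ R) (h : 24 ∉ R ∧ 25 ∉ R) :
    Triple P P.boundProg (fun r m => r.Known R m) (fun r m => r.Known (25 :: 24 :: R) m)
      (fun _ => []) :=
  (triple_bound P R hR hin h.1).seq (triple_size P (24 :: R) (by simp) (by simp [h.2]))

theorem triple_prog (P : FamilyCode) :
    Triple P P.prog (fun r m => r.Known [16] m)
      (fun r m => m (-1) = 1 - if r.bad = 0 then 1 else 0) trace := by
  have H := (triple_leverrierProg P).seq <|
    (triple_bufProg P _ (by decide) (by decide) (by decide)).seq <|
    (triple_boundProg P _ (by decide) (by decide) (by decide)).seq <|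
    (triple_queryProg P _ (by decide) (by decide) (by decide)).seq <|
    (triple_sampleProg P _ (by decide) (by decide) (by decide)).seq <|
    (triple_momentProg P _ (by decide) (by decide) (by decide)).seq <|
    (triple_productProg P _ (by decide) (by decide) (by decide)).seq <|
    (triple_distProg P _ (by decide) (by decide) (by decide)).seq <|
    (triple_badLengthProg P _ (by decide) (by decide) (by decide)).seq <|
    (triple_badMomentProg P _ (by decide) (by decide) (by decide)).seq <|
    (triple_badDistProg P _ (by decide) (by decide) (by decide)).seq
    (triple_verdictProg P _ (by decide))
  have e : (fun r : RunData => r.trace) = trace := rfl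
  simp only [List.nil_append, List.append_nil, e] at H
  exact H

/-- The data of the run with the answers `as`. -/
def withAnswers (r : RunData) (as : List (List ℤ)) : RunData :=
  { r with as := fun s => as.getD s [] }

theorem Valid.withAnswers {P : FamilyCode} {r : RunData} (h : r.Valid P) (as : List (List ℤ)) :
    (r.withAnswers as).Valid P :=
  ⟨h.1, h.2, h.3, h.4, h.5, h.6, h.7⟩

/-- The list of all queries. -/
def queries (r : RunData) : List (List ℤ) :=
  (List.range (r.K * r.N)).map fun s => r.query (s / r.N)

theorem trace_withAnswers (r : RunData) {as : List (List ℤ)} (h : as.length = r.queries.length) :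
    (r.withAnswers as).trace = r.queries.zip as := by
  have hl : as.length = r.K * r.N := by simpa [queries] using h
  have e : (r.withAnswers as).trace = (List.range (r.K * r.N)).map fun s =>
      (r.query (s / r.N), as.getD s []) := List.flatMap_pure_eq_map _ _
  rw [e]
  apply List.ext_getElem
  · simp [queries, hl]
  · intro i h1 h2
    simp only [List.length_map, List.length_range] at h1
    have h3 : i < as.length := by rw [hl]; exact h1
    simp [queries, List.getElem?_eq_getElem h3]

end RunData

theorem writeList_eq_zero {l : List ℤ} {x : ℤ} (h : ¬ (0 ≤ x ∧ x < l.length)) :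
    writeList (fun _ => 0) 0 l x = 0 := by
  simp [writeList, h]

theorem bdd_writeList {l : List ℤ} (hl : l ≠ []) : Bdd (listSize l) (writeList (fun _ => 0) 0 l) := by
  intro x
  have h1 : 1 ≤ listSize l := (List.length_pos_iff.2 hl).trans_le (RunData.length_le_listSize l)
  unfold writeList
  split_ifs with h
  · rw [List.getD_eq_getElem _ _ (by omega)]
    exact RunData.bitLen_le_listSize (List.getElem_mem _)
  · exact h1

theorem toReal_toOuterMeasure_map {α β : Type*} (p : PMF α) (f : α → β) (s : Set β) :
    ((p.map f).toOuterMeasure s).toReal = (p.toOuterMeasure (f ⁻¹' s)).toReal := by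
  rw [PMF.toOuterMeasure_map_apply]

theorem length_of_mem_support_tape (O : Oracle) : ∀ (qs : List (List ℤ)) (as : List (List ℤ)),
    as ∈ (tape O qs).support → as.length = qs.length
  | [], as, h => by
    rw [tape, PMF.mem_support_pure_iff] at h
    simp [h]
  | q :: qs, as, h => by
    simp only [tape, PMF.mem_support_bind_iff, PMF.mem_support_map_iff] at h
    obtain ⟨a, -, as', h', rfl⟩ := h
    simp [length_of_mem_support_tape O qs as' h']

theorem toOuterMeasure_congr {α : Type*} (p : PMF α) {s t : Set α}
    (h : ∀ a ∈ p.support, a ∈ s ↔ a ∈ t) : p.toOuterMeasure s = p.toOuterMeasure t := by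
  apply PMF.toOuterMeasure_apply_eq_of_inter_support_eq
  ext a
  exact ⟨fun h' => ⟨(h a h'.2).1 h'.1, h'.2⟩, fun h' => ⟨(h a h'.2).2 h'.1, h'.2⟩⟩

/-- The program runs in time `X (κ B)`, and accepts exactly if the verdict is negative. -/
theorem exists_acceptProb_eq (P : FamilyCode) : ∃ κ : ℕ, ∀ (r : RunData) (input : List ℤ) (B : ℕ),
    r.Valid P → r.input = writeList (fun _ => 0) 0 input → input ≠ [] → input.length ≤ r.H →
    listSize input ≤ B → r.beta ≤ B → ∀ T, r.X * (κ * B) ≤ T → ∀ O : Oracle,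
    HaltsWithin P.prog O input T ∧ acceptProb P.prog O input T =
      ((tape O r.queries).toOuterMeasure {as | (r.withAnswers as).bad ≠ 0}).toReal := by
  obtain ⟨κ, w, H⟩ := RunData.triple_prog P
  refine ⟨κ, fun r input B hP hin hne hlen hsize hβ T hT O => ?_⟩
  have hB : 1 ≤ B :=
    (Nat.succ_le_of_lt (List.length_pos_iff.2 hne)).trans
      ((RunData.length_le_listSize input).trans hsize)
  have hrun : ∀ as : List (List ℤ), ∃ c : Config, as.length = r.queries.length →
      Exec (initial P.prog input) (r.queries.zip as) c ∧ c.todo = [] ∧ c.time ≤ 0 + T ∧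
      (c.mem (-1) = 1 ↔ (r.withAnswers as).bad ≠ 0) := by
    intro as
    by_cases hl : as.length = r.queries.length
    · obtain ⟨m', h1, h2, -⟩ := H (r.withAnswers as) (writeList (fun _ => 0) 0 input) B
        (hP.withAnswers as) hB hβ ((bdd_writeList hne).mono hsize) (by
          intro x h2 h3 h9
          have hH : (r.withAnswers as).H = r.H := rfl
          by_cases hx : 0 ≤ x ∧ x < r.H
          · have h16 : (r.withAnswers as).region x = 16 := by
              rw [RunData.region, if_neg (by omega), if_neg (by omega), if_pos (by omega)]
            rw [h16, if_pos (by simp), RunData.full, if_neg (by omega), if_neg (by omega),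
              if_pos (by omega), ← hin]
            rfl
          · have h16 : (r.withAnswers as).region x ≠ 16 := by
              unfold RunData.region
              split_ifs <;> omega
            rw [writeList_eq_zero (by omega), if_neg (by simpa using h16)])
      obtain ⟨t', h3, h4⟩ := h2 [] 0
      rw [r.trace_withAnswers hl] at h4
      refine ⟨⟨[], m', t'⟩, fun _ => ⟨h4, rfl, ?_, ?_⟩⟩
      · have : (r.withAnswers as).X = r.X := rfl
        rw [this] at h3
        simp only
        omega
      · simp only
        rw [h1]
        split_ifs with h5 <;> simp [h5]
    -- Lists of a wrong length are not in the support of the tape; any configuration may be assigned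
    -- to them.
    · exact ⟨initial P.prog input, fun h => absurd h hl⟩
  choose final hfinal using hrun
  have heq := run_eq_map_tape O T (initial P.prog input) r.queries final fun as has =>
    ⟨(hfinal as has).1, (hfinal as has).2.1, (hfinal as has).2.2.1⟩
  constructor
  · intro c hc
    rw [heq, PMF.mem_support_map_iff] at hc
    obtain ⟨as, has, rfl⟩ := hc
    obtain ⟨-, h1, h2, -⟩ := hfinal as (length_of_mem_support_tape O _ _ has)
    exact ⟨h1, by omega⟩
  · rw [acceptProb, heq, toReal_toOuterMeasure_map]
    congr 1
    refine toOuterMeasure_congr _ fun as has => ?_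
    obtain ⟨-, h1, -, h2⟩ := hfinal as (length_of_mem_support_tape O _ _ has)
    simp [h1, h2]

namespace RunData

theorem natAbs_entry_lt {n : ℕ} {A : Matrix (Fin n) (Fin n) ℤ} {M : ℕ} (hM : 0 < M)
    (h : ∀ i j, (A i j).natAbs < M) (i j : ℕ) : (entry A i j).natAbs < M := by
  unfold entry
  split_ifs
  · exact h _ _
  · simpa

theorem size_Y_le (r : RunData) {s c : ℕ} (hn : r.n ≤ s)
    (hA : ∀ i j, (r.A i j).natAbs < 2 ^ s) (hY : r.Y₀ < 2 ^ (c * s)) :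
    Nat.size r.Y ≤ (c + 4) * s := by
  rw [Nat.size_le]
  have h1 : r.n < 2 ^ s := hn.trans_lt Nat.lt_two_pow_self
  have h2 : r.Y ≤ ∑ _p ∈ Finset.range (r.n * r.n), (2 ^ s) ^ 2 * 2 ^ (c * s) := by
    refine Finset.sum_le_sum fun p _ => Nat.mul_le_mul (Nat.pow_le_pow_left
      (natAbs_entry_lt (by positivity) hA _ _).le _) hY.le
  rw [Finset.sum_const, Finset.card_range, smul_eq_mul] at h2
  calc r.Y ≤ r.n * r.n * ((2 ^ s) ^ 2 * 2 ^ (c * s)) := h2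
    _ < 2 ^ s * 2 ^ s * ((2 ^ s) ^ 2 * 2 ^ (c * s)) :=
      Nat.mul_lt_mul_of_pos_right (Nat.mul_lt_mul'' h1 h1) (by positivity)
    _ = _ := by ring

theorem bitLen_le_of_le_two_pow {z : ℤ} {k : ℕ} (h : z.natAbs ≤ 2 ^ k) : bitLen z ≤ k + 2 := by
  rw [bitLen_le_iff, pow_succ]
  have : 0 < 2 ^ k := by positivity
  omega

theorem bitLen_power_le (r : RunData) {s : ℕ} (hs : 1 ≤ s) (hn : r.n ≤ s)
    (hA : ∀ i j, (r.A i j).natAbs < 2 ^ s) :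
    bitLen ((2 * (r.n : ℤ) ^ 3 * r.maxEntry ^ 2) ^ r.n) ≤ 12 * s * s + 2 := by
  have h1 : (r.n : ℤ) ≤ 2 ^ s := by exact_mod_cast (hn.trans_lt Nat.lt_two_pow_self).le
  have h2 : (2 : ℤ) ≤ 2 ^ s := by
    calc (2 : ℤ) = 2 ^ 1 := by norm_num
      _ ≤ 2 ^ s := pow_le_pow_right₀ (by norm_num) hs
  have h0 : 0 ≤ r.maxEntry := by
    have : 0 ≤ ∑ i, ∑ j, |r.A i j| := by positivity
    unfold maxEntry
    omega
  have h3 : r.maxEntry ≤ 2 ^ (4 * s) := by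
    have h4 : ∑ i, ∑ j, |r.A i j| ≤ ∑ _i : Fin r.n, ∑ _j : Fin r.n, (2 : ℤ) ^ s := by
      refine Finset.sum_le_sum fun i _ => Finset.sum_le_sum fun j _ => ?_
      rw [Int.abs_eq_natAbs]
      exact_mod_cast (hA i j).le
    simp only [Finset.sum_const, Finset.card_univ, Fintype.card_fin, nsmul_eq_mul] at h4
    have h5 : (r.n : ℤ) * (r.n * 2 ^ s) ≤ 2 ^ s * (2 ^ s * 2 ^ s) := by gcongr
    have h6 : (2 : ℤ) * (2 ^ s * (2 ^ s * 2 ^ s)) ≤ 2 ^ s * (2 ^ s * (2 ^ s * 2 ^ s)) := by gcongr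
    have h7 : (1 : ℤ) ≤ 2 ^ s * (2 ^ s * 2 ^ s) := by
      have : (0 : ℤ) < 2 ^ s * (2 ^ s * 2 ^ s) := by positivity
      omega
    have h8 : (2 : ℤ) ^ (4 * s) = 2 ^ s * (2 ^ s * (2 ^ s * 2 ^ s)) := by ring
    unfold maxEntry
    omega
  have h4 : 2 * (r.n : ℤ) ^ 3 * r.maxEntry ^ 2 ≤ 2 ^ (12 * s) := by
    calc 2 * (r.n : ℤ) ^ 3 * r.maxEntry ^ 2 ≤ 2 ^ s * (2 ^ s) ^ 3 * (2 ^ (4 * s)) ^ 2 := by gcongr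
      _ = _ := by ring
  have h5 : (2 * (r.n : ℤ) ^ 3 * r.maxEntry ^ 2) ^ r.n ≤ 2 ^ (12 * s * s) := by
    calc _ ≤ ((2 : ℤ) ^ (12 * s)) ^ r.n := by gcongr
      _ ≤ ((2 : ℤ) ^ (12 * s)) ^ s := pow_le_pow_right₀ (one_le_pow₀ (by norm_num)) hn
      _ = _ := by rw [← pow_mul]
  have h6 : 0 ≤ (2 * (r.n : ℤ) ^ 3 * r.maxEntry ^ 2) ^ r.n := by positivity
  refine bitLen_le_of_le_two_pow ?_
  zify
  rwa [abs_of_nonneg h6]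

theorem X_le (r : RunData) {s c : ℕ} (hn : r.n ≤ s) (hK : r.K ≤ s)
    (hN : r.N ≤ c * s ^ 5) (hA : ∀ i j, (r.A i j).natAbs < 2 ^ s) (hY : r.Y₀ < 2 ^ (c * s)) :
    r.X ≤ (s + 1) * (c * s ^ 5 + 1) * (s + 2) ^ 5 + (c + 4) * s + 1 := by
  have := r.size_Y_le hn hA hY
  unfold X
  gcongr

theorem beta_le (r : RunData) {s c : ℕ} (hs : 1 ≤ s) (hn : r.n ≤ s)
    (hA : ∀ i j, (r.A i j).natAbs < 2 ^ s) (hY : r.Y₀ < 2 ^ (c * s)) :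
    r.beta ≤ (12 * s * s + 2) + s * ((c + 4) * s + 1) + (3 * s + 2) := by
  have h1 := r.size_Y_le hn hA hY
  have h2 := r.bitLen_power_le hs hn hA
  have h3 : bitLen ((r.n ^ 3 : ℕ) : ℤ) ≤ 3 * s + 2 := by
    refine bitLen_le_of_le_two_pow ?_
    rw [Int.natAbs_natCast, mul_comm, pow_mul]
    exact Nat.pow_le_pow_left (hn.trans_lt Nat.lt_two_pow_self).le _
  unfold beta cap
  gcongr

end RunData

/-- A family of instances with polynomial parameters is decided in polynomial time. -/
theorem exists_polynomial_acceptProb_eq (P : FamilyCode) (c : ℕ) {ι : Type*} (data : ι → RunData)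
    (input : ι → List ℤ) (hv : ∀ x, (data x).Valid P)
    (hin : ∀ x, (data x).input = writeList (fun _ => 0) 0 (input x))
    (hne : ∀ x, input x ≠ []) (hlen : ∀ x, (input x).length ≤ (data x).H)
    (hn : ∀ x, (data x).n ≤ listSize (input x)) (hK : ∀ x, (data x).K ≤ listSize (input x))
    (hN : ∀ x, (data x).N ≤ c * listSize (input x) ^ 5)
    (hA : ∀ x i j, ((data x).A i j).natAbs < 2 ^ listSize (input x))
    (hY : ∀ x, (data x).Y₀ < 2 ^ (c * listSize (input x))) :
    ∃ p : Polynomial ℕ, ∀ (x : ι) (O : Oracle),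
      HaltsWithin P.prog O (input x) (p.eval (listSize (input x))) ∧
      acceptProb P.prog O (input x) (p.eval (listSize (input x))) =
        ((tape O (data x).queries).toOuterMeasure
          {as | ((data x).withAnswers as).bad ≠ 0}).toReal := by
  obtain ⟨κ, H⟩ := exists_acceptProb_eq P
  have hs : ∀ x, 1 ≤ listSize (input x) := fun x =>
    (List.length_pos_iff.2 (hne x)).trans_le (RunData.length_le_listSize _)
  -- The first factor is the bound of `X_le` for the lengths of the loops. The second is `κ` times
  -- the bound of `beta_le`, enlarged by the size of the input so that it also covers the initial
  -- memory.
  refine ⟨((.X + 1) * (.C c * .X ^ 5 + 1) * (.X + 2) ^ 5 + (.C c + 4) * .X + 1) *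
    (.C κ * ((12 * .X * .X + 2) + .X * ((.C c + 4) * .X + 1) + (3 * .X + 2) + .X)), fun x O =>
    H (data x) (input x) _ (hv x) (hin x) (hne x) (hlen x) (Nat.le_add_left _ _)
      (((data x).beta_le (hs x) (hn x) (hA x) (hY x)).trans (Nat.le_add_right _ _)) _ ?_ O⟩
  have := (data x).X_le (hn x) (hK x) (hN x) (hA x) (hY x)
  simp only [Polynomial.eval_mul, Polynomial.eval_add, Polynomial.eval_pow, Polynomial.eval_X,
    Polynomial.eval_C, Polynomial.eval_one, Polynomial.eval_ofNat]
  exact Nat.mul_le_mul_right _ this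

/-! ## The Poisson summation formula -/

section Poisson

open MeasureTheory UnitAddTorus

variable {n : ℕ}

/-- An integer vector as a real vector. -/
def intVec (v : Fin n → ℤ) : Fin n → ℝ := fun i => v i

theorem intVec_add (v w : Fin n → ℤ) : intVec (v + w) = intVec v + intVec w := by
  ext i; simp [intVec]

/-- The standard character. -/
noncomputable def char (z : Fin n → ℤ) (y : Fin n → ℝ) : ℂ :=
  Complex.exp (2 * Real.pi * Complex.I * ∑ i, (z i : ℂ) * y i)

theorem mFourier_coe (z : Fin n → ℤ) (y : Fin n → ℝ) :
    mFourier z (fun i => (y i : UnitAddCircle)) = char z y := by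
  simp only [mFourier, ContinuousMap.coe_mk, fourier_coe_apply, char]
  rw [← Complex.exp_sum, Finset.mul_sum]
  congr 1
  refine Finset.sum_congr rfl fun i _ => ?_
  simp
  ring

theorem norm_char (z : Fin n → ℤ) (y : Fin n → ℝ) : ‖char z y‖ = 1 := by
  have h : 2 * Real.pi * Complex.I * ∑ i, (z i : ℂ) * y i =
      ((2 * Real.pi * ∑ i, (z i : ℝ) * y i : ℝ) : ℂ) * Complex.I := by push_cast; ring
  rw [char, h, Complex.norm_exp_ofReal_mul_I]

theorem char_add_intVec (z v : Fin n → ℤ) (y : Fin n → ℝ) :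
    char z (y + intVec v) = char z y := by
  have h : 2 * Real.pi * Complex.I * ∑ i, (z i : ℂ) * ((y + intVec v) i : ℝ) =
      2 * Real.pi * Complex.I * ∑ i, (z i : ℂ) * y i +
        ((∑ i, z i * v i : ℤ) : ℂ) * (2 * Real.pi * Complex.I) := by
    simp only [intVec, Pi.add_apply, Complex.ofReal_add, mul_add, Finset.sum_add_distrib]
    push_cast
    ring
  rw [char, h, Complex.exp_periodic.int_mul, char]

theorem continuous_char (z : Fin n → ℤ) : Continuous (char z) := by
  unfold char
  fun_prop

/-- The half-open unit cube at an integer point. -/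
def cube (v : Fin n → ℤ) : Set (Fin n → ℝ) := {x | ∀ i, x i ∈ Set.Ioc (v i : ℝ) (v i + 1)}

theorem measurableSet_cube (v : Fin n → ℤ) : MeasurableSet (cube v) :=
  MeasurableSet.univ_pi' fun _ => measurableSet_Ioc

theorem mem_cube_iff {v : Fin n → ℤ} {x : Fin n → ℝ} : x ∈ cube v ↔ ∀ i, v i = ⌈x i⌉ - 1 := by
  refine forall_congr' fun i => ?_
  rw [eq_sub_iff_add_eq, eq_comm, Int.ceil_eq_iff, Set.mem_Ioc]
  push_cast
  simp

theorem iUnion_cube : ⋃ v : Fin n → ℤ, cube v = Set.univ :=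
  Set.eq_univ_of_forall fun x => Set.mem_iUnion.2 ⟨fun i => ⌈x i⌉ - 1, mem_cube_iff.2 fun _ => rfl⟩

theorem pairwise_disjoint_cube : Pairwise (Function.onFun Disjoint (cube (n := n))) := by
  intro v w hvw
  refine Set.disjoint_left.2 fun x hv hw => hvw ?_
  ext i
  rw [mem_cube_iff.1 hv i, mem_cube_iff.1 hw i]

theorem setIntegral_cube {F : Type*} [NormedAddCommGroup F] [NormedSpace ℝ F] (f : (Fin n → ℝ) → F)
    (v : Fin n → ℤ) : ∫ x in cube v, f x = ∫ x in cube 0, f (x + intVec v) := by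
  have h := (measurePreserving_add_right (volume : Measure (Fin n → ℝ))
    (intVec v)).setIntegral_preimage_emb (measurableEmbedding_addRight _) f (cube v)
  rw [← h]
  congr 2
  ext x
  simp only [cube, intVec, Set.mem_preimage, Set.mem_ofPred_eq, Pi.add_apply, Set.mem_Ioc,
    Pi.zero_apply, Int.cast_zero, zero_add]
  refine forall_congr' fun i => ?_
  constructor <;> rintro ⟨h1, h2⟩ <;> constructor <;> linarith

theorem hasSum_setIntegral_cube {F : Type*} [NormedAddCommGroup F] [NormedSpace ℝ F]
    {f : (Fin n → ℝ) → F} (hf : Integrable f) :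
    HasSum (fun v => ∫ x in cube 0, f (x + intVec v)) (∫ x, f x) := by
  have h := hasSum_integral_iUnion (μ := volume) (f := f) (s := cube (n := n)) measurableSet_cube
    pairwise_disjoint_cube hf.integrableOn
  rw [iUnion_cube, setIntegral_univ] at h
  exact h.congr_fun fun v => (setIntegral_cube f v).symm

/-- A function whose translates by integer vectors are summable, locally uniformly. -/
def LocallySummable (g : (Fin n → ℝ) → ℂ) : Prop :=
  ∀ M : ℝ, ∃ u : (Fin n → ℤ) → ℝ, Summable u ∧ ∀ y, ‖y‖ ≤ M → ∀ v, ‖g (y + intVec v)‖ ≤ u v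

theorem periodic_tsum (g : (Fin n → ℝ) → ℂ) (w : Fin n → ℤ) (y : Fin n → ℝ) :
    ∑' v, g (y + intVec w + intVec v) = ∑' v, g (y + intVec v) := by
  rw [← (Equiv.addLeft w).tsum_eq fun v => g (y + intVec v)]
  refine tsum_congr fun v => ?_
  rw [Equiv.coe_addLeft, intVec_add, add_assoc]

theorem LocallySummable.continuous {g : (Fin n → ℝ) → ℂ} (hg : Continuous g)
    (h : LocallySummable g) : Continuous fun y => ∑' v, g (y + intVec v) := by
  refine continuous_iff_continuousAt.2 fun y => ?_
  obtain ⟨u, hu, hb⟩ := h (‖y‖ + 1)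
  have h1 : ContinuousOn (fun y => ∑' v, g (y + intVec v)) (Metric.ball y 1) := by
    refine continuousOn_tsum (fun v => (hg.comp (by fun_prop)).continuousOn) hu fun v x hx => ?_
    refine hb x ?_ v
    have h2 : ‖x - y‖ < 1 := by simpa [dist_eq_norm] using hx
    have h3 := norm_add_le (x - y) y
    rw [sub_add_cancel] at h3
    linarith
  exact h1.continuousAt (Metric.ball_mem_nhds y one_pos)

/-- The sum over the integer translates of `g` is a continuous function on the torus. Its Fourier
coefficients unfold to integrals over the whole space, since the characters are invariant under
integer vectors, and a continuous function with summable Fourier coefficients is the sum of its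
Fourier series at every point. -/
theorem hasSum_poisson {g : (Fin n → ℝ) → ℂ} (hg : Continuous g) (hi : Integrable g)
    (h : LocallySummable g) (hF : Summable fun z => ∫ y, char (-z) y * g y) (y : Fin n → ℝ) :
    HasSum (fun z => (∫ x, char (-z) x * g x) * char z y) (∑' v, g (y + intVec v)) := by
  set G : (Fin n → ℝ) → ℂ := fun y => ∑' v, g (y + intVec v) with hG
  set G' : UnitAddTorus (Fin n) → ℂ := fun θ => G fun i => (AddCircle.equivIco 1 0 (θ i)).1 with hG'
  have hG'y : ∀ y : Fin n → ℝ, G' (fun i => (y i : UnitAddCircle)) = G y := by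
    intro y
    have h1 : ∀ i, ∃ k : ℤ, (AddCircle.equivIco 1 0 (y i : UnitAddCircle)).1 = y i + k := by
      intro i
      have h2 : ((AddCircle.equivIco 1 0 (y i : UnitAddCircle)).1 - y i : UnitAddCircle) = 0 := by
        rw [AddCircle.coe_equivIco, sub_self]
      rw [← AddCircle.coe_sub, AddCircle.coe_eq_zero_iff] at h2
      obtain ⟨k, hk⟩ := h2
      exact ⟨k, by rw [zsmul_eq_mul, mul_one] at hk; linarith⟩
    choose k hk using h1
    have h3 : (fun i => (AddCircle.equivIco 1 0 (y i : UnitAddCircle)).1) = y + intVec k := by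
      ext i
      rw [hk]
      rfl
    rw [hG']
    simp only
    rw [h3]
    exact periodic_tsum g k y
  have hcont : Continuous G' := by
    -- The function on the torus is defined with representatives in `[0, 1)`, which jump. Its
    -- continuity can be checked after composition with the quotient map, where it becomes that of
    -- the periodic sum.
    have hq : IsOpenQuotientMap (Pi.map fun (_ : Fin n) (x : ℝ) => (x : UnitAddCircle)) :=
      IsOpenQuotientMap.piMap fun _ => QuotientAddGroup.isOpenQuotientMap_mk
    rw [hq.isQuotientMap.continuous_iff]
    refine (h.continuous hg).congr fun y => (hG'y y).symm
  have hcoeff : ∀ z, mFourierCoeff G' z = ∫ x, char (-z) x * g x := by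
    intro z
    have hint : Integrable fun x => char (-z) x * g x := by
      refine hi.bdd_mul (c := 1) (continuous_char _).aestronglyMeasurable ?_
      exact Filter.Eventually.of_forall fun x => (norm_char _ _).le
    rw [mFourierCoeff_eq_integral G' z 0]
    have e1 : {x : Fin n → ℝ | ∀ i, x i ∈ Set.Ioc ((0 : Fin n → ℝ) i) ((0 : Fin n → ℝ) i + 1)} =
        cube 0 := by
      ext x; simp [cube]
    rw [e1, ← (hasSum_setIntegral_cube hint).tsum_eq, integral_tsum_of_summable_integral_norm]
    · refine setIntegral_congr_fun (measurableSet_cube 0) fun x _ => ?_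
      simp only [smul_eq_mul]
      rw [hG'y, mFourier_coe, hG]
      simp only [char_add_intVec]
      rw [tsum_mul_left]
    · intro v
      exact ((hint.comp_add_right (intVec v))).integrableOn
    · exact (hasSum_setIntegral_cube hint.norm).summable
  have h1 := hasSum_mFourier_series_apply_of_summable (f := ⟨G', hcont⟩)
    (hF.congr fun z => (hcoeff z).symm) (fun i => (y i : UnitAddCircle))
  simp only [ContinuousMap.coe_mk, hcoeff, mFourier_coe, smul_eq_mul] at h1
  rwa [hG'y] at h1

end Poisson

/-! ### Poisson summation for Gaussians and lattices with dual bases -/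

section PoissonGaussian

open MeasureTheory

variable {n : ℕ}

/-- `b` and `d` are dual bases. -/
def IsDualPair (b d : Fin n → E n) : Prop :=
  ∀ i j, inner ℝ (b i) (d j) = if i = j then (1 : ℝ) else 0

theorem IsDualPair.symm {b d : Fin n → E n} (h : IsDualPair b d) : IsDualPair d b := by
  intro i j
  rw [real_inner_comm, h]
  simp only [eq_comm]

/-- Real combinations of the vectors `b i`. -/
noncomputable def realComb (b : Fin n → E n) (y : Fin n → ℝ) : E n := ∑ i, y i • b i

/-- Integer combinations of the vectors `b i`. -/
noncomputable def intComb (b : Fin n → E n) (z : Fin n → ℤ) : E n := ∑ i, z i • b i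

theorem realComb_intVec (b : Fin n → E n) (z : Fin n → ℤ) :
    realComb b (intVec z) = intComb b z := by
  simp [realComb, intComb, intVec, Int.cast_smul_eq_zsmul]

theorem intComb_add (b : Fin n → E n) (y z : Fin n → ℤ) :
    intComb b (y + z) = intComb b y + intComb b z := by
  simp [intComb, add_smul, Finset.sum_add_distrib]

theorem intComb_neg (b : Fin n → E n) (z : Fin n → ℤ) : intComb b (-z) = -intComb b z := by
  simp [intComb]

@[simp] theorem intComb_zero (b : Fin n → E n) : intComb b 0 = 0 := by simp [intComb]

theorem IsDualPair.inner_realComb {b d : Fin n → E n} (h : IsDualPair b d) (y : Fin n → ℝ)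
    (j : Fin n) : inner ℝ (realComb b y) (d j) = y j := by
  simp [realComb, sum_inner, real_inner_smul_left, h _ _]

theorem IsDualPair.inner_intComb {b d : Fin n → E n} (h : IsDualPair b d) (z : Fin n → ℤ)
    (j : Fin n) : inner ℝ (intComb b z) (d j) = (z j : ℝ) := by
  rw [← realComb_intVec, h.inner_realComb, intVec]

theorem IsDualPair.inner_realComb_intComb {b d : Fin n → E n} (h : IsDualPair b d)
    (y : Fin n → ℝ) (z : Fin n → ℤ) :
    inner ℝ (intComb d z) (realComb b y) = ∑ i, (z i : ℝ) * y i := by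
  rw [realComb, inner_sum]
  refine Finset.sum_congr rfl fun i _ => ?_
  rw [real_inner_smul_right, h.symm.inner_intComb, mul_comm]

/-- The coordinates with respect to a basis that has a dual basis. -/
noncomputable def IsDualPair.equiv {b d : Fin n → E n} (h : IsDualPair b d) :
    (Fin n → ℝ) ≃L[ℝ] E n :=
  (LinearMap.linearEquivOfInjective
    (Fintype.linearCombination ℝ b) (by
      refine (injective_iff_map_eq_zero _).2 fun y hy => ?_
      ext j
      rw [← h.inner_realComb y j]
      have : realComb b y = 0 := by simpa [realComb, Fintype.linearCombination_apply] using hy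
      simp [this]) (by simp)).toContinuousLinearEquiv

theorem IsDualPair.equiv_apply {b d : Fin n → E n} (h : IsDualPair b d) (y : Fin n → ℝ) :
    h.equiv y = realComb b y := by
  simp [IsDualPair.equiv, realComb, Fintype.linearCombination_apply]

theorem IsDualPair.exists_realComb {b d : Fin n → E n} (h : IsDualPair b d) (x : E n) :
    ∃ y, realComb b y = x :=
  ⟨h.equiv.symm x, by rw [← h.equiv_apply, ContinuousLinearEquiv.apply_symm_apply]⟩

theorem rho_eq (s : ℝ) (x : E n) : rho s x = Real.exp (-(Real.pi / s ^ 2) * ‖x‖ ^ 2) := by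
  rw [rho, div_pow]
  congr 1
  ring

theorem rho_pos (s : ℝ) (x : E n) : 0 < rho s x := Real.exp_pos _

theorem continuous_rho (s : ℝ) : Continuous (rho s : E n → ℝ) := by
  unfold rho
  fun_prop

/-- The Fourier transform of `ρ_s` is `sⁿ ρ_{1/s}`. -/
theorem integral_rho_mul_cexp {s : ℝ} (hs : 0 < s) (w : E n) :
    Integrable (fun x : E n => Complex.exp (-2 * Real.pi * Complex.I * (inner ℝ w x : ℝ)) *
      (rho s x : ℂ)) ∧
    ∫ x : E n, Complex.exp (-2 * Real.pi * Complex.I * (inner ℝ w x : ℝ)) * (rho s x : ℂ) =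
      ((s ^ n * rho (1 / s) w : ℝ) : ℂ) := by
  have hb : 0 < ((Real.pi / s ^ 2 : ℝ) : ℂ).re := by
    rw [Complex.ofReal_re]; positivity
  have e : (fun x : E n => Complex.exp (-2 * Real.pi * Complex.I * (inner ℝ w x : ℝ)) *
      (rho s x : ℂ)) = fun x => Complex.exp (-((Real.pi / s ^ 2 : ℝ) : ℂ) * ‖x‖ ^ 2 +
        (-2 * Real.pi * Complex.I) * (inner ℝ w x : ℝ)) := by
    ext x
    rw [rho_eq, Complex.ofReal_exp, ← Complex.exp_add]
    congr 1
    push_cast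
    ring
  refine ⟨?_, ?_⟩
  · rw [e]
    exact GaussianFourier.integrable_cexp_neg_mul_sq_norm_add hb _ w
  · rw [e, GaussianFourier.integral_cexp_neg_mul_sq_norm_add hb, rho_eq]
    have e1 : (Real.pi : ℂ) / ((Real.pi / s ^ 2 : ℝ) : ℂ) = ((s ^ 2 : ℝ) : ℂ) := by
      have : (Real.pi : ℂ) ≠ 0 := by exact_mod_cast Real.pi_ne_zero
      have : (s : ℂ) ≠ 0 := by exact_mod_cast hs.ne'
      push_cast
      field_simp
    have e2 : (((s ^ 2 : ℝ) : ℂ)) ^ ((Module.finrank ℝ (E n) : ℂ) / 2) = ((s ^ n : ℝ) : ℂ) := by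
      have : ((Module.finrank ℝ (E n) : ℂ) / 2) = (((n : ℝ) / 2 : ℝ) : ℂ) := by simp
      rw [this, ← Complex.ofReal_cpow (by positivity), ← Real.rpow_natCast s 2,
        ← Real.rpow_mul hs.le, ← Real.rpow_natCast s n]
      congr 2
      push_cast
      ring
    rw [e1, e2, Complex.ofReal_mul, Complex.ofReal_exp]
    congr 2
    have : (Real.pi : ℂ) ≠ 0 := by exact_mod_cast Real.pi_ne_zero
    have : (s : ℂ) ≠ 0 := by exact_mod_cast hs.ne'
    push_cast
    field_simp
    ring_nf
    simp

/-- Integrals in coordinates. -/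
theorem IsDualPair.exists_integral_eq {b d : Fin n → E n} (h : IsDualPair b d) :
    ∃ c : ℝ, 0 < c ∧ ∀ f : E n → ℂ, Integrable f →
      Integrable (fun y => f (realComb b y)) ∧ ∫ y, f (realComb b y) = c * ∫ x, f x := by
  -- The image of Lebesgue measure under the coordinate map is a Haar measure, hence a positive
  -- multiple of the volume. The factor is the inverse of the covolume, but only its positivity is
  -- used: it cancels in all quotients of Gaussian sums.
  set μ : Measure (E n) := Measure.map h.equiv volume with hμ
  have hμ' : μ = Measure.addHaarScalarFactor μ volume • volume :=
    Measure.isAddLeftInvariant_eq_smul μ volume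
  have hpos := Measure.addHaarScalarFactor_pos_of_isAddHaarMeasure μ volume
  have hemb : MeasurableEmbedding h.equiv := h.equiv.toHomeomorph.measurableEmbedding
  have e : ∀ f : E n → ℂ, (fun y => f (realComb b y)) = f ∘ h.equiv := by
    intro f
    ext y
    rw [Function.comp_apply, h.equiv_apply]
  refine ⟨Measure.addHaarScalarFactor μ volume, hpos, fun f hf => ⟨?_, ?_⟩⟩
  · rw [e, ← hemb.integrable_map_iff, ← hμ, hμ']
    exact hf.smul_measure_nnreal
  · rw [e]
    change ∫ y, f (h.equiv y) = _
    rw [← hemb.integral_map, ← hμ]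
    conv_lhs => rw [hμ']
    rw [integral_smul_nnreal_measure]
    rfl

/-- A value at `y + v` is compared with the average over the unit cube at `v`. From `‖a + c‖² ≤ 2
‖a‖² + 2 ‖c‖²` one gets `ρ_s(y + v) ≤ const · ρ_{√2 s}(x + v)` for all `x` in the cube, and the
integrals over the cubes add up to the integral of an integrable Gaussian. -/
theorem IsDualPair.locallySummable {b d : Fin n → E n} (h : IsDualPair b d) {s : ℝ} (hs : 0 < s) :
    LocallySummable fun y => (rho s (realComb b y) : ℂ) := by
  intro M
  obtain ⟨c, -, hc⟩ := h.exists_integral_eq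
  set t := Real.sqrt 2 * s with ht
  have ht0 : 0 < t := by positivity
  have hint : Integrable fun x : E n => (rho t x : ℂ) := by
    simpa using (integral_rho_mul_cexp ht0 (0 : E n)).1
  have h1 := (hc _ hint).1
  set L := ‖(h.equiv : (Fin n → ℝ) →L[ℝ] E n)‖ with hL
  set m := L * (1 + M) with hm
  refine ⟨fun v => Real.exp (Real.pi / s ^ 2 * m ^ 2) *
    ∫ x in cube 0, ‖(rho t (realComb b (x + intVec v)) : ℂ)‖,
    (hasSum_setIntegral_cube h1.norm).summable.mul_left _, fun y hy v => ?_⟩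
  have hvol : volume (cube (0 : Fin n → ℤ)) = 1 := by
    have : cube (0 : Fin n → ℤ) = Set.univ.pi fun _ => Set.Ioc 0 1 := by
      ext x; simp [cube, Set.mem_pi]
    rw [this, volume_pi_pi]
    simp
  have key : ∀ x ∈ cube (0 : Fin n → ℤ), ‖(rho s (realComb b (y + intVec v)) : ℂ)‖ ≤
      Real.exp (Real.pi / s ^ 2 * m ^ 2) * ‖(rho t (realComb b (x + intVec v)) : ℂ)‖ := by
    intro x hx
    have hx1 : ‖x‖ ≤ 1 := by
      refine (pi_norm_le_iff_of_nonneg zero_le_one).2 fun i => ?_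
      have := hx i
      simp only [Pi.zero_apply, Int.cast_zero, Set.mem_Ioc, zero_add] at this
      rw [Real.norm_eq_abs, abs_le]
      constructor <;> linarith
    rw [Complex.norm_real, Complex.norm_real, Real.norm_of_nonneg (rho_pos _ _).le,
      Real.norm_of_nonneg (rho_pos _ _).le, rho_eq, rho_eq, ← Real.exp_add, Real.exp_le_exp,
      ← h.equiv_apply, ← h.equiv_apply]
    have e : h.equiv (x + intVec v) = h.equiv (y + intVec v) + h.equiv (x - y) := by
      rw [← map_add]; congr 1; abel
    have h2 : ‖h.equiv (x - y)‖ ≤ m :=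
      ((h.equiv : (Fin n → ℝ) →L[ℝ] E n).le_opNorm _).trans (by
        rw [hm]
        gcongr
        exact (norm_sub_le _ _).trans (by linarith))
    have h3 : ‖h.equiv (x + intVec v)‖ ^ 2 ≤ 2 * ‖h.equiv (y + intVec v)‖ ^ 2 + 2 * m ^ 2 := by
      have h4 := norm_add_le (h.equiv (y + intVec v)) (h.equiv (x - y))
      rw [← e] at h4
      nlinarith [norm_nonneg (h.equiv (x + intVec v)), norm_nonneg (h.equiv (y + intVec v)),
        norm_nonneg (h.equiv (x - y)), sq_nonneg (‖h.equiv (y + intVec v)‖ - m)]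
    have e2 : t ^ 2 = 2 * s ^ 2 := by rw [ht, mul_pow, Real.sq_sqrt (by norm_num)]
    rw [e2]
    have h5 : 0 < Real.pi / s ^ 2 := by positivity
    have e3 : Real.pi / (2 * s ^ 2) = Real.pi / s ^ 2 / 2 := by field_simp
    rw [e3]
    nlinarith
  have h2 := setIntegral_mono_on (μ := volume) (s := cube (0 : Fin n → ℤ))
    (f := fun _ => ‖(rho s (realComb b (y + intVec v)) : ℂ)‖)
    (g := fun x => Real.exp (Real.pi / s ^ 2 * m ^ 2) *
      ‖(rho t (realComb b (x + intVec v)) : ℂ)‖)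
    (integrableOn_const (by rw [hvol]; simp))
    ((h1.norm.comp_add_right (intVec v)).const_mul _).integrableOn (measurableSet_cube 0) key
  rw [integral_const_mul, setIntegral_const, Measure.real, hvol] at h2
  simpa using h2

/-- The Gaussian sum of a translate of the lattice spanned by `b`. -/
noncomputable def gsum (b : Fin n → E n) (s : ℝ) (x : E n) : ℝ :=
  ∑' v : Fin n → ℤ, rho s (x + intComb b v)

theorem IsDualPair.summable_rho {b d : Fin n → E n} (h : IsDualPair b d) {s : ℝ} (hs : 0 < s)
    (x : E n) : Summable fun v : Fin n → ℤ => rho s (x + intComb b v) := by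
  obtain ⟨y, rfl⟩ := h.exists_realComb x
  obtain ⟨u, hu, hb⟩ := h.locallySummable hs ‖y‖
  refine Summable.of_nonneg_of_le (fun v => (rho_pos _ _).le) (fun v => ?_) hu
  have h1 := hb y le_rfl v
  simp only at h1
  rw [← h.equiv_apply, map_add, h.equiv_apply, h.equiv_apply, realComb_intVec, Complex.norm_real,
    Real.norm_of_nonneg (rho_pos _ _).le] at h1
  exact h1

/-- The Poisson summation formula for Gaussians. -/
theorem IsDualPair.exists_hasSum_rho {b d : Fin n → E n} (h : IsDualPair b d) :
    ∃ c : ℝ, 0 < c ∧ ∀ s : ℝ, 0 < s → ∀ x, HasSum (fun z : Fin n → ℤ => c * s ^ n *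
      (rho (1 / s) (intComb d z) * Real.cos (2 * Real.pi * inner ℝ (intComb d z) x)))
      (gsum b s x) := by
  obtain ⟨c, hc0, hc⟩ := h.exists_integral_eq
  refine ⟨c, hc0, fun s hs x => ?_⟩
  obtain ⟨y, rfl⟩ := h.exists_realComb x
  have hchar : ∀ (z : Fin n → ℤ) (y : Fin n → ℝ), char z y =
      Complex.exp (2 * Real.pi * Complex.I * (inner ℝ (intComb d z) (realComb b y) : ℝ)) := by
    intro z y
    rw [char, h.inner_realComb_intComb]
    push_cast
    rfl
  have hI : ∀ z : Fin n → ℤ, ∫ y, char (-z) y * (rho s (realComb b y) : ℂ) =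
      ((c * s ^ n * rho (1 / s) (intComb d z) : ℝ) : ℂ) := by
    intro z
    obtain ⟨h1, h2⟩ := integral_rho_mul_cexp hs (intComb d z)
    have h3 := (hc _ h1).2
    rw [h2] at h3
    rw [mul_assoc, Complex.ofReal_mul, ← h3]
    refine integral_congr_ae (Filter.Eventually.of_forall fun y => ?_)
    simp only
    rw [hchar, intComb_neg, inner_neg_left]
    congr 2
    push_cast
    ring
  have hint : Integrable fun x : E n => (rho s x : ℂ) := by
    simpa using (integral_rho_mul_cexp hs (0 : E n)).1
  have hcont : Continuous fun y : Fin n → ℝ => (rho s (realComb b y) : ℂ) := by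
    refine Complex.continuous_ofReal.comp ((continuous_rho s).comp ?_)
    unfold realComb
    fun_prop
  have hsum : Summable fun z : Fin n → ℤ =>
      ∫ y, char (-z) y * (rho s (realComb b y) : ℂ) := by
    simp only [hI]
    have := h.symm.summable_rho (one_div_pos.2 hs) 0
    simp only [zero_add] at this
    exact_mod_cast this.mul_left (c * s ^ n)
  have H := hasSum_poisson hcont (hc _ hint).1 (h.locallySummable hs) hsum y
  have H' := Complex.hasSum_re H
  simp only [hI] at H'
  simp only [hchar] at H'
  convert H' using 1
  · ext z
    rw [Complex.re_ofReal_mul]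
    have : 2 * Real.pi * Complex.I * (inner ℝ (intComb d z) (realComb b y) : ℝ) =
      ((2 * Real.pi * inner ℝ (intComb d z) (realComb b y) : ℝ) : ℂ) * Complex.I := by
      push_cast; ring
    rw [this, Complex.exp_ofReal_mul_I_re]
    ring
  · rw [gsum, ← Complex.ofReal_tsum, Complex.ofReal_re]
    refine tsum_congr fun v => ?_
    rw [← h.equiv_apply, ← h.equiv_apply, map_add, h.equiv_apply, h.equiv_apply, realComb_intVec]

end PoissonGaussian

/-! ### Inequalities for Gaussian sums over cosets -/

section GaussianSums

variable {n : ℕ} {b d : Fin n → E n}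

theorem rho_zero (s : ℝ) : rho s (0 : E n) = 1 := by simp [rho]

theorem IsDualPair.one_le_gsum_zero (h : IsDualPair b d) {s : ℝ} (hs : 0 < s) :
    1 ≤ gsum b s 0 := by
  have h1 := (h.summable_rho hs 0).le_tsum 0 fun v _ => (rho_pos _ _).le
  simpa [rho_zero, gsum] using h1

theorem IsDualPair.gsum_zero_pos (h : IsDualPair b d) {s : ℝ} (hs : 0 < s) : 0 < gsum b s 0 :=
  one_pos.trans_le (h.one_le_gsum_zero hs)

theorem IsDualPair.exists_gsum_zero (h : IsDualPair b d) : ∃ c : ℝ, 0 < c ∧ ∀ s : ℝ, 0 < s →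
    gsum b s 0 = c * s ^ n * gsum d (1 / s) 0 ∧
    ∀ x, HasSum (fun z : Fin n → ℤ => c * s ^ n *
      (rho (1 / s) (intComb d z) * Real.cos (2 * Real.pi * inner ℝ (intComb d z) x)))
      (gsum b s x) := by
  obtain ⟨c, hc, H⟩ := h.exists_hasSum_rho
  refine ⟨c, hc, fun s hs => ⟨?_, H s hs⟩⟩
  have h1 := (H s hs 0).tsum_eq
  simp only [inner_zero_right, mul_zero, Real.cos_zero, mul_one] at h1
  rw [← h1, tsum_mul_left, gsum]
  simp

/-- On the dual side all coefficients are positive, so replacing the cosines by one can only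
increase the sum. -/
theorem IsDualPair.gsum_le (h : IsDualPair b d) {s : ℝ} (hs : 0 < s) (x : E n) :
    gsum b s x ≤ gsum b s 0 := by
  obtain ⟨c, hc, H⟩ := h.exists_gsum_zero
  have h0 := (H s hs).2 0
  simp only [inner_zero_right, mul_zero, Real.cos_zero, mul_one] at h0
  refine hasSum_le (fun z => ?_) ((H s hs).2 x) h0
  refine mul_le_mul_of_nonneg_left ?_ (by positivity)
  exact mul_le_of_le_one_right (rho_pos _ _).le (Real.cos_le_one _)

theorem rho_mono {s t : ℝ} (hs : 0 < s) (hst : s ≤ t) (x : E n) : rho s x ≤ rho t x := by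
  rw [rho_eq, rho_eq, Real.exp_le_exp, neg_mul, neg_mul, neg_le_neg_iff]
  gcongr

/-- On the dual side doubling `s` makes the Gaussian narrower; only the factor `sⁿ` grows. -/
theorem IsDualPair.gsum_two_mul_le (h : IsDualPair b d) {s : ℝ} (hs : 0 < s) :
    gsum b (2 * s) 0 ≤ 2 ^ n * gsum b s 0 := by
  obtain ⟨c, hc, H⟩ := h.exists_gsum_zero
  rw [(H s hs).1, (H (2 * s) (by positivity)).1]
  have h1 : gsum d (1 / (2 * s)) 0 ≤ gsum d (1 / s) 0 := by
    refine (h.symm.summable_rho (by positivity) 0).tsum_le_tsum (fun v => rho_mono (by positivity)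
      ?_ _) (h.symm.summable_rho (by positivity) 0)
    gcongr
    linarith
  calc c * (2 * s) ^ n * gsum d (1 / (2 * s)) 0 ≤ c * (2 * s) ^ n * gsum d (1 / s) 0 := by
        gcongr
    _ = _ := by ring

open Classical in
/-- A tail bound of Banaszczyk, with weaker constants, and with a function that grows slowly. -/
theorem IsDualPair.tail_le (h : IsDualPair b d) {s R A : ℝ} (hs : 0 < s) (x : E n)
    (F : E n → ℝ) (hF : ∀ y, R ≤ ‖y‖ → 0 ≤ F y ∧ F y * rho s y ≤ A * rho (2 * s) y) (hA : 0 ≤ A) :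
    Summable (fun v : Fin n → ℤ => if R ≤ ‖x + intComb b v‖ then
      F (x + intComb b v) * rho s (x + intComb b v) else 0) ∧
    ∑' v : Fin n → ℤ, (if R ≤ ‖x + intComb b v‖ then
      F (x + intComb b v) * rho s (x + intComb b v) else 0) ≤ A * 2 ^ n * gsum b s 0 := by
  have h2 : 0 < 2 * s := by positivity
  have hle : ∀ v : Fin n → ℤ, (if R ≤ ‖x + intComb b v‖ then
      F (x + intComb b v) * rho s (x + intComb b v) else 0) ≤
      A * rho (2 * s) (x + intComb b v) := by
    intro v
    split_ifs with hv
    · exact (hF _ hv).2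
    · exact mul_nonneg hA (rho_pos _ _).le
  have hsum := (h.summable_rho h2 x).mul_left A
  have hs1 : Summable (fun v : Fin n → ℤ => if R ≤ ‖x + intComb b v‖ then
      F (x + intComb b v) * rho s (x + intComb b v) else 0) := by
    refine Summable.of_nonneg_of_le (fun v => ?_) hle hsum
    split_ifs with hv
    · exact mul_nonneg (hF _ hv).1 (rho_pos _ _).le
    · exact le_rfl
  refine ⟨hs1, (hs1.tsum_le_tsum hle hsum).trans ?_⟩
  rw [tsum_mul_left, mul_assoc]
  -- The tail is dominated by the wider Gaussian on the same coset. Its sum is largest on the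
  -- lattice itself, and widening costs at most `2ⁿ` there.
  exact mul_le_mul_of_nonneg_left ((h.gsum_le h2 x).trans (h.gsum_two_mul_le hs)) hA

theorem rho_le_of_le_norm {s R : ℝ} (hs : 0 < s) (hR : 0 ≤ R) {y : E n} (hy : R ≤ ‖y‖) :
    rho s y ≤ Real.exp (-(3 * Real.pi / 4) * (R / s) ^ 2) * rho (2 * s) y := by
  rw [rho, rho, ← Real.exp_add, Real.exp_le_exp]
  have h1 : (R / s) ^ 2 ≤ (‖y‖ / s) ^ 2 := by gcongr
  have h2 : (‖y‖ / (2 * s)) ^ 2 = (‖y‖ / s) ^ 2 / 4 := by field_simp; ring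
  rw [h2]
  nlinarith [Real.pi_pos]

/-- The square is bounded by `x² ≤ exp(x²)`, which takes `1` from the `3π/4` that lies between the
exponents of `ρ_s` and `ρ_{2s}`. -/
theorem sq_mul_rho_le_of_le_norm {s R : ℝ} (hs : 0 < s) (hR : 0 ≤ R) {y : E n} (hy : R ≤ ‖y‖) :
    (‖y‖ / s) ^ 2 * rho s y ≤
      Real.exp (-(3 * Real.pi / 4 - 1) * (R / s) ^ 2) * rho (2 * s) y := by
  have h0 : (‖y‖ / s) ^ 2 ≤ Real.exp ((‖y‖ / s) ^ 2) := by
    linarith [Real.add_one_le_exp ((‖y‖ / s) ^ 2)]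
  refine (mul_le_mul_of_nonneg_right h0 (rho_pos _ _).le).trans ?_
  rw [rho, rho, ← Real.exp_add, ← Real.exp_add, Real.exp_le_exp]
  have h1 : (R / s) ^ 2 ≤ (‖y‖ / s) ^ 2 := by gcongr
  have h2 : (‖y‖ / (2 * s)) ^ 2 = (‖y‖ / s) ^ 2 / 4 := by field_simp; ring
  rw [h2]
  nlinarith [Real.pi_gt_three]

theorem IsDualPair.gsum_le_of_forall (h : IsDualPair b d) {s R : ℝ} (hs : 0 < s) (hR : 0 ≤ R)
    {x : E n} (hx : ∀ v : Fin n → ℤ, R ≤ ‖x + intComb b v‖) :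
    gsum b s x ≤ Real.exp (-(3 * Real.pi / 4) * (R / s) ^ 2) * 2 ^ n * gsum b s 0 := by
  have h1 := (h.tail_le (R := R) (A := Real.exp (-(3 * Real.pi / 4) * (R / s) ^ 2)) hs x
    (fun _ => 1) (fun y hy => ⟨zero_le_one, by
      rw [one_mul]; exact rho_le_of_le_norm hs hR hy⟩) (Real.exp_pos _).le).2
  simpa [hx, gsum] using h1

/-- The bound for translates by short vectors. -/
theorem IsDualPair.gsum_le_add (h : IsDualPair b d) {s R : ℝ} (hs : 0 < s) (hR : 0 ≤ R)
    {x : E n} (hx : ∀ v : Fin n → ℤ, v ≠ 0 → R ≤ ‖x + intComb b v‖) :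
    gsum b s x ≤ rho s x + Real.exp (-(3 * Real.pi / 4) * (R / s) ^ 2) * 2 ^ n * gsum b s 0 := by
  classical
  have h1 := h.tail_le (R := R) (A := Real.exp (-(3 * Real.pi / 4) * (R / s) ^ 2)) hs x
    (fun _ => 1) (fun y hy => ⟨zero_le_one, by
      rw [one_mul]; exact rho_le_of_le_norm hs hR hy⟩) (Real.exp_pos _).le
  rw [gsum, (h.summable_rho hs x).tsum_eq_add_tsum_ite 0, intComb_zero, add_zero]
  refine add_le_add le_rfl (le_trans ?_ h1.2)
  have hle : ∀ v : Fin n → ℤ, (if v = 0 then 0 else rho s (x + intComb b v)) ≤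
      if R ≤ ‖x + intComb b v‖ then 1 * rho s (x + intComb b v) else 0 := by
    intro v
    split_ifs with h1 h2 h2
    · rw [one_mul]; exact (rho_pos _ _).le
    · exact le_rfl
    · rw [one_mul]
    · exact absurd (hx v h1) h2
  refine Summable.tsum_le_tsum hle (Summable.of_nonneg_of_le (fun v => ?_) hle h1.1) h1.1
  split_ifs
  · exact le_rfl
  · exact (rho_pos _ _).le

/-- The lattice vectors `y` and `-y` are paired. The parallelogram law shows that `ρ(x) ρ(y)` is the
geometric mean of `ρ(x + y)` and `ρ(x - y)`, so it is at most the arithmetic mean. -/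
theorem IsDualPair.rho_mul_le_gsum (h : IsDualPair b d) {s : ℝ} (hs : 0 < s) (x : E n) :
    rho s x * gsum b s 0 ≤ gsum b s x := by
  have h1 := h.summable_rho hs x
  have h2 : Summable fun v : Fin n → ℤ => rho s (x - intComb b v) := by
    have := (Equiv.neg (Fin n → ℤ)).summable_iff.2 h1
    refine this.congr fun v => ?_
    simp [intComb_neg, sub_eq_add_neg]
  have h3 : ∑' v : Fin n → ℤ, rho s (x - intComb b v) = gsum b s x := by
    rw [gsum, ← (Equiv.neg (Fin n → ℤ)).tsum_eq]
    refine tsum_congr fun v => ?_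
    simp [intComb_neg, sub_eq_add_neg]
  have h4 : 2 * (rho s x * gsum b s 0) ≤ gsum b s x + ∑' v : Fin n → ℤ, rho s (x - intComb b v) := by
    rw [gsum, gsum, ← h1.tsum_add h2, ← tsum_mul_left, ← tsum_mul_left]
    refine Summable.tsum_le_tsum (fun v => ?_)
      (((h.summable_rho hs 0).mul_left _).mul_left _) (h1.add h2)
    set y := intComb b v
    rw [zero_add]
    have e1 : rho s x * rho s y =
        Real.exp (-(Real.pi / s ^ 2) * (‖x + y‖ ^ 2 + ‖x - y‖ ^ 2) / 2) := by
      rw [rho_eq, rho_eq, ← Real.exp_add]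
      congr 1
      have := parallelogram_law_with_norm ℝ x y
      have e : ‖x + y‖ ^ 2 + ‖x - y‖ ^ 2 = 2 * (‖x‖ ^ 2 + ‖y‖ ^ 2) := by
        simpa only [sq] using this
      rw [e]
      ring
    have e2 : ∀ p q : ℝ, 2 * Real.exp ((p + q) / 2) ≤ Real.exp p + Real.exp q := by
      intro p q
      have hp : Real.exp p = Real.exp (p / 2) ^ 2 := by rw [← Real.exp_nat_mul]; congr 1; ring
      have hq : Real.exp q = Real.exp (q / 2) ^ 2 := by rw [← Real.exp_nat_mul]; congr 1; ring
      rw [hp, hq, add_div, Real.exp_add]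
      nlinarith [sq_nonneg (Real.exp (p / 2) - Real.exp (q / 2))]
    rw [e1, rho_eq s (x + y), rho_eq s (x - y), mul_add]
    exact e2 _ _
  rw [h3] at h4
  linarith

/-! ## The discrete Gaussian distribution in coordinates -/

/-- The probabilities of the discrete Gaussian distribution on the lattice spanned by `d`. -/
noncomputable def prob (d : Fin n → E n) (r : ℝ) (z : Fin n → ℤ) : ℝ :=
  rho r (intComb d z) / gsum d r 0

theorem IsDualPair.prob_nonneg (h : IsDualPair b d) {r : ℝ} (hr : 0 < r) (z : Fin n → ℤ) :
    0 ≤ prob d r z :=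
  div_nonneg (rho_pos _ _).le (h.symm.gsum_zero_pos hr).le

theorem IsDualPair.hasSum_prob (h : IsDualPair b d) {r : ℝ} (hr : 0 < r) :
    HasSum (prob d r) 1 := by
  have h1 := (h.symm.summable_rho hr 0).hasSum.div_const (gsum d r 0)
  have e : (∑' v : Fin n → ℤ, rho r (0 + intComb d v)) / gsum d r 0 = 1 :=
    div_self (h.symm.gsum_zero_pos hr).ne'
  rw [e] at h1
  refine h1.congr_fun fun z => ?_
  rw [prob, zero_add]

/-- The characteristic function. -/
theorem IsDualPair.hasSum_prob_mul_cos (h : IsDualPair b d) {r : ℝ} (hr : 0 < r) (x : E n) :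
    HasSum (fun z => prob d r z * Real.cos (2 * Real.pi * inner ℝ (intComb d z) x))
      (gsum b (1 / r) x / gsum b (1 / r) 0) := by
  obtain ⟨c, hc, H⟩ := h.exists_gsum_zero
  obtain ⟨h0, h1⟩ := H (1 / r) (by positivity)
  rw [one_div_one_div] at h0
  have h2 := (h1 x).div_const (gsum b (1 / r) 0)
  refine h2.congr_fun fun z => ?_
  have h3 := (h.symm.gsum_zero_pos hr).ne'
  rw [h0, one_div_one_div, prob]
  field_simp

open Classical in
theorem IsDualPair.prob_tail_le (h : IsDualPair b d) {r R A : ℝ} (hr : 0 < r)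
    (F : E n → ℝ) (hF : ∀ y, R ≤ ‖y‖ → 0 ≤ F y ∧ F y * rho r y ≤ A * rho (2 * r) y) (hA : 0 ≤ A) :
    Summable (fun z => prob d r z * if R ≤ ‖intComb d z‖ then F (intComb d z) else 0) ∧
    ∑' z, (prob d r z * if R ≤ ‖intComb d z‖ then F (intComb d z) else 0) ≤ A * 2 ^ n := by
  obtain ⟨h1, h2⟩ := h.symm.tail_le hr 0 F hF hA
  have h3 := h.symm.gsum_zero_pos hr
  have e : (fun z => prob d r z * if R ≤ ‖intComb d z‖ then F (intComb d z) else 0) =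
      fun v : Fin n → ℤ => (if R ≤ ‖0 + intComb d v‖ then
      F (0 + intComb d v) * rho r (0 + intComb d v) else 0) / gsum d r 0 := by
    ext z
    rw [prob, zero_add]
    split_ifs
    · ring
    · simp
  rw [e]
  refine ⟨h1.div_const _, ?_⟩
  rw [tsum_div_const]
  exact (div_le_iff₀ h3).2 h2

end GaussianSums

/-! ### Second moments of the discrete Gaussian distribution -/

section Moments

theorem summable_mul_of_bounded {ι : Type*} {p f : ι → ℝ} (hp : ∀ i, 0 ≤ p i) (hs : Summable p)
    {C : ℝ} (hf : ∀ i, |f i| ≤ C) : Summable fun i => p i * f i := by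
  refine Summable.of_norm_bounded (hs.mul_right C) fun i => ?_
  rw [norm_mul, Real.norm_of_nonneg (hp i)]
  exact mul_le_mul_of_nonneg_left (hf i) (hp i)

/-- A bound for the second moment from the characteristic function near `0`. -/
theorem summable_sq_of_le_tsum_cos {ι : Type*} {p a : ι → ℝ} (hp : ∀ i, 0 ≤ p i)
    (hs : HasSum p 1) {A : ℝ} (H : ∀ ε > 0, 1 - A * ε ^ 2 ≤ ∑' i, p i * Real.cos (ε * a i)) :
    Summable (fun i => p i * a i ^ 2) ∧ ∑' i, p i * a i ^ 2 ≤ 2 * A := by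
  have hfin : ∀ S : Finset ι, ∑ i ∈ S, p i * a i ^ 2 ≤ 2 * A := by
    intro S
    -- The error of the expansion of the cosine to second order. The set `S` is finite, so no fourth
    -- moment has to exist, and the contribution disappears as `ε` tends to zero.
    set Q := ∑ i ∈ S, p i * a i ^ 4 * (5 / 96) with hQ
    have hcos : ∀ ε > 0, ∑ i ∈ S, p i * (1 - Real.cos (ε * a i)) ≤ A * ε ^ 2 := by
      intro ε hε
      have h1 : Summable fun i => p i * Real.cos (ε * a i) :=
        summable_mul_of_bounded hp hs.summable fun i => Real.abs_cos_le_one _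
      have h2 : HasSum (fun i => p i * (1 - Real.cos (ε * a i)))
          (1 - ∑' i, p i * Real.cos (ε * a i)) := by
        simpa only [mul_sub, mul_one] using hs.sub h1.hasSum
      have h3 := sum_le_hasSum S (fun i _ => mul_nonneg (hp i)
        (sub_nonneg.2 (Real.cos_le_one _))) h2
      linarith [H ε hε]
    have hlim : Filter.Tendsto (fun ε : ℝ => 2 * A + 2 * (ε ^ 2 * Q)) (nhdsWithin 0 (Set.Ioi 0))
        (nhds (2 * A)) := by
      have : Filter.Tendsto (fun ε : ℝ => 2 * A + 2 * (ε ^ 2 * Q)) (nhds 0)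
          (nhds (2 * A + 2 * ((0 : ℝ) ^ 2 * Q))) := by
        apply Continuous.tendsto
        fun_prop
      simpa using this.mono_left nhdsWithin_le_nhds
    refine ge_of_tendsto hlim ?_
    have hsmall : ∀ᶠ ε in nhdsWithin (0 : ℝ) (Set.Ioi 0), ∀ i ∈ S, |ε * a i| ≤ 1 := by
      rw [Filter.eventually_all_finset]
      intro i _
      have : Filter.Tendsto (fun ε : ℝ => |ε * a i|) (nhds 0) (nhds |0 * a i|) := by
        apply Continuous.tendsto
        fun_prop
      rw [zero_mul, abs_zero] at this
      exact (this.mono_left nhdsWithin_le_nhds).eventually (ge_mem_nhds one_pos)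
    filter_upwards [hsmall, self_mem_nhdsWithin] with ε h1 hε
    have hε0 : (0 : ℝ) < ε := hε
    have h2 : ∑ i ∈ S, p i * (ε ^ 2 * a i ^ 2 / 2 - ε ^ 4 * a i ^ 4 * (5 / 96)) ≤ A * ε ^ 2 := by
      refine (Finset.sum_le_sum fun i hi => mul_le_mul_of_nonneg_left ?_ (hp i)).trans (hcos ε hε)
      have h3 := (abs_le.1 (Real.cos_bound (h1 i hi))).2
      rw [pow_abs, abs_of_nonneg (by positivity)] at h3
      have e1 : (ε * a i) ^ 4 = ε ^ 4 * a i ^ 4 := mul_pow _ _ _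
      have e2 : (ε * a i) ^ 2 = ε ^ 2 * a i ^ 2 := mul_pow _ _ _
      rw [e1, e2] at h3
      linarith
    have h3 : ∑ i ∈ S, p i * (ε ^ 2 * a i ^ 2 / 2 - ε ^ 4 * a i ^ 4 * (5 / 96)) =
        ε ^ 2 * ((∑ i ∈ S, p i * a i ^ 2) / 2 - ε ^ 2 * Q) := by
      rw [hQ, Finset.sum_div, Finset.mul_sum, ← Finset.sum_sub_distrib, Finset.mul_sum]
      refine Finset.sum_congr rfl fun i _ => ?_
      ring
    rw [h3, mul_comm A] at h2
    have h4 := le_of_mul_le_mul_left h2 (by positivity)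
    linarith
  have h0 : ∀ i, 0 ≤ p i * a i ^ 2 := fun i => mul_nonneg (hp i) (sq_nonneg _)
  exact ⟨summable_of_sum_le h0 hfin, Real.tsum_le_of_sum_le h0 hfin⟩

variable {n : ℕ} {b d : Fin n → E n}

/-- By `rho_mul_le_gsum` the characteristic function at `ε u` is at least `exp(-π r² ε² ‖u‖²) ≥ 1 -
π r² ε² ‖u‖²`. Comparing the second order terms at `ε = 0` gives the variance of the continuous
Gaussian as an upper bound, for every lattice and every `r`. -/
theorem IsDualPair.second_moment_le (h : IsDualPair b d) {r : ℝ} (hr : 0 < r) (u : E n) :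
    Summable (fun z => prob d r z * (inner ℝ (intComb d z) u) ^ 2) ∧
    ∑' z, prob d r z * (inner ℝ (intComb d z) u) ^ 2 ≤ r ^ 2 / (2 * Real.pi) * ‖u‖ ^ 2 := by
  have hpi := Real.pi_pos
  obtain ⟨h1, h2⟩ := summable_sq_of_le_tsum_cos (p := prob d r)
    (a := fun z => 2 * Real.pi * inner ℝ (intComb d z) u) (A := Real.pi * r ^ 2 * ‖u‖ ^ 2)
    (h.prob_nonneg hr) (h.hasSum_prob hr) (fun ε hε => by
      have h3 := (h.hasSum_prob_mul_cos hr (ε • u)).tsum_eq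
      have e : (fun z => prob d r z * Real.cos (2 * Real.pi * inner ℝ (intComb d z) (ε • u))) =
          fun z => prob d r z * Real.cos (ε * (2 * Real.pi * inner ℝ (intComb d z) u)) := by
        ext z
        rw [real_inner_smul_right]
        congr 2
        ring
      rw [e] at h3
      rw [h3]
      have hr' : 0 < 1 / r := by positivity
      have h4 := h.rho_mul_le_gsum hr' (ε • u)
      have h5 := h.gsum_zero_pos hr'
      refine le_trans ?_ ((le_div_iff₀ h5).2 h4)
      rw [rho]
      refine le_trans ?_ (Real.add_one_le_exp _)
      rw [norm_smul, Real.norm_of_nonneg hε.le]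
      apply le_of_eq
      field_simp
      ring)
  have e : ∀ z, prob d r z * (2 * Real.pi * inner ℝ (intComb d z) u) ^ 2 =
      (4 * Real.pi ^ 2) * (prob d r z * (inner ℝ (intComb d z) u) ^ 2) := fun z => by ring
  simp only [e] at h1 h2
  have h4 : (4 * Real.pi ^ 2) ≠ 0 := by positivity
  refine ⟨(summable_mul_left_iff h4).1 h1, ?_⟩
  rw [tsum_mul_left] at h2
  rw [div_mul_eq_mul_div, le_div_iff₀ (by positivity)]
  have : 2 * Real.pi * (∑' z, prob d r z * (inner ℝ (intComb d z) u) ^ 2 * (2 * Real.pi)) ≤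
      2 * Real.pi * (r ^ 2 * ‖u‖ ^ 2) := by
    rw [tsum_mul_right]
    linarith
  rw [tsum_mul_right] at this
  exact le_of_mul_le_mul_left this (by positivity)

/-- The expectation of `1 - cos y ≤ y² / 2`. Unlike the upper bound it is applied at a fixed `x`,
where the Gaussian sum must decay visibly. -/
theorem IsDualPair.le_second_moment (h : IsDualPair b d) {r : ℝ} (hr : 0 < r) (x : E n) :
    1 - gsum b (1 / r) x / gsum b (1 / r) 0 ≤
      2 * Real.pi ^ 2 * ∑' z, prob d r z * (inner ℝ (intComb d z) x) ^ 2 := by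
  have h1 := (h.hasSum_prob hr).sub (h.hasSum_prob_mul_cos hr x)
  rw [← tsum_mul_left]
  refine hasSum_le (fun z => ?_) h1 ((h.second_moment_le hr x).1.mul_left _).hasSum
  have h2 := Real.one_sub_sq_div_two_le_cos (x := 2 * Real.pi * inner ℝ (intComb d z) x)
  have h3 := h.prob_nonneg hr z
  nlinarith

theorem two_pow_le_exp (n : ℕ) : (2 : ℝ) ^ n ≤ Real.exp n := by
  rw [← Real.exp_one_pow]
  gcongr
  have := Real.exp_one_gt_d9
  linarith

theorem exp_mul_two_pow_le {c c' : ℝ} (hc : c + 1 ≤ c') (n : ℕ) :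
    Real.exp (-(c' * n)) * 2 ^ n ≤ Real.exp (-(c * n)) := by
  refine (mul_le_mul_of_nonneg_left (two_pow_le_exp n) (Real.exp_pos _).le).trans ?_
  rw [← Real.exp_add, Real.exp_le_exp]
  have : (0 : ℝ) ≤ n := Nat.cast_nonneg n
  nlinarith

theorem exp_neg_four_mul_le {n : ℕ} (hn : 1 ≤ n) : Real.exp (-(4 * n)) ≤ 1 / (4 * n ^ 2) := by
  have h1 : (1 : ℝ) ≤ n := by exact_mod_cast hn
  have h2 : Real.exp (-(4 * n)) = 1 / Real.exp (2 * n) ^ 2 := by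
    rw [← Real.exp_nat_mul, Real.exp_neg, one_div]
    congr 2
    push_cast
    ring
  rw [h2]
  have h3 : 2 * (n : ℝ) ≤ Real.exp (2 * n) := by linarith [Real.add_one_le_exp (2 * (n : ℝ))]
  have h4 : (4 : ℝ) * n ^ 2 = (2 * n) ^ 2 := by ring
  rw [h4]
  gcongr

/-- Along a unit vector the second moment is almost as large as that of a continuous Gaussian. -/
theorem IsDualPair.le_second_moment_of_norm_eq_one (h : IsDualPair b d) (hn : 1 ≤ n) {r : ℝ}
    (hr : 0 < r)
    (hb : ∀ v : Fin n → ℤ, v ≠ 0 → 5 * Real.sqrt n / r ≤ ‖intComb b v‖) {u : E n} (hu : ‖u‖ = 1) :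
    r ^ 2 / (2 * Real.pi) * (1 - 1 / n) ≤
      ∑' z, prob d r z * (inner ℝ (intComb d z) u) ^ 2 := by
  have hpi := Real.pi_pos
  have hn1 : (1 : ℝ) ≤ n := by exact_mod_cast hn
  set q := Real.sqrt n with hq
  have hq2 : q ^ 2 = n := Real.sq_sqrt (by positivity)
  have hq1 : 1 ≤ q := Real.one_le_sqrt.2 hn1
  -- The length `δ / r` of the test vector is a compromise. The relative loss in `1 - exp(-πδ²) ≤
  -- πδ²` is of order `δ²`, which must be `O(1/n)`, while the lattice tail `1 / (4n²)` must stay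
  -- small against `πδ²`. With `δ² = 1 / (4n)` both losses add up to `(π/8 + 1/π) / n ≤ 1/n`.
  set δ := 1 / (2 * q) with hδ
  have hδ0 : 0 < δ := by positivity
  have hδ2 : δ ^ 2 = 1 / (4 * n) := by rw [hδ, div_pow, mul_pow, hq2]; norm_num
  have hr' : 0 < 1 / r := by positivity
  have hx : ‖(δ / r) • u‖ = δ / r := by
    rw [norm_smul, hu, mul_one, Real.norm_of_nonneg (by positivity)]
  have hδq : δ ≤ q / 2 := by
    rw [hδ, div_le_div_iff₀ (by positivity) (by norm_num)]
    nlinarith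
  have h1 := h.gsum_le_add hr' (R := 9 / 2 * q / r) (by positivity) (x := (δ / r) • u)
    (fun v hv => by
      have h2 := norm_sub_norm_le (intComb b v) (-((δ / r) • u))
      rw [sub_neg_eq_add, norm_neg, hx, add_comm] at h2
      refine le_trans ?_ h2
      have h3 := hb v hv
      have h4 : δ / r ≤ q / 2 / r := by gcongr
      have h5 : 5 * q / r - q / 2 / r = 9 / 2 * q / r := by ring
      linarith)
  have h0 := h.gsum_zero_pos hr'
  have h01 := h.one_le_gsum_zero hr'
  have e1 : (9 / 2 * q / r / (1 / r)) ^ 2 = 81 / 4 * n := by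
    rw [← hq2]; field_simp; ring
  have e2 : rho (1 / r) ((δ / r) • u) = Real.exp (-(Real.pi * δ ^ 2)) := by
    rw [rho, hx]
    congr 1
    field_simp
  rw [e1, e2] at h1
  -- The nonzero lattice vectors have length at least `5 √n / r`, and the translation by `δ / r`
  -- shortens them to no less than `(9/2) √n / r`; the square of `9/2` is `81/4`.
  have hT : Real.exp (-(3 * Real.pi / 4) * (81 / 4 * n)) * 2 ^ n ≤ 1 / (4 * n ^ 2) := by
    have := exp_mul_two_pow_le (c := 4) (c' := 3 * Real.pi / 4 * (81 / 4))
      (by nlinarith [Real.pi_gt_three]) n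
    refine le_trans (le_of_eq ?_) (this.trans (exp_neg_four_mul_le hn))
    congr 2
    ring
  have h2 : gsum b (1 / r) ((δ / r) • u) / gsum b (1 / r) 0 ≤
      Real.exp (-(Real.pi * δ ^ 2)) + 1 / (4 * n ^ 2) := by
    rw [div_le_iff₀ h0, add_mul]
    refine h1.trans (add_le_add ?_ (mul_le_mul_of_nonneg_right hT h0.le))
    exact le_mul_of_one_le_right (Real.exp_pos _).le h01
  have h3 := h.le_second_moment hr ((δ / r) • u)
  have e3 : ∀ z, prob d r z * (inner ℝ (intComb d z) ((δ / r) • u)) ^ 2 =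
      δ ^ 2 / r ^ 2 * (prob d r z * (inner ℝ (intComb d z) u) ^ 2) := by
    intro z
    rw [real_inner_smul_right]
    ring
  simp only [e3] at h3
  rw [tsum_mul_left] at h3
  set V := ∑' z, prob d r z * (inner ℝ (intComb d z) u) ^ 2
  have h4 : Real.exp (-(Real.pi * δ ^ 2)) ≤ 1 - Real.pi * δ ^ 2 + (Real.pi * δ ^ 2) ^ 2 / 2 := by
    have hy : 0 ≤ Real.pi * δ ^ 2 := by positivity
    generalize Real.pi * δ ^ 2 = y at hy
    rw [Real.exp_neg]
    refine (inv_anti₀ (by positivity) (Real.quadratic_le_exp_of_nonneg hy)).trans ?_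
    rw [inv_le_iff_one_le_mul₀ (by positivity)]
    nlinarith [mul_nonneg hy hy, mul_nonneg hy (mul_nonneg hy hy),
      mul_nonneg (mul_nonneg hy hy) (mul_nonneg hy hy)]
  have h5 : Real.pi * δ ^ 2 - (Real.pi * δ ^ 2) ^ 2 / 2 - 1 / (4 * n ^ 2) ≤
      2 * Real.pi ^ 2 * (δ ^ 2 / r ^ 2 * V) := by linarith
  rw [hδ2] at h5
  have e4 : 2 * Real.pi ^ 2 * (1 / (4 * (n : ℝ)) / r ^ 2 * V) =
      Real.pi / (4 * n) * (2 * Real.pi / r ^ 2 * V) := by field_simp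
  have e5 : Real.pi * (1 / (4 * (n : ℝ))) - (Real.pi * (1 / (4 * n))) ^ 2 / 2 - 1 / (4 * n ^ 2) =
      Real.pi / (4 * n) * (1 - (Real.pi / 8 + 1 / Real.pi) / n) := by field_simp; ring
  rw [e4, e5] at h5
  have h6 := le_of_mul_le_mul_left h5 (by positivity)
  have h7 : Real.pi / 8 + 1 / Real.pi ≤ 1 := by
    have h8 : 1 / Real.pi ≤ 1 / 3 := by
      gcongr
      exact Real.pi_gt_three.le
    linarith [Real.pi_lt_four]
  have h8 : (Real.pi / 8 + 1 / Real.pi) / n ≤ 1 / n := by gcongr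
  have h9 : 1 - 1 / (n : ℝ) ≤ 2 * Real.pi / r ^ 2 * V := by linarith
  calc r ^ 2 / (2 * Real.pi) * (1 - 1 / n) ≤ r ^ 2 / (2 * Real.pi) * (2 * Real.pi / r ^ 2 * V) := by
        gcongr
    _ = V := by field_simp

/-- The weights in the tests of the second moments. -/
def weight (n : ℕ) (j k : Fin n) : ℝ := if j = k then 1 else n

/-- For `j ≠ k` the vectors `e_j ± e_k` have squared norm two, so the second moment along them is at
most `2 r² / (2π)`. It equals the sum of the two diagonal moments, each at least `(1 - 1/n) r² /
(2π)`, plus or minus twice the mixed moment. The mixed moment is therefore at most `r² / (2π n)`,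
and the weight `n` is affordable. -/
theorem IsDualPair.moment_le (h : IsDualPair b d) (hn : 1 ≤ n) {r : ℝ} (hr : 0 < r)
    (hb : ∀ v : Fin n → ℤ, v ≠ 0 → 5 * Real.sqrt n / r ≤ ‖intComb b v‖) (j k : Fin n) :
    Summable (fun z => prob d r z * (intComb d z j * intComb d z k)) ∧
    |weight n j k * ∑' z, prob d r z * (intComb d z j * intComb d z k)| ≤
      r ^ 2 / (2 * Real.pi) := by
  have hn1 : (1 : ℝ) ≤ n := by exact_mod_cast hn
  have hpi := Real.pi_pos
  set e : Fin n → E n := fun j => EuclideanSpace.single j 1 with he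
  have he1 : ∀ j, ‖e j‖ = 1 := fun j => by simp [he]
  have hin : ∀ (w : E n) (j : Fin n), inner ℝ w (e j) = w j := fun w j => by
    simp [he, EuclideanSpace.inner_single_right]
  have hj := h.second_moment_le hr (e j)
  have hk := h.second_moment_le hr (e k)
  have hj' := h.le_second_moment_of_norm_eq_one hn hr hb (he1 j)
  have hk' := h.le_second_moment_of_norm_eq_one hn hr hb (he1 k)
  simp only [hin, he1, one_pow, mul_one] at hj hk hj' hk'
  by_cases hjk : j = k
  · subst hjk
    simp only [← sq, weight, if_true, one_mul]
    refine ⟨hj.1, ?_⟩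
    rw [abs_of_nonneg (tsum_nonneg fun z => mul_nonneg (h.prob_nonneg hr z) (sq_nonneg _))]
    exact hj.2
  have hnorm : ∀ σ : ℝ, σ ^ 2 = 1 → ‖e j + σ • e k‖ ^ 2 = 2 := by
    intro σ hσ
    rw [@norm_add_sq_real, real_inner_smul_right, norm_smul, mul_pow, he1, he1, hin]
    have : e j k = 0 := by simp [he, Ne.symm hjk]
    rw [this, Real.norm_eq_abs, sq_abs, hσ]
    norm_num
  have hp := h.second_moment_le hr (e j + (1 : ℝ) • e k)
  have hm := h.second_moment_le hr (e j + (-1 : ℝ) • e k)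
  rw [hnorm 1 (by norm_num)] at hp
  rw [hnorm (-1) (by norm_num)] at hm
  simp only [inner_add_right, real_inner_smul_right, hin] at hp hm
  have hs : Summable fun z => prob d r z * (intComb d z j * intComb d z k) := by
    refine ((hp.1.sub hm.1).div_const 4).congr fun z => ?_
    ring
  refine ⟨hs, ?_⟩
  have e1 : ∀ σ : ℝ, σ ^ 2 = 1 →
      ∑' z, prob d r z * (intComb d z j + σ * intComb d z k) ^ 2 =
      ∑' z, prob d r z * (intComb d z j) ^ 2 + ∑' z, prob d r z * (intComb d z k) ^ 2 +
        2 * σ * ∑' z, prob d r z * (intComb d z j * intComb d z k) := by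
    intro σ hσ
    rw [← hj.1.tsum_add hk.1, ← tsum_mul_left, ← (hj.1.add hk.1).tsum_add (hs.mul_left _)]
    refine tsum_congr fun z => ?_
    have : (intComb d z j + σ * intComb d z k) ^ 2 = (intComb d z j) ^ 2 +
      σ ^ 2 * (intComb d z k) ^ 2 + 2 * σ * (intComb d z j * intComb d z k) := by ring
    rw [this, hσ]
    ring
  rw [e1 1 (by norm_num)] at hp
  rw [e1 (-1) (by norm_num)] at hm
  set c := ∑' z, prob d r z * (intComb d z j * intComb d z k)
  rw [weight, if_neg hjk]
  have hc : |c| ≤ r ^ 2 / (2 * Real.pi) / n := by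
    have e2 : r ^ 2 / (2 * Real.pi) * (1 - 1 / n) =
      r ^ 2 / (2 * Real.pi) - r ^ 2 / (2 * Real.pi) / n := by ring
    rw [e2] at hj' hk'
    rw [abs_le]
    constructor <;> linarith [hp.2, hm.2]
  rw [abs_mul, abs_of_nonneg (by positivity)]
  rwa [le_div_iff₀ (by positivity), mul_comm] at hc

end Moments

/-! ### Expectations of the truncated tests -/

section Tests

variable {n : ℕ} {b d : Fin n → E n}

/-- The radius at which the samples are truncated. -/
noncomputable def cutoff (n : ℕ) (r : ℝ) : ℝ := Real.sqrt (20 * n) * r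

theorem cutoff_nonneg (n : ℕ) {r : ℝ} (hr : 0 < r) : 0 ≤ cutoff n r := by
  unfold cutoff; positivity

theorem cutoff_div_sq (n : ℕ) {r : ℝ} (hr : 0 < r) : (cutoff n r / r) ^ 2 = 20 * n := by
  rw [cutoff, mul_div_cancel_right₀ _ hr.ne', Real.sq_sqrt (by positivity)]

-- The truncation radius `√(20 n) r` turns the tail bound into `exp(-15 π n) 2ⁿ`. Since `15 π ≥ 41`
-- and `2 ≤ e`, this is below `exp(-40 n)`, the error that is aimed at for every single event.
open Classical in
theorem IsDualPair.prob_cutoff_le (h : IsDualPair b d) {r : ℝ} (hr : 0 < r) :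
    Summable (fun z => prob d r z * if cutoff n r ≤ ‖intComb d z‖ then 1 else 0) ∧
    ∑' z, (prob d r z * if cutoff n r ≤ ‖intComb d z‖ then 1 else 0) ≤ Real.exp (-(40 * n)) := by
  obtain ⟨h1, h2⟩ := h.prob_tail_le (R := cutoff n r)
    (A := Real.exp (-(3 * Real.pi / 4) * (cutoff n r / r) ^ 2)) hr
    (fun _ => 1) (fun y hy => ⟨zero_le_one, by
      rw [one_mul]; exact rho_le_of_le_norm hr (cutoff_nonneg n hr) hy⟩) (Real.exp_pos _).le
  refine ⟨h1, h2.trans ?_⟩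
  rw [cutoff_div_sq n hr]
  refine le_trans (le_of_eq ?_) (exp_mul_two_pow_le (c := 40) (c' := 3 * Real.pi / 4 * 20)
    (by nlinarith [Real.pi_gt_three]) n)
  congr 2
  ring

open Classical in
theorem IsDualPair.moment_cutoff_le (h : IsDualPair b d) {r : ℝ} (hr : 0 < r) :
    Summable (fun z => prob d r z * if cutoff n r ≤ ‖intComb d z‖ then
      (‖intComb d z‖ / r) ^ 2 else 0) ∧
    ∑' z, (prob d r z * if cutoff n r ≤ ‖intComb d z‖ then (‖intComb d z‖ / r) ^ 2 else 0) ≤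
      Real.exp (-(26 * n)) := by
  obtain ⟨h1, h2⟩ := h.prob_tail_le (R := cutoff n r)
    (A := Real.exp (-(3 * Real.pi / 4 - 1) * (cutoff n r / r) ^ 2)) hr
    (fun y => (‖y‖ / r) ^ 2) (fun y hy => ⟨by positivity,
      sq_mul_rho_le_of_le_norm hr (cutoff_nonneg n hr) hy⟩) (Real.exp_pos _).le
  refine ⟨h1, h2.trans ?_⟩
  rw [cutoff_div_sq n hr]
  refine le_trans (le_of_eq ?_) (exp_mul_two_pow_le (c := 26) (c' := (3 * Real.pi / 4 - 1) * 20)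
    (by nlinarith [Real.pi_gt_d2]) n)
  congr 2
  ring

theorem abs_apply_le_norm (w : E n) (j : Fin n) : |w j| ≤ ‖w‖ := by
  simpa using PiLp.norm_apply_le w j

theorem weight_mem (hn : 1 ≤ n) (j k : Fin n) : 1 ≤ weight n j k ∧ weight n j k ≤ n := by
  have hn1 : (1 : ℝ) ≤ n := by exact_mod_cast hn
  unfold weight
  split_ifs
  · exact ⟨le_rfl, hn1⟩
  · exact ⟨hn1, le_rfl⟩

theorem abs_mul_le_sq_norm (hn : 1 ≤ n) {r : ℝ} (w : E n) (j k : Fin n) :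
    |weight n j k * (w j * w k) / r ^ 2| ≤ n * (‖w‖ / r) ^ 2 := by
  obtain ⟨h1, h2⟩ := weight_mem hn j k
  rw [abs_div, abs_mul, abs_mul, abs_of_pos (by linarith : 0 < weight n j k), abs_sq, div_pow,
    ← mul_div_assoc]
  have h3 : |w j| * |w k| ≤ ‖w‖ ^ 2 := by
    rw [sq]
    exact mul_le_mul (abs_apply_le_norm w j) (abs_apply_le_norm w k) (abs_nonneg _)
      (norm_nonneg _)
  gcongr

open Classical in
/-- The truncated contribution of a sample to the test of a second moment. -/
noncomputable def momentTest (n : ℕ) (r σ : ℝ) (j k : Fin n) (w : E n) : ℝ :=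
  if cutoff n r ≤ ‖w‖ then 0 else σ * (weight n j k * (w j * w k) / r ^ 2)

theorem abs_momentTest_le (hn : 1 ≤ n) {r σ : ℝ} (hr : 0 < r) (hσ : |σ| = 1) (j k : Fin n)
    (w : E n) : |momentTest n r σ j k w| ≤ 20 * n ^ 2 := by
  unfold momentTest
  split_ifs with h
  · rw [abs_zero]; positivity
  · rw [abs_mul, hσ, one_mul]
    refine (abs_mul_le_sq_norm hn w j k).trans ?_
    have h1 : (‖w‖ / r) ^ 2 ≤ (cutoff n r / r) ^ 2 := by
      have := (not_le.1 h).le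
      gcongr
    rw [cutoff_div_sq n hr] at h1
    calc (n : ℝ) * (‖w‖ / r) ^ 2 ≤ n * (20 * n) := by gcongr
      _ = _ := by ring

theorem exp_neg_mul_le {c : ℝ} (hc : 0 < c) {n : ℕ} (hn : 1 ≤ n) :
    Real.exp (-(c * n)) ≤ 1 / (c * n) := by
  have hn1 : (1 : ℝ) ≤ n := by exact_mod_cast hn
  have h0 : 0 < c * n := by positivity
  rw [Real.exp_neg, ← one_div]
  gcongr
  linarith [Real.add_one_le_exp (c * (n : ℝ))]

/-- Without truncation the expectation is at most `1 / (2π)`. Truncation, which is needed to make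
the contributions bounded, changes it by at most `n exp(-26 n) ≤ 1/26`, and the sum of the two is
just below `1/5`. -/
theorem IsDualPair.tsum_momentTest_le (h : IsDualPair b d) (hn : 1 ≤ n) {r : ℝ} (hr : 0 < r)
    (hb : ∀ v : Fin n → ℤ, v ≠ 0 → 5 * Real.sqrt n / r ≤ ‖intComb b v‖) {σ : ℝ} (hσ : |σ| = 1)
    (j k : Fin n) : ∑' z, prob d r z * momentTest n r σ j k (intComb d z) ≤ 1 / 5 := by
  classical
  have hn1 : (1 : ℝ) ≤ n := by exact_mod_cast hn
  obtain ⟨h1, h2⟩ := h.moment_le hn hr hb j k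
  obtain ⟨h3, h4⟩ := h.moment_cutoff_le hr
  have h5 : ∀ z, prob d r z * momentTest n r σ j k (intComb d z) ≤
      σ * weight n j k / r ^ 2 * (prob d r z * (intComb d z j * intComb d z k)) +
      n * (prob d r z * if cutoff n r ≤ ‖intComb d z‖ then (‖intComb d z‖ / r) ^ 2 else 0) := by
    intro z
    have hp := h.prob_nonneg hr z
    unfold momentTest
    split_ifs with hz
    · have h6 := abs_mul_le_sq_norm (r := r) hn (intComb d z) j k
      have h7 : |σ * (weight n j k * (intComb d z j * intComb d z k) / r ^ 2)| ≤
          n * (‖intComb d z‖ / r) ^ 2 := by rwa [abs_mul, hσ, one_mul]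
      have h8 := (abs_le.1 h7).1
      have h9 := mul_nonneg hp (by linarith : 0 ≤ σ * (weight n j k *
        (intComb d z j * intComb d z k) / r ^ 2) + n * (‖intComb d z‖ / r) ^ 2)
      rw [mul_zero]
      refine h9.trans_eq ?_
      ring
    · apply le_of_eq
      ring
  have hbd : Summable fun z => prob d r z * momentTest n r σ j k (intComb d z) :=
    summable_mul_of_bounded (h.prob_nonneg hr) (h.hasSum_prob hr).summable
      fun z => abs_momentTest_le hn hr hσ j k _
  have h6 := hbd.tsum_le_tsum h5 ((h1.mul_left _).add (h3.mul_left _))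
  rw [(h1.mul_left _).tsum_add (h3.mul_left _), tsum_mul_left, tsum_mul_left] at h6
  set c := ∑' z, prob d r z * (intComb d z j * intComb d z k)
  have h7 : σ * weight n j k / r ^ 2 * c ≤ 1 / (2 * Real.pi) := by
    have e : σ * weight n j k / r ^ 2 * c = σ * (weight n j k * c) / r ^ 2 := by ring
    rw [e, div_le_iff₀ (by positivity)]
    refine (le_abs_self _).trans ?_
    rw [abs_mul, hσ, one_mul]
    refine h2.trans_eq ?_
    ring
  have h8 : (n : ℝ) * Real.exp (-(26 * n)) ≤ 1 / 26 := by
    have := exp_neg_mul_le (c := 26) (by norm_num) hn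
    calc (n : ℝ) * Real.exp (-(26 * n)) ≤ n * (1 / (26 * n)) := by gcongr
      _ = _ := by field_simp
  have h9 : (n : ℝ) * ∑' z, (prob d r z * if cutoff n r ≤ ‖intComb d z‖ then
      (‖intComb d z‖ / r) ^ 2 else 0) ≤ n * Real.exp (-(26 * n)) := by gcongr
  have h10 : 1 / (2 * Real.pi) ≤ 1 / (2 * 3.14) := by
    gcongr
    exact Real.pi_gt_d2.le
  norm_num at h10 h8 h9 h7 h6 ⊢
  linarith

/-- The contribution of a sample to the test of the distance. -/
noncomputable def distTest (t w : E n) : ℝ :=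
  2 - 40 * (inner ℝ w t - round (inner ℝ w t)) ^ 2

theorem sq_sub_round_le (x : ℝ) : (x - round x) ^ 2 ≤ 1 / 4 := by
  have h := abs_sub_round x
  rw [← sq_abs]
  nlinarith [abs_nonneg (x - round x)]

theorem abs_distTest_le (hn : 1 ≤ n) (t w : E n) : |distTest t w| ≤ 20 * n ^ 2 := by
  have hn1 : (1 : ℝ) ≤ n := by exact_mod_cast hn
  have h1 := sq_sub_round_le (inner ℝ w t)
  have h2 := sq_nonneg (inner ℝ w t - round (inner ℝ w t) : ℝ)
  unfold distTest
  rw [abs_le]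
  constructor <;> nlinarith

/-- The characteristic function at `t` is at most `1/40`, because every vector of the coset `t + L`
is long. The cosine does not change when the nearest integer is subtracted, so `1 - cos(2πx) ≤ 2π²
(x - round x)²` bounds the mean squared distance to the integers from below by nearly `1 / (2π²)`.
After scaling by 40 and subtraction from 2 less than `1/5` remains. -/
theorem IsDualPair.tsum_distTest_le (h : IsDualPair b d) (hn : 1 ≤ n) {r : ℝ} (hr : 0 < r) {t : E n}
    (ht : ∀ v : Fin n → ℤ, 5 * Real.sqrt n / r ≤ ‖t + intComb b v‖) :
    ∑' z, prob d r z * distTest t (intComb d z) ≤ 1 / 5 := by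
  have hr' : 0 < 1 / r := by positivity
  have h1 := h.gsum_le_of_forall hr' (by positivity) ht
  have e1 : (5 * Real.sqrt n / r / (1 / r)) ^ 2 = 25 * n := by
    rw [div_div, mul_one_div_cancel hr.ne', div_one, mul_pow, Real.sq_sqrt (by positivity)]
    norm_num
  rw [e1] at h1
  have h2 : Real.exp (-(3 * Real.pi / 4) * (25 * n)) * 2 ^ n ≤ 1 / 40 := by
    have h3 := exp_mul_two_pow_le (c := 40) (c' := 3 * Real.pi / 4 * 25)
      (by nlinarith [Real.pi_gt_three]) n
    have hn1 : (1 : ℝ) ≤ n := by exact_mod_cast hn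
    have h4 : Real.exp (-(40 * n)) ≤ 1 / 40 := by
      refine (exp_neg_mul_le (c := 40) (by norm_num) hn).trans ?_
      gcongr
      linarith
    refine le_trans (le_of_eq ?_) (h3.trans h4)
    congr 2
    ring
  have h0 := h.gsum_zero_pos hr'
  have h3 : gsum b (1 / r) t / gsum b (1 / r) 0 ≤ 1 / 40 :=
    (div_le_iff₀ h0).2 (h1.trans (by gcongr))
  have hc := h.hasSum_prob_mul_cos hr t
  have h5 : ∀ z, prob d r z * distTest t (intComb d z) ≤
      prob d r z * (2 - 20 / Real.pi ^ 2) + 20 / Real.pi ^ 2 *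
        (prob d r z * Real.cos (2 * Real.pi * inner ℝ (intComb d z) t)) := by
    intro z
    set x : ℝ := inner ℝ (intComb d z) t with hx
    have e : Real.cos (2 * Real.pi * x) = Real.cos (2 * Real.pi * (x - round x)) := by
      have : 2 * Real.pi * (x - round x) = 2 * Real.pi * x - (round x : ℤ) * (2 * Real.pi) := by
        ring
      rw [this, Real.cos_sub_int_mul_two_pi]
    have h6 := Real.one_sub_sq_div_two_le_cos (x := 2 * Real.pi * (x - round x))
    rw [← e] at h6
    have h7 : 20 / Real.pi ^ 2 * (1 - (2 * Real.pi * (x - round x)) ^ 2 / 2) ≤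
        20 / Real.pi ^ 2 * Real.cos (2 * Real.pi * x) := by gcongr
    have e2 : 20 / Real.pi ^ 2 * (1 - (2 * Real.pi * (x - round x)) ^ 2 / 2) =
        20 / Real.pi ^ 2 - 40 * (x - round x) ^ 2 := by
      have := Real.pi_ne_zero
      field_simp
      ring
    rw [e2] at h7
    have h8 := mul_le_mul_of_nonneg_left h7 (h.prob_nonneg hr z)
    unfold distTest
    rw [← hx]
    linarith
  have hp := h.hasSum_prob hr
  have hbd : Summable fun z => prob d r z * distTest t (intComb d z) :=
    summable_mul_of_bounded (h.prob_nonneg hr) hp.summable fun z => abs_distTest_le hn t _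
  have h6 := hasSum_le h5 hbd.hasSum ((hp.mul_right _).add (hc.mul_left (20 / Real.pi ^ 2)))
  have h7 : 1.97 ≤ 20 / Real.pi ^ 2 := by
    rw [le_div_iff₀ (by positivity)]
    nlinarith [Real.pi_lt_d2, Real.pi_pos]
  have h8 : 20 / Real.pi ^ 2 ≤ 20 / 9 := by
    gcongr
    nlinarith [Real.pi_gt_three]
  have h9 : 20 / Real.pi ^ 2 * (gsum b (1 / r) t / gsum b (1 / r) 0) ≤ 20 / 9 * (1 / 40) := by
    refine mul_le_mul h8 h3 ?_ (by norm_num)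
    exact div_nonneg (tsum_nonneg fun v => (rho_pos _ _).le) h0.le
  norm_num at h6 h7 h9 ⊢
  linarith

/-- The bound for exponential moments that is behind Chernoff's inequality. -/
theorem tsum_exp_le {ι : Type*} {p X : ι → ℝ} (hp : ∀ i, 0 ≤ p i) (hs : HasSum p 1) {M l μ : ℝ}
    (hX : ∀ i, |X i| ≤ M) (hl : 0 ≤ l) (hM : l * M ≤ 1) (hμ : ∑' i, p i * X i ≤ μ) :
    Summable (fun i => p i * Real.exp (l * X i)) ∧
    ∑' i, p i * Real.exp (l * X i) ≤ Real.exp (l * μ + l ^ 2 * M ^ 2) := by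
  have hsX := summable_mul_of_bounded hp hs.summable hX
  have habs : ∀ i, |l * X i| ≤ l * M := fun i => by
    rw [abs_mul, abs_of_nonneg hl]
    exact mul_le_mul_of_nonneg_left (hX i) hl
  have h1 : Summable (fun i => p i * Real.exp (l * X i)) := by
    refine summable_mul_of_bounded hp hs.summable (C := Real.exp 1) fun i => ?_
    rw [abs_of_pos (Real.exp_pos _), Real.exp_le_exp]
    exact (le_abs_self _).trans ((habs i).trans hM)
  refine ⟨h1, ?_⟩
  have h2 : ∀ i, p i * Real.exp (l * X i) ≤ p i * (1 + l ^ 2 * M ^ 2) + l * (p i * X i) := by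
    intro i
    have h3 := (abs_le.1 (Real.abs_exp_sub_one_sub_id_le ((habs i).trans hM))).2
    have h4 : (l * X i) ^ 2 ≤ l ^ 2 * M ^ 2 := by
      rw [← mul_pow]
      exact sq_le_sq' (abs_le.1 (habs i)).1 (abs_le.1 (habs i)).2
    have h5 := mul_le_mul_of_nonneg_left (by linarith :
      Real.exp (l * X i) ≤ 1 + l ^ 2 * M ^ 2 + l * X i) (hp i)
    linarith
  have h3 := hasSum_le h2 h1.hasSum ((hs.mul_right _).add (hsX.hasSum.mul_left l))
  have h4 : l * ∑' i, p i * X i ≤ l * μ := by gcongr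
  have h5 := Real.add_one_le_exp (l * μ + l ^ 2 * M ^ 2)
  linarith

end Tests

/-! ### Expectations for independent answers -/

section Tape

open scoped ENNReal

/-- The expectation of a nonnegative function. -/
noncomputable def expect {α : Type*} (p : PMF α) (f : α → ℝ≥0∞) : ℝ≥0∞ := ∑' a, p a * f a

theorem toOuterMeasure_le_expect {α : Type*} (p : PMF α) {s : Set α} {f : α → ℝ≥0∞}
    (h : ∀ a ∈ s, 1 ≤ f a) : p.toOuterMeasure s ≤ expect p f := by
  rw [PMF.toOuterMeasure_apply, expect]
  refine ENNReal.tsum_le_tsum fun a => ?_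
  by_cases ha : a ∈ s
  · rw [Set.indicator_of_mem ha]
    exact le_mul_of_one_le_right (zero_le) (h a ha)
  · rw [Set.indicator_of_notMem ha]
    exact zero_le

theorem expect_bind {α β : Type*} (p : PMF α) (q : α → PMF β) (f : β → ℝ≥0∞) :
    expect (p.bind q) f = expect p fun a => expect (q a) f := by
  simp only [expect, PMF.bind_apply, ← ENNReal.tsum_mul_right, ← ENNReal.tsum_mul_left]
  rw [ENNReal.tsum_comm]
  simp only [mul_assoc]

theorem expect_pure {α : Type*} (a : α) (f : α → ℝ≥0∞) : expect (PMF.pure a) f = f a := by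
  classical
  rw [expect, tsum_eq_single a fun b hb => by simp [hb]]
  simp

theorem expect_map {α β : Type*} (p : PMF α) (g : α → β) (f : β → ℝ≥0∞) :
    expect (p.map g) f = expect p fun a => f (g a) := by
  rw [PMF.map, expect_bind]
  simp [expect_pure]

theorem expect_mul_left {α : Type*} (p : PMF α) (c : ℝ≥0∞) (f : α → ℝ≥0∞) :
    (expect p fun a => c * f a) = c * expect p f := by
  rw [expect, expect, ← ENNReal.tsum_mul_left]
  exact tsum_congr fun a => mul_left_comm _ _ _

theorem expect_mul_right {α : Type*} (p : PMF α) (c : ℝ≥0∞) (f : α → ℝ≥0∞) :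
    (expect p fun a => f a * c) = expect p f * c := by
  rw [expect, expect, ← ENNReal.tsum_mul_right]
  exact tsum_congr fun a => (mul_assoc _ _ _).symm

theorem expect_one {α : Type*} (p : PMF α) : (expect p fun _ => 1) = 1 := by
  simp [expect, p.tsum_coe]

theorem expect_tape (O : Oracle) : ∀ (qs : List (List ℤ)) (f : ℕ → List ℤ → ℝ≥0∞),
    (expect (tape O qs) fun as => ∏ s ∈ Finset.range qs.length, f s (as.getD s [])) =
      ∏ s ∈ Finset.range qs.length, expect (O (qs.getD s [])) (f s)
  | [], f => by simp [expect_one]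
  | q :: qs, f => by
    rw [tape, expect_bind, List.length_cons, Finset.prod_range_succ', List.getD_cons_zero]
    simp only [expect_map, Finset.prod_range_succ', List.getD_cons_succ, List.getD_cons_zero,
      expect_mul_right]
    rw [expect_mul_left, expect_tape O qs fun s => f (s + 1)]

/-- Independent answers, where only the answers with numbers in `S` matter. -/
theorem toOuterMeasure_tape_le (O : Oracle) {qs : List (List ℤ)} {S : Finset ℕ}
    (hS : S ⊆ Finset.range qs.length) {A : Set (List (List ℤ))} {f : List ℤ → ℝ≥0∞} {c : ℝ≥0∞}
    (hA : ∀ as ∈ A, 1 ≤ ∏ s ∈ S, f (as.getD s []))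
    (hc : ∀ s ∈ S, expect (O (qs.getD s [])) f ≤ c) :
    (tape O qs).toOuterMeasure A ≤ c ^ S.card := by
  have h1 := expect_tape O qs fun s a => if s ∈ S then f a else 1
  have e : ∀ g : ℕ → ℝ≥0∞, ∏ s ∈ Finset.range qs.length, (if s ∈ S then g s else 1) =
      ∏ s ∈ S, g s := by
    intro g
    rw [Finset.prod_ite_mem, Finset.inter_eq_right.2 hS]
  simp only [e] at h1
  refine (toOuterMeasure_le_expect _ hA).trans ?_
  rw [h1, ← Finset.prod_const]
  have e2 : ∀ s, expect (O (qs.getD s [])) (fun a => if s ∈ S then f a else 1) =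
      if s ∈ S then expect (O (qs.getD s [])) f else 1 := by
    intro s
    split_ifs
    · rfl
    · exact expect_one _
  simp only [e2, e]
  exact Finset.prod_le_prod' hc

theorem toOuterMeasure_tape_single_le (O : Oracle) {qs : List (List ℤ)} {s : ℕ}
    (hs : s < qs.length) {A : Set (List ℤ)} {c : ℝ≥0∞}
    (hc : (O (qs.getD s [])).toOuterMeasure A ≤ c) :
    (tape O qs).toOuterMeasure {as | as.getD s [] ∈ A} ≤ c := by
  classical
  have h := toOuterMeasure_tape_le O (qs := qs) (S := {s}) (by simpa using hs)
    (A := {as | as.getD s [] ∈ A}) (f := A.indicator 1) (c := c)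
    (fun as has => by
      rw [Finset.prod_singleton, Set.indicator_of_mem (show as.getD s [] ∈ A from has)]
      rfl)
    (fun s' hs' => by
      rw [Finset.mem_singleton.1 hs']
      refine le_trans (le_of_eq ?_) hc
      rw [PMF.toOuterMeasure_apply, expect]
      refine tsum_congr fun a => ?_
      by_cases ha : a ∈ A <;> simp [ha])
  simpa using h

/-- Chernoff's inequality for a block of independent answers. -/
theorem toOuterMeasure_tape_sum_le (O : Oracle) {qs : List (List ℤ)} {i N : ℕ}
    (hi : (i + 1) * N ≤ qs.length) {X : List ℤ → ℝ} {l e : ℝ} (hl : 0 < l)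
    (hc : ∀ s, s / N = i → expect (O (qs.getD s [])) (fun a => ENNReal.ofReal (Real.exp (l * X a))) ≤
      ENNReal.ofReal (Real.exp e)) :
    (tape O qs).toOuterMeasure
      {as | (N : ℝ) ≤ ∑ s ∈ Finset.range N, X (as.getD (i * N + s) [])} ≤
      ENNReal.ofReal (Real.exp (N * (e - l))) := by
  have hblock : ∀ s ∈ Finset.Ico (i * N) ((i + 1) * N), s / N = i := fun s hs =>
    Nat.div_eq_of_lt_le (Finset.mem_Ico.1 hs).1 (Finset.mem_Ico.1 hs).2
  have hcard : (Finset.Ico (i * N) ((i + 1) * N)).card = N := by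
    rw [Nat.card_Ico, add_mul, one_mul, Nat.add_sub_cancel_left]
  have h := toOuterMeasure_tape_le O (qs := qs) (S := Finset.Ico (i * N) ((i + 1) * N))
    (fun s hs => Finset.mem_range.2 ((Finset.mem_Ico.1 hs).2.trans_le hi))
    (A := {as | (N : ℝ) ≤ ∑ s ∈ Finset.range N, X (as.getD (i * N + s) [])})
    -- Exponential Markov inequality: on the event the product of these factors is at least one, and
    -- its expectation factors over the independent answers.
    (f := fun a => ENNReal.ofReal (Real.exp (l * (X a - 1)))) (c := ENNReal.ofReal (Real.exp (e - l)))
    (fun as has => by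
      rw [Finset.prod_Ico_eq_prod_range, ← Nat.card_Ico, hcard,
        ← ENNReal.ofReal_prod_of_nonneg fun _ _ => (Real.exp_pos _).le, ← Real.exp_sum,
        ← Finset.mul_sum, Finset.sum_sub_distrib, Finset.sum_const, Finset.card_range, nsmul_one]
      rw [ENNReal.one_le_ofReal]
      exact Real.one_le_exp (mul_nonneg hl.le (sub_nonneg.2 has)))
    (fun s hs => by
      have e1 : (fun a => ENNReal.ofReal (Real.exp (l * (X a - 1)))) = fun a =>
          ENNReal.ofReal (Real.exp (l * X a)) * ENNReal.ofReal (Real.exp (-l)) := by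
        ext a
        rw [← ENNReal.ofReal_mul (Real.exp_pos _).le, ← Real.exp_add]
        congr 2
        ring
      rw [e1, expect_mul_right, sub_eq_add_neg, Real.exp_add,
        ENNReal.ofReal_mul (Real.exp_pos _).le]
      gcongr
      exact hc s (hblock s hs))
  refine h.trans_eq ?_
  rw [hcard, ← ENNReal.ofReal_pow (Real.exp_pos _).le, ← Real.exp_nat_mul]

end Tape

/-! ### Answers that are samples from a discrete Gaussian distribution -/

section Samples

open scoped ENNReal

variable {n : ℕ} {b d : Fin n → E n}

/-- The answers are integer vectors, with given probabilities. -/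
theorem expect_eq_tsum {p : PMF (List ℤ)} {pr : (Fin n → ℤ) → ℝ} (h0 : ∀ z, 0 ≤ pr z)
    (h1 : HasSum pr 1) (hp : ∀ z, p (List.ofFn z) = ENNReal.ofReal (pr z)) (F : List ℤ → ℝ≥0∞) :
    expect p F = ∑' z, ENNReal.ofReal (pr z) * F (List.ofFn z) := by
  have hinj : Function.Injective (List.ofFn : (Fin n → ℤ) → List ℤ) := List.ofFn_injective
  have hr : ∑' a : Set.range (List.ofFn : (Fin n → ℤ) → List ℤ), p a = 1 := by
    rw [tsum_range _ hinj]
    simp only [hp]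
    rw [← ENNReal.ofReal_tsum_of_nonneg h0 h1.summable, h1.tsum_eq, ENNReal.ofReal_one]
  -- The prescribed probabilities of the coefficient lists add up to one, so nothing is left for
  -- other lists.
  have hc : ∑' a : ((Set.range (List.ofFn : (Fin n → ℤ) → List ℤ))ᶜ : Set (List ℤ)), p a = 0 := by
    have h2 := ENNReal.summable.tsum_add_tsum_compl (f := p)
      (s := Set.range (List.ofFn : (Fin n → ℤ) → List ℤ)) ENNReal.summable
    rw [hr, p.tsum_coe] at h2
    exact (ENNReal.add_right_inj ENNReal.one_ne_top).1 (h2.trans (add_zero 1).symm)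
  have hz : ∀ a, a ∉ Set.range (List.ofFn : (Fin n → ℤ) → List ℤ) → p a = 0 := fun a ha =>
    ENNReal.tsum_eq_zero.1 hc ⟨a, ha⟩
  rw [expect, ← hinj.tsum_eq (f := fun a => p a * F a)]
  · simp only [hp]
  · intro a ha
    by_contra h
    exact ha (by simp [hz a h])

theorem expect_ofReal {p : PMF (List ℤ)} {pr : (Fin n → ℤ) → ℝ} (h0 : ∀ z, 0 ≤ pr z)
    (h1 : HasSum pr 1) (hp : ∀ z, p (List.ofFn z) = ENNReal.ofReal (pr z)) {f : List ℤ → ℝ}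
    (hf : ∀ a, 0 ≤ f a) (hs : Summable fun z => pr z * f (List.ofFn z)) :
    (expect p fun a => ENNReal.ofReal (f a)) =
      ENNReal.ofReal (∑' z, pr z * f (List.ofFn z)) := by
  rw [expect_eq_tsum h0 h1 hp, ENNReal.ofReal_tsum_of_nonneg (fun z => mul_nonneg (h0 z) (hf _)) hs]
  simp only [ENNReal.ofReal_mul (h0 _)]

/-- The vector with the coefficients given by a list. -/
noncomputable def answerVec (d : Fin n → E n) (a : List ℤ) : E n :=
  intComb d fun l => a.getD l 0

theorem answerVec_ofFn (d : Fin n → E n) (z : Fin n → ℤ) :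
    answerVec d (List.ofFn z) = intComb d z := by
  unfold answerVec
  congr 1
  ext l
  simp

/-- The answers that are coefficients of short vectors. -/
def goodAnswers (d : Fin n → E n) (r : ℝ) : Set (List ℤ) :=
  {a | ∃ z : Fin n → ℤ, a = List.ofFn z ∧ ‖intComb d z‖ < cutoff n r}

theorem IsDualPair.goodAnswers_compl_le (h : IsDualPair b d) {r : ℝ} (hr : 0 < r)
    {p : PMF (List ℤ)} (hp : ∀ z, p (List.ofFn z) = ENNReal.ofReal (prob d r z)) :
    p.toOuterMeasure (goodAnswers d r)ᶜ ≤ ENNReal.ofReal (Real.exp (-(40 * n))) := by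
  classical
  obtain ⟨h1, h2⟩ := h.prob_cutoff_le hr
  refine (toOuterMeasure_le_expect p (f := fun a => if a ∈ goodAnswers d r then 0 else 1)
    fun a ha => by rw [if_neg ha]).trans ?_
  rw [expect_eq_tsum (h.prob_nonneg hr) (h.hasSum_prob hr) hp]
  refine le_trans (le_of_eq ?_) (ENNReal.ofReal_le_ofReal h2)
  rw [ENNReal.ofReal_tsum_of_nonneg (fun z => mul_nonneg (h.prob_nonneg hr z)
    (by split_ifs <;> norm_num)) h1]
  refine tsum_congr fun z => ?_
  have : List.ofFn z ∈ goodAnswers d r ↔ ‖intComb d z‖ < cutoff n r := by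
    constructor
    · rintro ⟨z', h3, h4⟩
      rwa [List.ofFn_injective h3]
    · intro h3
      exact ⟨z, rfl, h3⟩
  rw [ENNReal.ofReal_mul (h.prob_nonneg hr z)]
  congr 1
  by_cases h3 : ‖intComb d z‖ < cutoff n r
  · rw [if_pos (this.2 h3), if_neg (not_le.2 h3), ENNReal.ofReal_zero]
  · rw [if_neg (fun h4 => h3 (this.1 h4)), if_pos (not_lt.1 h3), ENNReal.ofReal_one]

/-- The tail bound for a test that is the sum of independent contributions of the samples. -/
theorem IsDualPair.test_tail_le (h : IsDualPair b d) (hn : 1 ≤ n) {r : ℝ} (hr : 0 < r) {O : Oracle}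
    {qs : List (List ℤ)} {i N : ℕ} (hi : (i + 1) * N ≤ qs.length) (hN : N = 10 ^ 5 * n ^ 5)
    (hO : ∀ s, s / N = i → ∀ z, O (qs.getD s []) (List.ofFn z) = ENNReal.ofReal (prob d r z))
    {X : E n → ℝ} (hX : ∀ w, |X w| ≤ 20 * n ^ 2)
    (hE : ∑' z, prob d r z * X (intComb d z) ≤ 1 / 5) :
    (tape O qs).toOuterMeasure
      {as | (N : ℝ) ≤ ∑ s ∈ Finset.range N, X (answerVec d (as.getD (i * N + s) []))} ≤
      ENNReal.ofReal (Real.exp (-(40 * n))) := by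
  have hn1 : (1 : ℝ) ≤ n := by exact_mod_cast hn
  -- With contributions bounded by `20 n²` and mean at most `1/5`, the exponent per sample is `l/5 +
  -- 400 n⁴ l² - l`, and this choice makes it `-(2/5) l`. Multiplied by `N = 10⁵ n⁵` it is exactly
  -- `-40 n`.
  set l : ℝ := 1 / (1000 * n ^ 4) with hl
  have hl0 : 0 < l := by positivity
  have hp := h.hasSum_prob hr
  have h0 := h.prob_nonneg hr
  obtain ⟨h1, h2⟩ := tsum_exp_le (l := l) h0 hp (fun z => hX (intComb d z)) hl0.le (by
    rw [hl, div_mul_eq_mul_div, one_mul, div_le_one (by positivity)]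
    nlinarith [one_le_pow₀ hn1 (n := 2)]) hE
  refine (toOuterMeasure_tape_sum_le O hi (X := fun a => X (answerVec d a)) hl0
    (e := l * (1 / 5) + l ^ 2 * (20 * n ^ 2) ^ 2) fun s hs => ?_).trans ?_
  · rw [expect_ofReal h0 hp (hO s hs) (fun a => (Real.exp_pos _).le)
      (by simpa only [answerVec_ofFn] using h1)]
    simp only [answerVec_ofFn]
    exact ENNReal.ofReal_le_ofReal h2
  · refine ENNReal.ofReal_le_ofReal (Real.exp_le_exp.2 (le_of_eq ?_))
    rw [hN, hl]
    push_cast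
    field_simp
    norm_num

/-! ## Lattices with dual bases -/

theorem comb_eq_intComb (B : LatticeBasis n) (z : Fin n → ℤ) : B.comb z = intComb B.vec z := rfl

theorem mem_span_iff (d : Fin n → E n) (x : E n) :
    x ∈ Submodule.span ℤ (Set.range d) ↔ ∃ z, intComb d z = x :=
  Submodule.mem_span_range_iff_exists_fun ℤ

theorem IsDualPair.intComb_injective (h : IsDualPair b d) : Function.Injective (intComb b) := by
  intro y z hyz
  ext j
  have h1 := h.inner_intComb y j
  rw [hyz, h.inner_intComb] at h1
  exact_mod_cast h1.symm

theorem IsDualPair.inner_intComb_intComb (h : IsDualPair b d) (y z : Fin n → ℤ) :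
    inner ℝ (intComb b y) (intComb d z) = ((∑ i, y i * z i : ℤ) : ℝ) := by
  rw [real_inner_comm, ← realComb_intVec b, h.inner_realComb_intComb]
  push_cast
  exact Finset.sum_congr rfl fun i _ => mul_comm _ _

theorem IsDualPair.dual_span (h : IsDualPair b d) :
    dual (Submodule.span ℤ (Set.range d)) = Submodule.span ℤ (Set.range b) := by
  ext x
  rw [mem_span_iff]
  constructor
  · intro hx
    have h1 : ∀ j, ∃ k : ℤ, inner ℝ (d j) x = (k : ℝ) := fun j =>
      hx _ (Submodule.subset_span ⟨j, rfl⟩)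
    choose z hz using h1
    refine ⟨z, ?_⟩
    obtain ⟨y, rfl⟩ := h.exists_realComb x
    rw [← realComb_intVec]
    congr 1
    ext j
    rw [intVec, ← hz, real_inner_comm, h.inner_realComb]
  · rintro ⟨z, rfl⟩ y hy
    obtain ⟨y, rfl⟩ := (mem_span_iff d y).1 hy
    exact ⟨_, h.symm.inner_intComb_intComb y z⟩

theorem IsDualPair.rhoSum_span (h : IsDualPair b d) (s : ℝ) :
    rhoSum s (Submodule.span ℤ (Set.range d) : Set (E n)) = gsum d s 0 := by
  have e : (Submodule.span ℤ (Set.range d) : Set (E n)) = Set.range (intComb d) := by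
    ext x
    exact mem_span_iff d x
  rw [rhoSum, e, tsum_range (rho s) h.symm.intComb_injective, gsum]
  simp only [zero_add]

theorem lambda1_le_of_mem {L : Submodule ℤ (E n)} {x : E n} (hx : x ∈ L) (h0 : x ≠ 0) :
    lambda1 L ≤ ‖x‖ :=
  csInf_le ⟨0, by rintro _ ⟨y, -, -, rfl⟩; exact norm_nonneg y⟩ ⟨x, hx, h0, rfl⟩

theorem infDist_le_of_mem {L : Submodule ℤ (E n)} {t x : E n} (hx : x ∈ L) :
    Metric.infDist t (L : Set (E n)) ≤ ‖t - x‖ := by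
  rw [← dist_eq_norm]
  exact Metric.infDist_le_dist_of_mem hx

end Samples

theorem flatten_ofFn (n : ℕ) (f : ℕ → ℕ → ℤ) :
    (List.ofFn fun i : Fin n => List.ofFn fun j : Fin n => f i j).flatten =
      (List.range (n * n)).map fun x => f (x / n) (x % n) := by
  have h : ∀ (m : ℕ) (f : ℕ → ℤ), (List.range m).map f = List.ofFn fun x : Fin m => f x :=
    fun m f => List.ext_getElem (by simp) (by simp)
  rw [h, List.ofFn_mul]
  congr 2
  ext1 i
  congr 1
  ext1 j
  obtain ⟨h1, h2⟩ := mul_add_div_mod i j.2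
  simp only [h1, h2]

namespace RunData

/-! ## The geometry behind the integer computations -/

/-- The data describe full rank lattices. -/
structure Regular (r : RunData) : Prop where
  n_pos : 1 ≤ r.n
  N_pos : 1 ≤ r.N
  a_pos : 0 < r.a
  g_pos : 0 < r.g
  s_pos : 0 < r.s
  dn_pos : 0 < r.dn
  dd_pos : 0 < r.dd
  det_ne_zero : r.A.det ≠ 0
  F_pos : ∀ i < r.K, ∀ j < r.n, 0 < r.F i j

/-- The parameter of the discrete Gaussian distributions. -/
noncomputable def radius (r : RunData) : ℝ := r.dd / (20 * r.dn)

/-- The bases of the lattices of the family. -/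
noncomputable def primal (r : RunData) (i : ℕ) (j : Fin r.n) : E r.n :=
  WithLp.toLp 2 fun k => (r.g : ℝ) / r.F i j / r.a * r.A j k

/-- The dual bases. -/
noncomputable def dualVec (r : RunData) (i : ℕ) (j : Fin r.n) : E r.n :=
  WithLp.toLp 2 fun k => (r.num i j k : ℝ) / r.den

/-- The targets. -/
noncomputable def target (r : RunData) (i : ℕ) : E r.n :=
  WithLp.toLp 2 fun k => (r.τ i k : ℝ) / r.s

variable {r : RunData}

theorem Regular.c_ne_zero (h : r.Regular) : r.c ≠ 0 := leverrier_ne_zero h.det_ne_zero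

theorem Regular.den_pos (h : r.Regular) : 0 < r.den := by
  have h1 : (0 : ℤ) < r.g := by exact_mod_cast h.g_pos
  exact mul_pos h1 (mul_self_pos.2 h.c_ne_zero)

/-- The last matrix `M` of the algorithm satisfies `A M = -c`, so `-M / c` is the inverse of `A`.
The numerators contain it scaled by `F` and `a`, which undo the scaling of the primal basis. -/
theorem sum_mul_num (i : ℕ) (j j' : Fin r.n) :
    ∑ k, r.A j k * r.num i j' k = r.F i j' * r.a * r.c * (if j = j' then r.c else 0) := by
  have h1 := congrFun (congrFun (mul_leverrier r.A) j) j'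
  rw [Matrix.mul_apply, Matrix.neg_apply, Matrix.smul_apply, Matrix.one_apply] at h1
  have h2 : ∀ k : Fin r.n, r.A j k * r.num i j' k =
      -(r.F i j' * r.a * r.c) * (r.A j k * (leverrier r.A r.n).1 k j') := by
    intro k
    rw [num, entry_coe]
    ring
  rw [Finset.sum_congr rfl fun k _ => h2 k, ← Finset.mul_sum, h1, smul_eq_mul]
  split_ifs
  · rw [RunData.c]; ring
  · ring

theorem Regular.isDualPair (h : r.Regular) {i : ℕ} (hi : i < r.K) :
    IsDualPair (r.primal i) (r.dualVec i) := by
  intro j j'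
  have hF : (r.F i j : ℝ) ≠ 0 := by exact_mod_cast (h.F_pos i hi j j.2).ne'
  have hc : (r.c : ℝ) ≠ 0 := by exact_mod_cast h.c_ne_zero
  have ha : (r.a : ℝ) ≠ 0 := by exact_mod_cast h.a_pos.ne'
  have hg : (r.g : ℝ) ≠ 0 := by exact_mod_cast h.g_pos.ne'
  have hden : (r.den : ℝ) = r.g * (r.c * r.c) := by rw [den]; push_cast; rfl
  have h1 : inner ℝ (r.primal i j) (r.dualVec i j') =
      (r.g : ℝ) / r.F i j / r.a / r.den * ((∑ k, r.A j k * r.num i j' k : ℤ) : ℝ) := by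
    rw [PiLp.inner_apply]
    push_cast
    rw [Finset.mul_sum]
    refine Finset.sum_congr rfl fun k _ => ?_
    simp only [primal, dualVec, RCLike.inner_apply, conj_trivial]
    ring
  rw [h1, sum_mul_num, hden]
  split_ifs with hjj
  · subst hjj
    push_cast
    field_simp
  · simp

/-- The basis in the `i`-th query. -/
def dualBasis (h : r.Regular) {i : ℕ} (hi : i < r.K) : LatticeBasis r.n where
  num := Matrix.of fun j k => r.num i j k
  den := r.den.toNat
  den_pos := by have := h.den_pos; omega
  -- The product of `A` with the transposed numerators is diagonal with nonzero entries.
  det_ne_zero := by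
    intro h0
    have h1 : r.A * (Matrix.of fun j k : Fin r.n => r.num i j k).transpose =
        Matrix.diagonal fun j : Fin r.n => r.F i j * r.a * r.c * r.c := by
      ext j j'
      rw [Matrix.mul_apply, Matrix.diagonal_apply]
      simp only [Matrix.transpose_apply, Matrix.of_apply]
      rw [sum_mul_num]
      split_ifs with hjj
      · rw [hjj]
      · rw [mul_zero]
    have h2 := congrArg Matrix.det h1
    rw [Matrix.det_mul, Matrix.det_transpose, h0, mul_zero, Matrix.det_diagonal] at h2
    refine Finset.prod_ne_zero_iff.2 (fun j _ => ?_) h2.symm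
    have h3 := h.F_pos i hi j j.2
    have h4 := h.a_pos
    have h5 := h.c_ne_zero
    positivity

theorem dualBasis_vec (h : r.Regular) {i : ℕ} (hi : i < r.K) :
    (dualBasis h hi).vec = r.dualVec i := by
  ext j k
  have h1 : ((r.den.toNat : ℕ) : ℝ) = (r.den : ℝ) := by
    have : ((r.den.toNat : ℕ) : ℤ) = r.den := Int.toNat_of_nonneg h.den_pos.le
    exact_mod_cast this
  change ((r.num i j k : ℤ) : ℝ) / ((r.den.toNat : ℕ) : ℝ) = _
  rw [h1]
  rfl

theorem dualBasis_lattice (h : r.Regular) {i : ℕ} (hi : i < r.K) :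
    (dualBasis h hi).lattice = Submodule.span ℤ (Set.range (r.dualVec i)) := by
  rw [LatticeBasis.lattice, dualBasis_vec]

theorem Regular.dual_dualBasis_lattice (h : r.Regular) {i : ℕ} (hi : i < r.K) :
    dual (dualBasis h hi).lattice = Submodule.span ℤ (Set.range (r.primal i)) := by
  rw [dualBasis_lattice, (h.isDualPair hi).dual_span]

/-- The parameter in the queries. -/
def radiusQ (h : r.Regular) : PosRational where
  num := r.dd
  den := 20 * r.dn
  num_pos := h.dd_pos
  den_pos := Nat.mul_pos (by norm_num) h.dn_pos

theorem radiusQ_val (h : r.Regular) : (radiusQ h).val = r.radius := by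
  simp [radiusQ, PosRational.val, radius]

theorem Regular.radius_pos (h : r.Regular) : 0 < r.radius := by
  have h1 : (0 : ℝ) < r.dd := by exact_mod_cast h.dd_pos
  have h2 : (0 : ℝ) < r.dn := by exact_mod_cast h.dn_pos
  unfold radius
  positivity

theorem query_eq (h : r.Regular) {i : ℕ} (hi : i < r.K) :
    r.query i = (dualBasis h hi).encode ++ (radiusQ h).encode := by
  have hflat : (List.ofFn fun j => List.ofFn fun k => (dualBasis h hi).num j k).flatten =
      (List.range (r.n * r.n)).map fun x => r.num i (x / r.n) (x % r.n) :=
    flatten_ofFn r.n (r.num i)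
  have hden : ((dualBasis h hi).den : ℤ) = r.den := Int.toNat_of_nonneg h.den_pos.le
  have hmid : (List.range (r.n * r.n)).map (r.buf i ∘ Nat.succ) =
      (List.range (r.n * r.n)).map fun x => r.num i (x / r.n) (x % r.n) := by
    refine List.map_congr_left fun x hx => ?_
    rw [List.mem_range] at hx
    simp only [Function.comp_apply, buf]
    rw [if_neg (by omega), if_pos (by omega), Nat.succ_sub_one]
  have e : r.n * r.n + 4 = (r.n * r.n + 3) + 1 := rfl
  have b0 : r.buf i 0 = r.n := by simp [buf]
  have b1 : r.buf i (r.n * r.n + 1) = r.den := by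
    rw [buf, if_neg (by omega), if_neg (by omega), if_pos rfl]
  have b2 : r.buf i (r.n * r.n + 2) = r.dd := by
    rw [buf, if_neg (by omega), if_neg (by omega), if_neg (by omega), if_pos rfl]
  have b3 : r.buf i (r.n * r.n + 3) = 20 * r.dn := by
    rw [buf, if_neg (by omega), if_neg (by omega), if_neg (by omega), if_neg (by omega)]
  rw [query, e, List.range_succ_eq_map, List.range_succ, List.range_succ, List.range_succ,
    LatticeBasis.encode, PosRational.encode, hflat, hden]
  simp only [List.map_cons, List.map_append, List.map_map, List.map_nil, hmid, b0,
    List.cons_append, List.append_assoc, List.nil_append, b1, b2, b3, radiusQ, Nat.succ_eq_add_one]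
  push_cast
  rfl

/-! ## The tests in terms of real vectors -/

/-- The sample that is used by the program. -/
noncomputable def sample (r : RunData) (s : ℕ) : E r.n :=
  intComb (r.dualVec (s / r.N)) fun l => r.received s (l + 1)

theorem Regular.sample_apply (h : r.Regular) (s : ℕ) (k : Fin r.n) :
    r.sample s k = (r.w s k : ℝ) / r.den := by
  have hden : (r.den : ℝ) ≠ 0 := by exact_mod_cast h.den_pos.ne'
  rw [sample, intComb, w, Finset.sum_range]
  simp only [← Int.cast_smul_eq_zsmul ℝ, WithLp.ofLp_sum, Finset.sum_apply, WithLp.ofLp_smul,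
    Pi.smul_apply, smul_eq_mul]
  push_cast
  rw [Finset.sum_div]
  refine Finset.sum_congr rfl fun l _ => ?_
  simp only [dualVec]
  ring

theorem Regular.inner_sample_target (h : r.Regular) (s : ℕ) :
    inner ℝ (r.sample s) (r.target (s / r.N)) = (r.y s : ℝ) / r.D := by
  have hden : (r.den : ℝ) ≠ 0 := by exact_mod_cast h.den_pos.ne'
  have hs : (r.s : ℝ) ≠ 0 := by exact_mod_cast h.s_pos.ne'
  rw [PiLp.inner_apply, y, D, Finset.sum_range]
  push_cast
  rw [Finset.sum_div]
  refine Finset.sum_congr rfl fun k _ => ?_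
  rw [h.sample_apply]
  simp only [RCLike.inner_apply, conj_trivial, target]
  field_simp

/-- Both sides subtract the same integer multiple of `D`, because `round x = ⌊x + 1/2⌋`. -/
theorem centeredMod_eq {y D : ℤ} (hD : 0 < D) :
    (centeredMod y D : ℝ) = D * ((y : ℝ) / D - round ((y : ℝ) / D)) := by
  have hD' : (D : ℝ) ≠ 0 := by exact_mod_cast hD.ne'
  have h1 : round ((y : ℝ) / D) = (2 * y + D) / (2 * D) := by
    rw [round_eq]
    have : (y : ℝ) / D + 1 / 2 = ((2 * y + D : ℤ) : ℝ) / ((2 * D : ℤ) : ℝ) := by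
      push_cast
      field_simp
    rw [this]
    have h2 := Rat.floor_intCast_div_natCast (2 * y + D) (2 * D).toNat
    have h3 : (((2 * D).toNat : ℕ) : ℤ) = 2 * D := Int.toNat_of_nonneg (by omega)
    rw [← Rat.floor_cast (α := ℝ)] at h2
    rw [h3] at h2
    rw [← h2]
    have h4 : (((2 * D).toNat : ℕ) : ℝ) = ((2 * D : ℤ) : ℝ) := by exact_mod_cast h3
    push_cast at h4 ⊢
    rw [h4]
  rw [h1, centeredMod]
  push_cast
  field_simp

/-- The distance test. -/
theorem Regular.badDist_ne_zero_iff (h : r.Regular) (i : ℕ) : r.badDist i ≠ 0 ↔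
    40 * ∑ s ∈ Finset.range r.N, (inner ℝ (r.sample (i * r.N + s)) (r.target i) -
      round (inner ℝ (r.sample (i * r.N + s)) (r.target i))) ^ 2 ≤ (r.N : ℝ) := by
  have hD : 0 < r.D := mul_pos h.den_pos (by exact_mod_cast h.s_pos)
  have hD' : (0 : ℝ) < r.D := by exact_mod_cast hD
  have e : (r.dist i : ℝ) = r.D ^ 2 * ∑ s ∈ Finset.range r.N,
      (inner ℝ (r.sample (i * r.N + s)) (r.target i) -
      round (inner ℝ (r.sample (i * r.N + s)) (r.target i))) ^ 2 := by
    rw [dist]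
    push_cast
    rw [Finset.mul_sum]
    refine Finset.sum_congr rfl fun s hs => ?_
    have h1 := h.inner_sample_target (i * r.N + s)
    rw [(mul_add_div_mod i (Finset.mem_range.1 hs)).1] at h1
    rw [centeredMod_eq hD, h1]
    ring
  set Θ := ∑ s ∈ Finset.range r.N, (inner ℝ (r.sample (i * r.N + s)) (r.target i) -
      round (inner ℝ (r.sample (i * r.N + s)) (r.target i))) ^ 2 with hΘ
  have h1 : r.badDist i ≠ 0 ↔ 40 * r.dist i ≤ r.N * (r.D * r.D) := by
    rw [badDist]
    split_ifs with h2
    · simp only [sub_self, ne_eq, not_true_eq_false, false_iff]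
      omega
    · simp only [sub_zero, ne_eq, one_ne_zero, not_false_eq_true, true_iff]
      omega
  rw [h1, ← Int.cast_le (R := ℝ)]
  push_cast
  rw [e]
  constructor
  · intro h2
    have h3 : (r.D : ℝ) ^ 2 * (40 * Θ) ≤ r.D ^ 2 * r.N := by linarith
    exact le_of_mul_le_mul_left h3 (by positivity)
  · intro h2
    have h3 : (r.D : ℝ) ^ 2 * (40 * Θ) ≤ r.D ^ 2 * r.N := by gcongr
    linarith

/-- The test of the second moments. -/
theorem Regular.badMoment_ne_zero_iff (h : r.Regular) (i : ℕ) (j k : Fin r.n) :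
    r.badMoment i j k ≠ 0 ↔ (r.N : ℝ) < |∑ s ∈ Finset.range r.N,
      weight r.n j k * (r.sample (i * r.N + s) j * r.sample (i * r.N + s) k) / r.radius ^ 2| := by
  have hden : (0 : ℝ) < r.den := by exact_mod_cast h.den_pos
  have hdd : (0 : ℝ) < r.dd := by exact_mod_cast h.dd_pos
  have hdn : (0 : ℝ) < r.dn := by exact_mod_cast h.dn_pos
  set V := ∑ s ∈ Finset.range r.N,
      weight r.n j k * (r.sample (i * r.N + s) j * r.sample (i * r.N + s) k) / r.radius ^ 2 with hV
  have e1 : (r.weightedMoment i j k : ℝ) = r.dd ^ 2 * r.den ^ 2 * V := by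
    have hw : ((r.n - (r.n - 1) * if ((j : ℕ) : ℤ) = ((k : ℕ) : ℤ) then 1 else 0 : ℤ) : ℝ) =
        weight r.n j k := by
      by_cases hjk : j = k
      · subst hjk; simp [weight]
      · have : ¬ (((j : ℕ) : ℤ) = ((k : ℕ) : ℤ)) := fun h => hjk (Fin.ext (by exact_mod_cast h))
        rw [weight, if_neg this, if_neg hjk]
        simp
    rw [weightedMoment, Int.cast_mul, Int.cast_mul, hw, S, hV]
    push_cast
    rw [Finset.mul_sum, Finset.sum_mul, Finset.sum_mul]
    refine Finset.sum_congr rfl fun s _ => ?_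
    rw [h.sample_apply, h.sample_apply, radius]
    field_simp
    ring
  have e2 : (r.momentBound : ℝ) = r.dd ^ 2 * r.den ^ 2 * r.N := by
    rw [momentBound]
    push_cast
    ring
  have h1 : r.badMoment i j k ≠ 0 ↔ r.momentBound * r.momentBound <
      r.weightedMoment i j k * r.weightedMoment i j k := by
    rw [badMoment]
    split_ifs with h2
    · simp only [ne_eq, one_ne_zero, not_false_eq_true, true_iff]
      omega
    · simp only [ne_eq, not_true_eq_false, false_iff]
      omega
  rw [h1, ← Int.cast_lt (R := ℝ)]
  push_cast
  rw [e1, e2, ← sq, ← sq, mul_pow, mul_pow (_ * _) V, mul_lt_mul_iff_right₀ (by positivity), sq_lt_sq,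
    Nat.abs_cast]

theorem bad_eq_zero_iff (r : RunData) : r.bad = 0 ↔
    (∀ s < r.K * r.N, r.badLength s = 0) ∧
    (∀ i < r.K, ∀ j < r.n, ∀ k < r.n, r.badMoment i j k = 0) ∧ ∀ i < r.K, r.badDist i = 0 := by
  have h1 : ∀ s, 0 ≤ r.badLength s := fun s => by unfold badLength; split_ifs <;> norm_num
  have h2 : ∀ i j k, 0 ≤ r.badMoment i j k := fun i j k => by
    unfold badMoment; split_ifs <;> norm_num
  have h3 : ∀ i, 0 ≤ r.badDist i := fun i => by unfold badDist; split_ifs <;> norm_num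
  have s1 : 0 ≤ ∑ s ∈ Finset.range (r.K * r.N), r.badLength s := Finset.sum_nonneg fun s _ => h1 s
  have s2 : 0 ≤ ∑ p ∈ Finset.range (r.K * (r.n * r.n)),
    r.badMoment (p / (r.n * r.n)) (p / r.n % r.n) (p % r.n) := Finset.sum_nonneg fun p _ => h2 _ _ _
  have s3 : 0 ≤ ∑ i ∈ Finset.range r.K, r.badDist i := Finset.sum_nonneg fun i _ => h3 i
  have e : r.bad = 0 ↔ ∑ s ∈ Finset.range (r.K * r.N), r.badLength s = 0 ∧
      ∑ p ∈ Finset.range (r.K * (r.n * r.n)),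
        r.badMoment (p / (r.n * r.n)) (p / r.n % r.n) (p % r.n) = 0 ∧
      ∑ i ∈ Finset.range r.K, r.badDist i = 0 := by
    unfold bad
    omega
  rw [e, Finset.sum_eq_zero_iff_of_nonneg fun s _ => h1 s,
    Finset.sum_eq_zero_iff_of_nonneg fun p _ => h2 _ _ _,
    Finset.sum_eq_zero_iff_of_nonneg fun i _ => h3 i]
  simp only [Finset.mem_range]
  refine and_congr Iff.rfl (and_congr ⟨fun h i hi j hj k hk => ?_, fun h p hp => ?_⟩ Iff.rfl)
  · obtain ⟨d1, d2, d3⟩ := digits i hj hk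
    have h4 := h (i * (r.n * r.n) + (j * r.n + k)) (mul_add_lt_mul hi (entry_index_lt hj hk))
    rwa [d1, d2, d3] at h4
  · have hn : 0 < r.n := by
      rcases Nat.eq_zero_or_pos r.n with h0 | h0
      · simp [h0] at hp
      · exact h0
    exact h _ (Nat.div_lt_of_lt_mul (by rwa [mul_comm])) _ (Nat.mod_lt _ hn) _ (Nat.mod_lt _ hn)

end RunData

/-! ### A close target makes one of the tests fail -/

variable {n : ℕ}

/-- The diagonal gives `‖e‖²`, and the other terms at most `(∑ |e_j|)² / n ≤ ‖e‖²` by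
Cauchy–Schwarz. This is the purpose of the weights: finitely many tests of moments control `∑ ⟨w,
e⟩²` for all vectors `e` at once, up to a factor of two. -/
theorem sum_abs_mul_div_weight_le (hn : 1 ≤ n) (e : E n) :
    ∑ j, ∑ k, |e j| * |e k| / weight n j k ≤ 2 * ‖e‖ ^ 2 := by
  have hn' : (0 : ℝ) < n := by exact_mod_cast hn
  have h1 : ∀ j k : Fin n, |e j| * |e k| / weight n j k ≤
      (if j = k then |e j| * |e k| else 0) + |e j| * |e k| / n := by
    intro j k
    have h0 : 0 ≤ |e j| * |e k| / n := by positivity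
    unfold weight
    split_ifs
    · simpa using h0
    · simp
  have h2 : ∑ j, |e j| ^ 2 = ‖e‖ ^ 2 := by
    rw [EuclideanSpace.norm_sq_eq]
    rfl
  have h3 : (∑ j, |e j|) ^ 2 ≤ n * ∑ j, |e j| ^ 2 := by
    simpa using sq_sum_le_card_mul_sum_sq (s := Finset.univ) (f := fun j => |e j|)
  have h4 : ∑ j, ∑ k, |e j| * |e k| / n = (∑ j, |e j|) ^ 2 / n := by
    rw [sq, Finset.sum_mul_sum, Finset.sum_div]
    exact Finset.sum_congr rfl fun j _ => by rw [Finset.sum_div]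
  calc ∑ j, ∑ k, |e j| * |e k| / weight n j k
      ≤ ∑ j, ∑ k, ((if j = k then |e j| * |e k| else 0) + |e j| * |e k| / n) :=
        Finset.sum_le_sum fun j _ => Finset.sum_le_sum fun k _ => h1 j k
    _ = ∑ j, |e j| ^ 2 + (∑ j, |e j|) ^ 2 / n := by
        simp only [Finset.sum_add_distrib, h4]
        congr 1
        exact Finset.sum_congr rfl fun j _ => by simp [sq]
    _ ≤ ‖e‖ ^ 2 + ‖e‖ ^ 2 := by
        rw [h2] at h3 ⊢
        gcongr
        rwa [div_le_iff₀ hn', mul_comm]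
    _ = _ := by ring

/-- Samples with small second moments have small inner products with short vectors. -/
theorem sum_sq_inner_le (hn : 1 ≤ n) {ι : Type*} (I : Finset ι) (W : ι → E n) (e : E n) {M : ℝ}
    (h : ∀ j k, |∑ s ∈ I, weight n j k * (W s j * W s k)| ≤ M) :
    ∑ s ∈ I, (inner ℝ (W s) e) ^ 2 ≤ M * (2 * ‖e‖ ^ 2) := by
  have h0 : 0 ≤ M := (abs_nonneg _).trans (h ⟨0, hn⟩ ⟨0, hn⟩)
  have h1 : ∀ s, (inner ℝ (W s) e) ^ 2 = ∑ j, ∑ k, e j * e k * (W s j * W s k) := by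
    intro s
    rw [PiLp.inner_apply, sq, Finset.sum_mul_sum]
    refine Finset.sum_congr rfl fun j _ => Finset.sum_congr rfl fun k _ => ?_
    simp only [RCLike.inner_apply, conj_trivial]
    ring
  have h2 : ∑ s ∈ I, (inner ℝ (W s) e) ^ 2 =
      ∑ j, ∑ k, e j * e k / weight n j k * ∑ s ∈ I, weight n j k * (W s j * W s k) := by
    simp only [h1]
    rw [Finset.sum_comm]
    refine Finset.sum_congr rfl fun j _ => ?_
    rw [Finset.sum_comm]
    refine Finset.sum_congr rfl fun k _ => ?_
    rw [Finset.mul_sum]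
    refine Finset.sum_congr rfl fun s _ => ?_
    have := (weight_mem hn j k).1
    field_simp
  rw [h2]
  calc _ ≤ ∑ j, ∑ k, M * (|e j| * |e k| / weight n j k) := by
        refine Finset.sum_le_sum fun j _ => Finset.sum_le_sum fun k _ => (le_abs_self _).trans ?_
        have hw := (weight_mem hn j k).1
        rw [abs_mul, abs_div, abs_mul, abs_of_pos (by linarith : 0 < weight n j k), mul_comm M]
        exact mul_le_mul_of_nonneg_left (h j k) (by positivity)
    _ = M * ∑ j, ∑ k, |e j| * |e k| / weight n j k := by simp only [Finset.mul_sum]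
    _ ≤ _ := by gcongr; exact sum_abs_mul_div_weight_le hn e

namespace RunData

variable {r : RunData}

/-- If the target is close to the lattice, then one of the tests fails. -/
theorem Regular.bad_ne_zero (h : r.Regular) {i : ℕ} (hi : i < r.K) {v : Fin r.n → ℤ}
    (hv : ‖r.target i - intComb (r.primal i) v‖ ≤ 2 * (r.dn / r.dd)) : r.bad ≠ 0 := by
  intro h0
  obtain ⟨-, hM, hD⟩ := r.bad_eq_zero_iff.1 h0
  refine (h.badDist_ne_zero_iff i).2 ?_ (hD i hi)
  set e := r.target i - intComb (r.primal i) v with he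
  have hr := h.radius_pos
  have hN : (0 : ℝ) < r.N := by exact_mod_cast h.N_pos
  have hdd : (0 : ℝ) < r.dd := by exact_mod_cast h.dd_pos
  have hdn : (0 : ℝ) < r.dn := by exact_mod_cast h.dn_pos
  -- The nearest integer to `⟨w, t⟩` is at least as near as the integer `⟨w, v⟩`, and the difference
  -- to the latter is `⟨w, e⟩`. Only the integrality of the received coefficients is used.
  have h1 : ∀ s ∈ Finset.range r.N, (inner ℝ (r.sample (i * r.N + s)) (r.target i) -
      round (inner ℝ (r.sample (i * r.N + s)) (r.target i))) ^ 2 ≤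
      (inner ℝ (r.sample (i * r.N + s)) e) ^ 2 := by
    intro s hs
    have h2 := (h.isDualPair hi).inner_intComb_intComb v
      fun l => r.received (i * r.N + s) (l + 1)
    rw [real_inner_comm] at h2
    rw [sq_le_sq]
    refine (round_le _ (∑ l, v l * r.received (i * r.N + s) (l + 1))).trans_eq ?_
    rw [he, inner_sub_right, ← h2, sample, (mul_add_div_mod i (Finset.mem_range.1 hs)).1]
  have h2 : ∀ j k, |∑ s ∈ Finset.range r.N, weight r.n j k *
      (r.sample (i * r.N + s) j * r.sample (i * r.N + s) k)| ≤ r.N * r.radius ^ 2 := by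
    intro j k
    have h3 := (h.badMoment_ne_zero_iff i j k).not.1 (not_not.2 (hM i hi j j.2 k k.2))
    rw [not_lt, ← Finset.sum_div, abs_div, abs_of_pos (by positivity : 0 < r.radius ^ 2),
      div_le_iff₀ (by positivity)] at h3
    exact h3
  have h3 := sum_sq_inner_le h.n_pos (Finset.range r.N) (fun s => r.sample (i * r.N + s)) e h2
  have h4 := Finset.sum_le_sum h1
  -- The parameter is `1 / (20 d)` and the error vector has length at most `2 d`. The mean squared
  -- distance is then at most `2/100 < 1/40`.
  have h5 : r.radius ^ 2 * ‖e‖ ^ 2 ≤ 1 / 100 := by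
    calc r.radius ^ 2 * ‖e‖ ^ 2 ≤ r.radius ^ 2 * (2 * (r.dn / r.dd)) ^ 2 := by gcongr
      _ = 1 / 100 := by unfold radius; field_simp; norm_num
  have h6 : (r.N : ℝ) * r.radius ^ 2 * (2 * ‖e‖ ^ 2) ≤ r.N * (1 / 50) := by
    calc (r.N : ℝ) * r.radius ^ 2 * (2 * ‖e‖ ^ 2) = r.N * (2 * (r.radius ^ 2 * ‖e‖ ^ 2)) := by ring
      _ ≤ _ := by gcongr; linarith
  linarith

end RunData

/-! ### Far targets pass all tests with high probability -/

namespace RunData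

variable {r : RunData}

/-- The data of an instance in which all lattices have large minimum distances and are far from the
targets. -/
structure Separated (r : RunData) : Prop extends r.Regular where
  N_eq : r.N = 10 ^ 5 * r.n ^ 5
  K_le : r.K ≤ r.n
  Y_eq : r.Y₀ = 20 * r.n * r.dd ^ 2 * r.g ^ 2
  le_norm : ∀ i < r.K, ∀ v : Fin r.n → ℤ, v ≠ 0 →
    5 * Real.sqrt r.n / r.radius ≤ ‖intComb (r.primal i) v‖
  le_norm_target : ∀ i < r.K, ∀ v : Fin r.n → ℤ,
    5 * Real.sqrt r.n / r.radius ≤ ‖r.target i + intComb (r.primal i) v‖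

theorem Regular.sq_norm_primal_le (h : r.Regular) {i : ℕ} (hi : i < r.K) (l : Fin r.n) :
    ‖r.primal i l‖ ^ 2 ≤ r.g ^ 2 * ∑ k, (r.A l k : ℝ) ^ 2 := by
  have hF : (1 : ℝ) ≤ r.F i l := by exact_mod_cast h.F_pos i hi l l.2
  have ha : (1 : ℝ) ≤ r.a := by exact_mod_cast h.a_pos
  rw [EuclideanSpace.norm_sq_eq, Finset.mul_sum]
  refine Finset.sum_le_sum fun k _ => ?_
  simp only [primal, Real.norm_eq_abs, sq_abs, mul_pow]
  refine mul_le_mul_of_nonneg_right ?_ (sq_nonneg _)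
  gcongr
  exact (div_le_self (by positivity) ha).trans (div_le_self (by positivity) hF)

theorem sum_sq_row_mul_le (r : RunData) (l : Fin r.n) :
    (∑ k, (r.A l k : ℝ) ^ 2) * r.Y₀ ≤ r.Y := by
  have h1 : ∑ k : Fin r.n, (r.A l k).natAbs ^ 2 * r.Y₀ ≤ r.Y := by
    have h2 : ∑ k : Fin r.n, (r.A l k).natAbs ^ 2 * r.Y₀ = ∑ k ∈ Finset.range r.n,
        (entry r.A ((l * r.n + k) / r.n) ((l * r.n + k) % r.n)).natAbs ^ 2 * r.Y₀ := by
      rw [Finset.sum_range]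
      refine Finset.sum_congr rfl fun k _ => ?_
      obtain ⟨d1, d2⟩ := mul_add_div_mod (l : ℕ) k.2
      rw [d1, d2, entry_coe]
    rw [h2, Y]
    rw [← Finset.sum_image (s := Finset.range r.n) (g := fun k => (l : ℕ) * r.n + k)
      (f := fun p => (entry r.A (p / r.n) (p % r.n)).natAbs ^ 2 * r.Y₀)
      fun x _ y _ hxy => Nat.add_left_cancel hxy]
    refine Finset.sum_le_sum_of_subset fun p hp => ?_
    obtain ⟨k, hk, rfl⟩ := Finset.mem_image.1 hp
    exact Finset.mem_range.2 (mul_add_lt_mul l.2 (Finset.mem_range.1 hk))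
  have h3 : (∑ k, (r.A l k : ℝ) ^ 2) * r.Y₀ =
      ((∑ k : Fin r.n, (r.A l k).natAbs ^ 2 * r.Y₀ : ℕ) : ℝ) := by
    push_cast
    rw [Finset.sum_mul]
    exact Finset.sum_congr rfl fun k _ => by rw [Nat.cast_natAbs, Int.cast_abs, sq_abs]
  rw [h3]
  exact_mod_cast h1

/-- The coefficients of short vectors are not too long. -/
theorem Separated.listSize_le (h : r.Separated) {i : ℕ} (hi : i < r.K) {z : Fin r.n → ℤ}
    (hz : ‖intComb (r.dualVec i) z‖ < cutoff r.n r.radius) :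
    listSize (List.ofFn z) ≤ r.cap := by
  have hr := h.radius_pos
  have h1 : ∀ l, bitLen (z l) ≤ Nat.size r.Y + 1 := by
    intro l
    have hdn : (1 : ℝ) ≤ r.dn := by exact_mod_cast h.dn_pos
    have h2 := (h.isDualPair hi).symm.inner_intComb z l
    -- The `l`-th coefficient of a dual vector is its inner product with the `l`-th primal basis
    -- vector, so short vectors have short coefficients and the limit `cap` never rejects them.
    have h3 : |(z l : ℝ)| ≤ cutoff r.n r.radius * ‖r.primal i l‖ := by
      rw [← h2]
      exact (abs_real_inner_le_norm _ _).trans (by gcongr)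
    have h4 : cutoff r.n r.radius ^ 2 = 20 * r.n * r.radius ^ 2 := by
      rw [cutoff, mul_pow, Real.sq_sqrt (by positivity)]
    have h5 : r.radius ≤ r.dd := div_le_self (by positivity) (by linarith)
    have h6 : (z l : ℝ) ^ 2 ≤ r.Y := by
      calc (z l : ℝ) ^ 2 = |(z l : ℝ)| ^ 2 := (sq_abs _).symm
        _ ≤ (cutoff r.n r.radius * ‖r.primal i l‖) ^ 2 := by gcongr
        _ = 20 * r.n * r.radius ^ 2 * ‖r.primal i l‖ ^ 2 := by rw [mul_pow, h4]
        _ ≤ 20 * r.n * r.dd ^ 2 * (r.g ^ 2 * ∑ k, (r.A l k : ℝ) ^ 2) := by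
          gcongr
          exact h.sq_norm_primal_le hi l
        _ = (∑ k, (r.A l k : ℝ) ^ 2) * r.Y₀ := by rw [h.Y_eq]; push_cast; ring
        _ ≤ r.Y := r.sum_sq_row_mul_le l
    have h7 : (z l).natAbs ^ 2 ≤ r.Y := by
      have : (((z l).natAbs ^ 2 : ℕ) : ℝ) ≤ r.Y := by
        push_cast
        rwa [Nat.cast_natAbs, Int.cast_abs, sq_abs]
      exact_mod_cast this
    rw [bitLen_le_iff]
    exact ((Nat.le_self_pow two_ne_zero _).trans h7).trans_lt (Nat.lt_size_self _)
  refine (RunData.listSize_le (B := Nat.size r.Y + 1) ?_).trans_eq (by rw [List.length_ofFn, cap])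
  intro x hx
  obtain ⟨l, rfl⟩ := (List.mem_ofFn' _ _).1 hx
  exact h1 l

theorem Separated.of_mem_goodAnswers (h : r.Separated) (as : List (List ℤ)) {s : ℕ}
    (hi : s / r.N < r.K) (hs : as.getD s [] ∈ goodAnswers (r.dualVec (s / r.N)) r.radius) :
    (r.withAnswers as).badLength s = 0 ∧
    (r.withAnswers as).sample s = answerVec (r.dualVec (s / r.N)) (as.getD s []) ∧
    ‖answerVec (r.dualVec (s / r.N)) (as.getD s [])‖ < cutoff r.n r.radius := by
  obtain ⟨z, hz, hn⟩ := hs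
  have h1 : ∀ x, (r.withAnswers as).received s x = ((r.n : ℤ) :: List.ofFn z).getD x 0 := by
    intro x
    change (if listSize (as.getD s []) ≤ r.cap then
      ((as.getD s []).length : ℤ) :: as.getD s [] else [-1]).getD x 0 = _
    rw [hz, if_pos (h.listSize_le hi hn), List.length_ofFn]
  refine ⟨?_, ?_, ?_⟩
  · rw [badLength, h1]
    simp [withAnswers]
  · rw [hz, answerVec]
    change intComb (r.dualVec (s / r.N)) (fun l => (r.withAnswers as).received s (l + 1)) = _
    congr 1
    ext l
    rw [h1, List.getD_cons_succ]
  · rwa [hz, answerVec_ofFn]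

theorem Regular.withAnswers (h : r.Regular) (as : List (List ℤ)) : (r.withAnswers as).Regular :=
  ⟨h.1, h.2, h.3, h.4, h.5, h.6, h.7, h.8, h.9⟩

/-- The ways in which the tests can fail. -/
theorem Separated.bad_ne_zero_subset (h : r.Separated) :
    {as | (r.withAnswers as).bad ≠ 0} ⊆
      (⋃ s ∈ Finset.range (r.K * r.N),
        {as | as.getD s [] ∈ (goodAnswers (r.dualVec (s / r.N)) r.radius)ᶜ}) ∪
      ((⋃ i ∈ Finset.range r.K, ⋃ j ∈ (Finset.univ : Finset (Fin r.n)),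
        ⋃ k ∈ (Finset.univ : Finset (Fin r.n)), ⋃ σ ∈ ({1, -1} : Finset ℝ),
        {as | (r.N : ℝ) ≤ ∑ s ∈ Finset.range r.N, momentTest r.n r.radius σ j k
          (answerVec (r.dualVec i) (as.getD (i * r.N + s) []))}) ∪
      ⋃ i ∈ Finset.range r.K, {as | (r.N : ℝ) ≤ ∑ s ∈ Finset.range r.N,
        distTest (r.target i) (answerVec (r.dualVec i) (as.getD (i * r.N + s) []))}) := by
  intro as has
  by_contra hc
  simp only [Set.mem_union, Set.mem_iUnion, Finset.mem_range, Finset.mem_univ, Set.mem_ofPred_eq,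
    Set.mem_compl_iff, exists_prop, not_or, not_exists, not_and, not_not, true_and,
    Finset.mem_insert, Finset.mem_singleton] at hc
  obtain ⟨hgood, hmom, hdist⟩ := hc
  have hN : 0 < r.N := h.N_pos
  have hA := fun s (hs : s < r.K * r.N) => h.of_mem_goodAnswers as
    (Nat.div_lt_of_lt_mul (by rwa [mul_comm])) (hgood s hs)
  obtain ⟨W, hW⟩ : ∃ W : ℕ → E r.n, W = (r.withAnswers as).sample := ⟨_, rfl⟩
  have hB : ∀ i < r.K, ∀ s ∈ Finset.range r.N, W (i * r.N + s) =
        answerVec (r.dualVec i) (as.getD (i * r.N + s) []) ∧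
      ‖answerVec (r.dualVec i) (as.getD (i * r.N + s) [])‖ < cutoff r.n r.radius := by
    intro i hi s hs
    have h1 := (hA _ (mul_add_lt_mul hi (Finset.mem_range.1 hs))).2
    rw [(mul_add_div_mod i (Finset.mem_range.1 hs)).1] at h1
    rwa [hW]
  refine has ((r.withAnswers as).bad_eq_zero_iff.2 ⟨fun s hs => (hA s hs).1, ?_, ?_⟩)
  · intro i hi j hj k hk
    by_contra h0
    have h1 : (r.N : ℝ) < |∑ s ∈ Finset.range r.N, weight r.n ⟨j, hj⟩ ⟨k, hk⟩ *
        (W (i * r.N + s) ⟨j, hj⟩ * W (i * r.N + s) ⟨k, hk⟩) / r.radius ^ 2| := by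
      rw [hW]
      exact ((h.withAnswers as).badMoment_ne_zero_iff i ⟨j, hj⟩ ⟨k, hk⟩).1 h0
    -- All answers are below the truncation radius here, so the truncated contributions are the true
    -- ones. The two signs of `σ` cover the absolute value.
    have h2 : ∀ σ : ℝ, σ * ∑ s ∈ Finset.range r.N, weight r.n ⟨j, hj⟩ ⟨k, hk⟩ *
        (W (i * r.N + s) ⟨j, hj⟩ * W (i * r.N + s) ⟨k, hk⟩) / r.radius ^ 2 =
        ∑ s ∈ Finset.range r.N, momentTest r.n r.radius σ ⟨j, hj⟩ ⟨k, hk⟩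
          (answerVec (r.dualVec i) (as.getD (i * r.N + s) [])) := by
      intro σ
      rw [Finset.mul_sum]
      refine Finset.sum_congr rfl fun s hs => ?_
      obtain ⟨h3, h4⟩ := hB i hi s hs
      rw [momentTest, if_neg (not_le.2 h4), h3]
    rcases lt_abs.1 h1 with h3 | h3
    · refine hmom i hi ⟨j, hj⟩ ⟨k, hk⟩ 1 (Or.inl rfl) ?_
      rw [← h2, one_mul]
      exact h3.le
    · refine hmom i hi ⟨j, hj⟩ ⟨k, hk⟩ (-1) (Or.inr rfl) ?_
      rw [← h2, neg_one_mul]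
      exact h3.le
  · intro i hi
    by_contra h0
    have h1 : 40 * ∑ s ∈ Finset.range r.N, (inner ℝ (W (i * r.N + s)) (r.target i) -
        round (inner ℝ (W (i * r.N + s)) (r.target i))) ^ 2 ≤ (r.N : ℝ) := by
      rw [hW]
      exact ((h.withAnswers as).badDist_ne_zero_iff i).1 h0
    refine hdist i hi ?_
    have h2 : ∀ s ∈ Finset.range r.N,
        distTest (r.target i) (answerVec (r.dualVec i) (as.getD (i * r.N + s) [])) =
        2 - 40 * (inner ℝ (W (i * r.N + s)) (r.target i) -
          round (inner ℝ (W (i * r.N + s)) (r.target i))) ^ 2 := by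
      intro s hs
      rw [distTest, (hB i hi s hs).1]
    rw [Finset.sum_congr rfl h2, Finset.sum_sub_distrib, ← Finset.mul_sum, Finset.sum_const,
      Finset.card_range, nsmul_eq_mul]
    linarith

/-- The union bound runs over `K N` answers that may be too long, `2 K n²` signed moments and `K`
distances. These are at most `2¹⁷ n⁶ ≤ exp(23 n)` events, each of probability at most `exp(-40 n)`.
-/
theorem error_le {n K N : ℕ} (hn : 1 ≤ n) (hK : K ≤ n) (hN : N = 10 ^ 5 * n ^ 5) :
    ((K * N + (K * (n * (n * 2)) + K) : ℕ) : ℝ) * Real.exp (-(40 * n)) ≤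
      min (1 / 3) ((2 : ℝ) ^ (-(1 * (n : ℝ)))) := by
  have hn' : (1 : ℝ) ≤ n := by exact_mod_cast hn
  have h1 : K * N + (K * (n * (n * 2)) + K) ≤ 2 ^ 17 * n ^ 6 := by
    have e1 : n ^ 3 ≤ n ^ 6 := Nat.pow_le_pow_right hn (by norm_num)
    have e2 : n ≤ n ^ 6 := Nat.le_self_pow (by norm_num) n
    calc K * N + (K * (n * (n * 2)) + K) ≤ n * N + (n * (n * (n * 2)) + n) := by gcongr
      _ = 10 ^ 5 * n ^ 6 + (2 * n ^ 3 + n) := by rw [hN]; ring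
      _ ≤ 2 ^ 17 * n ^ 6 := by omega
  have h2 : ((K * N + (K * (n * (n * 2)) + K) : ℕ) : ℝ) ≤ Real.exp (23 * n) := by
    calc ((K * N + (K * (n * (n * 2)) + K) : ℕ) : ℝ) ≤ ((2 ^ 17 * n ^ 6 : ℕ) : ℝ) := by
          exact_mod_cast h1
      _ = 2 ^ 17 * (n : ℝ) ^ 6 := by push_cast; ring
      _ ≤ Real.exp (17 : ℕ) * Real.exp n ^ 6 := by
          gcongr
          · exact two_pow_le_exp 17
          · exact (by linarith : (n : ℝ) ≤ n + 1).trans (Real.add_one_le_exp _)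
      _ = Real.exp (17 + 6 * n) := by
          rw [← Real.exp_nat_mul, ← Real.exp_add]
          norm_num
      _ ≤ Real.exp (23 * n) := Real.exp_le_exp.2 (by linarith)
  have h3 : ((K * N + (K * (n * (n * 2)) + K) : ℕ) : ℝ) * Real.exp (-(40 * n)) ≤
      Real.exp (-(2 * n)) := by
    calc _ ≤ Real.exp (23 * n) * Real.exp (-(40 * n)) := by gcongr
      _ = Real.exp (-(17 * n)) := by rw [← Real.exp_add]; congr 1; ring
      _ ≤ _ := Real.exp_le_exp.2 (by linarith)
  refine h3.trans (le_min ?_ ?_)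
  · have h4 := two_pow_le_exp 2
    calc Real.exp (-(2 * n)) ≤ Real.exp (-(2 : ℕ)) := Real.exp_le_exp.2 (by push_cast; linarith)
      _ = (Real.exp (2 : ℕ))⁻¹ := Real.exp_neg _
      _ ≤ (2 ^ 2)⁻¹ := inv_anti₀ (by norm_num) h4
      _ ≤ 1 / 3 := by norm_num
  · rw [one_mul, Real.rpow_neg (by norm_num), Real.rpow_natCast]
    calc Real.exp (-(2 * n)) ≤ Real.exp (-n) := Real.exp_le_exp.2 (by linarith)
      _ = (Real.exp n)⁻¹ := Real.exp_neg _
      _ ≤ _ := inv_anti₀ (by positivity) (two_pow_le_exp n)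

/-- If the minimum distances and the distances to the targets are large, then it is unlikely that
one of the tests fails. -/
theorem Separated.prob_bad_le (h : r.Separated) {O : Oracle}
    (hO : ∀ i < r.K, ∀ z, O (r.query i) (List.ofFn z) =
      ENNReal.ofReal (prob (r.dualVec i) r.radius z)) :
    ((tape O r.queries).toOuterMeasure {as | (r.withAnswers as).bad ≠ 0}).toReal ≤
      min (1 / 3) ((2 : ℝ) ^ (-(1 * (r.n : ℝ)))) := by
  have hr := h.radius_pos
  have hN : 0 < r.N := h.N_pos
  have hlen : r.queries.length = r.K * r.N := by simp [queries]
  have hget : ∀ s < r.K * r.N, r.queries.getD s [] = r.query (s / r.N) := by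
    intro s hs
    rw [List.getD_eq_getElem _ _ (by rwa [hlen])]
    simp [queries]
  have hO' : ∀ i < r.K, ∀ s, s / r.N = i → ∀ z, O (r.queries.getD s []) (List.ofFn z) =
      ENNReal.ofReal (prob (r.dualVec i) r.radius z) := by
    intro i hi s hs z
    have hs' : s < r.K * r.N := by
      exact (Nat.div_lt_iff_lt_mul hN).1 (hs ▸ hi)
    rw [hget s hs', hs]
    exact hO i hi z
  have hlast : ∀ i < r.K, (i + 1) * r.N ≤ r.queries.length := fun i hi => by
    rw [hlen]; exact Nat.mul_le_mul_right _ hi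
  set ε := ENNReal.ofReal (Real.exp (-(40 * r.n))) with hε
  have h1 : ∀ s ∈ Finset.range (r.K * r.N), (tape O r.queries).toOuterMeasure
      {as | as.getD s [] ∈ (goodAnswers (r.dualVec (s / r.N)) r.radius)ᶜ} ≤ ε := by
    intro s hs
    rw [Finset.mem_range] at hs
    have hi : s / r.N < r.K := Nat.div_lt_of_lt_mul (by rwa [mul_comm])
    exact toOuterMeasure_tape_single_le O (by rwa [hlen])
      ((h.isDualPair hi).goodAnswers_compl_le hr (hO' _ hi s rfl))
  have h2 : ∀ i ∈ Finset.range r.K, ∀ j ∈ (Finset.univ : Finset (Fin r.n)),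
      ∀ k ∈ (Finset.univ : Finset (Fin r.n)), ∀ σ ∈ ({1, -1} : Finset ℝ),
      (tape O r.queries).toOuterMeasure {as | (r.N : ℝ) ≤ ∑ s ∈ Finset.range r.N,
        momentTest r.n r.radius σ j k
          (answerVec (r.dualVec i) (as.getD (i * r.N + s) []))} ≤ ε := by
    intro i hi j _ k _ σ hσ
    rw [Finset.mem_range] at hi
    have hσ' : |σ| = 1 := by
      rcases Finset.mem_insert.1 hσ with rfl | h
      · simp
      · rw [Finset.mem_singleton.1 h]; simp
    exact (h.isDualPair hi).test_tail_le h.n_pos hr (hlast i hi) h.N_eq (hO' i hi)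
      (abs_momentTest_le h.n_pos hr hσ' j k)
      ((h.isDualPair hi).tsum_momentTest_le h.n_pos hr (h.le_norm i hi) hσ' j k)
  have h3 : ∀ i ∈ Finset.range r.K, (tape O r.queries).toOuterMeasure
      {as | (r.N : ℝ) ≤ ∑ s ∈ Finset.range r.N,
        distTest (r.target i) (answerVec (r.dualVec i) (as.getD (i * r.N + s) []))} ≤ ε := by
    intro i hi
    rw [Finset.mem_range] at hi
    exact (h.isDualPair hi).test_tail_le h.n_pos hr (hlast i hi) h.N_eq (hO' i hi)
      (abs_distTest_le h.n_pos _)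
      ((h.isDualPair hi).tsum_distTest_le h.n_pos hr (h.le_norm_target i hi))
  have key : ∀ {ι : Type} (I : Finset ι) (f : ι → Set (List (List ℤ))) (m : ℕ) (c : ℕ),
      I.card ≤ c → (∀ i ∈ I, (tape O r.queries).toOuterMeasure (f i) ≤ (m : ENNReal) * ε) →
      (tape O r.queries).toOuterMeasure (⋃ i ∈ I, f i) ≤ ((c * m : ℕ) : ENNReal) * ε := by
    intro ι I f m c hc hf
    refine (MeasureTheory.measure_biUnion_finset_le I f).trans ((Finset.sum_le_sum hf).trans ?_)
    rw [Finset.sum_const, nsmul_eq_mul, ← mul_assoc, ← Nat.cast_mul]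
    gcongr
  have hsum : (tape O r.queries).toOuterMeasure {as | (r.withAnswers as).bad ≠ 0} ≤
      ((r.K * r.N + (r.K * (r.n * (r.n * 2)) + r.K) : ℕ) : ENNReal) * ε := by
    refine (MeasureTheory.measure_mono h.bad_ne_zero_subset).trans
      ((MeasureTheory.measure_union_le _ _).trans ?_)
    rw [Nat.cast_add, add_mul, Nat.cast_add, add_mul]
    refine add_le_add ?_ ((MeasureTheory.measure_union_le _ _).trans (add_le_add ?_ ?_))
    · have := key (Finset.range (r.K * r.N)) _ 1 (r.K * r.N) (by simp)
        fun s hs => (h1 s hs).trans_eq (by simp)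
      rwa [mul_one] at this
    · refine key _ _ _ _ (by simp) fun i hi => key _ _ _ _ (by simp) fun j hj =>
        key _ _ 2 _ (by simp) fun k hk => ?_
      refine (key _ _ 1 2 Finset.card_le_two fun σ hσ =>
        (h2 i hi j hj k hk σ hσ).trans_eq (by simp)).trans_eq (by simp)
    · have := key (Finset.range r.K) _ 1 r.K (by simp) fun i hi => (h3 i hi).trans_eq (by simp)
      rwa [mul_one] at this
  refine (ENNReal.toReal_mono (ENNReal.mul_ne_top (ENNReal.natCast_ne_top _)
    ENNReal.ofReal_ne_top) hsum).trans ?_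
  rw [ENNReal.toReal_mul, ENNReal.toReal_natCast, ENNReal.toReal_ofReal (Real.exp_pos _).le]
  exact error_le h.n_pos h.K_le h.N_eq

end RunData

theorem RunData.Regular.oracle_eq {r : RunData} (h : r.Regular) {φ : LatticeFunction} {O : Oracle}
    (hO : SolvesDGS φ O) {i : ℕ} (hi : i < r.K)
    (hφ : φ r.n (RunData.dualBasis h hi).lattice < r.radius) (z : Fin r.n → ℤ) :
    O (r.query i) (List.ofFn z) = ENNReal.ofReal (prob (r.dualVec i) r.radius z) := by
  rw [RunData.query_eq h hi, hO r.n (RunData.dualBasis h hi) (RunData.radiusQ h) h.n_pos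
    (by rwa [RunData.radiusQ_val])]
  rw [RunData.radiusQ_val, comb_eq_intComb, RunData.dualBasis_vec, discreteGaussian,
    RunData.dualBasis_lattice, (h.isDualPair hi).rhoSum_span, prob]

/-! ### Short vectors, the smoothing parameter, odd coefficients -/

variable {n : ℕ} {b d : Fin n → E n}

theorem IsDualPair.intComb_ne_zero (h : IsDualPair b d) {v : Fin n → ℤ} (hv : v ≠ 0) :
    intComb b v ≠ 0 := by
  intro h0
  refine hv (h.intComb_injective (h0.trans ?_))
  simp [intComb]

theorem IsDualPair.lambda1_span_le (h : IsDualPair b d) {v : Fin n → ℤ} (hv : v ≠ 0) :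
    lambda1 (Submodule.span ℤ (Set.range b)) ≤ ‖intComb b v‖ :=
  lambda1_le_of_mem ((mem_span_iff _ _).2 ⟨v, rfl⟩) (h.intComb_ne_zero hv)

theorem IsDualPair.exists_norm_lt (h : IsDualPair b d) (hn : 1 ≤ n) {R : ℝ}
    (hR : lambda1 (Submodule.span ℤ (Set.range b)) < R) :
    ∃ v : Fin n → ℤ, v ≠ 0 ∧ ‖intComb b v‖ < R := by
  have hne : {l : ℝ | ∃ x ∈ Submodule.span ℤ (Set.range b), x ≠ 0 ∧ ‖x‖ = l}.Nonempty := by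
    refine ⟨_, intComb b (Pi.single ⟨0, hn⟩ 1), (mem_span_iff _ _).2 ⟨_, rfl⟩,
      h.intComb_ne_zero ?_, rfl⟩
    simp
  obtain ⟨l, ⟨x, hx, h0, rfl⟩, hl⟩ := exists_lt_of_csInf_lt hne hR
  obtain ⟨v, rfl⟩ := (mem_span_iff _ _).1 hx
  refine ⟨v, ?_, hl⟩
  rintro rfl
  exact h0 (by simp [intComb])

theorem IsDualPair.rhoSum_span_diff (h : IsDualPair b d) {s : ℝ} (hs : 0 < s) :
    rhoSum s ((Submodule.span ℤ (Set.range b) : Set (E n)) \ {0}) = gsum b s 0 - 1 := by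
  classical
  set L := (Submodule.span ℤ (Set.range b) : Set (E n)) with hL
  have h0 : (0 : E n) ∈ L := Submodule.zero_mem _
  have hsum : Summable (L.indicator (rho s)) := by
    rw [← summable_subtype_iff_indicator]
    let e : (Fin n → ℤ) ≃ L := Equiv.ofBijective
      (fun v => ⟨intComb b v, (mem_span_iff _ _).2 ⟨v, rfl⟩⟩)
      ⟨fun v w hvw => h.intComb_injective (congrArg Subtype.val hvw), fun x => by
        obtain ⟨v, hv⟩ := (mem_span_iff _ _).1 x.2
        exact ⟨v, Subtype.ext hv⟩⟩
    rw [← e.summable_iff]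
    simpa using! h.summable_rho hs 0
  have h1 := hsum.tsum_eq_add_tsum_ite 0
  rw [Set.indicator_of_mem h0, rho_zero, ← tsum_subtype] at h1
  have h2 : rhoSum s L = gsum b s 0 := h.symm.rhoSum_span s
  rw [← h2, rhoSum, rhoSum, h1, add_sub_cancel_left, tsum_subtype]
  refine tsum_congr fun x => ?_
  by_cases hx : x = 0
  · simp [hx]
  · by_cases hxL : x ∈ L
    · rw [if_neg hx, Set.indicator_of_mem hxL, Set.indicator_of_mem (show x ∈ L \ {0} from ⟨hxL, hx⟩)]
    · rw [if_neg hx, Set.indicator_of_notMem hxL, Set.indicator_of_notMem fun h => hxL h.1]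

/-- The smoothing parameter is small if the dual minimum distance is large. -/
theorem IsDualPair.smoothingParameter_le (h : IsDualPair b d) (hn : 1 ≤ n) {R : ℝ} (hR : 0 < R)
    (hb : ∀ v : Fin n → ℤ, v ≠ 0 → R ≤ ‖intComb b v‖) :
    smoothingParameter ((2 : ℝ) ^ (-(n : ℝ))) (Submodule.span ℤ (Set.range d)) ≤
      Real.sqrt n / R := by
  have hn' : (0 : ℝ) < n := by exact_mod_cast hn
  have hs : 0 < Real.sqrt n := Real.sqrt_pos.2 hn'
  refine csInf_le ⟨0, fun s hs => hs.1.le⟩ ⟨by positivity, ?_⟩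
  have hp : 0 < 1 / (Real.sqrt n / R) := by positivity
  rw [h.dual_span, h.rhoSum_span_diff hp]
  have h1 := h.gsum_le_add hp hR.le (x := 0) fun v hv => by rw [zero_add]; exact hb v hv
  have h2 : (R / (1 / (Real.sqrt n / R))) ^ 2 = n := by
    rw [one_div, div_inv_eq_mul, mul_div_cancel₀ _ hR.ne', Real.sq_sqrt hn'.le]
  rw [h2, rho_zero] at h1
  set G := gsum b (1 / (Real.sqrt n / R)) 0
  have hG : 0 < G := h.gsum_zero_pos hp
  set u : ℝ := (2 : ℝ) ^ (-(n : ℝ)) with hu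
  have hu' : u = ((2 : ℝ) ^ n)⁻¹ := by rw [hu, Real.rpow_neg (by norm_num), Real.rpow_natCast]
  -- This amounts to `8ⁿ ≤ exp(3πn/4)`, which holds because `3 log 2 < 3π/4`.
  have h3 : Real.exp (-(3 * Real.pi / 4) * n) * 2 ^ n ≤ u ^ 2 := by
    have h4 : ((2 : ℝ) ^ n) ^ 3 ≤ Real.exp (3 * Real.pi / 4 * n) := by
      have h5 : (2 : ℝ) ^ n = Real.exp (n * Real.log 2) := by
        rw [Real.exp_nat_mul, Real.exp_log (by norm_num)]
      rw [h5, ← Real.exp_nat_mul, Real.exp_le_exp]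
      have h6 := Real.log_two_lt_d9
      have h7 := Real.pi_gt_three
      push_cast
      nlinarith
    rw [neg_mul, Real.exp_neg, hu', inv_pow]
    calc (Real.exp (3 * Real.pi / 4 * n))⁻¹ * 2 ^ n ≤ (((2 : ℝ) ^ n) ^ 3)⁻¹ * 2 ^ n := by gcongr
      _ = _ := by field_simp
  have h8 : 0 < u := by positivity
  have h9 : u ≤ 1 / 2 := by
    rw [hu', one_div]
    exact inv_anti₀ (by norm_num) (by simpa using pow_le_pow_right₀ (by norm_num : (1 : ℝ) ≤ 2) hn)
  have h10 : G ≤ 1 + u ^ 2 * G := h1.trans (by gcongr)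
  -- The tail bound says that the left side is at most `1`; the right side is at least `1` because
  -- `u + u² ≤ 1` for `0 < u ≤ 1/2`.
  have h11 : G * (1 - u ^ 2) ≤ (1 + u) * (1 - u ^ 2) := by nlinarith
  have h12 : 0 < 1 - u ^ 2 := by nlinarith
  linarith [le_of_mul_le_mul_right h11 h12]

theorem intComb_smul (b : Fin n → E n) (m v : Fin n → ℤ) :
    intComb (fun j => m j • b j) v = intComb b (m * v) :=
  Finset.sum_congr rfl fun j _ => by rw [smul_smul, Pi.mul_apply, mul_comm]

theorem intComb_single (b : Fin n → E n) (i : Fin n) : intComb b (Pi.single i 1) = b i := by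
  rw [intComb, Finset.sum_eq_single i]
  · simp
  · intro j _ hj
    simp [Pi.single_eq_of_ne hj]
  · simp

/-- A nonzero vector is a multiple of a vector with an odd coefficient. -/
theorem exists_odd_norm_le (b : Fin n → E n) {z : Fin n → ℤ} (hz : z ≠ 0) :
    ∃ (y : Fin n → ℤ) (i : Fin n), Odd (y i) ∧ ‖intComb b y‖ ≤ ‖intComb b z‖ := by
  obtain ⟨i₀, hi₀⟩ := Function.ne_iff.1 hz
  obtain ⟨y, hy, hg⟩ := Finset.extract_gcd (s := Finset.univ) z ⟨i₀, Finset.mem_univ _⟩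
  set g := Finset.univ.gcd z
  have hg0 : g ≠ 0 := by
    intro h0
    exact hi₀ (by rw [hy i₀ (Finset.mem_univ _), h0, zero_mul]; rfl)
  have hodd : ∃ i, Odd (y i) := by
    by_contra! hc
    have h1 : (2 : ℤ) ∣ Finset.univ.gcd y :=
      Finset.dvd_gcd fun i _ => (Int.not_odd_iff_even.1 (hc i)).two_dvd
    rw [hg] at h1
    omega
  obtain ⟨i, hi⟩ := hodd
  refine ⟨y, i, hi, ?_⟩
  have h2 : intComb b z = (g : ℝ) • intComb b y := by
    rw [intComb, intComb, Finset.smul_sum]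
    refine Finset.sum_congr rfl fun j hj => ?_
    rw [hy j hj, mul_smul, Int.cast_smul_eq_zsmul]
  rw [h2, norm_smul]
  refine le_mul_of_one_le_left (norm_nonneg _) ?_
  rw [Real.norm_eq_abs, ← Int.cast_abs]
  exact_mod_cast Int.one_le_abs hg0

/-! ## The inputs -/

theorem writeList_natCast (l : List ℤ) (k : ℕ) : writeList (fun _ => 0) 0 l k = l.getD k 0 := by
  by_cases h : k < l.length
  · simp [writeList, h]
  · rw [writeList_eq_zero (by omega), List.getD_eq_default _ _ (not_lt.1 h)]

section Encode

variable {n : ℕ} (B : LatticeBasis n) (rest : List ℤ)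

theorem LatticeBasis.encode_eq : B.encode =
    (n : ℤ) :: ((List.range (n * n)).map (fun x => entry B.num (x / n) (x % n)) ++ [(B.den : ℤ)]) := by
  rw [LatticeBasis.encode, List.cons_append, ← flatten_ofFn]
  simp only [entry_coe]

theorem LatticeBasis.length_encode : B.encode.length = n * n + 2 := by
  simp [B.encode_eq]

theorem LatticeBasis.encode_getD_zero : (B.encode ++ rest).getD 0 0 = n := by
  simp [B.encode_eq]

theorem LatticeBasis.encode_getD_num {i j : ℕ} (hi : i < n) (hj : j < n) :
    (B.encode ++ rest).getD (1 + i * n + j) 0 = entry B.num i j := by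
  have h1 : i * n + j < n * n := RunData.entry_index_lt hi hj
  obtain ⟨d1, d2⟩ := mul_add_div_mod i hj
  rw [B.encode_eq, show 1 + i * n + j = (i * n + j) + 1 by ring, List.cons_append,
    List.getD_cons_succ, List.append_assoc,
    List.getD_append _ _ _ _ (by simpa using h1), List.getD_eq_getElem _ _ (by simpa using h1)]
  simp [d1, d2]

theorem LatticeBasis.encode_getD_den : (B.encode ++ rest).getD (n * n + 1) 0 = B.den := by
  rw [B.encode_eq, List.cons_append, List.getD_cons_succ, List.append_assoc,
    List.getD_append_right _ _ _ _ (by simp)]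
  simp

theorem LatticeBasis.encode_getD_rest (k : ℕ) :
    (B.encode ++ rest).getD (n * n + 2 + k) 0 = rest.getD k 0 := by
  rw [List.getD_append_right _ _ _ _ (by rw [B.length_encode]; omega), B.length_encode,
    Nat.add_sub_cancel_left]

theorem LatticeBasis.le_listSize : n ≤ listSize (B.encode ++ rest) := by
  refine le_trans ?_ (RunData.length_le_listSize _)
  rw [List.length_append, B.length_encode]
  nlinarith

theorem natAbs_lt_of_mem {l : List ℤ} {z : ℤ} (h : z ∈ l) : z.natAbs < 2 ^ listSize l :=
  natAbs_lt_of_bitLen_le (RunData.bitLen_le_listSize h)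

theorem LatticeBasis.num_lt (i j : Fin n) :
    (B.num i j).natAbs < 2 ^ listSize (B.encode ++ rest) := by
  refine natAbs_lt_of_mem (List.mem_append_left _ ?_)
  simp only [LatticeBasis.encode, List.mem_append, List.mem_cons, List.mem_flatten, List.mem_ofFn]
  exact Or.inl (Or.inr ⟨_, ⟨i, rfl⟩, List.mem_ofFn.2 ⟨j, rfl⟩⟩)

end Encode

/-- The exponent `10 s` would suffice. The large constant is the one that also bounds the number of
samples, so that a single constant serves in the polynomial. -/
theorem factor_lt {n d g s : ℕ} (hs : 1 ≤ s) (hn : n ≤ s) (hd : d < 2 ^ s) (hg : g ≤ 2) :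
    20 * n * d ^ 2 * g ^ 2 < 2 ^ (10 ^ 5 * s) := by
  have h1 : n < 2 ^ s := hn.trans_lt Nat.lt_two_pow_self
  have h2 : 20 * g ^ 2 ≤ 2 ^ (7 * s) := by
    calc 20 * g ^ 2 ≤ 20 * 2 ^ 2 := by gcongr
      _ ≤ 2 ^ 7 := by norm_num
      _ ≤ 2 ^ (7 * s) := Nat.pow_le_pow_right two_pos (by omega)
  calc 20 * n * d ^ 2 * g ^ 2 = n * (20 * g ^ 2) * d ^ 2 := by ring
    _ ≤ n * 2 ^ (7 * s) * (2 ^ s) ^ 2 := by gcongr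
    _ < 2 ^ s * 2 ^ (7 * s) * (2 ^ s) ^ 2 := by gcongr
    _ = 2 ^ (10 * s) := by ring
    _ ≤ _ := Nat.pow_le_pow_right two_pos (by omega)

/-- The error is one-sided: YES instances are accepted for every tape of answers, so nothing is
required of the oracle there. Only NO instances need parameters above `φ`. The constant in the
exponent of the error is `1`. -/
theorem reduces_of_data {Q : PromiseProblem} {φ : LatticeFunction} (P : FamilyCode)
    (data : Q.Inst → RunData) (hdim : ∀ x, (data x).n = Q.dim x)
    (hP : ∃ p : Polynomial ℕ, ∀ (x : Q.Inst) (O : Oracle),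
      HaltsWithin P.prog O (Q.encode x) (p.eval (listSize (Q.encode x))) ∧
      acceptProb P.prog O (Q.encode x) (p.eval (listSize (Q.encode x))) =
        ((tape O (data x).queries).toOuterMeasure
          {as | ((data x).withAnswers as).bad ≠ 0}).toReal)
    (hyes : ∀ x, Q.yes x → ∀ as, ((data x).withAnswers as).bad ≠ 0)
    (hno : ∀ x, Q.no x → ∃ h : (data x).Separated, ∀ i, ∀ hi : i < (data x).K,
      φ (data x).n (RunData.dualBasis h.toRegular hi).lattice < (data x).radius) :
    PolyTimeReducesToDGS Q φ := by
  obtain ⟨p, hp⟩ := hP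
  refine ⟨P.prog, p, 1, one_pos, fun O x => (hp x O).1, fun O hO x => ⟨fun hx => ?_, fun hx => ?_⟩⟩
  · have h1 : (tape O (data x).queries).toOuterMeasure {as | ((data x).withAnswers as).bad ≠ 0} = 1 :=
      (PMF.toOuterMeasure_apply_eq_one_iff _ _).2 fun as _ => hyes x hx as
    rw [(hp x O).2, h1, ENNReal.toReal_one]
    have : 0 ≤ min (1 / 3) ((2 : ℝ) ^ (-(1 * (Q.dim x : ℝ)))) := by positivity
    linarith
  · obtain ⟨h, hφ⟩ := hno x hx
    rw [(hp x O).2, ← hdim x]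
    exact h.prob_bad_le fun i hi => h.oracle_eq hO hi (hφ i hi)

/-! ## The closest vector problem -/

/-- The expressions for the reduction from the closest vector problem. -/
def cvpCode : FamilyCode where
  K := 1
  N := 100000 * (nE * nE * nE * nE * nE)
  a := Expr.load (nE * nE + 1)
  g := 1
  s := Expr.load (nE * nE + 2 + nE)
  dn := Expr.load (nE * nE + 2 + (nE + 1))
  dd := Expr.load (nE * nE + 2 + (nE + 2))
  Y := 20 * nE * (Expr.load (nE * nE + 2 + (nE + 2)) * Expr.load (nE * nE + 2 + (nE + 2)))
  F := fun _ _ => 1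
  τ := fun _ f => Expr.load (nE * nE + 2 + f)

/-- The data of an instance of the closest vector problem. -/
abbrev CVPInstance.data (x : CVPInstance) : RunData where
  n := x.n
  K := 1
  N := 10 ^ 5 * x.n ^ 5
  a := x.B.den
  g := 1
  s := x.t.den
  dn := x.d.num
  dd := x.d.den
  Y₀ := 20 * x.n * x.d.den ^ 2 * 1 ^ 2
  A := x.B.num
  F := fun _ _ => 1
  τ := fun _ k => if h : k < x.n then x.t.num ⟨k, h⟩ else 0
  input := writeList (fun _ => 0) 0 (x.B.encode ++ (x.t.encode ++ x.d.encode))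
  as := fun _ => []

namespace CVPInstance

variable (x : CVPInstance)

theorem getD_num {k : ℕ} (hk : k < x.n) :
    (x.t.encode ++ x.d.encode).getD k 0 = x.t.num ⟨k, hk⟩ := by
  rw [RationalVector.encode, List.append_assoc, List.getD_append _ _ _ _ (by simpa using hk),
    List.getD_eq_getElem _ _ (by simpa using hk), List.getElem_ofFn]

theorem getD_rest (k : ℕ) : (x.t.encode ++ x.d.encode).getD (x.n + k) 0 =
    [(x.t.den : ℤ), x.d.num, x.d.den].getD k 0 := by
  rw [RationalVector.encode, List.append_assoc, List.getD_append_right _ _ _ _ (by simp)]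
  simp [PosRational.encode]

theorem valid : x.data.Valid cvpCode := by
  have key : ∀ m : ℤ → ℤ, (∀ y : ℤ, 0 ≤ y → y < x.data.H → m y = x.data.input y) → ∀ k : ℕ,
      k < x.n * x.n + x.n + 5 →
      m k = (x.B.encode ++ (x.t.encode ++ x.d.encode)).getD k 0 := by
    intro m hm k hk
    rw [hm k (by omega) (by exact_mod_cast hk), ← writeList_natCast]
  have hn : ∀ m : ℤ → ℤ, (∀ y : ℤ, 0 ≤ y → y < x.data.H → m y = x.data.input y) →
      nE.eval m = x.n := by
    intro m hm
    have := key m hm 0 (by omega)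
    rw [LatticeBasis.encode_getD_zero] at this
    exact this
  have hrest : ∀ m : ℤ → ℤ, (∀ y : ℤ, 0 ≤ y → y < x.data.H → m y = x.data.input y) → ∀ k : ℕ,
      k < x.n + 3 → m (x.n * x.n + 2 + k) = (x.t.encode ++ x.d.encode).getD k 0 := by
    intro m hm k hk
    have := key m hm (x.n * x.n + 2 + k) (by omega)
    rw [LatticeBasis.encode_getD_rest] at this
    rw [← this]
    push_cast
    rfl
  refine ⟨x.n_pos, ?_, ?_, ?_, ?_, ?_, ?_⟩
  · exact Nat.mul_pos (by norm_num) (pow_pos x.n_pos 5)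
  · have := writeList_natCast (x.B.encode ++ (x.t.encode ++ x.d.encode)) 0
    rw [LatticeBasis.encode_getD_zero] at this
    exact this
  · intro i j hi hj
    have := writeList_natCast (x.B.encode ++ (x.t.encode ++ x.d.encode)) (1 + i * x.n + j)
    rw [LatticeBasis.encode_getD_num _ _ hi hj] at this
    push_cast at this
    exact this
  · intro m hm
    have e0 := hn m hm
    have e1 := key m hm (x.n * x.n + 1) (by omega)
    rw [LatticeBasis.encode_getD_den] at e1
    have e2 := hrest m hm (x.n + 0) (by omega)
    have e3 := hrest m hm (x.n + 1) (by omega)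
    have e4 := hrest m hm (x.n + 2) (by omega)
    rw [getD_rest] at e2 e3 e4
    simp only [List.getD_cons_zero, List.getD_cons_succ] at e2 e3 e4
    push_cast at e1 e2 e3 e4
    rw [add_zero] at e2
    simp only [cvpCode, Expr.eval_ofNat, Expr.eval_mul, Expr.eval_add, Expr.eval_load, e0,
      Nat.cast_one, Nat.cast_ofNat, e1, e2, e3, e4]
    push_cast
    refine ⟨trivial, ?_, trivial, trivial, trivial, trivial, trivial, ?_⟩ <;> ring
  · intro m _ e f i j _ _ _ _
    simp [cvpCode]
  · intro m hm e f i j _ hf _ hj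
    have e1 := hrest m hm j (hj.trans (Nat.lt_add_of_pos_right three_pos))
    rw [getD_num x hj] at e1
    simp only [cvpCode, Expr.eval_load, Expr.eval_add, Expr.eval_mul, Expr.eval_ofNat, hn m hm, hf]
    rw [dif_pos hj, ← e1]
    norm_num

theorem regular : x.data.Regular where
  n_pos := x.n_pos
  N_pos := Nat.mul_pos (by norm_num) (pow_pos x.n_pos 5)
  a_pos := x.B.den_pos
  g_pos := one_pos
  s_pos := x.t.den_pos
  dn_pos := x.d.num_pos
  dd_pos := x.d.den_pos
  det_ne_zero := x.B.det_ne_zero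
  F_pos := fun _ _ _ _ => one_pos

theorem primal_eq (i : ℕ) : x.data.primal i = x.B.vec := by
  ext j k
  simp only [RunData.primal, LatticeBasis.vec]
  push_cast
  ring

theorem target_eq (i : ℕ) : x.data.target i = x.t.val := by
  ext k
  simp [RunData.target, RationalVector.val]

/-- The factor two in `‖e‖ ≤ 2 d` makes it unnecessary to show that the distance to the lattice is
attained. -/
theorem bad_ne_zero (h : Metric.infDist x.t.val (x.B.lattice : Set (E x.n)) ≤ x.d.val)
    (as : List (List ℤ)) : (x.data.withAnswers as).bad ≠ 0 := by
  have hd : 0 < x.d.val := div_pos (by exact_mod_cast x.d.num_pos) (by exact_mod_cast x.d.den_pos)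
  obtain ⟨y, hy, hlt⟩ := (Metric.infDist_lt_iff ⟨0, Submodule.zero_mem _⟩).1
    (h.trans_lt (by linarith : x.d.val < 2 * x.d.val))
  obtain ⟨v, rfl⟩ := (mem_span_iff _ _).1 hy
  rw [dist_eq_norm] at hlt
  refine (x.regular.withAnswers as).bad_ne_zero (i := 0) (v := v) Nat.one_pos ?_
  change ‖x.data.target 0 - intComb (x.data.primal 0) v‖ ≤ _
  rw [target_eq, primal_eq]
  exact hlt.le

theorem separated {γ : ℝ} (hγ : 1 ≤ γ)
    (h1 : 100 * Real.sqrt x.n * γ * x.d.val < lambda1 x.B.lattice)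
    (h2 : 100 * Real.sqrt x.n * γ * x.d.val <
      Metric.infDist x.t.val (x.B.lattice : Set (E x.n))) :
    ∃ h : x.data.Separated, ∀ i, ∀ hi : i < x.data.K, Real.sqrt x.n * γ /
      lambda1 (dual (RunData.dualBasis h.toRegular hi).lattice) < x.data.radius := by
  have hn : (0 : ℝ) < x.d.num := by exact_mod_cast x.d.num_pos
  have hd : (0 : ℝ) < x.d.den := by exact_mod_cast x.d.den_pos
  have hs : 0 < Real.sqrt x.n := Real.sqrt_pos.2 (by exact_mod_cast x.n_pos)
  have hpair : IsDualPair x.B.vec (x.data.dualVec 0) := by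
    have := x.regular.isDualPair (i := 0) Nat.one_pos
    rwa [primal_eq] at this
  -- With radius `1 / (20 d)` the left side is `100 √n d`; this is the source of the constant `100`
  -- in the gap.
  have e : 5 * Real.sqrt x.n / x.data.radius ≤ 100 * Real.sqrt x.n * γ * x.d.val := by
    have e1 : 5 * Real.sqrt x.n / x.data.radius = 100 * Real.sqrt x.n * 1 * x.d.val := by
      rw [RunData.radius, PosRational.val]
      field_simp
      norm_num
    rw [e1]
    have : 0 ≤ x.d.val := div_nonneg hn.le hd.le
    gcongr
  refine ⟨⟨x.regular, rfl, x.n_pos, rfl, fun i _ v hv => ?_, fun i _ v => ?_⟩, fun i hi => ?_⟩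
  · rw [primal_eq]
    exact (e.trans h1.le).trans (hpair.lambda1_span_le hv)
  · rw [primal_eq, target_eq]
    refine (e.trans h2.le).trans ?_
    have h3 := infDist_le_of_mem (t := x.t.val) ((mem_span_iff x.B.vec _).2 ⟨-v, rfl⟩)
    rwa [intComb_neg, sub_neg_eq_add] at h3
  · rw [RunData.Regular.dual_dualBasis_lattice, primal_eq]
    change _ / lambda1 x.B.lattice < _
    have h3 : 0 ≤ 100 * Real.sqrt x.n * γ * x.d.val := by
      have : 0 ≤ x.d.val := div_nonneg hn.le hd.le
      positivity
    rw [div_lt_iff₀ (h3.trans_lt h1)]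
    have h4 : Real.sqrt x.n * γ ≤ x.data.radius * (100 * Real.sqrt x.n * γ * x.d.val) := by
      have h5 : x.data.radius * (100 * Real.sqrt x.n * γ * x.d.val) =
          5 * (Real.sqrt x.n * γ) := by
        rw [RunData.radius, PosRational.val]
        field_simp
        norm_num
      have h6 : 0 ≤ Real.sqrt x.n * γ := by positivity
      rw [h5]
      linarith
    exact h4.trans_lt (mul_lt_mul_of_pos_left h1 x.regular.radius_pos)

theorem encode_eq (x : CVPInstance) :
    x.B.encode ++ x.t.encode ++ x.d.encode = x.B.encode ++ (x.t.encode ++ x.d.encode) :=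
  List.append_assoc _ _ _

end CVPInstance

theorem gapCVPPrime_reduces {γ : ℕ → ℝ} (hγ : ∀ n, 1 ≤ n → 1 ≤ γ n) :
    PolyTimeReducesToDGS (GapCVPPrime fun n => 100 * Real.sqrt n * γ n)
      (fun n L => Real.sqrt n * γ n / lambda1 (dual L)) := by
  refine reduces_of_data cvpCode CVPInstance.data (fun _ => rfl) ?_
    (fun x hx as => x.bad_ne_zero hx as) fun x hx => x.separated (hγ _ x.n_pos) hx.1 hx.2
  have hlen : ∀ x : CVPInstance, 1 ≤ listSize (x.B.encode ++ (x.t.encode ++ x.d.encode)) :=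
    fun x => x.n_pos.trans (x.B.le_listSize _)
  have hden : ∀ x : CVPInstance, x.d.den < 2 ^ listSize (x.B.encode ++ (x.t.encode ++ x.d.encode)) := by
    intro x
    have := natAbs_lt_of_mem (l := x.B.encode ++ (x.t.encode ++ x.d.encode)) (z := (x.d.den : ℤ))
      (by simp [PosRational.encode])
    simpa using this
  have := exists_polynomial_acceptProb_eq cvpCode (10 ^ 5) CVPInstance.data
    (fun x => x.B.encode ++ (x.t.encode ++ x.d.encode)) (fun x => x.valid) (fun _ => rfl)
    (fun x => by simp [LatticeBasis.encode]) (fun x => by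
      rw [List.length_append, LatticeBasis.length_encode]
      simp only [RunData.H, RationalVector.encode, PosRational.encode, List.length_append,
        List.length_ofFn, List.length_cons, List.length_nil]
      omega) (fun x => x.B.le_listSize _) hlen
    (fun x => Nat.mul_le_mul_left _ (Nat.pow_le_pow_left (x.B.le_listSize _) 5))
    (fun x => x.B.num_lt _)
    (fun x => factor_lt (hlen x) (x.B.le_listSize _) (hden x) one_le_two)
  simpa only [← CVPInstance.encode_eq] using! this

/-! ## The shortest vector problem -/

/-- The expressions for the reduction from the shortest vector problem. The lattices of the family
are obtained by doubling one of the basis vectors, and this vector is the target. -/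
def svpCode : FamilyCode where
  K := nE
  N := 100000 * (nE * nE * nE * nE * nE)
  a := Expr.load (nE * nE + 1)
  g := 2
  s := Expr.load (nE * nE + 1)
  dn := Expr.load (nE * nE + 2)
  dd := Expr.load (nE * nE + 2 + 1)
  Y := 80 * nE * (Expr.load (nE * nE + 2 + 1) * Expr.load (nE * nE + 2 + 1))
  F := fun e f => 2 - Expr.eqInd e f
  τ := fun e f => Expr.load (1 + e * nE + f)

/-- The data of an instance of the shortest vector problem. -/
abbrev SVPInstance.data (x : SVPInstance) : RunData where
  n := x.n
  K := x.n
  N := 10 ^ 5 * x.n ^ 5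
  a := x.B.den
  g := 2
  s := x.B.den
  dn := x.d.num
  dd := x.d.den
  Y₀ := 20 * x.n * x.d.den ^ 2 * 2 ^ 2
  A := x.B.num
  F := fun i j => if i = j then 1 else 2
  τ := fun i k => entry x.B.num i k
  input := writeList (fun _ => 0) 0 (x.B.encode ++ x.d.encode)
  as := fun _ => []

namespace SVPInstance

variable (x : SVPInstance)

theorem valid : x.data.Valid svpCode := by
  have key : ∀ m : ℤ → ℤ, (∀ y : ℤ, 0 ≤ y → y < x.data.H → m y = x.data.input y) → ∀ k : ℕ,
      k < x.n * x.n + x.n + 5 → m k = (x.B.encode ++ x.d.encode).getD k 0 := by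
    intro m hm k hk
    rw [hm k (by omega) (by exact_mod_cast hk), ← writeList_natCast]
  have hn : ∀ m : ℤ → ℤ, (∀ y : ℤ, 0 ≤ y → y < x.data.H → m y = x.data.input y) →
      nE.eval m = x.n := by
    intro m hm
    have := key m hm 0 (by omega)
    rw [LatticeBasis.encode_getD_zero] at this
    exact this
  refine ⟨x.n_pos, ?_, ?_, ?_, ?_, ?_, ?_⟩
  · exact Nat.mul_pos (by norm_num) (pow_pos x.n_pos 5)
  · have := writeList_natCast (x.B.encode ++ x.d.encode) 0
    rw [LatticeBasis.encode_getD_zero] at this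
    exact this
  · intro i j hi hj
    have := writeList_natCast (x.B.encode ++ x.d.encode) (1 + i * x.n + j)
    rw [LatticeBasis.encode_getD_num _ _ hi hj] at this
    push_cast at this
    exact this
  · intro m hm
    have e0 := hn m hm
    have e1 := key m hm (x.n * x.n + 1) (by omega)
    have e2 := key m hm (x.n * x.n + 2 + 0) (by omega)
    have e3 := key m hm (x.n * x.n + 2 + 1) (by omega)
    rw [LatticeBasis.encode_getD_den] at e1
    rw [LatticeBasis.encode_getD_rest, PosRational.encode] at e2 e3
    simp only [List.getD_cons_zero, List.getD_cons_succ] at e2 e3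
    push_cast at e1 e2 e3
    rw [add_zero] at e2
    simp only [svpCode, Expr.eval_ofNat, Expr.eval_mul, Expr.eval_add, Expr.eval_load, e0,
      Nat.cast_one, Nat.cast_ofNat, e1, e2, e3]
    push_cast
    refine ⟨trivial, ?_, trivial, trivial, trivial, trivial, trivial, ?_⟩ <;> ring
  · intro m _ e f i j he hf _ _
    simp only [svpCode, Expr.eval_sub, Expr.eval_ofNat, Expr.eval_eqInd, he, hf, Nat.cast_inj]
    split_ifs <;> norm_num
  · intro m hm e f i j he hf hi hj
    have e1 := key m hm (1 + i * x.n + j) (by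
      have := RunData.entry_index_lt hi hj
      change i * x.n + j < x.n * x.n at this
      omega)
    rw [LatticeBasis.encode_getD_num _ _ hi hj] at e1
    push_cast at e1
    simp only [svpCode, Expr.eval_load, Expr.eval_add, Expr.eval_mul, Expr.eval_ofNat, hn m hm, he,
      hf]
    exact e1

theorem regular : x.data.Regular where
  n_pos := x.n_pos
  N_pos := Nat.mul_pos (by norm_num) (pow_pos x.n_pos 5)
  a_pos := x.B.den_pos
  g_pos := two_pos
  s_pos := x.B.den_pos
  dn_pos := x.d.num_pos
  dd_pos := x.d.den_pos
  det_ne_zero := x.B.det_ne_zero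
  F_pos := fun i _ j _ => by
    change 0 < if i = j then (1 : ℤ) else 2
    split_ifs <;> norm_num

theorem primal_eq (i : Fin x.n) :
    x.data.primal i = fun j => (if j = i then (2 : ℤ) else 1) • x.B.vec j := by
  ext j k
  rw [← Int.cast_smul_eq_zsmul ℝ]
  simp only [RunData.primal, LatticeBasis.vec, PiLp.smul_apply, smul_eq_mul]
  by_cases hj : j = i
  · subst hj
    simp
    ring
  · have : ¬ ((i : ℕ) = (j : ℕ)) := fun h => hj (Fin.ext h.symm)
    simp [hj, this]
    ring

theorem intComb_primal (i : Fin x.n) (v : Fin x.n → ℤ) :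
    intComb (x.data.primal i) v = intComb x.B.vec ((fun j => if j = i then 2 else 1) * v) := by
  rw [primal_eq, intComb_smul]

theorem target_eq (i : Fin x.n) : x.data.target i = intComb x.B.vec (Pi.single i 1) := by
  rw [intComb_single]
  ext k
  simp only [RunData.target, LatticeBasis.vec, entry_coe]

/-- With all weights `F` equal to `2` the scale `g = 2` is undone, and the primal basis in the
family is the given basis itself. -/
theorem isDualPair : ∃ d, IsDualPair x.B.vec d := by
  let r : RunData := { x.data with F := fun _ _ => 2 }
  have hr : r.Regular := by
    obtain ⟨h1, h2, h3, h4, h5, h6, h7, h8, -⟩ := x.regular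
    exact ⟨h1, h2, h3, h4, h5, h6, h7, h8, fun _ _ _ _ => two_pos⟩
  have h := hr.isDualPair (i := 0) x.n_pos
  have e : r.primal 0 = x.B.vec := by
    ext j k
    simp only [RunData.primal, LatticeBasis.vec, r]
    push_cast
    ring
  rw [e] at h
  exact ⟨_, h⟩

/-- Dividing a short vector by the gcd of its coefficients leaves one with an odd coefficient `2 m +
1` at some `b_i`. It equals `b_i` minus a vector of the lattice in which `b_i` is doubled, whose
coefficient at `2 b_i` is `-m`. So the `i`-th target is close to the `i`-th lattice. -/
theorem bad_ne_zero (h : lambda1 x.B.lattice ≤ x.d.val) (as : List (List ℤ)) :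
    (x.data.withAnswers as).bad ≠ 0 := by
  have hd : 0 < x.d.val := div_pos (by exact_mod_cast x.d.num_pos) (by exact_mod_cast x.d.den_pos)
  obtain ⟨d, hpair⟩ := x.isDualPair
  obtain ⟨z, hz, hlt⟩ := hpair.exists_norm_lt x.n_pos
    (h.trans_lt (by linarith : x.d.val < 2 * x.d.val))
  obtain ⟨y, i, ⟨m, hm⟩, hle⟩ := exists_odd_norm_le x.B.vec hz
  let v : Fin x.n → ℤ := fun j => if j = i then -m else -y j
  refine (x.regular.withAnswers as).bad_ne_zero (i := i) (v := v) i.2 ?_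
  change ‖x.data.target i - intComb (x.data.primal i) v‖ ≤ _
  rw [target_eq, intComb_primal, sub_eq_add_neg, ← intComb_neg, ← intComb_add]
  have e : Pi.single i 1 + -((fun j => if j = i then (2 : ℤ) else 1) * v) = y := by
    ext j
    by_cases hj : j = i
    · subst hj
      simp [hm, v]
      ring
    · simp [hj, v]
  rw [e]
  exact hle.trans hlt.le

/-- All lattices of the family are contained in `L`, and the vectors of `b_i + L_i` lie in `L` and
have an odd coefficient at `b_i`, so they are not zero. Both minimum distances are therefore at
least `λ₁(L)`. The hypothesis of the oracle follows from `√(2n) · √n / λ₁ / α = √2 (n/α) / λ₁` and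
`λ₁ > 100 (n/α) d = 5 (n/α) / r`. -/
theorem separated {α : ℝ} (h0 : 0 < α) (h1 : α < 1)
    (h : 100 * (x.n / α) * x.d.val < lambda1 x.B.lattice) :
    ∃ h : x.data.Separated, ∀ i, ∀ hi : i < x.data.K, Real.sqrt (2 * x.n) *
      smoothingParameter ((2 : ℝ) ^ (-(x.n : ℝ))) (RunData.dualBasis h.toRegular hi).lattice / α <
        x.data.radius := by
  have hdn : (0 : ℝ) < x.d.num := by exact_mod_cast x.d.num_pos
  have hdd : (0 : ℝ) < x.d.den := by exact_mod_cast x.d.den_pos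
  have hval : 0 < x.d.val := div_pos hdn hdd
  have hn : (1 : ℝ) ≤ x.n := by exact_mod_cast x.n_pos
  have hsq : Real.sqrt x.n * Real.sqrt x.n = x.n := Real.mul_self_sqrt (by linarith)
  have hs : 0 < Real.sqrt x.n := Real.sqrt_pos.2 (by linarith)
  set R := lambda1 x.B.lattice with hR
  have hpos : 0 < 100 * (x.n / α) * x.d.val := by positivity
  obtain ⟨d, hpair⟩ := x.isDualPair
  have hshort : ∀ v : Fin x.n → ℤ, v ≠ 0 → R ≤ ‖intComb x.B.vec v‖ :=
    fun v hv => hpair.lambda1_span_le hv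
  have hprimal : ∀ (i : Fin x.n) (v : Fin x.n → ℤ), v ≠ 0 → R ≤ ‖intComb (x.data.primal i) v‖ := by
    intro i v hv
    rw [intComb_primal]
    refine hshort _ fun h0 => hv (funext fun j => ?_)
    have h2 := congrFun h0 j
    simp only [Pi.mul_apply, Pi.zero_apply] at h2 ⊢
    split_ifs at h2 <;> omega
  have htarget : ∀ (i : Fin x.n) (v : Fin x.n → ℤ),
      R ≤ ‖x.data.target i + intComb (x.data.primal i) v‖ := by
    intro i v
    rw [intComb_primal, target_eq, ← intComb_add]
    refine hshort _ fun h0 => ?_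
    have h2 : (1 : ℤ) + 2 * v i = 0 := by simpa using congrFun h0 i
    omega
  have e : 5 * Real.sqrt x.n / x.data.radius ≤ R := by
    refine le_trans ?_ h.le
    have e1 : 5 * Real.sqrt x.n / x.data.radius = 100 * Real.sqrt x.n * x.d.val := by
      rw [RunData.radius, PosRational.val]
      field_simp
      norm_num
    rw [e1]
    have e2 : Real.sqrt x.n ≤ x.n / α := by
      rw [le_div_iff₀ h0]
      have : 1 ≤ Real.sqrt x.n := Real.one_le_sqrt.2 hn
      nlinarith
    gcongr
  refine ⟨⟨x.regular, rfl, le_rfl, rfl, fun i hi v hv => ?_, fun i hi v => ?_⟩, fun i hi => ?_⟩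
  · exact e.trans (hprimal ⟨i, hi⟩ v hv)
  · exact e.trans (htarget ⟨i, hi⟩ v)
  · rw [RunData.dualBasis_lattice]
    have hRpos : 0 < R := hpos.trans h
    have h2 := (x.regular.isDualPair hi).smoothingParameter_le x.n_pos hRpos (hprimal ⟨i, hi⟩)
    change smoothingParameter ((2 : ℝ) ^ (-(x.n : ℝ))) _ ≤ Real.sqrt x.n / R at h2
    have h3 : Real.sqrt 2 ≤ 5 := by
      rw [Real.sqrt_le_left (by norm_num)]
      norm_num
    calc _ ≤ Real.sqrt (2 * x.n) * (Real.sqrt x.n / R) / α := by gcongr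
      _ = Real.sqrt 2 * (x.n / α) / R := by
        rw [Real.sqrt_mul (by norm_num), ← hsq]
        simp only [Real.sqrt_mul_self hs.le]
        ring
      _ ≤ 5 * (x.n / α) / R := by gcongr
      _ < x.data.radius := by
        rw [div_lt_iff₀ hRpos]
        refine lt_of_eq_of_lt ?_ (mul_lt_mul_of_pos_left h x.regular.radius_pos)
        rw [RunData.radius, PosRational.val]
        field_simp
        norm_num

end SVPInstance

theorem gapSVP_reduces {α : ℕ → ℝ} (hα : ∀ n, 1 ≤ n → 0 < α n ∧ α n < 1) :
    PolyTimeReducesToDGS (GapSVP fun n => 100 * (n / α n))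
      (fun n L => Real.sqrt (2 * n) * smoothingParameter ((2 : ℝ) ^ (-(n : ℝ))) L / α n) := by
  refine reduces_of_data svpCode SVPInstance.data (fun _ => rfl) ?_
    (fun x hx as => x.bad_ne_zero hx as)
    fun x hx => x.separated (hα _ x.n_pos).1 (hα _ x.n_pos).2 hx
  have hlen : ∀ x : SVPInstance, 1 ≤ listSize (x.B.encode ++ x.d.encode) :=
    fun x => x.n_pos.trans (x.B.le_listSize _)
  have hden : ∀ x : SVPInstance, x.d.den < 2 ^ listSize (x.B.encode ++ x.d.encode) := by
    intro x
    have := natAbs_lt_of_mem (l := x.B.encode ++ x.d.encode) (z := (x.d.den : ℤ))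
      (by simp [PosRational.encode])
    simpa using this
  exact exists_polynomial_acceptProb_eq svpCode (10 ^ 5) SVPInstance.data
    (fun x => x.B.encode ++ x.d.encode) (fun x => x.valid) (fun _ => rfl)
    (fun x => by simp [LatticeBasis.encode]) (fun x => by
      rw [List.length_append, LatticeBasis.length_encode]
      simp only [RunData.H, PosRational.encode, List.length_cons, List.length_nil]
      omega) (fun x => x.B.le_listSize _) (fun x => x.B.le_listSize _)
    (fun x => Nat.mul_le_mul_left _ (Nat.pow_le_pow_left (x.B.le_listSize _) 5))
    (fun x => x.B.num_lt _)
    (fun x => factor_lt (hlen x) (x.B.le_listSize _) (hden x) le_rfl)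

end LatticeReduction

theorem mainTheorem10 :
    (∀ γ : ℕ → ℝ, (∀ n : ℕ, 1 ≤ n → 1 ≤ γ n) →
      LatticeReduction.PolyTimeReducesToDGS
        (LatticeReduction.GapCVPPrime fun n => 100 * Real.sqrt (n : ℝ) * γ n)
        (fun n L => Real.sqrt (n : ℝ) * γ n /
          LatticeReduction.lambda1 (LatticeReduction.dual L))) ∧
    (∃ C : ℝ, 0 < C ∧ ∀ α : ℕ → ℝ, (∀ n : ℕ, 1 ≤ n → 0 < α n ∧ α n < 1) →
      LatticeReduction.PolyTimeReducesToDGS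
        (LatticeReduction.GapSVP fun n => C * ((n : ℝ) / α n))
        (fun n L => Real.sqrt (2 * (n : ℝ)) *
          LatticeReduction.smoothingParameter ((2 : ℝ) ^ (-(n : ℝ))) L / α n)) :=
  ⟨fun _ hγ => LatticeReduction.gapCVPPrime_reduces hγ,
    100, by norm_num, fun _ hα => LatticeReduction.gapSVP_reduces hα⟩
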